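/- Let $0<\bar\rho<\rho_m/2$, write $f=\rho_m-\bar\rho$, and let $\kappa\in\mathbb R$. For $T>0$ consider on $\mathbb R^2\times(0,T)$, with spatial variable $(x,y)$ and $\nabla,\Delta$ acting on $(x,y)$, the forward–backward system for real functions $\psi,\varphi$ $$\partial_t\psi=(f-2\bar\rho)\,\partial_x\psi+\bar\rho f^2\Delta\varphi+\nabla\cdot\Big(\big(\psi f^2-2f(\bar\rho+\psi)\psi+(\bar\rho+\psi)\psi^2\big)\nabla\varphi\Big)+\tfrac1f\partial_x(\psi^3)+\Big(\tfrac{\bar\rho}{f}-2\Big)\partial_x(\psi^2),$$ $$\partial_t\varphi=f\,\partial_x\varphi-\tfrac1f\psi+\tfrac12f^2|\nabla\varphi|^2+\tfrac12(\psi^2-2f\psi)|\nabla\varphi|^2+\kappa\,\psi^2+\partial_x\varphi\Big(\tfrac1f\psi^2-2\psi\Big),$$ with $\psi(0)=\psi_0$ and $\varphi(T)=\varphi_T$. (For $\kappa=\frac1{2f^2}$ this is the system satisfied by the perturbation of the constant flow $(\bar\rho,x/f)$ for $\partial_t\rho=\nabla\cdot(\rho(\rho_m-\rho)^2\nabla\phi)$,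 $\partial_t\phi=\frac12(\rho_m-\rho)^2|\nabla\phi|^2-\frac12$.) A solution in $L^2\cap L^\infty$ on $[0,T]$ is a pair $(\psi,\varphi)$ such that $\psi(t)$ and the weak gradient $\nabla\varphi(t)$ are bounded in $L^2\cap L^\infty(\mathbb R^2)$ uniformly in $t\in[0,T]$ and measurable in $(t,x,y)$, and such that the two equations, integrated in time from the datum $\psi_0$ at time $0$, respectively $\varphi_T$ at time $T$, hold in the sense of distributions on $\mathbb R^2$ at every time $t\in[0,T]$. Write $\|\psi\|_{L^p}+\|\nabla\varphi\|_{L^p}$ at time $t$ for $\|\psi(t)\|_{L^p(\mathbb R^2)}+\|\nabla\varphi(t)\|_{L^p(\mathbb R^2)}$, and set $$N_0=\|(1+|\xi|)^3\hat\psi_0\|_{L^\infty(\mathbb R^2)},\qquad N_T=\|(1+|\xi|)^3\widehat{\nabla\varphi_T}\|_{L^\infty(\mathbb R^2)},$$ where $\hat g(\xi)=\int g(z)e^{-2\pi i z\cdot\xi}\,dz$ (extended to $L^2$). Then there are $\varepsilon_0,\delta,K>0$, depending only on $\rho_m,\bar\rho,\kappa$ (in particular not on $T$), such that for every $T>0$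 and all data with $N_0+N_T\le\varepsilon_0$ there is a solution $(\psi,\varphi)$ in $L^2\cap L^\infty$ on $[0,T]$ with the following properties. 1. $\|\psi(t)\|_{L^\infty}+\|\nabla\varphi(t)\|_{L^\infty}\le\delta$ for all $t\in[0,T]$, and it is the only solution in $L^2\cap L^\infty$ on $[0,T]$ with this property (up to equality almost everywhere in space at each time). 2. $\psi$ and $\varphi$ are real analytic on $]0,T[\times\mathbb R^2$, and the equations hold there pointwise. 3. For all $t\in[0,T]$, $$\big(\|\psi\|_{L^2}+\|\nabla\varphi\|_{L^2}\big)(t)\le K\Big(\frac{N_0}{1+t}+\frac{N_T}{1+T-t}\Big),$$ $$\big(\|\psi\|_{L^\infty}+\|\nabla\varphi\|_{L^\infty}\big)(t)\le K\Big(\frac{N_0}{(1+t)^2}+\frac{N_T}{(1+T-t)^2}\Big).$$ -/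

import Mathlib

open MeasureTheory Set Filter Topology
open scoped ENNReal NNReal ContDiff Gradient FourierTransform Laplacian

noncomputable section

namespace CrowdMFG

/-- The plane `ℝ²` with its Euclidean norm. -/
abbrev Plane : Type := EuclideanSpace ℝ (Fin 2)

/-- The unit vector in the direction of the first coordinate `x`. -/
def e₁ : Plane := EuclideanSpace.single 0 1

/-- Partial derivative in the first coordinate, `∂ₓ g`. -/
def dx (g : Plane → ℝ) (z : Plane) : ℝ := fderiv ℝ g z e₁

/-- Divergence of a vector field on the plane. -/
def divergence (V : Plane → Plane) (z : Plane) : ℝ :=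
  ∑ i : Fin 2, (fderiv ℝ V z (EuclideanSpace.single i 1)) i

/-- Smooth compactly supported test functions on the plane. -/
def IsTestFunction (χ : Plane → ℝ) : Prop :=
  ContDiff ℝ ∞ χ ∧ HasCompactSupport χ

/-- `G` is the weak (distributional) gradient of `g`. -/
def HasWeakGradient (g : Plane → ℝ) (G : Plane → Plane) : Prop :=
  LocallyIntegrable g ∧ LocallyIntegrable G ∧
    ∀ χ : Plane → ℝ, IsTestFunction χ → ∫ z, g z • ∇ χ z = - ∫ z, χ z • G z

section Fourier

variable {F : Type*} [NormedAddCommGroup F] [InnerProductSpace ℂ F] [CompleteSpace F]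

open Classical in
/-- The norm `‖(1 + |ξ|)³ ĝ(ξ)‖_{L^∞}`, where `ĝ` is the Fourier transform of the square
integrable function `g`. If `g` is not square integrable, the value is `∞`: a function `ĝ` with
`(1 + |ξ|)³ ĝ` bounded is square integrable on the plane, hence so is `g`. -/
def weightedFourierNorm (g : Plane → F) : ℝ≥0∞ :=
  if hg : MemLp g 2 (volume : Measure Plane) then
    eLpNorm (fun ξ : Plane => ((1 + ‖ξ‖) ^ 3 : ℝ) • (𝓕 (hg.toLp g) : Lp F 2 (volume : Measure Plane)) ξ)
      ∞ volume
  else ∞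

end Fourier

/-- A real function, seen as a complex one. -/
def toComplexFun (g : Plane → ℝ) (z : Plane) : ℂ := (g z : ℂ)

/-- A real vector field, seen as a complex one. -/
def toComplexField (G : Plane → Plane) (z : Plane) : EuclideanSpace ℂ (Fin 2) :=
  WithLp.toLp 2 fun i => ((G z i : ℝ) : ℂ)

/-- The saturation function `f(ρ) = ρ_m - ρ`. -/
def sat (ρm ρ : ℝ) : ℝ := ρm - ρ

/-- The coefficient `ψ f² - 2 f (ρ̄ + ψ) ψ + (ρ̄ + ψ) ψ²` (with `f = f(ρ̄)`) of `∇φ` in the nonlinear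
part of the density equation. -/
def mobility (ρm ρb r : ℝ) : ℝ :=
  r * sat ρm ρb ^ 2 - 2 * sat ρm ρb * (ρb + r) * r + (ρb + r) * r ^ 2

/-- The right-hand side of the equation for `∂ₜψ`, for smooth `ψ, φ` at a fixed time. -/
def densityRHS (ρm ρb : ℝ) (ψ φ : Plane → ℝ) (z : Plane) : ℝ :=
  (sat ρm ρb - 2 * ρb) * dx ψ z + ρb * sat ρm ρb ^ 2 * (Δ φ) z
    + divergence (fun y => mobility ρm ρb (ψ y) • ∇ φ y) z
    + 1 / sat ρm ρb * dx (fun y => ψ y ^ 3) z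
    + (ρb / sat ρm ρb - 2) * dx (fun y => ψ y ^ 2) z

/-- The vector field of which the right-hand side of the equation for `∂ₜψ` is the divergence,
as a function of the values `r` of `ψ` and `p` of `∇φ`. -/
def flux (ρm ρb r : ℝ) (p : Plane) : Plane :=
  ((sat ρm ρb - 2 * ρb) * r + 1 / sat ρm ρb * r ^ 3 + (ρb / sat ρm ρb - 2) * r ^ 2) • e₁
    + (ρb * sat ρm ρb ^ 2 + mobility ρm ρb r) • p

/-- The right-hand side of the equation for `∂ₜφ`, as a function of the values `r` of `ψ` and `p`
of `∇φ`. Here `κ` is the coefficient of the quadratic term `ψ²`. -/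
def valueRHS (ρm ρb κ r : ℝ) (p : Plane) : ℝ :=
  sat ρm ρb * p 0 - 1 / sat ρm ρb * r
    + 1 / 2 * sat ρm ρb ^ 2 * ‖p‖ ^ 2 + 1 / 2 * (r ^ 2 - 2 * sat ρm ρb * r) * ‖p‖ ^ 2
    + κ * r ^ 2 + p 0 * (1 / sat ρm ρb * r ^ 2 - 2 * r)

/-- `(ψ, φ)` is a solution in `L² ∩ L^∞` on `[0, T]` of the forward-backward system
`∂ₜψ = div (flux (ψ, ∇φ))`, `∂ₜφ = valueRHS (ψ, ∇φ)`, with `ψ = ψ₀` at time `0` and `φ = φ_T` at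
time `T`: the functions `ψ(t)` and `p(t) = ∇φ(t)` (a weak gradient) are in `L² ∩ L^∞` with bounds
uniform in `t ∈ [0, T]`, and the equations, integrated in time from the datum, hold in the sense of
distributions on the plane at each time `t ∈ [0, T]`. -/
structure IsSolution (ρm ρb κ T : ℝ) (ψ₀ φT : Plane → ℝ)
    (ψ φ : ℝ → Plane → ℝ) (p : ℝ → Plane → Plane) : Prop where
  measurable_density : AEStronglyMeasurable (fun w : ℝ × Plane => ψ w.1 w.2)
    ((volume.restrict (Icc 0 T)).prod volume)
  measurable_gradient : AEStronglyMeasurable (fun w : ℝ × Plane => p w.1 w.2)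
    ((volume.restrict (Icc 0 T)).prod volume)
  gradient : ∀ t ∈ Icc 0 T, HasWeakGradient (φ t) (p t)
  memLp : ∀ t ∈ Icc 0 T, MemLp (ψ t) 2 ∧ MemLp (ψ t) ∞ ∧ MemLp (p t) 2 ∧ MemLp (p t) ∞
  bounded : ∃ C : ℝ≥0, ∀ t ∈ Icc 0 T,
    eLpNorm (ψ t) 2 volume ≤ C ∧ eLpNorm (ψ t) ∞ volume ≤ C ∧
      eLpNorm (p t) 2 volume ≤ C ∧ eLpNorm (p t) ∞ volume ≤ C
  initial : ψ 0 =ᵐ[volume] ψ₀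
  terminal : φ T =ᵐ[volume] φT
  density_eq : ∀ χ : Plane → ℝ, IsTestFunction χ → ∀ t ∈ Icc 0 T,
    ∫ z, ψ t z * χ z = (∫ z, ψ₀ z * χ z)
      - ∫ s in (0 : ℝ)..t, ∫ z, inner ℝ (flux ρm ρb (ψ s z) (p s z)) (∇ χ z)
  value_eq : ∀ χ : Plane → ℝ, IsTestFunction χ → ∀ t ∈ Icc 0 T,
    ∫ z, φ t z * χ z = (∫ z, φT z * χ z)
      - ∫ s in t..T, ∫ z, valueRHS ρm ρb κ (ψ s z) (p s z) * χ z

/-- The system holds classically at every interior time. -/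
def SolvesClassically (ρm ρb κ T : ℝ) (ψ φ : ℝ → Plane → ℝ) : Prop :=
  ∀ t ∈ Ioo 0 T, ∀ z : Plane,
    HasDerivAt (fun s => ψ s z) (densityRHS ρm ρb (ψ t) (φ t) z) t ∧
    HasDerivAt (fun s => φ s z) (valueRHS ρm ρb κ (ψ t z) (∇ (φ t) z)) t

/-- A function of time and space is real analytic on `]0, T[ × ℝ²`. -/
def AnalyticInside (T : ℝ) (g : ℝ → Plane → ℝ) : Prop :=
  AnalyticOnNhd ℝ (fun w : ℝ × Plane => g w.1 w.2) (Ioo 0 T ×ˢ univ)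

/-- The perturbation stays in the ball of radius `δ` of `L^∞`, at all times of `[0, T]`. -/
def StaysSmall (T δ : ℝ) (ψ : ℝ → Plane → ℝ) (p : ℝ → Plane → Plane) : Prop :=
  ∀ t ∈ Icc 0 T, eLpNorm (ψ t) ∞ volume + eLpNorm (p t) ∞ volume ≤ ENNReal.ofReal δ

end CrowdMFG

end

open CrowdMFG

noncomputable section

namespace CrowdMFG

open scoped ComplexConjugate SchwartzMap

/-! ### Weights -/

/-! On the Fourier side write `w` for the transform of the density and `v` for `2π|ξ|` times that of
the value function. The linearized system is then, for each frequency, a 2 × 2 ODE with eigenvalues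
`-lam` and `conj lam`, where `Re lam = 2π √(ρ̄ f |ξ|² - ρ̄² ξ₀²)`. The condition `ρ̄ < f`, that is
`ρ̄ < ρ_m/2`, makes this real part comparable to `|ξ|`: the linear problem is elliptic in
space-time. It splits into a mode decaying forward in time and one decaying backward. The density is
prescribed at `0` and the value function at `T`; the determinant `bdet` of these conditions has real
part bounded below uniformly in `T`, which is why no constant depends on `T` (`exists_adm_linSol`).

The nonlinear problem is solved in the space of functions of size `env`, that is `(N₀ e^{-ct|ξ|} +
N₁ e^{-c(T-t)|ξ|}) (1+|ξ|)⁻³`. Two facts carry the argument. This space is an algebra under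
convolution, with constant proportional to `N₀ + N₁` (`env_mul_le`, `Adm.conv`). The Duhamel
integrals absorb the factor `|ξ|` created by the one derivative in front of the nonlinearity,
because half of the available exponential decay integrates against `|ξ|` to a bounded quantity
(`Adm.duhamel`). As the nonlinearity is polynomial without constant or linear terms, the map is a
contraction for small `N₀ + N₁` (`exists_fixedPoint`).

All functions of time are kept holomorphic in a complex diamond over `]0, T[`. Together with the
exponential decay in `ξ` at interior times this yields joint real analyticity (`analyticAt_invF`),
and it gives time derivatives by Cauchy estimates. The decay rates come from comparing the envelope
with the rescaled weight `(1+(1+t)|ξ|)⁻³`, whose integral over the plane is proportional to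
`(1+t)⁻²` (`exists_decay`).

Uniqueness is an energy argument of monotonicity type. For the differences `D` of the densities and
`H` of the value functions, `∫ D H` vanishes at both ends of `[0, T]`, so the integral over
space-time of its time derivative is zero. The linear part of that integrand, up to sign, is the
quadratic form `D²/f - 2ρ̄ D ∂ₓH + ρ̄ f² |∇H|²`, which is positive definite exactly because `ρ̄ < f`
(`exists_coercive`); for small solutions the nonlinear part is a small multiple of the same energy
(`exists_state_unique`). Since solutions are only weak, the computation is carried out after
mollification in space (`energy_identity`). -/

/-- The weight `(1 + |ξ|)⁻³`. -/
def wt (ξ : Plane) : ℝ := ((1 + ‖ξ‖) ^ 3)⁻¹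

theorem wt_pos (ξ : Plane) : 0 < wt ξ := by
  unfold wt; positivity

theorem wt_nonneg (ξ : Plane) : 0 ≤ wt ξ := (wt_pos ξ).le

theorem wt_le_one (ξ : Plane) : wt ξ ≤ 1 := by
  unfold wt
  exact inv_le_one_of_one_le₀ (one_le_pow₀ (by linarith [norm_nonneg ξ]))

theorem wt_neg (ξ : Plane) : wt (-ξ) = wt ξ := by simp [wt]

theorem continuous_wt : Continuous wt := by
  unfold wt
  refine Continuous.inv₀ (by fun_prop) fun ξ => ?_
  positivity

theorem integrable_wt : Integrable wt := by
  have h := integrable_one_add_norm (E := Plane) (μ := volume) (r := 3)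
    (by simp; norm_num)
  refine h.congr (Eventually.of_forall fun ξ => ?_)
  have : (0 : ℝ) ≤ 1 + ‖ξ‖ := by positivity
  simp only [wt]
  rw [Real.rpow_neg this]
  norm_cast

/-- The integral of the weight. -/
def wtMass : ℝ := ∫ ξ, wt ξ

theorem wtMass_nonneg : 0 ≤ wtMass := integral_nonneg wt_nonneg

/-- One of `η`, `ξ - η` has norm at least `‖ξ‖ / 2`, and its weight is then at most `2 ^ 3 * wt ξ`;
the other weight is left for integration in `η`. -/
theorem wt_mul_le (ξ η : Plane) : wt η * wt (ξ - η) ≤ 8 * wt ξ * (wt η + wt (ξ - η)) := by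
  have key : ∀ a b : Plane, ‖ξ‖ ≤ ‖a‖ + ‖b‖ → ‖a‖ ≤ ‖b‖ → wt b ≤ 8 * wt ξ := by
    intro a b h1 h2
    have h3 : 1 + ‖ξ‖ ≤ 2 * (1 + ‖b‖) := by linarith
    have h4 : (1 + ‖ξ‖) ^ 3 ≤ 8 * (1 + ‖b‖) ^ 3 := by
      calc (1 + ‖ξ‖) ^ 3 ≤ (2 * (1 + ‖b‖)) ^ 3 := by gcongr
        _ = _ := by ring
    unfold wt
    rw [← div_eq_mul_inv, inv_eq_one_div, div_le_div_iff₀ (by positivity) (by positivity)]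
    linarith
  have hξ : ‖ξ‖ ≤ ‖η‖ + ‖ξ - η‖ := by
    calc ‖ξ‖ = ‖η + (ξ - η)‖ := by congr 1; abel
      _ ≤ _ := norm_add_le _ _
  have p1 := wt_pos η
  have p2 := wt_pos (ξ - η)
  have p3 := wt_pos ξ
  rcases le_total ‖η‖ ‖ξ - η‖ with h | h
  · have := key _ _ hξ h
    nlinarith [mul_pos p3 p2]
  · have := key (ξ - η) η (by linarith) h
    nlinarith [mul_pos p3 p1]

theorem integrable_wt_sub (ξ : Plane) : Integrable fun η => wt (ξ - η) :=
  integrable_wt.comp_sub_left ξ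

theorem integral_wt_sub (ξ : Plane) : ∫ η, wt (ξ - η) = wtMass := by
  rw [wtMass, ← integral_sub_left_eq_self (fun η => wt η) volume ξ]

/-- The two-sided exponentially decaying envelope, at real time `x ∈ [0, T]`. -/
def env (c T N₀ N₁ x : ℝ) (ξ : Plane) : ℝ :=
  (N₀ * Real.exp (-c * x * ‖ξ‖) + N₁ * Real.exp (-c * (T - x) * ‖ξ‖)) * wt ξ

/-! ### The two-sided envelope: propagation and product estimates -/

section Env

variable {c T N₀ N₁ x y : ℝ}

theorem env_nonneg (h₀ : 0 ≤ N₀) (h₁ : 0 ≤ N₁) (ξ : Plane) : 0 ≤ env c T N₀ N₁ x ξ := by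
  have := wt_nonneg ξ
  unfold env; positivity

theorem env_reverse (ξ : Plane) : env c T N₁ N₀ (T - x) ξ = env c T N₀ N₁ x ξ := by
  unfold env
  rw [sub_sub_cancel, add_comm]

theorem continuous_env : Continuous (env c T N₀ N₁ x) := by
  unfold env
  have := continuous_wt
  fun_prop

theorem env_le_wt (hc : 0 ≤ c) (h₀ : 0 ≤ N₀) (h₁ : 0 ≤ N₁) (hx : x ∈ Icc 0 T) (ξ : Plane) :
    env c T N₀ N₁ x ξ ≤ (N₀ + N₁) * wt ξ := by
  have e1 : Real.exp (-c * x * ‖ξ‖) ≤ 1 := by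
    rw [Real.exp_le_one_iff]
    have := mul_nonneg (mul_nonneg hc hx.1) (norm_nonneg ξ); linarith
  have e2 : Real.exp (-c * (T - x) * ‖ξ‖) ≤ 1 := by
    rw [Real.exp_le_one_iff]
    have := mul_nonneg (mul_nonneg hc (sub_nonneg.2 hx.2)) (norm_nonneg ξ); linarith
  unfold env
  have := wt_nonneg ξ
  gcongr
  · nlinarith
  · nlinarith

theorem integrable_env (hc : 0 ≤ c) (h₀ : 0 ≤ N₀) (h₁ : 0 ≤ N₁) (hx : x ∈ Icc 0 T) :
    Integrable (env c T N₀ N₁ x) := by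
  refine (integrable_wt.const_mul (N₀ + N₁)).mono' continuous_env.aestronglyMeasurable
    (Eventually.of_forall fun ξ => ?_)
  rw [Real.norm_of_nonneg (env_nonneg h₀ h₁ ξ)]
  exact env_le_wt hc h₀ h₁ hx ξ

/-- A move from time `x` to time `y` changes each exponent by at most `c |y - x| ‖ξ‖`, in whichever
direction. The same envelope therefore serves forward and backward propagation. -/
theorem env_mul_exp_le (hc : 0 ≤ c) (h₀ : 0 ≤ N₀) (h₁ : 0 ≤ N₁) (ξ : Plane) :
    env c T N₀ N₁ x ξ * Real.exp (-c * |y - x| * ‖ξ‖) ≤ env c T N₀ N₁ y ξ := by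
  unfold env
  have hw := wt_nonneg ξ
  have hξ := norm_nonneg ξ
  rw [mul_right_comm]
  refine mul_le_mul_of_nonneg_right ?_ hw
  rw [add_mul, mul_assoc N₀, mul_assoc N₁, ← Real.exp_add, ← Real.exp_add]
  have hcx := mul_nonneg hc hξ
  have a1 := le_abs_self (y - x)
  have a2 := neg_abs_le (y - x)
  gcongr
  · nlinarith
  · nlinarith

/-- The pointwise form of the algebra property. Like exponentials multiply well by the triangle
inequality for `‖ξ‖`; the mixed products are the delicate ones. The constant is 2 from the
exponentials times 8 from `wt_mul_le`. -/
theorem env_mul_le (hc : 0 ≤ c) (h₀ : 0 ≤ N₀) (h₁ : 0 ≤ N₁) (hx : x ∈ Icc 0 T) (ξ η : Plane) :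
    env c T N₀ N₁ x η * env c T N₀ N₁ x (ξ - η) ≤
      16 * (N₀ + N₁) * env c T N₀ N₁ x ξ * (wt η + wt (ξ - η)) := by
  have hξ : ‖ξ‖ ≤ ‖η‖ + ‖ξ - η‖ := by
    calc ‖ξ‖ = ‖η + (ξ - η)‖ := by congr 1; abel
      _ ≤ _ := norm_add_le _ _
  have hw := wt_mul_le ξ η
  obtain ⟨hx0, hxT⟩ := hx
  have hxT' : 0 ≤ T - x := by linarith
  set a := ‖η‖ with ha
  set b := ‖ξ - η‖ with hb
  set s := ‖ξ‖ with hs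
  have ha0 : 0 ≤ a := norm_nonneg _
  have hb0 : 0 ≤ b := norm_nonneg _
  set E := Real.exp (-c * x * s) with hE
  set E' := Real.exp (-c * (T - x) * s) with hE'
  have pE : 0 < E := Real.exp_pos _
  have pE' : 0 < E' := Real.exp_pos _
  have k1 : ∀ u v : ℝ, 0 ≤ u → 0 ≤ v → s ≤ u + v →
      Real.exp (-c * x * u) * Real.exp (-c * x * v) ≤ E := by
    intro u v hu hv huv
    rw [← Real.exp_add, hE]; apply Real.exp_le_exp.2
    have := mul_le_mul_of_nonneg_left huv (mul_nonneg hc hx0); nlinarith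
  have k2 : ∀ u v : ℝ, 0 ≤ u → 0 ≤ v → s ≤ u + v →
      Real.exp (-c * (T - x) * u) * Real.exp (-c * (T - x) * v) ≤ E' := by
    intro u v hu hv huv
    rw [← Real.exp_add, hE']; apply Real.exp_le_exp.2
    have := mul_le_mul_of_nonneg_left huv (mul_nonneg hc hxT'); nlinarith
  -- Mixed product: both rates may be lowered to the smaller of `x` and `T - x`, which reduces to
  -- `k1` or `k2`.
  have k3 : ∀ u v : ℝ, 0 ≤ u → 0 ≤ v → s ≤ u + v →
      Real.exp (-c * x * u) * Real.exp (-c * (T - x) * v) ≤ E + E' := by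
    intro u v hu hv huv
    rcases le_total x (T - x) with h | h
    · refine le_trans ?_ (le_add_of_nonneg_right pE'.le)
      refine le_trans ?_ (k1 u v hu hv huv)
      gcongr Real.exp (-c * x * u) * Real.exp ?_
      have := mul_le_mul_of_nonneg_left h (mul_nonneg hc hv); nlinarith
    · refine le_trans ?_ (le_add_of_nonneg_left pE.le)
      refine le_trans ?_ (k2 u v hu hv huv)
      gcongr Real.exp ?_ * Real.exp (-c * (T - x) * v)
      have := mul_le_mul_of_nonneg_left h (mul_nonneg hc hu); nlinarith
  have key : (N₀ * Real.exp (-c * x * a) + N₁ * Real.exp (-c * (T - x) * a)) *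
      (N₀ * Real.exp (-c * x * b) + N₁ * Real.exp (-c * (T - x) * b)) ≤
      2 * (N₀ + N₁) * (N₀ * E + N₁ * E') := by
    have l1 := mul_le_mul_of_nonneg_left (k1 a b ha0 hb0 hξ) (mul_nonneg h₀ h₀)
    have l2 := mul_le_mul_of_nonneg_left (k2 a b ha0 hb0 hξ) (mul_nonneg h₁ h₁)
    have l3 := mul_le_mul_of_nonneg_left (k3 a b ha0 hb0 hξ) (mul_nonneg h₀ h₁)
    have l4 := mul_le_mul_of_nonneg_left (k3 b a hb0 ha0 (by linarith)) (mul_nonneg h₀ h₁)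
    have q1 := mul_nonneg (mul_nonneg h₀ h₀) pE.le
    have q2 := mul_nonneg (mul_nonneg h₁ h₁) pE'.le
    nlinarith
  have hm0 : 0 ≤ N₀ * E + N₁ * E' := by positivity
  calc env c T N₀ N₁ x η * env c T N₀ N₁ x (ξ - η)
      = ((N₀ * Real.exp (-c * x * a) + N₁ * Real.exp (-c * (T - x) * a)) *
      (N₀ * Real.exp (-c * x * b) + N₁ * Real.exp (-c * (T - x) * b))) *
        (wt η * wt (ξ - η)) := by unfold env; ring
    _ ≤ (2 * (N₀ + N₁) * (N₀ * E + N₁ * E')) * (8 * wt ξ * (wt η + wt (ξ - η))) :=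
        mul_le_mul key hw (mul_nonneg (wt_nonneg _) (wt_nonneg _)) (by positivity)
    _ = _ := by unfold env; ring

end Env

/-! ### Holomorphic families of integrands -/

/-- The derivative is the limit of difference quotients along one sequence of increments, so
measurability at each fixed parameter suffices; joint measurability is not needed. -/
theorem aestronglyMeasurable_deriv {α : Type*} [MeasurableSpace α] {ν : Measure α}
    {E : Type*} [NormedAddCommGroup E] [NormedSpace ℂ E]
    {f : ℂ → α → E} {U : Set ℂ} (hU : IsOpen U) (hm : ∀ t ∈ U, AEStronglyMeasurable (f t) ν)
    (hd : ∀ᵐ x ∂ν, DifferentiableOn ℂ (fun t => f t x) U) {t : ℂ} (ht : t ∈ U) :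
    AEStronglyMeasurable (fun x => deriv (fun t => f t x) t) ν := by
  obtain ⟨r, hr, hrU⟩ := Metric.isOpen_iff.1 hU t ht
  set a : ℕ → ℂ := fun n => ((r / 2 * (1 / ((n : ℝ) + 1)) : ℝ) : ℂ) with ha
  have ha_pos : ∀ n : ℕ, 0 < r / 2 * (1 / ((n : ℝ) + 1)) := fun n => by positivity
  have ha0 : Tendsto a atTop (𝓝[≠] 0) := by
    refine tendsto_nhdsWithin_iff.2 ⟨?_, Eventually.of_forall fun n => ?_⟩
    · have h := (tendsto_one_div_add_atTop_nhds_zero_nat (𝕜 := ℝ)).const_mul (r / 2)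
      rw [mul_zero] at h
      exact (Complex.continuous_ofReal.tendsto' 0 0 (by simp)).comp h
    · simpa [ha] using ⟨hr.ne', by norm_cast⟩
  have haU : ∀ n, t + a n ∈ U := by
    intro n
    apply hrU
    rw [Metric.mem_ball, dist_eq_norm, add_sub_cancel_left, ha, Complex.norm_real,
      Real.norm_of_nonneg (ha_pos n).le]
    have : 1 / ((n : ℝ) + 1) ≤ 1 := by
      rw [div_le_one (by positivity)]; linarith [(Nat.cast_nonneg n : (0 : ℝ) ≤ n)]
    nlinarith
  refine aestronglyMeasurable_of_tendsto_ae atTop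
    (f := fun n x => (a n)⁻¹ • (f (t + a n) x - f t x))
    (fun n => ((hm _ (haU n)).sub (hm t ht)).const_smul _) ?_
  filter_upwards [hd] with x hx
  have hx' := (hx.differentiableAt (hU.mem_nhds ht)).hasDerivAt
  exact (hasDerivAt_iff_tendsto_slope_zero.1 hx').comp ha0

/-- For holomorphic integrands a majorant of the functions alone is enough: Cauchy's estimate on
circles of radius `r / 4` bounds the derivatives by `B / (r / 4)`. -/
theorem hasDerivAt_integral_of_differentiableOn {α : Type*} [MeasurableSpace α] {ν : Measure α}
    {E : Type*} [NormedAddCommGroup E] [NormedSpace ℂ E] [CompleteSpace E]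
    {f : ℂ → α → E} {U : Set ℂ} (hU : IsOpen U)
    (hm : ∀ t ∈ U, AEStronglyMeasurable (f t) ν)
    (hd : ∀ᵐ x ∂ν, DifferentiableOn ℂ (fun t => f t x) U) {B : α → ℝ} (hB : Integrable B ν)
    (hb : ∀ᵐ x ∂ν, ∀ t ∈ U, ‖f t x‖ ≤ B x) {t : ℂ} (ht : t ∈ U) :
    HasDerivAt (fun t => ∫ x, f t x ∂ν) (∫ x, deriv (fun t => f t x) t ∂ν) t := by
  obtain ⟨r, hr, hrU⟩ := Metric.isOpen_iff.1 hU t ht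
  have hsub : ∀ s ∈ Metric.ball t (r / 2), Metric.closedBall s (r / 4) ⊆ U := by
    intro s hs y hy
    apply hrU
    rw [Metric.mem_ball] at hs ⊢
    rw [Metric.mem_closedBall] at hy
    have := dist_triangle y s t
    linarith
  refine (hasDerivAt_integral_of_dominated_loc_of_deriv_le (𝕜 := ℂ) (μ := ν)
    (s := Metric.ball t (r / 2)) (bound := fun x => B x / (r / 4))
    (F' := fun s x => deriv (fun t => f t x) s)
    (Metric.ball_mem_nhds t (by positivity)) ?_ ?_ ?_ ?_ (hB.div_const _) ?_).2
  · filter_upwards [hU.mem_nhds ht] with s hs using hm s hs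
  · exact hB.mono' (hm t ht) (hb.mono fun x hx => hx t ht)
  · exact aestronglyMeasurable_deriv hU hm hd ht
  · filter_upwards [hd, hb] with x hx hbx s hs
    refine Complex.norm_deriv_le_of_forall_mem_sphere_norm_le (by positivity)
      ((hx.mono (hsub s hs)).diffContOnCl_ball subset_rfl) fun z hz => ?_
    exact hbx z (hsub s hs (Metric.sphere_subset_closedBall hz))
  · filter_upwards [hd] with x hx s hs
    refine (hx.differentiableAt (hU.mem_nhds ?_)).hasDerivAt
    exact hsub s hs (Metric.mem_closedBall_self (by positivity))

theorem differentiableOn_integral_of_differentiableOn {α : Type*} [MeasurableSpace α]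
    {ν : Measure α} {E : Type*} [NormedAddCommGroup E] [NormedSpace ℂ E] [CompleteSpace E]
    {f : ℂ → α → E} {U : Set ℂ} (hU : IsOpen U)
    (hm : ∀ t ∈ U, AEStronglyMeasurable (f t) ν)
    (hd : ∀ᵐ x ∂ν, DifferentiableOn ℂ (fun t => f t x) U) {B : α → ℝ} (hB : Integrable B ν)
    (hb : ∀ᵐ x ∂ν, ∀ t ∈ U, ‖f t x‖ ≤ B x) :
    DifferentiableOn ℂ (fun t => ∫ x, f t x ∂ν) U := fun _ ht =>
  (hasDerivAt_integral_of_differentiableOn hU hm hd hB hb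
    ht).differentiableAt.differentiableWithinAt

/-! ### The complex time diamond and admissible functions -/

/-- The closed diamond of aperture `σ` over the time interval `[0, T]`. -/
def diamond (σ T : ℝ) : Set ℂ := {t | |t.im| ≤ σ * t.re ∧ |t.im| ≤ σ * (T - t.re)}

/-- The open diamond of aperture `σ` over the time interval `]0, T[`. -/
def openDiamond (σ T : ℝ) : Set ℂ := {t | |t.im| < σ * t.re ∧ |t.im| < σ * (T - t.re)}

section Diamond

variable {σ T : ℝ}

theorem isOpen_openDiamond : IsOpen (openDiamond σ T) := by
  refine IsOpen.and (isOpen_lt ?_ ?_) (isOpen_lt ?_ ?_)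
  all_goals first
    | exact Complex.continuous_im.abs
    | exact (continuous_const.mul Complex.continuous_re)
    | exact (continuous_const.mul (continuous_const.sub Complex.continuous_re))

theorem openDiamond_subset : openDiamond σ T ⊆ diamond σ T := fun _ h => ⟨h.1.le, h.2.le⟩

theorem re_mem_of_mem_diamond (hσ : 0 < σ) {t : ℂ} (ht : t ∈ diamond σ T) : t.re ∈ Icc 0 T := by
  constructor
  · exact nonneg_of_mul_nonneg_right ((abs_nonneg _).trans ht.1) hσ
  · exact sub_nonneg.1 (nonneg_of_mul_nonneg_right ((abs_nonneg _).trans ht.2) hσ)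

theorem ofReal_mem_diamond (hσ : 0 < σ) {t : ℝ} (ht : t ∈ Icc 0 T) : (t : ℂ) ∈ diamond σ T := by
  constructor
  · simpa using mul_nonneg hσ.le ht.1
  · simpa using mul_nonneg hσ.le (sub_nonneg.2 ht.2)

theorem ofReal_mem_openDiamond (hσ : 0 < σ) {t : ℝ} (ht : t ∈ Ioo 0 T) :
    (t : ℂ) ∈ openDiamond σ T := by
  constructor
  · simpa using mul_pos hσ ht.1
  · simpa using mul_pos hσ (sub_pos.2 ht.2)

/-- The symmetry `t ↦ T - t` of the diamond lets every backward statement be deduced from the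
forward one. -/
theorem reverse_mem_diamond {t : ℂ} (ht : t ∈ diamond σ T) : (T : ℂ) - t ∈ diamond σ T := by
  refine ⟨?_, ?_⟩
  · simpa using ht.2
  · simpa using ht.1

theorem reverse_mem_openDiamond {t : ℂ} (ht : t ∈ openDiamond σ T) :
    (T : ℂ) - t ∈ openDiamond σ T := by
  refine ⟨?_, ?_⟩
  · simpa using ht.2
  · simpa using ht.1

/-- The diamond is star-shaped about `0`, so that the Duhamel integral can run along the segment
from `0` to `t`. -/
theorem smul_mem_diamond (hσ : 0 < σ) {t : ℂ} (ht : t ∈ diamond σ T) {τ : ℝ}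
    (hτ : τ ∈ Icc (0 : ℝ) 1) : (τ : ℂ) * t ∈ diamond σ T := by
  obtain ⟨h0, hT⟩ := re_mem_of_mem_diamond hσ ht
  obtain ⟨t1, t2⟩ := ht
  obtain ⟨τ0, τ1⟩ := hτ
  simp only [diamond, mem_ofPred_eq, Complex.mul_im, Complex.ofReal_re, Complex.ofReal_im, zero_mul,
    add_zero, Complex.mul_re, sub_zero, abs_mul, abs_of_nonneg τ0]
  constructor
  · nlinarith
  · nlinarith [mul_nonneg hσ.le (mul_nonneg (h0.trans hT) (sub_nonneg.2 τ1))]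

theorem smul_mem_openDiamond (hσ : 0 < σ) {t : ℂ} (ht : t ∈ openDiamond σ T) {τ : ℝ}
    (hτ : τ ∈ Ioc (0 : ℝ) 1) : (τ : ℂ) * t ∈ openDiamond σ T := by
  obtain ⟨h0, hT⟩ := re_mem_of_mem_diamond hσ (openDiamond_subset ht)
  obtain ⟨t1, t2⟩ := ht
  obtain ⟨τ0, τ1⟩ := hτ
  simp only [openDiamond, mem_ofPred_eq, Complex.mul_im, Complex.ofReal_re, Complex.ofReal_im,
    zero_mul, add_zero, Complex.mul_re, sub_zero, abs_mul, abs_of_nonneg τ0.le]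
  constructor
  · nlinarith
  · nlinarith [mul_nonneg hσ.le (mul_nonneg (h0.trans hT) (sub_nonneg.2 τ1))]

end Diamond

/-- Functions of complex time and frequency with the measurability, holomorphy and symmetry of the
Fourier transform of a real function analytic in time, bounded by `R` times the envelope. -/
structure Adm (σ T c N₀ N₁ R : ℝ) (s : ℂ → Plane → ℂ) : Prop where
  meas : Measurable fun w : ℂ × Plane => s w.1 w.2
  bound : ∀ t ∈ diamond σ T, ∀ ξ, ‖s t ξ‖ ≤ R * env c T N₀ N₁ t.re ξ
  holo : ∀ ξ, DifferentiableOn ℂ (fun t => s t ξ) (openDiamond σ T)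
  symm : ∀ t ∈ Icc 0 T, ∀ ξ, s (t : ℝ) (-ξ) = conj (s (t : ℝ) ξ)

/-- The convolution of two functions on the frequency plane. -/
def conv (u v : Plane → ℂ) (ξ : Plane) : ℂ := ∫ η, u η * v (ξ - η)

/-- The norm of the convolution product for the envelope. -/
def convConst (N₀ N₁ : ℝ) : ℝ := 32 * wtMass * (N₀ + N₁)

namespace Adm

variable {σ T c N₀ N₁ R R' : ℝ} {s u v : ℂ → Plane → ℂ}

theorem measurable_right (h : Adm σ T c N₀ N₁ R s) (t : ℂ) : Measurable (s t) :=
  h.meas.comp measurable_prodMk_left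

theorem measurable_left (h : Adm σ T c N₀ N₁ R s) (ξ : Plane) : Measurable fun t => s t ξ :=
  h.meas.comp measurable_prodMk_right

theorem congr (h : Adm σ T c N₀ N₁ R s) (hσ : 0 < σ)
    (hu : Measurable fun w : ℂ × Plane => u w.1 w.2)
    (he : ∀ t ∈ diamond σ T, ∀ ξ, u t ξ = s t ξ) : Adm σ T c N₀ N₁ R u where
  meas := hu
  bound t ht ξ := by rw [he t ht]; exact h.bound t ht ξ
  holo ξ := (h.holo ξ).congr fun t ht => he t (openDiamond_subset ht) ξ
  symm t ht ξ := by
    rw [he _ (ofReal_mem_diamond hσ ht), he _ (ofReal_mem_diamond hσ ht), h.symm t ht]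

theorem mono (h : Adm σ T c N₀ N₁ R s) (h₀ : 0 ≤ N₀) (h₁ : 0 ≤ N₁) (hR : R ≤ R') :
    Adm σ T c N₀ N₁ R' s where
  meas := h.meas
  bound t ht ξ := (h.bound t ht ξ).trans <| by
    have := env_nonneg (c := c) (T := T) (x := t.re) h₀ h₁ ξ
    gcongr
  holo := h.holo
  symm := h.symm

theorem zero : Adm σ T c N₀ N₁ 0 (fun _ _ => 0) where
  meas := measurable_const
  bound t ht ξ := by simp
  holo ξ := differentiableOn_const _
  symm t ht ξ := by simp

theorem add (hu : Adm σ T c N₀ N₁ R u) (hv : Adm σ T c N₀ N₁ R' v) :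
    Adm σ T c N₀ N₁ (R + R') (fun t ξ => u t ξ + v t ξ) where
  meas := hu.meas.add hv.meas
  bound t ht ξ := (norm_add_le _ _).trans (by
    rw [add_mul]; exact add_le_add (hu.bound t ht ξ) (hv.bound t ht ξ))
  holo ξ := (hu.holo ξ).add (hv.holo ξ)
  symm t ht ξ := by rw [hu.symm t ht, hv.symm t ht, map_add]

theorem neg (hu : Adm σ T c N₀ N₁ R u) : Adm σ T c N₀ N₁ R (fun t ξ => -u t ξ) where
  meas := hu.meas.neg
  bound t ht ξ := by rw [norm_neg]; exact hu.bound t ht ξ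
  holo ξ := (hu.holo ξ).neg
  symm t ht ξ := by rw [hu.symm t ht, map_neg]

theorem sub (hu : Adm σ T c N₀ N₁ R u) (hv : Adm σ T c N₀ N₁ R' v) :
    Adm σ T c N₀ N₁ (R + R') (fun t ξ => u t ξ - v t ξ) := by
  simpa [sub_eq_add_neg] using hu.add hv.neg

theorem sum {ι : Type*} (A : Finset ι) {f : ι → ℂ → Plane → ℂ} {r : ι → ℝ}
    (hf : ∀ i ∈ A, Adm σ T c N₀ N₁ (r i) (f i)) :
    Adm σ T c N₀ N₁ (∑ i ∈ A, r i) (fun t ξ => ∑ i ∈ A, f i t ξ) := by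
  classical
  induction A using Finset.induction_on with
  | empty => simpa using zero
  | insert a A ha ih =>
    simp only [Finset.sum_insert ha]
    exact (hf a (Finset.mem_insert_self _ _)).add
      (ih fun i hi => hf i (Finset.mem_insert_of_mem hi))

theorem symbol_mul (hu : Adm σ T c N₀ N₁ R u) {a : Plane → ℂ} {C : ℝ}
    (hm : Measurable a) (hC : ∀ ξ, ‖a ξ‖ ≤ C) (hs : ∀ ξ, a (-ξ) = conj (a ξ)) :
    Adm σ T c N₀ N₁ (C * R) (fun t ξ => a ξ * u t ξ) where
  meas := (hm.comp measurable_snd).mul hu.meas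
  bound t ht ξ := by
    rw [norm_mul, mul_assoc]
    exact mul_le_mul (hC ξ) (hu.bound t ht ξ) (norm_nonneg _) ((norm_nonneg _).trans (hC ξ))
  holo ξ := (hu.holo ξ).const_mul _
  symm t ht ξ := by rw [hu.symm t ht, hs, map_mul]

theorem const_mul (hu : Adm σ T c N₀ N₁ R u) (a : ℝ) :
    Adm σ T c N₀ N₁ (|a| * R) (fun t ξ => (a : ℂ) * u t ξ) :=
  hu.symbol_mul (a := fun _ => (a : ℂ)) measurable_const (fun _ => by simp) (fun _ => by simp)

theorem reverse (hu : Adm σ T c N₀ N₁ R u) : Adm σ T c N₁ N₀ R (fun t ξ => u (T - t) ξ) where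
  meas := hu.meas.comp ((measurable_const.sub measurable_fst).prodMk measurable_snd)
  bound t ht ξ := by
    have := hu.bound _ (reverse_mem_diamond ht) ξ
    rwa [Complex.sub_re, Complex.ofReal_re, env_reverse] at this
  holo ξ := by
    refine (hu.holo ξ).comp (t := openDiamond σ T) (f := fun t => (T : ℂ) - t)
      (g := fun t => u t ξ) (by fun_prop) fun t ht => reverse_mem_openDiamond ht
  symm t ht ξ := by
    have := hu.symm (T - t) ⟨by linarith [ht.2], by linarith [ht.1]⟩ ξ
    push_cast at this
    exact this

theorem bound_wt (hu : Adm σ T c N₀ N₁ R u) (hσ : 0 < σ) (hc : 0 ≤ c) (h₀ : 0 ≤ N₀) (h₁ : 0 ≤ N₁)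
    (hR : 0 ≤ R) {t : ℂ} (ht : t ∈ diamond σ T) (ξ : Plane) :
    ‖u t ξ‖ ≤ R * ((N₀ + N₁) * wt ξ) :=
  (hu.bound t ht ξ).trans
    (mul_le_mul_of_nonneg_left (env_le_wt hc h₀ h₁ (re_mem_of_mem_diamond hσ ht) ξ) hR)

theorem integrable (hu : Adm σ T c N₀ N₁ R u) (hσ : 0 < σ) (hc : 0 ≤ c) (h₀ : 0 ≤ N₀)
    (h₁ : 0 ≤ N₁) {t : ℂ} (ht : t ∈ diamond σ T) : Integrable (u t) :=
  ((integrable_env hc h₀ h₁ (re_mem_of_mem_diamond hσ ht)).const_mul R).mono'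
    (hu.measurable_right t).aestronglyMeasurable (Eventually.of_forall (hu.bound t ht))

theorem norm_mul_le (hu : Adm σ T c N₀ N₁ R u) (hv : Adm σ T c N₀ N₁ R' v) (hσ : 0 < σ)
    (hc : 0 ≤ c) (h₀ : 0 ≤ N₀) (h₁ : 0 ≤ N₁) (hR : 0 ≤ R) (hR' : 0 ≤ R') {t : ℂ}
    (ht : t ∈ diamond σ T) (ξ η : Plane) :
    ‖u t η * v t (ξ - η)‖ ≤
      R * R' * (16 * (N₀ + N₁) * env c T N₀ N₁ t.re ξ * (wt η + wt (ξ - η))) := by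
  rw [norm_mul]
  calc ‖u t η‖ * ‖v t (ξ - η)‖
      ≤ (R * env c T N₀ N₁ t.re η) * (R' * env c T N₀ N₁ t.re (ξ - η)) :=
        mul_le_mul (hu.bound t ht η) (hv.bound t ht _) (norm_nonneg _)
          (mul_nonneg hR (env_nonneg h₀ h₁ _))
    _ = R * R' * (env c T N₀ N₁ t.re η * env c T N₀ N₁ t.re (ξ - η)) := by ring
    _ ≤ _ := mul_le_mul_of_nonneg_left
        (env_mul_le hc h₀ h₁ (re_mem_of_mem_diamond hσ ht) ξ η) (mul_nonneg hR hR')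

theorem measurable_conv_integrand (hu : Adm σ T c N₀ N₁ R u) (hv : Adm σ T c N₀ N₁ R' v) :
    Measurable fun w : (ℂ × Plane) × Plane => u w.1.1 w.2 * v w.1.1 (w.1.2 - w.2) :=
  (hu.meas.comp (measurable_fst.fst.prodMk measurable_snd)).mul
    (hv.meas.comp (measurable_fst.fst.prodMk (measurable_fst.snd.sub measurable_snd)))

theorem integrable_conv (hu : Adm σ T c N₀ N₁ R u) (hv : Adm σ T c N₀ N₁ R' v) (hσ : 0 < σ)
    (hc : 0 ≤ c) (h₀ : 0 ≤ N₀) (h₁ : 0 ≤ N₁) (hR : 0 ≤ R) (hR' : 0 ≤ R') {t : ℂ}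
    (ht : t ∈ diamond σ T) (ξ : Plane) : Integrable fun η => u t η * v t (ξ - η) :=
  (((integrable_wt.add (integrable_wt_sub ξ)).const_mul
    (16 * (N₀ + N₁) * env c T N₀ N₁ t.re ξ)).const_mul (R * R')).mono'
    ((measurable_conv_integrand hu hv).comp
      (measurable_prodMk_left (x := (t, ξ)))).aestronglyMeasurable
    (Eventually.of_forall (norm_mul_le hu hv hσ hc h₀ h₁ hR hR' ht ξ))

/-- Integration of the pointwise estimate in `η`: the two weights contribute `2 * wtMass`, whence
the factor `32` in `convConst`. -/
theorem conv (hu : Adm σ T c N₀ N₁ R u) (hv : Adm σ T c N₀ N₁ R' v) (hσ : 0 < σ)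
    (hc : 0 ≤ c) (h₀ : 0 ≤ N₀) (h₁ : 0 ≤ N₁) (hR : 0 ≤ R) (hR' : 0 ≤ R') :
    Adm σ T c N₀ N₁ (R * R' * convConst N₀ N₁) (fun t => CrowdMFG.conv (u t) (v t)) where
  meas := by
    have := (measurable_conv_integrand hu hv).stronglyMeasurable
    exact (StronglyMeasurable.integral_prod_right (ν := (volume : Measure Plane))
      (f := fun (w : ℂ × Plane) η => u w.1 η * v w.1 (w.2 - η)) this).measurable
  bound t ht ξ := by
    unfold CrowdMFG.conv
    refine (norm_integral_le_of_norm_le (((integrable_wt.add (integrable_wt_sub ξ)).const_mul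
      (16 * (N₀ + N₁) * env c T N₀ N₁ t.re ξ)).const_mul (R * R'))
      (Eventually.of_forall (norm_mul_le hu hv hσ hc h₀ h₁ hR hR' ht ξ))).trans ?_
    simp only [Pi.add_apply]
    rw [integral_const_mul, integral_const_mul, integral_add integrable_wt (integrable_wt_sub ξ),
      integral_wt_sub]
    change _ * (_ * (wtMass + wtMass)) ≤ _
    unfold convConst
    linarith
  holo ξ := by
    refine differentiableOn_integral_of_differentiableOn isOpen_openDiamond
      -- A cruder majorant, uniform in `t`, is enough for holomorphy: the second weight is replaced
      -- by `1`.
      (B := fun η => R * ((N₀ + N₁) * wt η) * (R' * ((N₀ + N₁) * 1))) (fun t ht => ?_)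
      (Eventually.of_forall fun η => (hu.holo η).mul (hv.holo (ξ - η)))
      (((integrable_wt.const_mul _).const_mul _).mul_const _)
      (Eventually.of_forall fun η t ht => ?_)
    · exact ((measurable_conv_integrand hu hv).comp
        (measurable_prodMk_left (x := (t, ξ)))).aestronglyMeasurable
    · rw [norm_mul]
      have ht' := openDiamond_subset ht
      have := wt_nonneg η
      have := wt_le_one (ξ - η)
      refine mul_le_mul (hu.bound_wt hσ hc h₀ h₁ hR ht' η)
        ((hv.bound_wt hσ hc h₀ h₁ hR' ht' _).trans (by gcongr)) (norm_nonneg _) (by positivity)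
  symm t ht ξ := by
    unfold CrowdMFG.conv
    rw [← integral_conj, ← integral_neg_eq_self]
    refine integral_congr_ae (Eventually.of_forall fun η => ?_)
    have : -ξ - -η = -(ξ - η) := by abel
    simp only [this, hu.symm t ht, hv.symm t ht, map_mul]

/-- Bilinearity: `u * u' - v * v' = (u - v) * u' + v * (u' - v')` for convolution products. -/
theorem conv_sub_conv {u' v' : ℂ → Plane → ℂ} {θ θ' : ℝ} (hu : Adm σ T c N₀ N₁ R u)
    (hv : Adm σ T c N₀ N₁ R v) (hu' : Adm σ T c N₀ N₁ R' u') (hv' : Adm σ T c N₀ N₁ R' v')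
    (hd : Adm σ T c N₀ N₁ θ (fun t ξ => u t ξ - v t ξ))
    (hd' : Adm σ T c N₀ N₁ θ' (fun t ξ => u' t ξ - v' t ξ)) (hσ : 0 < σ)
    (hc : 0 ≤ c) (h₀ : 0 ≤ N₀) (h₁ : 0 ≤ N₁) (hR : 0 ≤ R) (hR' : 0 ≤ R') (hθ : 0 ≤ θ)
    (hθ' : 0 ≤ θ') :
    Adm σ T c N₀ N₁ ((θ * R' + R * θ') * convConst N₀ N₁)
      (fun t ξ => CrowdMFG.conv (u t) (u' t) ξ - CrowdMFG.conv (v t) (v' t) ξ) := by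
  have h := (hd.conv hu' hσ hc h₀ h₁ hθ hR').add (hv.conv hd' hσ hc h₀ h₁ hR hθ')
  rw [← add_mul] at h
  refine h.congr hσ ((hu.conv hu' hσ hc h₀ h₁ hR hR').meas.sub
    (hv.conv hv' hσ hc h₀ h₁ hR hR').meas) fun t ht ξ => ?_
  have i1 := hu.integrable_conv hu' hσ hc h₀ h₁ hR hR' ht ξ
  have i2 := hv.integrable_conv hv' hσ hc h₀ h₁ hR hR' ht ξ
  have i3 := hd.integrable_conv hu' hσ hc h₀ h₁ hθ hR' ht ξ
  have i4 := hv.integrable_conv hd' hσ hc h₀ h₁ hR hθ' ht ξ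
  unfold CrowdMFG.conv
  rw [← integral_sub i1 i2, ← integral_add i3 i4]
  congr 1; ext η; ring

/-- Limits of admissible functions. -/
theorem of_tendsto {f : ℕ → ℂ → Plane → ℂ} (hf : ∀ n, Adm σ T c N₀ N₁ R (f n)) {θ : ℕ → ℝ}
    (hθ : Tendsto θ atTop (𝓝 0)) (hσ : 0 < σ) (hc : 0 ≤ c) (h₀ : 0 ≤ N₀) (h₁ : 0 ≤ N₁)
    (hs : Measurable fun w : ℂ × Plane => s w.1 w.2)
    (hle : ∀ n, ∀ t ∈ diamond σ T, ∀ ξ, ‖f n t ξ - s t ξ‖ ≤ θ n * env c T N₀ N₁ t.re ξ) :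
    Adm σ T c N₀ N₁ R s ∧ ∀ n, Adm σ T c N₀ N₁ (θ n) (fun t ξ => f n t ξ - s t ξ) := by
  have hlim : ∀ t ∈ diamond σ T, ∀ ξ, Tendsto (fun n => f n t ξ) atTop (𝓝 (s t ξ)) := by
    intro t ht ξ
    rw [tendsto_iff_norm_sub_tendsto_zero]
    refine squeeze_zero (fun n => norm_nonneg _) (fun n => hle n t ht ξ) ?_
    simpa using hθ.mul_const (env c T N₀ N₁ t.re ξ)
  have hA : Adm σ T c N₀ N₁ R s := by
    refine ⟨hs, fun t ht ξ => ?_, fun ξ => ?_, fun t ht ξ => ?_⟩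
    · exact le_of_tendsto (hlim t ht ξ).norm (Eventually.of_forall fun n => (hf n).bound t ht ξ)
    · refine TendstoLocallyUniformlyOn.differentiableOn (φ := atTop)
        (F := fun n t => f n t ξ) ?_ (Eventually.of_forall fun n => (hf n).holo ξ)
        isOpen_openDiamond
      refine TendstoUniformlyOn.tendstoLocallyUniformlyOn ?_
      rw [Metric.tendstoUniformlyOn_iff]
      intro ε hε
      have h0 : Tendsto (fun n => |θ n| * ((N₀ + N₁) * wt ξ)) atTop (𝓝 0) := by
        simpa using hθ.abs.mul_const ((N₀ + N₁) * wt ξ)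
      filter_upwards [h0.eventually (gt_mem_nhds hε)] with n hn t ht
      rw [dist_comm, dist_eq_norm]
      refine lt_of_le_of_lt (hle n t (openDiamond_subset ht) ξ) (lt_of_le_of_lt ?_ hn)
      refine mul_le_mul (le_abs_self _) (env_le_wt hc h₀ h₁
        (re_mem_of_mem_diamond hσ (openDiamond_subset ht)) ξ) (env_nonneg h₀ h₁ _) (abs_nonneg _)
    · have h1 := hlim t (ofReal_mem_diamond hσ ht) (-ξ)
      have h2 := (Complex.continuous_conj.tendsto _).comp (hlim t (ofReal_mem_diamond hσ ht) ξ)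
      refine tendsto_nhds_unique h1 (h2.congr fun n => ?_)
      simp [(hf n).symm t ht]
  exact ⟨hA, fun n => ⟨(hf n).meas.sub hs, hle n, fun ξ => ((hf n).holo ξ).sub (hA.holo ξ),
    fun t ht ξ => by rw [(hf n).symm t ht, hA.symm t ht, map_sub]⟩⟩

end Adm

/-! ### Polynomial nonlinearities -/

/-- Polynomial expressions in three unknowns, without constant term. -/
inductive Poly : Type
  | var (i : Fin 3) : Poly
  | add (p q : Poly) : Poly
  | smul (a : ℝ) (p : Poly) : Poly
  | mul (p q : Poly) : Poly

namespace Poly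

/-- Evaluation of a polynomial expression. -/
def eval {𝕜 : Type*} [CommRing 𝕜] [Algebra ℝ 𝕜] (x : Fin 3 → 𝕜) : Poly → 𝕜
  | var i => x i
  | add p q => eval x p + eval x q
  | smul a p => algebraMap ℝ 𝕜 a * eval x p
  | mul p q => eval x p * eval x q

/-- Evaluation of a polynomial expression, with convolutions in place of products. -/
def four (u : Fin 3 → ℂ → Plane → ℂ) : Poly → ℂ → Plane → ℂ
  | var i => u i
  | add p q => fun t ξ => four u p t ξ + four u q t ξ
  | smul a p => fun t ξ => (a : ℂ) * four u p t ξ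
  | mul p q => fun t => conv (four u p t) (four u q t)

/-- A bound for a polynomial expression of arguments bounded by `R`. -/
def size (R : ℝ) : Poly → ℝ
  | var _ => R
  | add p q => size R p + size R q
  | smul a p => |a| * size R p
  | mul p q => size R p * size R q

/-- A Lipschitz constant for a polynomial expression of arguments bounded by `R`. -/
def lip (R : ℝ) : Poly → ℝ
  | var _ => 1
  | add p q => lip R p + lip R q
  | smul a p => |a| * lip R p
  | mul p q => lip R p * size R q + size R p * lip R q

theorem size_nonneg {R : ℝ} (hR : 0 ≤ R) (p : Poly) : 0 ≤ size R p := by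
  induction p with
  | var i => exact hR
  | add p q hp hq => exact add_nonneg hp hq
  | smul a p hp => exact mul_nonneg (abs_nonneg a) hp
  | mul p q hp hq => exact mul_nonneg hp hq

theorem lip_nonneg {R : ℝ} (hR : 0 ≤ R) (p : Poly) : 0 ≤ lip R p := by
  induction p with
  | var i => exact zero_le_one
  | add p q hp hq => exact add_nonneg hp hq
  | smul a p hp => exact mul_nonneg (abs_nonneg a) hp
  | mul p q hp hq =>
    exact add_nonneg (mul_nonneg hp (size_nonneg hR q)) (mul_nonneg (size_nonneg hR p) hq)

section

variable {σ T c N₀ N₁ R θ : ℝ} {u v : Fin 3 → ℂ → Plane → ℂ}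

/-- Once `convConst N₀ N₁ ≤ 1`, convolution is submultiplicative for the constants `R`, so these
obey the same arithmetic as absolute values of numbers. -/
theorem adm_four (hu : ∀ i, Adm σ T c N₀ N₁ R (u i)) (hσ : 0 < σ) (hc : 0 ≤ c) (h₀ : 0 ≤ N₀)
    (h₁ : 0 ≤ N₁) (hκ : convConst N₀ N₁ ≤ 1) (hR : 0 ≤ R) (p : Poly) :
    Adm σ T c N₀ N₁ (size R p) (four u p) := by
  induction p with
  | var i => exact hu i
  | add p q hp hq => exact hp.add hq
  | smul a p hp => exact hp.const_mul a
  | mul p q hp hq =>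
    refine (hp.conv hq hσ hc h₀ h₁ (size_nonneg hR p) (size_nonneg hR q)).mono h₀ h₁ ?_
    exact mul_le_of_le_one_right (mul_nonneg (size_nonneg hR p) (size_nonneg hR q)) hκ

theorem adm_four_sub (hu : ∀ i, Adm σ T c N₀ N₁ R (u i)) (hv : ∀ i, Adm σ T c N₀ N₁ R (v i))
    (hd : ∀ i, Adm σ T c N₀ N₁ θ (fun t ξ => u i t ξ - v i t ξ)) (hσ : 0 < σ) (hc : 0 ≤ c)
    (h₀ : 0 ≤ N₀) (h₁ : 0 ≤ N₁) (hκ : convConst N₀ N₁ ≤ 1) (hR : 0 ≤ R) (hθ : 0 ≤ θ) (p : Poly) :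
    Adm σ T c N₀ N₁ (lip R p * θ) (fun t ξ => four u p t ξ - four v p t ξ) := by
  induction p with
  | var i => simpa [four, lip] using hd i
  | add p q hp hq =>
    have := hp.add hq
    rw [← add_mul] at this
    refine this.congr hσ ((adm_four hu hσ hc h₀ h₁ hκ hR (add p q)).meas.sub
      (adm_four hv hσ hc h₀ h₁ hκ hR (add p q)).meas) fun t _ ξ => ?_
    simp only [four]; ring
  | smul a p hp =>
    have := hp.const_mul a
    rw [← mul_assoc] at this
    refine this.congr hσ ((adm_four hu hσ hc h₀ h₁ hκ hR (smul a p)).meas.sub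
      (adm_four hv hσ hc h₀ h₁ hκ hR (smul a p)).meas) fun t _ ξ => ?_
    simp only [four]; ring
  | mul p q hp hq =>
    have sp := size_nonneg hR p
    have sq := size_nonneg hR q
    have lp := mul_nonneg (lip_nonneg hR p) hθ
    have lq := mul_nonneg (lip_nonneg hR q) hθ
    refine (Adm.conv_sub_conv (adm_four hu hσ hc h₀ h₁ hκ hR p) (adm_four hv hσ hc h₀ h₁ hκ hR p)
      (adm_four hu hσ hc h₀ h₁ hκ hR q) (adm_four hv hσ hc h₀ h₁ hκ hR q) hp hq hσ hc h₀ h₁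
      sp sq lp lq).mono h₀ h₁ ?_
    refine (mul_le_of_le_one_right (by positivity) hκ).trans (le_of_eq ?_)
    simp only [lip]; ring

/-- A sum of products with the unknowns: a polynomial without constant and linear terms. -/
def fourQuad (P : Fin 3 → Poly) (u : Fin 3 → ℂ → Plane → ℂ) (t : ℂ) (ξ : Plane) : ℂ :=
  ∑ i, conv (four u (P i) t) (u i t) ξ

/-- Every term contains at least one product, and the factor `convConst N₀ N₁` of the outermost one
is kept instead of being bounded by `1`. This factor is the source of smallness in the fixed point
argument. -/
theorem adm_fourQuad (hu : ∀ i, Adm σ T c N₀ N₁ R (u i)) (hσ : 0 < σ) (hc : 0 ≤ c) (h₀ : 0 ≤ N₀)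
    (h₁ : 0 ≤ N₁) (hκ : convConst N₀ N₁ ≤ 1) (hR : 0 ≤ R) (P : Fin 3 → Poly) :
    Adm σ T c N₀ N₁ ((∑ i, size R (P i) * R) * convConst N₀ N₁) (fourQuad P u) := by
  rw [Finset.sum_mul]
  exact Adm.sum _ fun i _ => (adm_four hu hσ hc h₀ h₁ hκ hR (P i)).conv (hu i) hσ hc h₀ h₁
    (size_nonneg hR _) hR

theorem adm_fourQuad_sub (hu : ∀ i, Adm σ T c N₀ N₁ R (u i)) (hv : ∀ i, Adm σ T c N₀ N₁ R (v i))
    (hd : ∀ i, Adm σ T c N₀ N₁ θ (fun t ξ => u i t ξ - v i t ξ)) (hσ : 0 < σ) (hc : 0 ≤ c)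
    (h₀ : 0 ≤ N₀) (h₁ : 0 ≤ N₁) (hκ : convConst N₀ N₁ ≤ 1) (hR : 0 ≤ R) (hθ : 0 ≤ θ)
    (P : Fin 3 → Poly) :
    Adm σ T c N₀ N₁ ((∑ i, (lip R (P i) * R + size R (P i))) * convConst N₀ N₁ * θ)
      (fun t ξ => fourQuad P u t ξ - fourQuad P v t ξ) := by
  rw [Finset.sum_mul, Finset.sum_mul]
  simp only [fourQuad, ← Finset.sum_sub_distrib]
  refine Adm.sum _ fun i _ => ?_
  refine (Adm.conv_sub_conv (adm_four hu hσ hc h₀ h₁ hκ hR (P i))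
    (adm_four hv hσ hc h₀ h₁ hκ hR (P i)) (hu i) (hv i)
    (adm_four_sub hu hv hd hσ hc h₀ h₁ hκ hR hθ (P i)) (hd i) hσ hc h₀ h₁ (size_nonneg hR _) hR
    (mul_nonneg (lip_nonneg hR _) hθ) hθ).mono h₀ h₁ (le_of_eq ?_)
  ring

end

end Poly

/-! ### Symbols and the Duhamel integral -/

/-- A bounded measurable Fourier multiplier mapping real functions to real functions. -/
structure IsSymbol (C : ℝ) (a : Plane → ℂ) : Prop where
  meas : Measurable a
  bound : ∀ ξ, ‖a ξ‖ ≤ C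
  symm : ∀ ξ, a (-ξ) = conj (a ξ)

namespace IsSymbol

variable {C C' : ℝ} {a b : Plane → ℂ}

theorem mul (ha : IsSymbol C a) (hb : IsSymbol C' b) : IsSymbol (C * C') (fun ξ => a ξ * b ξ) where
  meas := ha.meas.mul hb.meas
  bound ξ := by
    rw [norm_mul]
    exact mul_le_mul (ha.bound ξ) (hb.bound ξ) (norm_nonneg _) ((norm_nonneg _).trans (ha.bound ξ))
  symm ξ := by rw [ha.symm, hb.symm, map_mul]

theorem star (ha : IsSymbol C a) : IsSymbol C (fun ξ => conj (a ξ)) where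
  meas := Complex.continuous_conj.measurable.comp ha.meas
  bound ξ := by rw [RCLike.norm_conj]; exact ha.bound ξ
  symm ξ := by rw [ha.symm]

theorem const (r : ℝ) : IsSymbol |r| (fun _ => (r : ℂ)) where
  meas := measurable_const
  bound ξ := by simp
  symm ξ := by simp

theorem mono (ha : IsSymbol C a) (h : C ≤ C') : IsSymbol C' a :=
  ⟨ha.meas, fun ξ => (ha.bound ξ).trans h, ha.symm⟩

end IsSymbol

/-- A measurable symbol generating a semigroup in a sector of complex times, of decay `2 c |ξ|`. -/
structure IsDecay (σ c : ℝ) (lam : Plane → ℂ) : Prop where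
  meas : Measurable lam
  symm : ∀ ξ, lam (-ξ) = conj (lam ξ)
  decay : ∀ ξ (t : ℂ), 0 ≤ t.re → |t.im| ≤ σ * t.re → 2 * c * ‖ξ‖ * t.re ≤ (lam ξ * t).re

namespace IsDecay

variable {σ c : ℝ} {lam : Plane → ℂ}

theorem star (h : IsDecay σ c lam) : IsDecay σ c (fun ξ => conj (lam ξ)) where
  meas := Complex.continuous_conj.measurable.comp h.meas
  symm ξ := by rw [h.symm]
  decay ξ t h0 h1 := by
    have := h.decay ξ (conj t) (by simpa using h0) (by simpa using h1)
    rw [Complex.mul_re] at this ⊢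
    simpa using this

/-- Only half of the decay rate `2 c` is used here. The Duhamel integral needs both halves: one to
follow the envelope, one to absorb the factor `‖ξ‖`. -/
theorem norm_exp_le (h : IsDecay σ c lam) (hσ : 0 < σ) (hc : 0 ≤ c) (ξ : Plane) {t : ℂ}
    (h1 : |t.im| ≤ σ * t.re) : ‖Complex.exp (-lam ξ * t)‖ ≤ Real.exp (-c * |t.re| * ‖ξ‖) := by
  have h0 : 0 ≤ t.re := nonneg_of_mul_nonneg_right ((abs_nonneg _).trans h1) hσ
  rw [Complex.norm_exp, neg_mul, Complex.neg_re, abs_of_nonneg h0]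
  apply Real.exp_le_exp.2
  have := h.decay ξ t h0 h1
  have : 0 ≤ c * ‖ξ‖ * t.re := by positivity
  linarith

end IsDecay

/-- The Duhamel integral from time `0` to `t`, along a segment, with a source of size `|ξ|`. -/
def duhamel (lam : Plane → ℂ) (s : ℂ → Plane → ℂ) (t : ℂ) (ξ : Plane) : ℂ :=
  ∫ τ in (0 : ℝ)..1, t * (Complex.exp (-lam ξ * (t - τ * t)) * (‖ξ‖ * s (τ * t) ξ))

/-- Applied with `a = c * t.re * ‖ξ‖`, this is the gain of one derivative. The bound does not depend
on `a`, hence neither on the frequency nor on the time. -/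
theorem integral_mul_exp_le (a : ℝ) : ∫ τ in (0 : ℝ)..1, a * Real.exp (-a * (1 - τ)) ≤ 1 := by
  have h : ∀ τ ∈ uIcc (0 : ℝ) 1, HasDerivAt (fun τ => Real.exp (-a * (1 - τ)))
      (a * Real.exp (-a * (1 - τ))) τ := by
    intro τ _
    have h1 : HasDerivAt (fun τ : ℝ => -a * (1 - τ)) (-a * (-1)) τ :=
      ((hasDerivAt_id τ).const_sub 1).const_mul (-a)
    convert h1.exp using 1; ring
  rw [intervalIntegral.integral_eq_sub_of_hasDerivAt h
    (Continuous.intervalIntegrable (by fun_prop) _ _)]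
  simp [Real.exp_nonneg]

section Duhamel

variable {σ T c N₀ N₁ R R' : ℝ} {lam : Plane → ℂ} {s s' : ℂ → Plane → ℂ}

theorem sub_smul_mem_sector {t : ℂ} (ht : t ∈ diamond σ T) {τ : ℝ} (hτ : τ ∈ Icc (0 : ℝ) 1) :
    |(t - τ * t).im| ≤ σ * (t - τ * t).re := by
  have e : t - τ * t = ((1 - τ : ℝ) : ℂ) * t := by push_cast; ring
  have := ht.1
  have h1 : 0 ≤ 1 - τ := by linarith [hτ.2]
  rw [e, Complex.re_ofReal_mul, Complex.im_ofReal_mul, abs_mul, abs_of_nonneg h1]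
  nlinarith

theorem norm_le_two_mul_re (hσ1 : σ ≤ 1) (hσ : 0 < σ) {t : ℂ} (ht : t ∈ diamond σ T) :
    ‖t‖ ≤ 2 * t.re := by
  have h0 := (re_mem_of_mem_diamond hσ ht).1
  have h1 := ht.1
  calc ‖t‖ ≤ |t.re| + |t.im| := Complex.norm_le_abs_re_add_abs_im t
    _ ≤ _ := by rw [abs_of_nonneg h0]; nlinarith

/-- The decay `2 c` is split in two. One half carries the envelope from time `τ * t.re` to `t.re`;
the other stays as a kernel of integral at most `1`. The `2` in `2 / c` comes from `‖t‖ ≤ 2 * t.re`.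
-/
theorem norm_duhamel_integrand_le (hl : IsDecay σ c lam) (hs : Adm σ T c N₀ N₁ R s) (hσ : 0 < σ)
    (hσ1 : σ ≤ 1) (hc : 0 < c) (h₀ : 0 ≤ N₀) (h₁ : 0 ≤ N₁) (hR : 0 ≤ R) {t : ℂ}
    (ht : t ∈ diamond σ T) (ξ : Plane) {τ : ℝ} (hτ : τ ∈ Icc (0 : ℝ) 1) :
    ‖t * (Complex.exp (-lam ξ * (t - τ * t)) * (‖ξ‖ * s (τ * t) ξ))‖ ≤
      2 / c * R * env c T N₀ N₁ t.re ξ *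
        (c * t.re * ‖ξ‖ * Real.exp (-(c * t.re * ‖ξ‖) * (1 - τ))) := by
  have hx := (re_mem_of_mem_diamond hσ ht).1
  have hx1 : 0 ≤ (1 - τ) * t.re := mul_nonneg (by linarith [hτ.2]) hx
  have hre : (t - τ * t).re = (1 - τ) * t.re := by
    rw [Complex.sub_re, Complex.re_ofReal_mul]; ring
  have hxe : ‖Complex.exp (-lam ξ * (t - τ * t))‖ ≤
      Real.exp (-(c * t.re * ‖ξ‖) * (1 - τ)) * Real.exp (-c * |t.re - τ * t.re| * ‖ξ‖) := by
    rw [Complex.norm_exp, neg_mul, Complex.neg_re, ← Real.exp_add]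
    apply Real.exp_le_exp.2
    have := hl.decay ξ (t - τ * t) (by rw [hre]; exact hx1) (sub_smul_mem_sector ht hτ)
    have e : |t.re - τ * t.re| = (1 - τ) * t.re := by
      rw [← abs_of_nonneg hx1]; congr 1; ring
    rw [hre] at this
    rw [e]; linarith
  have hsb := hs.bound _ (smul_mem_diamond hσ ht hτ) ξ
  rw [Complex.re_ofReal_mul] at hsb
  have he := env_mul_exp_le (T := T) (x := τ * t.re) (y := t.re) hc.le h₀ h₁ ξ
  have hen := env_nonneg (c := c) (T := T) (x := τ * t.re) h₀ h₁ ξ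
  set E := Real.exp (-(c * t.re * ‖ξ‖) * (1 - τ)) with hE
  set E' := Real.exp (-c * |t.re - τ * t.re| * ‖ξ‖)
  have hE0 : 0 ≤ E := Real.exp_nonneg _
  rw [norm_mul, norm_mul, norm_mul, Complex.norm_real, norm_norm]
  calc ‖t‖ * (‖Complex.exp (-lam ξ * (t - τ * t))‖ * (‖ξ‖ * ‖s (τ * t) ξ‖))
      ≤ (2 * t.re) * ((E * E') * (‖ξ‖ * (R * env c T N₀ N₁ (τ * t.re) ξ))) := by
        gcongr
        exact norm_le_two_mul_re hσ1 hσ ht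
    _ = 2 * t.re * E * ‖ξ‖ * R * (env c T N₀ N₁ (τ * t.re) ξ * E') := by ring
    _ ≤ 2 * t.re * E * ‖ξ‖ * R * env c T N₀ N₁ t.re ξ := by gcongr
    _ = _ := by field_simp

theorem measurable_duhamel_integrand (hl : Measurable lam) (hs : Adm σ T c N₀ N₁ R s) :
    Measurable fun w : (ℂ × Plane) × ℝ =>
      w.1.1 * (Complex.exp (-lam w.1.2 * (w.1.1 - w.2 * w.1.1)) *
        (‖w.1.2‖ * s (w.2 * w.1.1) w.1.2)) := by
  have h1 : Measurable fun w : (ℂ × Plane) × ℝ => (w.2 : ℂ) * w.1.1 :=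
    (Complex.measurable_ofReal.comp measurable_snd).mul measurable_fst.fst
  have h2 : Measurable fun w : (ℂ × Plane) × ℝ => s (w.2 * w.1.1) w.1.2 :=
    hs.meas.comp (h1.prodMk measurable_fst.snd)
  have h3 : Measurable fun w : (ℂ × Plane) × ℝ => lam w.1.2 := hl.comp measurable_fst.snd
  exact measurable_fst.fst.mul ((Complex.measurable_exp.comp (h3.neg.mul
    (measurable_fst.fst.sub h1))).mul
    ((Complex.measurable_ofReal.comp measurable_fst.snd.norm).mul h2))

theorem intervalIntegrable_duhamel (hl : IsDecay σ c lam) (hs : Adm σ T c N₀ N₁ R s) (hσ : 0 < σ)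
    (hσ1 : σ ≤ 1) (hc : 0 < c) (h₀ : 0 ≤ N₀) (h₁ : 0 ≤ N₁) (hR : 0 ≤ R) {t : ℂ}
    (ht : t ∈ diamond σ T) (ξ : Plane) :
    IntervalIntegrable
      (fun τ : ℝ => t * (Complex.exp (-lam ξ * (t - τ * t)) * (‖ξ‖ * s (τ * t) ξ))) volume 0 1 := by
  have hc' : Continuous fun τ : ℝ => 2 / c * R * env c T N₀ N₁ t.re ξ *
        (c * t.re * ‖ξ‖ * Real.exp (-(c * t.re * ‖ξ‖) * (1 - τ))) := by fun_prop
  refine (hc'.intervalIntegrable 0 1).mono_fun' ?_ ?_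
  · exact ((measurable_duhamel_integrand hl.meas hs).comp
      (measurable_prodMk_left (x := (t, ξ)))).aestronglyMeasurable
  · rw [uIoc_of_le zero_le_one]
    refine (ae_restrict_iff' measurableSet_Ioc).2 (Eventually.of_forall fun τ hτ => ?_)
    exact norm_duhamel_integrand_le hl hs hσ hσ1 hc h₀ h₁ hR ht ξ (Ioc_subset_Icc_self hτ)

theorem Adm.duhamel (hl : IsDecay σ c lam) (hs : Adm σ T c N₀ N₁ R s) (hσ : 0 < σ)
    (hσ1 : σ ≤ 1) (hc : 0 < c) (h₀ : 0 ≤ N₀) (h₁ : 0 ≤ N₁) (hR : 0 ≤ R) :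
    Adm σ T c N₀ N₁ (2 / c * R) (CrowdMFG.duhamel lam s) where
  meas := by
    unfold CrowdMFG.duhamel
    simp only [intervalIntegral.integral_of_le zero_le_one]
    exact (StronglyMeasurable.integral_prod_right (ν := (volume : Measure ℝ).restrict (Ioc 0 1))
      (f := fun (w : ℂ × Plane) (τ : ℝ) => w.1 * (Complex.exp (-lam w.2 * (w.1 - τ * w.1)) *
        (‖w.2‖ * s (τ * w.1) w.2)))
      (measurable_duhamel_integrand hl.meas hs).stronglyMeasurable).measurable
  bound t ht ξ := by
    have hc' : Continuous fun τ : ℝ => 2 / c * R * env c T N₀ N₁ t.re ξ *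
        (c * t.re * ‖ξ‖ * Real.exp (-(c * t.re * ‖ξ‖) * (1 - τ))) := by fun_prop
    refine (intervalIntegral.norm_integral_le_of_norm_le zero_le_one
      (Eventually.of_forall fun τ hτ => norm_duhamel_integrand_le hl hs hσ hσ1 hc h₀ h₁ hR ht ξ
        (Ioc_subset_Icc_self hτ)) (hc'.intervalIntegrable 0 1)).trans ?_
    rw [intervalIntegral.integral_const_mul]
    refine mul_le_of_le_one_right ?_ (integral_mul_exp_le _)
    have := env_nonneg (c := c) (T := T) (x := t.re) h₀ h₁ ξ
    positivity
  holo ξ := by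
    unfold CrowdMFG.duhamel
    simp only [intervalIntegral.integral_of_le zero_le_one]
    refine differentiableOn_integral_of_differentiableOn isOpen_openDiamond
      -- This majorant depends on `ξ` and `T`, which is harmless: holomorphy is only needed for one
      -- frequency at a time.
      (B := fun _ => 2 * T * (1 * (‖ξ‖ * (R * ((N₀ + N₁) * 1))))) (fun t ht => ?_) ?_
      (integrable_const _) ?_
    · exact ((measurable_duhamel_integrand hl.meas hs).comp
        (measurable_prodMk_left (x := (t, ξ)))).aestronglyMeasurable
    · refine (ae_restrict_iff' measurableSet_Ioc).2 (Eventually.of_forall fun τ hτ => ?_)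
      -- `τ * t` lies in the open diamond only for `τ > 0`, since `0` is a vertex; the domain `Ioc`
      -- excludes `τ = 0`.
      have h1 : DifferentiableOn ℂ (fun t : ℂ => s (τ * t) ξ) (openDiamond σ T) :=
        (hs.holo ξ).comp (f := fun t : ℂ => (τ : ℂ) * t) (by fun_prop)
          fun t ht => smul_mem_openDiamond hσ ht hτ
      have h2 : DifferentiableOn ℂ (fun t : ℂ => -lam ξ * (t - τ * t)) (openDiamond σ T) := by
        fun_prop
      exact differentiableOn_id.mul (h2.cexp.mul (h1.const_mul _))
    · refine (ae_restrict_iff' measurableSet_Ioc).2 (Eventually.of_forall fun τ hτ t ht => ?_)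
      have hτ' := Ioc_subset_Icc_self hτ
      have ht' := openDiamond_subset ht
      have hx := re_mem_of_mem_diamond hσ ht'
      rw [norm_mul, norm_mul, norm_mul, Complex.norm_real, norm_norm]
      have e1 := hl.norm_exp_le hσ hc.le ξ (sub_smul_mem_sector ht' hτ')
      have e2 : Real.exp (-c * |(t - τ * t).re| * ‖ξ‖) ≤ 1 := by
        rw [Real.exp_le_one_iff]
        have : 0 ≤ c * |(t - τ * t).re| * ‖ξ‖ := by positivity
        linarith
      have e3 := hs.bound_wt hσ hc.le h₀ h₁ hR (smul_mem_diamond hσ ht' hτ') ξ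
      have e4 := wt_le_one ξ
      have e5 := norm_le_two_mul_re hσ1 hσ ht'
      have hT : 0 ≤ T := hx.1.trans hx.2
      gcongr
      · linarith [hx.2]
      · exact e1.trans e2
      · exact e3.trans (by gcongr)
  symm t ht ξ := by
    unfold CrowdMFG.duhamel
    rw [intervalIntegral.integral_of_le zero_le_one, intervalIntegral.integral_of_le zero_le_one,
      ← integral_conj]
    refine setIntegral_congr_fun measurableSet_Ioc fun τ hτ => ?_
    have hm : τ * t ∈ Icc 0 T :=
      ⟨mul_nonneg hτ.1.le ht.1, (mul_le_of_le_one_left ht.1 hτ.2).trans ht.2⟩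
    have h1 := hs.symm (τ * t) hm ξ
    push_cast at h1
    simp only [h1, norm_neg, hl.symm, map_mul, Complex.conj_ofReal, ← Complex.exp_conj, map_neg,
      map_sub]

theorem duhamel_sub (hl : IsDecay σ c lam) (hs : Adm σ T c N₀ N₁ R s)
    (hs' : Adm σ T c N₀ N₁ R' s') (hσ : 0 < σ) (hσ1 : σ ≤ 1) (hc : 0 < c) (h₀ : 0 ≤ N₀)
    (h₁ : 0 ≤ N₁) (hR : 0 ≤ R) (hR' : 0 ≤ R') {t : ℂ} (ht : t ∈ diamond σ T) (ξ : Plane) :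
    duhamel lam (fun t ξ => s t ξ - s' t ξ) t ξ = duhamel lam s t ξ - duhamel lam s' t ξ := by
  unfold duhamel
  rw [← intervalIntegral.integral_sub (intervalIntegrable_duhamel hl hs hσ hσ1 hc h₀ h₁ hR ht ξ)
    (intervalIntegrable_duhamel hl hs' hσ hσ1 hc h₀ h₁ hR' ht ξ)]
  congr 1; ext τ; ring

theorem Adm.intervalIntegrable (hs : Adm σ T c N₀ N₁ R s) (hσ : 0 < σ) (hc : 0 ≤ c) (h₀ : 0 ≤ N₀)
    (h₁ : 0 ≤ N₁) (hR : 0 ≤ R) {a b : ℝ} (ha : a ∈ Icc 0 T) (hb : b ∈ Icc 0 T) (ξ : Plane) :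
    IntervalIntegrable (fun r : ℝ => s r ξ) volume a b := by
  refine (intervalIntegrable_const (c := R * ((N₀ + N₁) * wt ξ))).mono_fun'
    ((hs.measurable_left ξ).comp Complex.measurable_ofReal).aestronglyMeasurable ?_
  refine (ae_restrict_iff' measurableSet_uIoc).2 (Eventually.of_forall fun r hr => ?_)
  exact hs.bound_wt hσ hc h₀ h₁ hR
    (ofReal_mem_diamond hσ ((ordConnected_Icc.uIcc_subset ha hb) (uIoc_subset_uIcc hr))) ξ

theorem Adm.continuousAt (hs : Adm σ T c N₀ N₁ R s) (hσ : 0 < σ) {t : ℝ} (ht : t ∈ Ioo 0 T)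
    (ξ : Plane) : ContinuousAt (fun r : ℝ => s r ξ) t :=
  ContinuousAt.comp (f := fun r : ℝ => (r : ℂ)) (g := fun z => s z ξ)
    ((hs.holo ξ).differentiableAt
      (isOpen_openDiamond.mem_nhds (ofReal_mem_openDiamond hσ ht))).continuousAt
    Complex.continuous_ofReal.continuousAt

/-- The substitution `r = τ * t` recovers the classical formula; written with `exp (lam ξ * r)`
inside the integral, its dependence on `t` is that of a primitive. -/
theorem duhamel_ofReal (t : ℝ) (ξ : Plane) :
    duhamel lam s t ξ =
      Complex.exp (-lam ξ * t) * ∫ r in (0 : ℝ)..t, Complex.exp (lam ξ * r) * (‖ξ‖ * s r ξ) := by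
  unfold duhamel
  rw [← intervalIntegral.integral_const_mul]
  have h := intervalIntegral.smul_integral_comp_mul_left (a := (0 : ℝ)) (b := 1)
    (fun r : ℝ => Complex.exp (-lam ξ * t) * (Complex.exp (lam ξ * r) * (‖ξ‖ * s r ξ))) t
  rw [mul_zero, mul_one] at h
  rw [← h, ← intervalIntegral.integral_smul]
  refine intervalIntegral.integral_congr fun τ _ => ?_
  simp only [Complex.real_smul]
  rw [← mul_assoc (Complex.exp _) (Complex.exp _), ← Complex.exp_add]
  push_cast
  rw [mul_comm (t : ℂ) (τ : ℂ)]
  congr 3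
  ring

/-- Admissible sources need not be continuous up to the times `0` and `T`. Continuity on the closed
interval comes from the integral being a primitive of an integrable function. -/
theorem continuousOn_duhamel (hs : Adm σ T c N₀ N₁ R s) (hσ : 0 < σ) (hc : 0 ≤ c) (h₀ : 0 ≤ N₀)
    (h₁ : 0 ≤ N₁) (hR : 0 ≤ R) (hT : 0 ≤ T) (ξ : Plane) :
    ContinuousOn (fun t : ℝ => duhamel lam s t ξ) (Icc 0 T) := by
  simp only [duhamel_ofReal]
  refine ContinuousOn.mul (by fun_prop) ?_
  have hi : IntervalIntegrable (fun r : ℝ => Complex.exp (lam ξ * r) * (‖ξ‖ * s r ξ)) volume 0 T :=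
    ((hs.intervalIntegrable hσ hc h₀ h₁ hR (left_mem_Icc.2 hT) (right_mem_Icc.2 hT) ξ).const_mul
      _).continuousOn_mul (Continuous.continuousOn (by fun_prop))
  have := intervalIntegral.continuousOn_primitive_interval' hi (left_mem_uIcc)
  rwa [uIcc_of_le hT] at this

theorem hasDerivAt_duhamel (hs : Adm σ T c N₀ N₁ R s) (hσ : 0 < σ) (hc : 0 ≤ c) (h₀ : 0 ≤ N₀)
    (h₁ : 0 ≤ N₁) (hR : 0 ≤ R) {t : ℝ} (ht : t ∈ Ioo 0 T) (ξ : Plane) :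
    HasDerivAt (fun t : ℝ => duhamel lam s t ξ)
      (-lam ξ * duhamel lam s t ξ + ‖ξ‖ * s t ξ) t := by
  simp only [duhamel_ofReal]
  have hT : 0 ≤ T := (ht.1.trans ht.2).le
  have hi : IntervalIntegrable (fun r : ℝ => Complex.exp (lam ξ * r) * (‖ξ‖ * s r ξ)) volume 0 t :=
    ((hs.intervalIntegrable hσ hc h₀ h₁ hR (left_mem_Icc.2 hT) (Ioo_subset_Icc_self ht) ξ).const_mul
      _).continuousOn_mul (Continuous.continuousOn (by fun_prop))
  have hmeas : Measurable fun r : ℝ => Complex.exp (lam ξ * r) * (‖ξ‖ * s r ξ) := by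
    have := (hs.measurable_left ξ).comp Complex.measurable_ofReal
    have h2 : Measurable fun r : ℝ => Complex.exp (lam ξ * r) := by fun_prop
    exact h2.mul (measurable_const.mul this)
  have h1 := intervalIntegral.integral_hasDerivAt_right hi
    (hmeas.stronglyMeasurable.stronglyMeasurableAtFilter)
    (ContinuousAt.mul (by fun_prop) (continuousAt_const.mul (hs.continuousAt hσ ht ξ)))
  have h2 : HasDerivAt (fun t : ℝ => Complex.exp (-lam ξ * t))
      (Complex.exp (-lam ξ * t) * (-lam ξ * 1)) t :=
    ((hasDerivAt_id t).ofReal_comp.const_mul (-lam ξ)).cexp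
  refine (h2.mul h1).congr_deriv ?_
  rw [← mul_assoc (Complex.exp _) (Complex.exp _), ← Complex.exp_add]
  have : -lam ξ * (t : ℂ) + lam ξ * t = 0 := by ring
  rw [this, Complex.exp_zero]
  ring

end Duhamel

/-! ### Boundary values -/

/-- Functions of frequency bounded by the envelope at time `x`. -/
structure IsBoundary (c T N₀ N₁ x b : ℝ) (A : Plane → ℂ) : Prop where
  meas : Measurable A
  bound : ∀ ξ, ‖A ξ‖ ≤ b * env c T N₀ N₁ x ξ
  symm : ∀ ξ, A (-ξ) = conj (A ξ)

namespace IsBoundary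

variable {σ T c N₀ N₁ x b b' : ℝ} {A A' lam : Plane → ℂ}

theorem add (h : IsBoundary c T N₀ N₁ x b A) (h' : IsBoundary c T N₀ N₁ x b' A') :
    IsBoundary c T N₀ N₁ x (b + b') (fun ξ => A ξ + A' ξ) where
  meas := h.meas.add h'.meas
  bound ξ := (norm_add_le _ _).trans (by rw [add_mul]; exact add_le_add (h.bound ξ) (h'.bound ξ))
  symm ξ := by rw [h.symm, h'.symm, map_add]

theorem sub (h : IsBoundary c T N₀ N₁ x b A) (h' : IsBoundary c T N₀ N₁ x b' A') :
    IsBoundary c T N₀ N₁ x (b + b') (fun ξ => A ξ - A' ξ) where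
  meas := h.meas.sub h'.meas
  bound ξ := (norm_sub_le _ _).trans (by rw [add_mul]; exact add_le_add (h.bound ξ) (h'.bound ξ))
  symm ξ := by rw [h.symm, h'.symm, map_sub]

theorem symbol_mul (h : IsBoundary c T N₀ N₁ x b A) {a : Plane → ℂ} {C : ℝ} (ha : IsSymbol C a) :
    IsBoundary c T N₀ N₁ x (C * b) (fun ξ => a ξ * A ξ) where
  meas := ha.meas.mul h.meas
  bound ξ := by
    rw [norm_mul, mul_assoc]
    exact mul_le_mul (ha.bound ξ) (h.bound ξ) (norm_nonneg _) ((norm_nonneg _).trans (ha.bound ξ))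
  symm ξ := by rw [ha.symm, h.symm, map_mul]

/-- Propagation of boundary values over the whole interval. -/
theorem exp_mul (h : IsBoundary c T N₀ N₁ x b A) (hl : IsDecay σ c lam) (hσ : 0 < σ) (hc : 0 ≤ c)
    (h₀ : 0 ≤ N₀) (h₁ : 0 ≤ N₁) (hT : 0 ≤ T) (hb : 0 ≤ b) {y : ℝ} (hy : |y - x| = T) :
    IsBoundary c T N₀ N₁ y b (fun ξ => Complex.exp (-lam ξ * T) * A ξ) where
  meas := (Complex.measurable_exp.comp (hl.meas.neg.mul_const _)).mul h.meas
  bound ξ := by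
    have h1 := hl.norm_exp_le hσ hc ξ (t := T) (by simpa using mul_nonneg hσ.le hT)
    have h2 := env_mul_exp_le (T := T) (x := x) (y := y) hc h₀ h₁ ξ
    rw [Complex.ofReal_re, abs_of_nonneg hT] at h1
    rw [hy] at h2
    rw [norm_mul]
    calc _ ≤ Real.exp (-c * T * ‖ξ‖) * (b * env c T N₀ N₁ x ξ) :=
          mul_le_mul h1 (h.bound ξ) (norm_nonneg _) (Real.exp_nonneg _)
      _ = b * (env c T N₀ N₁ x ξ * Real.exp (-c * T * ‖ξ‖)) := by ring
      _ ≤ _ := by gcongr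
  symm ξ := by
    simp only [h.symm, hl.symm, map_mul, ← Complex.exp_conj, map_neg, Complex.conj_ofReal]

theorem adm (h : IsBoundary c T N₀ N₁ 0 b A) (hl : IsDecay σ c lam) (hσ : 0 < σ) (hc : 0 ≤ c)
    (h₀ : 0 ≤ N₀) (h₁ : 0 ≤ N₁) (hb : 0 ≤ b) :
    Adm σ T c N₀ N₁ b (fun t ξ => Complex.exp (-lam ξ * t) * A ξ) where
  meas := (Complex.measurable_exp.comp
    ((hl.meas.comp measurable_snd).neg.mul measurable_fst)).mul (h.meas.comp measurable_snd)
  bound t ht ξ := by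
    have h1 := hl.norm_exp_le hσ hc ξ ht.1
    have h2 := env_mul_exp_le (T := T) (x := 0) (y := t.re) hc h₀ h₁ ξ
    rw [sub_zero] at h2
    rw [norm_mul]
    calc _ ≤ Real.exp (-c * |t.re| * ‖ξ‖) * (b * env c T N₀ N₁ 0 ξ) :=
          mul_le_mul h1 (h.bound ξ) (norm_nonneg _) (Real.exp_nonneg _)
      _ = b * (env c T N₀ N₁ 0 ξ * Real.exp (-c * |t.re| * ‖ξ‖)) := by ring
      _ ≤ _ := by gcongr
  holo ξ := by fun_prop
  symm t ht ξ := by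
    simp only [h.symm, hl.symm, map_mul, ← Complex.exp_conj, map_neg, Complex.conj_ofReal]

theorem reverse (h : IsBoundary c T N₀ N₁ T b A) : IsBoundary c T N₁ N₀ 0 b A where
  meas := h.meas
  bound ξ := by
    have := h.bound ξ
    rw [← env_reverse] at this
    rwa [sub_self] at this
  symm := h.symm

end IsBoundary

theorem Adm.boundary {σ T c N₀ N₁ R : ℝ} {s : ℂ → Plane → ℂ} (hs : Adm σ T c N₀ N₁ R s)
    (hσ : 0 < σ) {x : ℝ} (hx : x ∈ Icc 0 T) : IsBoundary c T N₀ N₁ x R (s x) where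
  meas := hs.measurable_right x
  bound ξ := by simpa using hs.bound x (ofReal_mem_diamond hσ hx) ξ
  symm := hs.symm x hx

/-! ### The linear boundary value problem -/

/-- The real part of the eigenvalues of the linearized system. -/
def decayRate (ρ f : ℝ) (ξ : Plane) : ℝ :=
  2 * Real.pi * √(ρ * f * ‖ξ‖ ^ 2 - ρ ^ 2 * ξ 0 ^ 2)

/-- The decaying eigenvalue of the linearized system, up to sign. -/
def lam (ρ f : ℝ) (ξ : Plane) : ℂ :=
  (decayRate ρ f ξ : ℂ) - Complex.I * ((2 * Real.pi * (f - ρ) * ξ 0 : ℝ) : ℂ)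

/-- The slope of the eigenvectors of the linearized system. -/
def slope (ρ f : ℝ) (ξ : Plane) : ℂ :=
  ((decayRate ρ f ξ : ℂ) - Complex.I * ((2 * Real.pi * ρ * ξ 0 : ℝ) : ℂ)) /
    ((2 * Real.pi * ρ * f ^ 2 * ‖ξ‖ : ℝ) : ℂ)

/-- The symbols of the Riesz transforms. -/
def dir (j : Fin 2) (ξ : Plane) : ℂ := Complex.I * (ξ j : ℂ) / (‖ξ‖ : ℂ)

/-- The constant in the exponential decay. -/
def rate (ρ f : ℝ) : ℝ := Real.pi / 2 * √(ρ * (f - ρ))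

/-- The aperture of the diamond of complex times. -/
def aperture (ρ f : ℝ) : ℝ := min 1 (rate ρ f / (Real.pi * (f - ρ)))

section Symbols

variable {ρ f : ℝ}

theorem abs_coord_le (ξ : Plane) (j : Fin 2) : |ξ j| ≤ ‖ξ‖ := by
  simpa using PiLp.norm_apply_le ξ j

theorem sq_coord_le (ξ : Plane) (j : Fin 2) : ξ j ^ 2 ≤ ‖ξ‖ ^ 2 :=
  sq_le_sq.2 (by rw [abs_norm]; exact abs_coord_le ξ j)

theorem rate_pos (hρ : 0 < ρ) (hf : ρ < f) : 0 < rate ρ f := by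
  have : 0 < ρ * (f - ρ) := mul_pos hρ (sub_pos.2 hf)
  unfold rate
  have := Real.pi_pos
  positivity

theorem aperture_pos (hρ : 0 < ρ) (hf : ρ < f) : 0 < aperture ρ f :=
  lt_min one_pos (div_pos (rate_pos hρ hf) (mul_pos Real.pi_pos (sub_pos.2 hf)))

theorem aperture_le_one : aperture ρ f ≤ 1 := min_le_left _ _

/-- Ellipticity: as `|ξ 0| ≤ ‖ξ‖`, the worst direction is that of the first axis, where the
discriminant equals `ρ (f - ρ) ‖ξ‖²`. -/
theorem radicand_nonneg (ξ : Plane) :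
    ρ * (f - ρ) * ‖ξ‖ ^ 2 ≤ ρ * f * ‖ξ‖ ^ 2 - ρ ^ 2 * ξ 0 ^ 2 := by
  nlinarith [mul_le_mul_of_nonneg_left (sq_coord_le ξ 0) (sq_nonneg ρ)]

theorem decayRate_nonneg (ξ : Plane) : 0 ≤ decayRate ρ f ξ := by
  unfold decayRate
  have := Real.pi_pos
  positivity

theorem decayRate_neg (ξ : Plane) : decayRate ρ f (-ξ) = decayRate ρ f ξ := by
  simp [decayRate]

/-- Of these four units of `rate`, two are claimed by `IsDecay` and two compensate the oscillating
part of `lam` at complex times. -/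
theorem le_decayRate (ξ : Plane) :
    4 * rate ρ f * ‖ξ‖ ≤ decayRate ρ f ξ := by
  have h := Real.sqrt_le_sqrt (radicand_nonneg (ρ := ρ) (f := f) ξ)
  rw [Real.sqrt_mul' _ (sq_nonneg _), Real.sqrt_sq (norm_nonneg _)] at h
  have := mul_le_mul_of_nonneg_left h (by positivity : 0 ≤ 2 * Real.pi)
  unfold rate decayRate
  linarith

theorem decayRate_sq (hρ : 0 < ρ) (hf : ρ < f) (ξ : Plane) :
    decayRate ρ f ξ ^ 2 + (2 * Real.pi * ρ * ξ 0) ^ 2 =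
      (2 * Real.pi) ^ 2 * (ρ * f * ‖ξ‖ ^ 2) := by
  have h0 : 0 ≤ ρ * f * ‖ξ‖ ^ 2 - ρ ^ 2 * ξ 0 ^ 2 :=
    (mul_nonneg (mul_pos hρ (sub_pos.2 hf)).le (sq_nonneg _)).trans (radicand_nonneg ξ)
  unfold decayRate
  rw [mul_pow, Real.sq_sqrt h0]
  ring

theorem continuous_decayRate : Continuous (decayRate ρ f) := by
  unfold decayRate
  fun_prop

theorem continuous_lam : Continuous (lam ρ f) := by
  have := continuous_decayRate (ρ := ρ) (f := f)
  unfold lam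
  fun_prop

theorem measurable_coord (j : Fin 2) : Measurable fun ξ : Plane => ξ j :=
  (by fun_prop : Continuous fun ξ : Plane => ξ j).measurable

theorem measurable_slope : Measurable (slope ρ f) := by
  have := (continuous_decayRate (ρ := ρ) (f := f)).measurable
  have := measurable_coord 0
  unfold slope
  fun_prop

theorem lam_neg (ξ : Plane) : lam ρ f (-ξ) = conj (lam ρ f ξ) := by
  simp only [lam, decayRate_neg, map_sub, map_mul, Complex.conj_ofReal, Complex.conj_I,
    PiLp.neg_apply]
  push_cast; ring

theorem slope_neg (ξ : Plane) : slope ρ f (-ξ) = conj (slope ρ f ξ) := by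
  simp only [slope, decayRate_neg, norm_neg, map_div₀, map_sub, map_mul, Complex.conj_ofReal,
    Complex.conj_I, PiLp.neg_apply]
  push_cast; ring

/-- At complex times the imaginary part of `lam` contributes to the real part of `lam * t`. The
aperture is chosen so that this contribution costs at most half of the bound in `le_decayRate`. -/
theorem isDecay_lam (hρ : 0 < ρ) (hf : ρ < f) : IsDecay (aperture ρ f) (rate ρ f) (lam ρ f) where
  meas := continuous_lam.measurable
  symm := lam_neg
  decay ξ t h0 h1 := by
    have hfρ : 0 < f - ρ := sub_pos.2 hf
    have hr := rate_pos hρ hf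
    have hpi := Real.pi_pos
    have h2 : aperture ρ f * (Real.pi * (f - ρ)) ≤ rate ρ f := by
      rw [← le_div_iff₀ (mul_pos hpi hfρ)]; exact min_le_right _ _
    have e : (lam ρ f ξ * t).re = decayRate ρ f ξ * t.re + 2 * Real.pi * (f - ρ) * ξ 0 * t.im := by
      simp [lam]
    rw [e]
    have h3 := mul_le_mul_of_nonneg_right (le_decayRate (ρ := ρ) (f := f) ξ) h0
    have h4 : -(2 * Real.pi * (f - ρ) * ξ 0 * t.im) ≤ 2 * rate ρ f * ‖ξ‖ * t.re := by
      refine (neg_le_abs _).trans ?_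
      rw [abs_mul, abs_mul, abs_of_pos (by positivity : 0 < 2 * Real.pi * (f - ρ))]
      calc 2 * Real.pi * (f - ρ) * |ξ 0| * |t.im|
          ≤ 2 * Real.pi * (f - ρ) * ‖ξ‖ * (aperture ρ f * t.re) := by
            gcongr
            exact abs_coord_le ξ 0
        _ = 2 * (aperture ρ f * (Real.pi * (f - ρ))) * ‖ξ‖ * t.re := by ring
        _ ≤ _ := by gcongr
    linarith

theorem isSymbol_dir (j : Fin 2) : IsSymbol 1 (dir j) where
  meas := by
    have := measurable_coord j
    unfold dir
    fun_prop
  bound ξ := by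
    unfold dir
    rw [norm_div, norm_mul, Complex.norm_I, one_mul, Complex.norm_real, Complex.norm_real,
      norm_norm]
    exact div_le_one_of_le₀ (abs_coord_le ξ j) (norm_nonneg _)
  symm ξ := by
    unfold dir
    simp

theorem re_slope (ξ : Plane) :
    (slope ρ f ξ).re = decayRate ρ f ξ / (2 * Real.pi * ρ * f ^ 2 * ‖ξ‖) := by
  unfold slope
  rw [Complex.div_ofReal_re]
  simp

/-- A lower bound for the real part of the slope. -/
def slopeGap (ρ f : ℝ) : ℝ := 4 * rate ρ f / (2 * Real.pi * ρ * f ^ 2)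

theorem slopeGap_pos (hρ : 0 < ρ) (hf : ρ < f) : 0 < slopeGap ρ f := by
  have := rate_pos hρ hf
  have := Real.pi_pos
  have : 0 < f := hρ.trans hf
  unfold slopeGap
  positivity

theorem slopeGap_le_re_slope (hρ : 0 < ρ) (hf : ρ < f) {ξ : Plane} (hξ : ξ ≠ 0) :
    slopeGap ρ f ≤ (slope ρ f ξ).re := by
  have := Real.pi_pos
  have : 0 < f := hρ.trans hf
  have := norm_pos_iff.2 hξ
  rw [re_slope, slopeGap, div_le_div_iff₀ (by positivity) (by positivity)]
  have h := mul_le_mul_of_nonneg_left (le_decayRate (ρ := ρ) (f := f) ξ)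
    (by positivity : 0 ≤ 2 * Real.pi * ρ * f ^ 2)
  linarith

/-- Division by zero gives the value `0` at the origin, so symbol bounds hold at every frequency;
the equations are used only for `ξ ≠ 0`, that is almost everywhere. -/
theorem slope_zero : slope ρ f 0 = 0 := by simp [slope]

theorem exists_isSymbol_slope (hρ : 0 < ρ) (hf : ρ < f) :
    IsSymbol ((√(ρ * f) + ρ) / (ρ * f ^ 2)) (slope ρ f) where
  meas := measurable_slope
  symm := slope_neg
  bound ξ := by
    have hf0 : 0 < f := hρ.trans hf
    rcases eq_or_ne ξ 0 with rfl | h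
    · rw [slope_zero, norm_zero]; positivity
    have hn := norm_pos_iff.2 h
    have hpi := Real.pi_pos
    have h1 : decayRate ρ f ξ ≤ 2 * Real.pi * (√(ρ * f) * ‖ξ‖) := by
      unfold decayRate
      gcongr
      rw [← Real.sqrt_sq hn.le, ← Real.sqrt_mul (by positivity), Real.sqrt_sq hn.le]
      apply Real.sqrt_le_sqrt
      have : 0 ≤ ρ ^ 2 * ξ 0 ^ 2 := by positivity
      linarith
    unfold slope
    rw [norm_div, Complex.norm_real, Real.norm_of_nonneg (by positivity), div_le_div_iff₀
      (by positivity) (by positivity)]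
    have h2 : ‖(decayRate ρ f ξ : ℂ) - Complex.I * ((2 * Real.pi * ρ * ξ 0 : ℝ) : ℂ)‖ ≤
        2 * Real.pi * (√(ρ * f) * ‖ξ‖) + 2 * Real.pi * ρ * ‖ξ‖ := by
      refine (norm_sub_le _ _).trans ?_
      rw [norm_mul, Complex.norm_I, one_mul, Complex.norm_real, Complex.norm_real,
        Real.norm_of_nonneg (decayRate_nonneg ξ)]
      refine add_le_add h1 ?_
      rw [Real.norm_eq_abs, abs_mul, abs_of_pos (by positivity)]
      have := abs_coord_le ξ 0
      gcongr
    calc _ ≤ (2 * Real.pi * (√(ρ * f) * ‖ξ‖) + 2 * Real.pi * ρ * ‖ξ‖) * (ρ * f ^ 2) := by gcongr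
      _ = _ := by ring

/-- The eigenvector `(1, slope)` has to satisfy two scalar relations. The definition of `slope`
encodes the one from the density equation; this is the one from the value equation, and the two
agree by the characteristic equation `decayRate_sq`. -/
theorem slope_mul (hρ : 0 < ρ) (hf : ρ < f) (ξ : Plane) :
    slope ρ f ξ * ((decayRate ρ f ξ : ℂ) + Complex.I * ((2 * Real.pi * ρ * ξ 0 : ℝ) : ℂ)) =
      ((2 * Real.pi * ‖ξ‖ / f : ℝ) : ℂ) := by
  have hf0 : 0 < f := hρ.trans hf
  rcases eq_or_ne ξ 0 with rfl | h
  · simp [slope_zero]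
  have hn := norm_pos_iff.2 h
  have hpi := Real.pi_pos
  unfold slope
  have h1 : ((decayRate ρ f ξ : ℂ) - Complex.I * ((2 * Real.pi * ρ * ξ 0 : ℝ) : ℂ)) *
      ((decayRate ρ f ξ : ℂ) + Complex.I * ((2 * Real.pi * ρ * ξ 0 : ℝ) : ℂ)) =
      ((decayRate ρ f ξ ^ 2 + (2 * Real.pi * ρ * ξ 0) ^ 2 : ℝ) : ℂ) := by
    push_cast
    linear_combination (-(2 * Real.pi * ρ * ξ 0) ^ 2 : ℂ) * Complex.I_sq
  rw [div_mul_eq_mul_div, h1, decayRate_sq hρ hf, ← Complex.ofReal_div]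
  congr 1
  field_simp

end Symbols

/-- The coefficients of the source of the decaying mode. -/
def coefA (ρ f : ℝ) (j : Fin 3) (ξ : Plane) : ℂ :=
  (![conj (slope ρ f ξ) * dir 0 ξ, conj (slope ρ f ξ) * dir 1 ξ, 1] : Fin 3 → ℂ) j *
    (((Real.pi : ℝ) : ℂ) * (((slope ρ f ξ).re : ℝ) : ℂ)⁻¹)

/-- The coefficients of the source of the growing mode. -/
def coefB (ρ f : ℝ) (j : Fin 3) (ξ : Plane) : ℂ :=
  (![slope ρ f ξ * dir 0 ξ, slope ρ f ξ * dir 1 ξ, -1] : Fin 3 → ℂ) j *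
    (((Real.pi : ℝ) : ℂ) * (((slope ρ f ξ).re : ℝ) : ℂ)⁻¹)

/-- The determinant of the boundary conditions. -/
def bdet (ρ f T : ℝ) (ξ : Plane) : ℂ :=
  conj (slope ρ f ξ) + slope ρ f ξ *
    (Complex.exp (-lam ρ f ξ * T) * Complex.exp (-conj (lam ρ f ξ) * T))

/-! ### Bounds for the symbols of the boundary value problem, uniform in `T` -/

section Coefficients

variable {ρ f : ℝ}

theorem isSymbol_inv_re_slope (hρ : 0 < ρ) (hf : ρ < f) :
    IsSymbol (slopeGap ρ f)⁻¹ (fun ξ => (((slope ρ f ξ).re : ℝ) : ℂ)⁻¹) where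
  meas := (Complex.measurable_ofReal.comp (Complex.measurable_re.comp measurable_slope)).inv
  symm ξ := by simp [slope_neg]
  bound ξ := by
    rcases eq_or_ne ξ 0 with rfl | h
    · simpa [slope_zero] using (slopeGap_pos hρ hf).le
    have h1 := slopeGap_le_re_slope hρ hf h
    have h2 := slopeGap_pos hρ hf
    rw [norm_inv, Complex.norm_real, Real.norm_of_nonneg (h2.le.trans h1)]
    exact inv_anti₀ h2 h1

/-- The two exponentials are conjugate to each other, so their product is a positive real number and
can only increase the real part of the determinant. The lower bound `slopeGap` is therefore
independent of `T`. -/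
theorem isSymbol_inv_bdet (hρ : 0 < ρ) (hf : ρ < f) (T : ℝ) :
    IsSymbol (slopeGap ρ f)⁻¹ (fun ξ => (bdet ρ f T ξ)⁻¹) where
  meas := by
    have h1 := (continuous_lam (ρ := ρ) (f := f)).measurable
    have h2 := measurable_slope (ρ := ρ) (f := f)
    have h3 : Measurable (conj : ℂ → ℂ) := Complex.continuous_conj.measurable
    unfold bdet
    fun_prop
  symm ξ := by
    simp only [bdet, slope_neg, lam_neg, map_inv₀, map_add, map_mul, ← Complex.exp_conj, map_neg,
      Complex.conj_ofReal, Complex.conj_conj]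
  bound ξ := by
    rcases eq_or_ne ξ 0 with rfl | h
    · simpa [slope_zero, bdet] using (slopeGap_pos hρ hf).le
    have h1 := slopeGap_le_re_slope hρ hf h
    have h2 := slopeGap_pos hρ hf
    have e : Complex.exp (-lam ρ f ξ * T) * Complex.exp (-conj (lam ρ f ξ) * T) =
        ((Real.exp (-(2 * decayRate ρ f ξ * T)) : ℝ) : ℂ) := by
      rw [← Complex.exp_add, Complex.ofReal_exp]
      congr 1
      simp only [lam, map_sub, map_mul, Complex.conj_ofReal, Complex.conj_I]
      push_cast; ring
    have h3 : (bdet ρ f T ξ).re =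
        (slope ρ f ξ).re * (1 + Real.exp (-(2 * decayRate ρ f ξ * T))) := by
      rw [bdet, e]
      simp only [Complex.add_re, Complex.conj_re, Complex.re_mul_ofReal]
      ring
    have h4 : slopeGap ρ f ≤ ‖bdet ρ f T ξ‖ := by
      refine le_trans ?_ (Complex.re_le_norm _)
      rw [h3]
      nlinarith [Real.exp_pos (-(2 * decayRate ρ f ξ * T))]
    rw [norm_inv]
    exact inv_anti₀ h2 h4

theorem bdet_ne_zero (hρ : 0 < ρ) (hf : ρ < f) (T : ℝ) {ξ : Plane} (hξ : ξ ≠ 0) :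
    bdet ρ f T ξ ≠ 0 := by
  intro h0
  have e : Complex.exp (-lam ρ f ξ * T) * Complex.exp (-conj (lam ρ f ξ) * T) =
      ((Real.exp (-(2 * decayRate ρ f ξ * T)) : ℝ) : ℂ) := by
    rw [← Complex.exp_add, Complex.ofReal_exp]
    congr 1
    simp only [lam, map_sub, map_mul, Complex.conj_ofReal, Complex.conj_I]
    push_cast; ring
  have h3 : (bdet ρ f T ξ).re =
      (slope ρ f ξ).re * (1 + Real.exp (-(2 * decayRate ρ f ξ * T))) := by
    rw [bdet, e]
    simp only [Complex.add_re, Complex.conj_re, Complex.re_mul_ofReal]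
    ring
  rw [h0] at h3
  have h1 := slopeGap_le_re_slope hρ hf hξ
  have h2 := slopeGap_pos hρ hf
  have := mul_pos (h2.trans_le h1) (add_pos one_pos (Real.exp_pos (-(2 * decayRate ρ f ξ * T))))
  simp at h3
  rcases h3 with h3 | h3 <;> linarith [Real.exp_pos (-(2 * decayRate ρ f ξ * T))]

/-- One constant is fixed for all symbols before `T` is introduced; the independence of the final
constants from `T` goes back to this order of quantifiers. -/
theorem exists_symbol_bound (hρ : 0 < ρ) (hf : ρ < f) : ∃ C : ℝ, 1 ≤ C ∧ IsSymbol C (slope ρ f) ∧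
    (∀ j, IsSymbol C (coefA ρ f j)) ∧ (∀ j, IsSymbol C (coefB ρ f j)) ∧
    ∀ T, IsSymbol C (fun ξ => (bdet ρ f T ξ)⁻¹) := by
  have hα := exists_isSymbol_slope hρ hf
  set a := (√(ρ * f) + ρ) / (ρ * f ^ 2) with ha
  have ha0 : 0 ≤ a := (norm_nonneg _).trans (hα.bound 0)
  have hi := isSymbol_inv_re_slope hρ hf
  set g := (slopeGap ρ f)⁻¹ with hg
  have hg0 : 0 ≤ g := (inv_pos.2 (slopeGap_pos hρ hf)).le
  have hpi := Real.pi_pos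
  have hf' := (IsSymbol.const Real.pi).mul hi
  rw [abs_of_pos hpi] at hf'
  refine ⟨1 + a + (1 + a) * (Real.pi * g) + g, ?_, hα.mono ?_, fun j => ?_, fun j => ?_,
    fun T => (isSymbol_inv_bdet hρ hf T).mono ?_⟩
  · have : 0 ≤ (1 + a) * (Real.pi * g) := by positivity
    linarith
  · have : 0 ≤ (1 + a) * (Real.pi * g) := by positivity
    linarith
  · have hle : (1 + a) * (Real.pi * g) ≤ 1 + a + (1 + a) * (Real.pi * g) + g := by linarith
    refine IsSymbol.mono ?_ hle
    refine IsSymbol.mul (a := fun ξ =>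
      (![conj (slope ρ f ξ) * dir 0 ξ, conj (slope ρ f ξ) * dir 1 ξ, 1] : Fin 3 → ℂ) j) ?_ hf'
    fin_cases j
    · exact (hα.star.mul (isSymbol_dir 0)).mono (by linarith)
    · exact (hα.star.mul (isSymbol_dir 1)).mono (by linarith)
    · simpa using (IsSymbol.const 1).mono (C' := 1 + a) (by simpa using ha0)
  · have hle : (1 + a) * (Real.pi * g) ≤ 1 + a + (1 + a) * (Real.pi * g) + g := by linarith
    refine IsSymbol.mono ?_ hle
    refine IsSymbol.mul (a := fun ξ =>
      (![slope ρ f ξ * dir 0 ξ, slope ρ f ξ * dir 1 ξ, -1] : Fin 3 → ℂ) j) ?_ hf'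
    fin_cases j
    · exact (hα.mul (isSymbol_dir 0)).mono (by linarith)
    · exact (hα.mul (isSymbol_dir 1)).mono (by linarith)
    · simpa using (IsSymbol.const (-1)).mono (C' := 1 + a) (by simpa using ha0)
  · have : 0 ≤ (1 + a) * (Real.pi * g) := by positivity
    linarith

end Coefficients

/-- The source of the decaying mode, divided by `|ξ|`. -/
def srcA (ρ f : ℝ) (S : Fin 3 → ℂ → Plane → ℂ) (t : ℂ) (ξ : Plane) : ℂ :=
  ∑ j, coefA ρ f j ξ * S j t ξ

/-- The source of the growing mode, divided by `|ξ|`. -/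
def srcB (ρ f : ℝ) (S : Fin 3 → ℂ → Plane → ℂ) (t : ℂ) (ξ : Plane) : ℂ :=
  ∑ j, coefB ρ f j ξ * S j t ξ

/-- The forward Duhamel integral. -/
def intA (ρ f : ℝ) (S : Fin 3 → ℂ → Plane → ℂ) : ℂ → Plane → ℂ :=
  duhamel (lam ρ f) (srcA ρ f S)

/-- The backward Duhamel integral. -/
def intB (ρ f T : ℝ) (S : Fin 3 → ℂ → Plane → ℂ) (t : ℂ) (ξ : Plane) : ℂ :=
  -duhamel (fun ξ => conj (lam ρ f ξ)) (fun t => srcB ρ f S (T - t)) (T - t) ξ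

/-- The final value of the growing mode. -/
def endB (ρ f T : ℝ) (d q : Plane → ℂ) (S : Fin 3 → ℂ → Plane → ℂ) (ξ : Plane) : ℂ :=
  (bdet ρ f T ξ)⁻¹ * (slope ρ f ξ * (Complex.exp (-lam ρ f ξ * T) *
    (d ξ - intB ρ f T S (0 : ℝ) ξ) + intA ρ f S T ξ) - q ξ)

/-- The initial value of the decaying mode. -/
def startA (ρ f T : ℝ) (d q : Plane → ℂ) (S : Fin 3 → ℂ → Plane → ℂ) (ξ : Plane) : ℂ :=
  d ξ - intB ρ f T S (0 : ℝ) ξ - Complex.exp (-conj (lam ρ f ξ) * T) * endB ρ f T d q S ξ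

/-- The decaying mode. -/
def modeA (ρ f T : ℝ) (d q : Plane → ℂ) (S : Fin 3 → ℂ → Plane → ℂ) (t : ℂ) (ξ : Plane) : ℂ :=
  Complex.exp (-lam ρ f ξ * t) * startA ρ f T d q S ξ + intA ρ f S t ξ

/-- The growing mode. -/
def modeB (ρ f T : ℝ) (d q : Plane → ℂ) (S : Fin 3 → ℂ → Plane → ℂ) (t : ℂ) (ξ : Plane) : ℂ :=
  Complex.exp (-conj (lam ρ f ξ) * (T - t)) * endB ρ f T d q S ξ + intB ρ f T S t ξ

/-- The Fourier transform of the density in the linear boundary value problem. -/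
def linDensity (ρ f T : ℝ) (d q : Plane → ℂ) (S : Fin 3 → ℂ → Plane → ℂ) (t : ℂ) (ξ : Plane) :
    ℂ := modeA ρ f T d q S t ξ + modeB ρ f T d q S t ξ

/-- The Fourier transform of `(-Δ)^{1/2} φ` in the linear boundary value problem. -/
def linValue (ρ f T : ℝ) (d q : Plane → ℂ) (S : Fin 3 → ℂ → Plane → ℂ) (t : ℂ) (ξ : Plane) :
    ℂ := slope ρ f ξ * modeA ρ f T d q S t ξ - conj (slope ρ f ξ) * modeB ρ f T d q S t ξ

/-- The Fourier transforms of the density and of the gradient of the value function in the linear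
boundary value problem. -/
def linSol (ρ f T : ℝ) (d q : Plane → ℂ) (S : Fin 3 → ℂ → Plane → ℂ) (i : Fin 3) (t : ℂ)
    (ξ : Plane) : ℂ :=
  (![linDensity ρ f T d q S t ξ, dir 0 ξ * linValue ρ f T d q S t ξ,
    dir 1 ξ * linValue ρ f T d q S t ξ] : Fin 3 → ℂ) i

/-- The linear solution operator is built from multipliers, propagators and Duhamel integrals, each
of which respects the envelope with a constant that does not involve `T`, `N₀` or `N₁`. -/
theorem exists_adm_linSol {ρ f : ℝ} (hρ : 0 < ρ) (hf : ρ < f) : ∃ C : ℝ, 0 < C ∧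
    ∀ (T N₀ N₁ a R : ℝ) (d q : Plane → ℂ) (S : Fin 3 → ℂ → Plane → ℂ), 0 < T → 0 ≤ N₀ → 0 ≤ N₁ →
      0 ≤ a → 0 ≤ R → IsBoundary (rate ρ f) T N₀ N₁ 0 a d → IsBoundary (rate ρ f) T N₀ N₁ T a q →
      (∀ j, Adm (aperture ρ f) T (rate ρ f) N₀ N₁ R (S j)) →
      Adm (aperture ρ f) T (rate ρ f) N₀ N₁ (C * (a + R)) (linValue ρ f T d q S) ∧
      ∀ i, Adm (aperture ρ f) T (rate ρ f) N₀ N₁ (C * (a + R)) (linSol ρ f T d q S i) := by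
  obtain ⟨C, hC, hα, hA, hB, hD⟩ := exists_symbol_bound hρ hf
  have hσ := aperture_pos hρ hf
  have hσ1 := aperture_le_one (ρ := ρ) (f := f)
  have hc := rate_pos hρ hf
  have hl := isDecay_lam hρ hf
  set K := 2 / rate ρ f * (3 * C) with hK
  have hK0 : 0 ≤ K := by positivity
  have hC0 : 0 ≤ C := zero_le_one.trans hC
  -- `bT a R` bounds the final value `endB`, and `tot a R` below bounds both modes together; they
  -- mirror the composition of the operators that follow.
  set bT : ℝ → ℝ → ℝ := fun a R => C * (C * (a + K * R + K * R) + a) with hbT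
  set tot : ℝ → ℝ → ℝ := fun a R =>
    C * (a + K * R + bT a R + K * R) + C * (bT a R + K * R) with htot
  refine ⟨tot 1 1 + 1, by positivity, ?_⟩
  intro T N₀ N₁ a R d q S hT h₀ h₁ ha hR hd hq hS
  have hbT0 : 0 ≤ bT a R := by positivity
  have sA : Adm (aperture ρ f) T (rate ρ f) N₀ N₁ (3 * C * R) (srcA ρ f S) := by
    have := Adm.sum Finset.univ fun j _ =>
      (hS j).symbol_mul (hA j).meas (hA j).bound (hA j).symm
    refine this.mono h₀ h₁ (le_of_eq ?_)
    simp; ring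
  have sB : Adm (aperture ρ f) T (rate ρ f) N₀ N₁ (3 * C * R) (srcB ρ f S) := by
    have := Adm.sum Finset.univ fun j _ =>
      (hS j).symbol_mul (hB j).meas (hB j).bound (hB j).symm
    refine this.mono h₀ h₁ (le_of_eq ?_)
    simp; ring
  have iA : Adm (aperture ρ f) T (rate ρ f) N₀ N₁ (K * R) (intA ρ f S) :=
    (sA.duhamel hl hσ hσ1 hc h₀ h₁ (by positivity)).mono h₀ h₁ (le_of_eq (by rw [hK]; ring))
  have iB : Adm (aperture ρ f) T (rate ρ f) N₀ N₁ (K * R) (intB ρ f T S) :=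
    ((sB.reverse.duhamel hl.star hσ hσ1 hc h₁ h₀ (by positivity)).reverse.neg).mono h₀ h₁
      (le_of_eq (by rw [hK]; ring))
  have hT0 : |T - 0| = T := by rw [sub_zero, abs_of_pos hT]
  have hT0' : |0 - T| = T := by rw [zero_sub, abs_neg, abs_of_pos hT]
  have b0 := hd.sub (iB.boundary hσ (left_mem_Icc.2 hT.le))
  have bE : IsBoundary (rate ρ f) T N₀ N₁ T (bT a R) (endB ρ f T d q S) :=
    (((((b0.exp_mul hl hσ hc.le h₀ h₁ hT.le (by positivity) hT0).add
      (iA.boundary hσ (right_mem_Icc.2 hT.le))).symbol_mul hα).sub hq).symbol_mul (hD T))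
  have bS : IsBoundary (rate ρ f) T N₀ N₁ 0 (a + K * R + bT a R) (startA ρ f T d q S) :=
    b0.sub (bE.exp_mul hl.star hσ hc.le h₀ h₁ hT.le hbT0 hT0')
  have mA : Adm (aperture ρ f) T (rate ρ f) N₀ N₁ (a + K * R + bT a R + K * R)
      (modeA ρ f T d q S) :=
    (bS.adm hl hσ hc.le h₀ h₁ (by positivity)).add iA
  have mB : Adm (aperture ρ f) T (rate ρ f) N₀ N₁ (bT a R + K * R) (modeB ρ f T d q S) :=
    ((bE.reverse.adm (σ := aperture ρ f) hl.star hσ hc.le h₁ h₀ hbT0).reverse).add iB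
  have hα' := hα.star
  have hv : Adm (aperture ρ f) T (rate ρ f) N₀ N₁ (tot a R) (linValue ρ f T d q S) :=
    (mA.symbol_mul hα.meas hα.bound hα.symm).sub (mB.symbol_mul hα'.meas hα'.bound hα'.symm)
  have hle : tot a R ≤ (tot 1 1 + 1) * (a + R) := by
    -- `tot` is linear in `(a, R)` with nonnegative coefficients, so its value at `(1, 1)` controls
    -- it.
    have e : (tot 1 1 + 1) * (a + R) - tot a R = tot 1 0 * R + tot 0 1 * a + (a + R) := by
      simp only [htot, hbT]; ring
    have : 0 ≤ tot 1 0 * R + tot 0 1 * a + (a + R) := by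
      simp only [htot, hbT]; positivity
    linarith
  refine ⟨hv.mono h₀ h₁ hle, fun i => ?_⟩
  fin_cases i
  · have h := mA.add mB
    refine h.mono h₀ h₁ (le_trans ?_ hle)
    simp only [htot]
    have h1 : 0 ≤ a + K * R + bT a R + K * R := by positivity
    have h2 : 0 ≤ bT a R + K * R := by positivity
    nlinarith
  · have h := hv.symbol_mul (isSymbol_dir 0).meas (isSymbol_dir 0).bound (isSymbol_dir 0).symm
    exact h.mono h₀ h₁ (by rw [one_mul]; exact hle)
  · have h := hv.symbol_mul (isSymbol_dir 1).meas (isSymbol_dir 1).bound (isSymbol_dir 1).symm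
    exact h.mono h₀ h₁ (by rw [one_mul]; exact hle)

/-! ### The modes solve the linearized boundary value problem -/

section LinearProblem

variable {ρ f T N₀ N₁ R : ℝ} {d q : Plane → ℂ} {S S' : Fin 3 → ℂ → Plane → ℂ}

theorem exists_adm_src (hρ : 0 < ρ) (hf : ρ < f)
    (hS : ∀ j, Adm (aperture ρ f) T (rate ρ f) N₀ N₁ R (S j)) :
    ∃ C : ℝ, 0 < C ∧ Adm (aperture ρ f) T (rate ρ f) N₀ N₁ (C * R) (srcA ρ f S) ∧
      Adm (aperture ρ f) T (rate ρ f) N₀ N₁ (C * R) (srcB ρ f S) := by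
  obtain ⟨C, hC, -, hA, hB, -⟩ := exists_symbol_bound hρ hf
  refine ⟨3 * C, by linarith, ?_, ?_⟩
  · have := Adm.sum Finset.univ fun j _ =>
      (hS j).symbol_mul (hA j).meas (hA j).bound (hA j).symm
    simp only [Finset.sum_const, Finset.card_univ, Fintype.card_fin, nsmul_eq_mul] at this
    rw [mul_assoc]
    exact this
  · have := Adm.sum Finset.univ fun j _ =>
      (hS j).symbol_mul (hB j).meas (hB j).bound (hB j).symm
    simp only [Finset.sum_const, Finset.card_univ, Fintype.card_fin, nsmul_eq_mul] at this
    rw [mul_assoc]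
    exact this

/-- The solution is affine in the source, and the common data cancel. Hence the bound for the
solution operator also gives the Lipschitz estimate of the fixed point map. -/
theorem linSol_sub (hρ : 0 < ρ) (hf : ρ < f) (hT : 0 < T) (h₀ : 0 ≤ N₀) (h₁ : 0 ≤ N₁) (hR : 0 ≤ R)
    (hS : ∀ j, Adm (aperture ρ f) T (rate ρ f) N₀ N₁ R (S j))
    (hS' : ∀ j, Adm (aperture ρ f) T (rate ρ f) N₀ N₁ R (S' j)) (i : Fin 3) {t : ℂ}
    (ht : t ∈ diamond (aperture ρ f) T) (ξ : Plane) :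
    linSol ρ f T d q S i t ξ - linSol ρ f T d q S' i t ξ =
      linSol ρ f T (fun _ => 0) (fun _ => 0) (fun j t ξ => S j t ξ - S' j t ξ) i t ξ := by
  have hσ := aperture_pos hρ hf
  have hσ1 := aperture_le_one (ρ := ρ) (f := f)
  have hc := rate_pos hρ hf
  have hl := isDecay_lam hρ hf
  obtain ⟨C, hC, sA, sB⟩ := exists_adm_src hρ hf hS
  obtain ⟨C', hC', sA', sB'⟩ := exists_adm_src hρ hf hS'
  have eA : srcA ρ f (fun j t ξ => S j t ξ - S' j t ξ) =
      fun t ξ => srcA ρ f S t ξ - srcA ρ f S' t ξ := by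
    funext t ξ
    simp only [srcA, mul_sub, Finset.sum_sub_distrib]
  have eB : (fun t => srcB ρ f (fun j t ξ => S j t ξ - S' j t ξ) (T - t)) =
      fun t ξ => srcB ρ f S (T - t) ξ - srcB ρ f S' (T - t) ξ := by
    funext t ξ
    simp only [srcB, mul_sub, Finset.sum_sub_distrib]
  have iA : ∀ t ∈ diamond (aperture ρ f) T, intA ρ f (fun j t ξ => S j t ξ - S' j t ξ) t ξ =
      intA ρ f S t ξ - intA ρ f S' t ξ := by
    intro t ht
    unfold intA
    rw [eA]
    exact duhamel_sub hl sA sA' hσ hσ1 hc h₀ h₁ (by positivity) (by positivity) ht ξ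
  have iB : ∀ t ∈ diamond (aperture ρ f) T, intB ρ f T (fun j t ξ => S j t ξ - S' j t ξ) t ξ =
      intB ρ f T S t ξ - intB ρ f T S' t ξ := by
    intro t ht
    unfold intB
    rw [eB, duhamel_sub hl.star sB.reverse sB'.reverse hσ hσ1 hc h₁ h₀ (by positivity)
      (by positivity) (reverse_mem_diamond ht) ξ]
    ring
  have z0 := ofReal_mem_diamond hσ (left_mem_Icc.2 hT.le)
  have zT := ofReal_mem_diamond hσ (right_mem_Icc.2 hT.le)
  have hE : endB ρ f T d q S ξ - endB ρ f T d q S' ξ = endB ρ f T (fun _ => 0) (fun _ => 0)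
      (fun j t ξ => S j t ξ - S' j t ξ) ξ := by
    unfold endB
    rw [iA _ zT, iB _ z0]
    ring
  have hst : startA ρ f T d q S ξ - startA ρ f T d q S' ξ = startA ρ f T (fun _ => 0) (fun _ => 0)
      (fun j t ξ => S j t ξ - S' j t ξ) ξ := by
    unfold startA
    rw [← hE, iB _ z0]
    ring
  have hmA : modeA ρ f T d q S t ξ - modeA ρ f T d q S' t ξ = modeA ρ f T (fun _ => 0) (fun _ => 0)
      (fun j t ξ => S j t ξ - S' j t ξ) t ξ := by
    unfold modeA
    rw [← hst, iA _ ht]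
    ring
  have hmB : modeB ρ f T d q S t ξ - modeB ρ f T d q S' t ξ = modeB ρ f T (fun _ => 0) (fun _ => 0)
      (fun j t ξ => S j t ξ - S' j t ξ) t ξ := by
    unfold modeB
    rw [← hE, iB _ ht]
    ring
  have hv : linValue ρ f T d q S t ξ - linValue ρ f T d q S' t ξ =
      linValue ρ f T (fun _ => 0) (fun _ => 0) (fun j t ξ => S j t ξ - S' j t ξ) t ξ := by
    unfold linValue
    rw [← hmA, ← hmB]
    ring
  fin_cases i
  · simp only [linSol, linDensity]
    change _ + _ - (_ + _) = _ + _
    rw [← hmA, ← hmB]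
    ring
  · simp only [linSol]
    change _ * _ - _ * _ = _ * _
    rw [← hv]
    ring
  · simp only [linSol]
    change _ * _ - _ * _ = _ * _
    rw [← hv]
    ring

theorem hasDerivAt_modeA (hρ : 0 < ρ) (hf : ρ < f) (h₀ : 0 ≤ N₀) (h₁ : 0 ≤ N₁) (hR : 0 ≤ R)
    (hS : ∀ j, Adm (aperture ρ f) T (rate ρ f) N₀ N₁ R (S j)) {t : ℝ} (ht : t ∈ Ioo 0 T)
    (ξ : Plane) :
    HasDerivAt (fun t : ℝ => modeA ρ f T d q S t ξ)
      (-lam ρ f ξ * modeA ρ f T d q S t ξ + ‖ξ‖ * srcA ρ f S t ξ) t := by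
  obtain ⟨C, hC, sA, -⟩ := exists_adm_src hρ hf hS
  have h1 := hasDerivAt_duhamel (lam := lam ρ f) sA (aperture_pos hρ hf) (rate_pos hρ hf).le h₀ h₁
    (by positivity) ht ξ
  have h2 : HasDerivAt (fun t : ℝ => Complex.exp (-lam ρ f ξ * t))
      (Complex.exp (-lam ρ f ξ * t) * (-lam ρ f ξ * 1)) t :=
    ((hasDerivAt_id t).ofReal_comp.const_mul (-lam ρ f ξ)).cexp
  refine ((h2.mul_const (startA ρ f T d q S ξ)).add h1).congr_deriv ?_
  simp only [modeA, intA]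
  ring

theorem hasDerivAt_modeB (hρ : 0 < ρ) (hf : ρ < f) (h₀ : 0 ≤ N₀) (h₁ : 0 ≤ N₁) (hR : 0 ≤ R)
    (hS : ∀ j, Adm (aperture ρ f) T (rate ρ f) N₀ N₁ R (S j)) {t : ℝ} (ht : t ∈ Ioo 0 T)
    (ξ : Plane) :
    HasDerivAt (fun t : ℝ => modeB ρ f T d q S t ξ)
      (conj (lam ρ f ξ) * modeB ρ f T d q S t ξ + ‖ξ‖ * srcB ρ f S t ξ) t := by
  obtain ⟨C, hC, -, sB⟩ := exists_adm_src hρ hf hS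
  have h1 := hasDerivAt_duhamel (lam := fun ξ => conj (lam ρ f ξ)) sB.reverse (aperture_pos hρ hf)
    (rate_pos hρ hf).le h₁ h₀ (by positivity) (t := T - t)
    ⟨by linarith [ht.2], by linarith [ht.1]⟩ ξ
  have h1' := (h1.scomp t ((hasDerivAt_id t).const_sub T)).neg
  have h2 : HasDerivAt (fun t : ℝ => Complex.exp (-conj (lam ρ f ξ) * (T - t)))
      (Complex.exp (-conj (lam ρ f ξ) * (T - t)) * (-conj (lam ρ f ξ) * -1)) t :=
    (((hasDerivAt_id t).ofReal_comp.const_sub (T : ℂ)).const_mul (-conj (lam ρ f ξ))).cexp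
  have h3 := (h2.mul_const (endB ρ f T d q S ξ)).add h1'
  have e : (fun t : ℝ => modeB ρ f T d q S t ξ) = (fun t : ℝ =>
      Complex.exp (-conj (lam ρ f ξ) * (T - t)) * endB ρ f T d q S ξ) + -((fun t : ℝ =>
        duhamel (fun ξ => conj (lam ρ f ξ)) (fun t => srcB ρ f S (T - t)) t ξ) ∘ fun t => T - t) := by
    funext t
    simp [modeB, intB]
  rw [e]
  refine h3.congr_deriv ?_
  simp only [modeB, intB]
  push_cast
  rw [sub_sub_cancel]
  simp only [neg_smul, one_smul]
  ring

theorem continuousOn_modeA (hρ : 0 < ρ) (hf : ρ < f) (hT : 0 ≤ T) (h₀ : 0 ≤ N₀) (h₁ : 0 ≤ N₁)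
    (hR : 0 ≤ R) (hS : ∀ j, Adm (aperture ρ f) T (rate ρ f) N₀ N₁ R (S j)) (ξ : Plane) :
    ContinuousOn (fun t : ℝ => modeA ρ f T d q S t ξ) (Icc 0 T) := by
  obtain ⟨C, hC, sA, -⟩ := exists_adm_src hρ hf hS
  have h1 := continuousOn_duhamel (lam := lam ρ f) sA (aperture_pos hρ hf) (rate_pos hρ hf).le h₀ h₁
    (by positivity) hT ξ
  exact ContinuousOn.add (Continuous.continuousOn (by fun_prop)) h1

theorem continuousOn_modeB (hρ : 0 < ρ) (hf : ρ < f) (hT : 0 ≤ T) (h₀ : 0 ≤ N₀) (h₁ : 0 ≤ N₁)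
    (hR : 0 ≤ R) (hS : ∀ j, Adm (aperture ρ f) T (rate ρ f) N₀ N₁ R (S j)) (ξ : Plane) :
    ContinuousOn (fun t : ℝ => modeB ρ f T d q S t ξ) (Icc 0 T) := by
  obtain ⟨C, hC, -, sB⟩ := exists_adm_src hρ hf hS
  have h1 := continuousOn_duhamel (lam := fun ξ => conj (lam ρ f ξ)) sB.reverse (aperture_pos hρ hf)
    (rate_pos hρ hf).le h₁ h₀ (by positivity) hT ξ
  have h2 : ContinuousOn (fun t : ℝ => duhamel (fun ξ => conj (lam ρ f ξ))
      (fun t => srcB ρ f S (T - t)) ((T - t : ℝ) : ℂ) ξ) (Icc 0 T) :=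
    h1.comp (f := fun t : ℝ => T - t) (by fun_prop)
      fun t ht => ⟨by linarith [ht.2], by linarith [ht.1]⟩
  push_cast at h2
  exact ContinuousOn.add (Continuous.continuousOn (by fun_prop)) h2.neg

theorem continuousOn_linDensity (hρ : 0 < ρ) (hf : ρ < f) (hT : 0 ≤ T) (h₀ : 0 ≤ N₀)
    (h₁ : 0 ≤ N₁) (hR : 0 ≤ R) (hS : ∀ j, Adm (aperture ρ f) T (rate ρ f) N₀ N₁ R (S j))
    (ξ : Plane) : ContinuousOn (fun t : ℝ => linDensity ρ f T d q S t ξ) (Icc 0 T) :=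
  (continuousOn_modeA hρ hf hT h₀ h₁ hR hS ξ).add (continuousOn_modeB hρ hf hT h₀ h₁ hR hS ξ)

theorem continuousOn_linValue (hρ : 0 < ρ) (hf : ρ < f) (hT : 0 ≤ T) (h₀ : 0 ≤ N₀)
    (h₁ : 0 ≤ N₁) (hR : 0 ≤ R) (hS : ∀ j, Adm (aperture ρ f) T (rate ρ f) N₀ N₁ R (S j))
    (ξ : Plane) : ContinuousOn (fun t : ℝ => linValue ρ f T d q S t ξ) (Icc 0 T) :=
  ((continuousOn_modeA hρ hf hT h₀ h₁ hR hS ξ).const_mul _).sub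
    ((continuousOn_modeB hρ hf hT h₀ h₁ hR hS ξ).const_mul _)

theorem norm_mul_dir {ξ : Plane} (hξ : ξ ≠ 0) (j : Fin 2) :
    (‖ξ‖ : ℂ) * dir j ξ = Complex.I * (ξ j : ℂ) := by
  have : (‖ξ‖ : ℂ) ≠ 0 := by simpa using hξ
  unfold dir
  field_simp

theorem sum_mul_dir {ξ : Plane} (hξ : ξ ≠ 0) :
    (ξ 0 : ℂ) * dir 0 ξ + (ξ 1 : ℂ) * dir 1 ξ = Complex.I * (‖ξ‖ : ℂ) := by
  have h : (‖ξ‖ : ℂ) ≠ 0 := by simpa using hξ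
  have h2 : (ξ 0 : ℂ) ^ 2 + (ξ 1 : ℂ) ^ 2 = (‖ξ‖ : ℂ) ^ 2 := by
    have := EuclideanSpace.norm_sq_eq ξ
    simp only [Fin.sum_univ_two, Real.norm_eq_abs, sq_abs] at this
    rw [← Complex.ofReal_pow ‖ξ‖, this]
    push_cast; ring
  unfold dir
  field_simp
  rw [h2]

/-- The Fourier transform of the flux, with a nonlinear part `S`. -/
def linFlux (ρ f : ℝ) (u S : Fin 3 → ℂ → Plane → ℂ) (j : Fin 2) (t : ℂ) (ξ : Plane) : ℂ :=
  (![(f - 2 * ρ) * u 0 t ξ + ρ * f ^ 2 * u 1 t ξ + S 0 t ξ, ρ * f ^ 2 * u 2 t ξ + S 1 t ξ] :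
    Fin 2 → ℂ) j

/-- The Fourier transform of the time derivative of the value function, with a nonlinear part
`S`. -/
def linRate (f : ℝ) (u S : Fin 3 → ℂ → Plane → ℂ) (t : ℂ) (ξ : Plane) : ℂ :=
  f * u 1 t ξ - 1 / f * u 0 t ξ + S 2 t ξ

/-- The first row of the system, recovered from the ODEs of the two modes: `hα` and `hα'` are its
eigenvector relations and `hsrc` is the recombination of the sources. -/
theorem hasDerivAt_linDensity (hρ : 0 < ρ) (hf : ρ < f) (h₀ : 0 ≤ N₀) (h₁ : 0 ≤ N₁) (hR : 0 ≤ R)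
    (hS : ∀ j, Adm (aperture ρ f) T (rate ρ f) N₀ N₁ R (S j)) {t : ℝ} (ht : t ∈ Ioo 0 T)
    {ξ : Plane} (hξ : ξ ≠ 0) :
    HasDerivAt (fun t : ℝ => linDensity ρ f T d q S t ξ)
      (∑ j, 2 * Real.pi * Complex.I * ξ j * linFlux ρ f (linSol ρ f T d q S) S j t ξ) t := by
  refine ((hasDerivAt_modeA (d := d) (q := q) hρ hf h₀ h₁ hR hS ht ξ).add
    (hasDerivAt_modeB (d := d) (q := q) hρ hf h₀ h₁ hR hS ht ξ)).congr_deriv ?_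
  have hf0 : (f : ℂ) ≠ 0 := by exact_mod_cast (hρ.trans hf).ne'
  have hρ0 : (ρ : ℂ) ≠ 0 := by exact_mod_cast hρ.ne'
  have hpi : (Real.pi : ℂ) ≠ 0 := by exact_mod_cast Real.pi_ne_zero
  have hn : (‖ξ‖ : ℂ) ≠ 0 := by simpa using hξ
  have hα : (2 * Real.pi * ρ * f ^ 2 * ‖ξ‖ : ℂ) * slope ρ f ξ =
      (decayRate ρ f ξ : ℂ) - Complex.I * (2 * Real.pi * ρ * ξ 0) := by
    unfold slope
    push_cast
    field_simp
  have hα' : (2 * Real.pi * ρ * f ^ 2 * ‖ξ‖ : ℂ) * conj (slope ρ f ξ) =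
      (decayRate ρ f ξ : ℂ) + Complex.I * (2 * Real.pi * ρ * ξ 0) := by
    unfold slope
    simp only [map_div₀, map_sub, map_mul, Complex.conj_ofReal, Complex.conj_I]
    push_cast
    field_simp
    ring
  have hre : slope ρ f ξ + conj (slope ρ f ξ) = 2 * ((slope ρ f ξ).re : ℂ) := by
    rw [Complex.add_conj]; push_cast; ring
  have hre0 : ((slope ρ f ξ).re : ℂ) ≠ 0 := by
    exact_mod_cast ((slopeGap_pos hρ hf).trans_le (slopeGap_le_re_slope hρ hf hξ)).ne'
  -- `coefA` and `coefB` come from Cramer's rule in the basis `(1, slope)`, `(1, -conj slope)`, with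
  -- determinant `-2 Re slope`; the `2` cancels against the `2π` of the derivative and leaves the
  -- factor `π`.
  have hsrc : srcA ρ f S t ξ + srcB ρ f S t ξ =
      2 * Real.pi * (dir 0 ξ * S 0 t ξ + dir 1 ξ * S 1 t ξ) := by
    simp only [srcA, srcB, coefA, coefB, Fin.sum_univ_three, Matrix.cons_val_zero,
      Matrix.cons_val_one, Matrix.cons_val]
    field_simp
    linear_combination (dir 0 ξ * S 0 t ξ + dir 1 ξ * S 1 t ξ) * hre
  have hd0 := norm_mul_dir hξ 0
  have hd1 := norm_mul_dir hξ 1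
  have hd := sum_mul_dir hξ
  have hlam : lam ρ f ξ = (decayRate ρ f ξ : ℂ) - Complex.I * (2 * Real.pi * (f - ρ) * ξ 0) := by
    unfold lam; push_cast; ring
  have hlam' : conj (lam ρ f ξ) =
      (decayRate ρ f ξ : ℂ) + Complex.I * (2 * Real.pi * (f - ρ) * ξ 0) := by
    simp only [lam, map_sub, map_mul, Complex.conj_ofReal, Complex.conj_I]; push_cast; ring
  rw [hlam', hlam]
  simp only [linFlux, linSol, linDensity, linValue, Fin.sum_univ_two, Matrix.cons_val_zero,
    Matrix.cons_val_one, Matrix.cons_val]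
  set A := modeA ρ f T d q S t ξ
  set B := modeB ρ f T d q S t ξ
  linear_combination (‖ξ‖ : ℂ) * hsrc + 2 * Real.pi * S 0 t ξ * hd0 + 2 * Real.pi * S 1 t ξ * hd1
    + A * hα - B * hα' - 2 * Real.pi * Complex.I * ρ * f ^ 2 *
      (slope ρ f ξ * A - conj (slope ρ f ξ) * B) * hd
    - 2 * Real.pi * ρ * f ^ 2 * (‖ξ‖ : ℂ) *
      (slope ρ f ξ * A - conj (slope ρ f ξ) * B) * Complex.I_sq

/-- The second row of the system, where the eigenvector relations are `slope_mul` and its conjugate.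
-/
theorem hasDerivAt_linValue (hρ : 0 < ρ) (hf : ρ < f) (h₀ : 0 ≤ N₀) (h₁ : 0 ≤ N₁) (hR : 0 ≤ R)
    (hS : ∀ j, Adm (aperture ρ f) T (rate ρ f) N₀ N₁ R (S j)) {t : ℝ} (ht : t ∈ Ioo 0 T)
    {ξ : Plane} (hξ : ξ ≠ 0) :
    HasDerivAt (fun t : ℝ => linValue ρ f T d q S t ξ)
      (2 * Real.pi * ‖ξ‖ * linRate f (linSol ρ f T d q S) S t ξ) t := by
  refine (((hasDerivAt_modeA (d := d) (q := q) hρ hf h₀ h₁ hR hS ht ξ).const_mul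
    (slope ρ f ξ)).sub ((hasDerivAt_modeB (d := d) (q := q) hρ hf h₀ h₁ hR hS ht ξ).const_mul
    (conj (slope ρ f ξ)))).congr_deriv ?_
  have hf0 : (f : ℂ) ≠ 0 := by exact_mod_cast (hρ.trans hf).ne'
  have hpi : (Real.pi : ℂ) ≠ 0 := by exact_mod_cast Real.pi_ne_zero
  have hα := slope_mul hρ hf ξ
  have hα' := congrArg conj hα
  simp only [map_add, map_mul, Complex.conj_ofReal, Complex.conj_I] at hα'
  push_cast at hα hα'
  have hre : slope ρ f ξ + conj (slope ρ f ξ) = 2 * ((slope ρ f ξ).re : ℂ) := by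
    rw [Complex.add_conj]; push_cast; ring
  have hre0 : ((slope ρ f ξ).re : ℂ) ≠ 0 := by
    exact_mod_cast ((slopeGap_pos hρ hf).trans_le (slopeGap_le_re_slope hρ hf hξ)).ne'
  have hsrc : slope ρ f ξ * srcA ρ f S t ξ - conj (slope ρ f ξ) * srcB ρ f S t ξ =
      2 * Real.pi * S 2 t ξ := by
    simp only [srcA, srcB, coefA, coefB, Fin.sum_univ_three, Matrix.cons_val_zero,
      Matrix.cons_val_one, Matrix.cons_val]
    field_simp
    linear_combination (S 2 t ξ) * hre
  have hd0 := norm_mul_dir hξ 0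
  have hlam : lam ρ f ξ = (decayRate ρ f ξ : ℂ) - Complex.I * (2 * Real.pi * (f - ρ) * ξ 0) := by
    unfold lam; push_cast; ring
  have hlam' : conj (lam ρ f ξ) =
      (decayRate ρ f ξ : ℂ) + Complex.I * (2 * Real.pi * (f - ρ) * ξ 0) := by
    simp only [lam, map_sub, map_mul, Complex.conj_ofReal, Complex.conj_I]; push_cast; ring
  rw [hlam', hlam]
  simp only [linRate, linSol, linDensity, linValue, Matrix.cons_val_zero,
    Matrix.cons_val_one]
  set A := modeA ρ f T d q S t ξ
  set B := modeB ρ f T d q S t ξ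
  linear_combination (‖ξ‖ : ℂ) * hsrc - A * hα - B * hα' - 2 * Real.pi * f *
      (slope ρ f ξ * A - conj (slope ρ f ξ) * B) * hd0

theorem linDensity_zero (ξ : Plane) : linDensity ρ f T d q S (0 : ℝ) ξ = d ξ := by
  have : intA ρ f S ((0 : ℝ) : ℂ) ξ = 0 := by simp [intA, duhamel]
  unfold linDensity modeA modeB startA
  rw [this]
  simp only [Complex.ofReal_zero, mul_zero, Complex.exp_zero, sub_zero]
  ring

/-- `endB` is the solution of the 2 × 2 system of boundary conditions after elimination of `startA`.
The origin is excluded because `slope` and hence `bdet` vanish there. -/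
theorem linValue_end (hρ : 0 < ρ) (hf : ρ < f) {ξ : Plane} (hξ : ξ ≠ 0) :
    linValue ρ f T d q S (T : ℝ) ξ = q ξ := by
  have h1 : intB ρ f T S ((T : ℝ) : ℂ) ξ = 0 := by simp [intB, duhamel]
  have hD := bdet_ne_zero hρ hf T hξ
  have hE : bdet ρ f T ξ * endB ρ f T d q S ξ = slope ρ f ξ * (Complex.exp (-lam ρ f ξ * T) *
    (d ξ - intB ρ f T S (0 : ℝ) ξ) + intA ρ f S T ξ) - q ξ := by
    unfold endB
    rw [mul_inv_cancel_left₀ hD]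
  unfold linValue modeA modeB startA
  rw [h1]
  simp only [sub_self, mul_zero, Complex.exp_zero]
  unfold bdet at hE
  linear_combination -hE

end LinearProblem

/-! ### The nonlinear problem in Fourier variables -/

/-- Picard iteration with contraction factor `1 / 2`. The iterates are compared pointwise with the
envelope, and their limit is taken at each point of the diamond instead of in a function space. -/
theorem exists_fixedPoint {ρ f : ℝ} (hρ : 0 < ρ) (hf : ρ < f) (P : Fin 3 → Fin 3 → Poly) :
    ∃ C : ℝ, 0 < C ∧ ∃ ε : ℝ, 0 < ε ∧ ∀ (T N₀ N₁ : ℝ) (d q : Plane → ℂ), 0 < T → 0 ≤ N₀ → 0 ≤ N₁ →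
      N₀ + N₁ ≤ ε → IsBoundary (rate ρ f) T N₀ N₁ 0 1 d → IsBoundary (rate ρ f) T N₀ N₁ T 1 q →
      convConst N₀ N₁ ≤ 1 ∧ ∃ u : Fin 3 → ℂ → Plane → ℂ,
        (∀ i, Adm (aperture ρ f) T (rate ρ f) N₀ N₁ C (u i)) ∧
        (∀ j, Adm (aperture ρ f) T (rate ρ f) N₀ N₁ 1 (Poly.fourQuad (P j) u)) ∧
        Adm (aperture ρ f) T (rate ρ f) N₀ N₁ C
          (linValue ρ f T d q fun j => Poly.fourQuad (P j) u) ∧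
        ∀ i, ∀ t ∈ diamond (aperture ρ f) T, ∀ ξ,
          u i t ξ = linSol ρ f T d q (fun j => Poly.fourQuad (P j) u) i t ξ := by
  obtain ⟨CL, hCL, hlin⟩ := exists_adm_linSol hρ hf
  have hσ := aperture_pos hρ hf
  have hc := rate_pos hρ hf
  -- Data of size `1` and sources of size at most `1` produce solutions of size `CL * (1 + 1)`.
  set R := 2 * CL with hR
  have hR0 : 0 < R := by positivity
  set B₁ := ∑ j, ∑ i, Poly.size R (P j i) * R with hB₁
  set B₂ := ∑ j, ∑ i, (Poly.lip R (P j i) * R + Poly.size R (P j i)) with hB₂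
  have hb1 : ∀ j, ∑ i, Poly.size R (P j i) * R ≤ B₁ := fun j =>
    Finset.single_le_sum (f := fun j => ∑ i, Poly.size R (P j i) * R)
      (fun j _ => Finset.sum_nonneg fun i _ => mul_nonneg (Poly.size_nonneg hR0.le _) hR0.le)
      (Finset.mem_univ j)
  have hb2 : ∀ j, ∑ i, (Poly.lip R (P j i) * R + Poly.size R (P j i)) ≤ B₂ := fun j =>
    Finset.single_le_sum (f := fun j => ∑ i, (Poly.lip R (P j i) * R + Poly.size R (P j i)))
      (fun j _ => Finset.sum_nonneg fun i _ => add_nonneg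
        (mul_nonneg (Poly.lip_nonneg hR0.le _) hR0.le) (Poly.size_nonneg hR0.le _))
      (Finset.mem_univ j)
  have hB1 : 0 ≤ B₁ := Finset.sum_nonneg fun j _ => Finset.sum_nonneg fun i _ =>
    mul_nonneg (Poly.size_nonneg hR0.le _) hR0.le
  have hB2 : 0 ≤ B₂ := Finset.sum_nonneg fun j _ => Finset.sum_nonneg fun i _ =>
    add_nonneg (mul_nonneg (Poly.lip_nonneg hR0.le _) hR0.le) (Poly.size_nonneg hR0.le _)
  have hw := wtMass_nonneg
  -- The three summands secure in turn `convConst ≤ 1`, invariance of the ball of radius `R`, and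
  -- contraction by `1 / 2`. The extra `1` added to `32 * wtMass` makes the quotient meaningful
  -- without knowing that `wtMass` is positive.
  refine ⟨R, hR0, ((32 * wtMass + 1) * (1 + B₁ + 2 * CL * B₂))⁻¹, by positivity, ?_⟩
  intro T N₀ N₁ d q hT h₀ h₁ hN hd hq
  have hκ0 : 0 ≤ convConst N₀ N₁ := by unfold convConst; positivity
  have hκ : convConst N₀ N₁ * (1 + B₁ + 2 * CL * B₂) ≤ 1 := by
    have h1 : convConst N₀ N₁ ≤ (32 * wtMass + 1) * (N₀ + N₁) := by
      unfold convConst; gcongr; linarith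
    calc _ ≤ (32 * wtMass + 1) * (N₀ + N₁) * (1 + B₁ + 2 * CL * B₂) := by gcongr
      _ ≤ (32 * wtMass + 1) * ((32 * wtMass + 1) * (1 + B₁ + 2 * CL * B₂))⁻¹ *
          (1 + B₁ + 2 * CL * B₂) := by gcongr
      _ = 1 := by field_simp
  have p1 : 0 ≤ convConst N₀ N₁ * B₁ := by positivity
  have p2 : 0 ≤ convConst N₀ N₁ * (2 * CL * B₂) := by positivity
  have hκ1 : convConst N₀ N₁ ≤ 1 := by linarith
  have hκB1 : B₁ * convConst N₀ N₁ ≤ 1 := by linarith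
  have hκB2 : CL * (B₂ * convConst N₀ N₁) ≤ 1 / 2 := by linarith
  refine ⟨hκ1, ?_⟩
  have hsrc : ∀ u : Fin 3 → ℂ → Plane → ℂ, (∀ i, Adm (aperture ρ f) T (rate ρ f) N₀ N₁ R (u i)) →
      ∀ j, Adm (aperture ρ f) T (rate ρ f) N₀ N₁ 1 (Poly.fourQuad (P j) u) := by
    intro u hu j
    refine (Poly.adm_fourQuad hu hσ hc.le h₀ h₁ hκ1 hR0.le (P j)).mono h₀ h₁ ?_
    exact (mul_le_mul_of_nonneg_right (hb1 j) hκ0).trans hκB1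
  set Φ : (Fin 3 → ℂ → Plane → ℂ) → Fin 3 → ℂ → Plane → ℂ :=
    fun u => linSol ρ f T d q (fun j => Poly.fourQuad (P j) u) with hΦ
  have hmap : ∀ u : Fin 3 → ℂ → Plane → ℂ, (∀ i, Adm (aperture ρ f) T (rate ρ f) N₀ N₁ R (u i)) →
      Adm (aperture ρ f) T (rate ρ f) N₀ N₁ R
        (linValue ρ f T d q fun j => Poly.fourQuad (P j) u) ∧
      ∀ i, Adm (aperture ρ f) T (rate ρ f) N₀ N₁ R (Φ u i) := by
    intro u hu
    have h := hlin T N₀ N₁ 1 1 d q _ hT h₀ h₁ zero_le_one zero_le_one hd hq (hsrc u hu)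
    have e : CL * (1 + 1) = R := by rw [hR]; ring
    rw [e] at h
    exact h
  have hzero : ∀ x, IsBoundary (rate ρ f) T N₀ N₁ x 0 (fun _ => 0) := fun x =>
    ⟨measurable_const, fun ξ => by simp, fun ξ => by simp⟩
  have hlip : ∀ (u v : Fin 3 → ℂ → Plane → ℂ) (θ : ℝ), 0 ≤ θ →
      (∀ i, Adm (aperture ρ f) T (rate ρ f) N₀ N₁ R (u i)) →
      (∀ i, Adm (aperture ρ f) T (rate ρ f) N₀ N₁ R (v i)) →
      (∀ i, Adm (aperture ρ f) T (rate ρ f) N₀ N₁ θ (fun t ξ => u i t ξ - v i t ξ)) →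
      ∀ i, Adm (aperture ρ f) T (rate ρ f) N₀ N₁ (θ / 2) (fun t ξ => Φ u i t ξ - Φ v i t ξ) := by
    intro u v θ hθ hu hv huv i
    have hS : ∀ j, Adm (aperture ρ f) T (rate ρ f) N₀ N₁ (B₂ * convConst N₀ N₁ * θ)
        (fun t ξ => Poly.fourQuad (P j) u t ξ - Poly.fourQuad (P j) v t ξ) := by
      intro j
      refine (Poly.adm_fourQuad_sub hu hv huv hσ hc.le h₀ h₁ hκ1 hR0.le hθ (P j)).mono h₀ h₁ ?_
      have := hb2 j
      gcongr
    have h := (hlin T N₀ N₁ 0 _ _ _ _ hT h₀ h₁ le_rfl (by positivity) (hzero 0) (hzero T) hS).2 i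
    refine (h.mono h₀ h₁ ?_).congr hσ (((hmap u hu).2 i).meas.sub ((hmap v hv).2 i).meas)
      fun t ht ξ => ?_
    · rw [zero_add]
      nlinarith
    · exact linSol_sub hρ hf hT h₀ h₁ zero_le_one (hsrc u hu) (hsrc v hv) i ht ξ
  set F : ℕ → Fin 3 → ℂ → Plane → ℂ := fun n => Φ^[n] (fun _ _ _ => 0) with hF
  have hF_succ : ∀ n, F (n + 1) = Φ (F n) := fun n => Function.iterate_succ_apply' Φ n _
  have hF_adm : ∀ n i, Adm (aperture ρ f) T (rate ρ f) N₀ N₁ R (F n i) := by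
    intro n
    induction n with
    | zero => exact fun i => Adm.zero.mono h₀ h₁ hR0.le
    | succ n ih => rw [hF_succ]; exact (hmap _ ih).2
  have hF_diff : ∀ n i, Adm (aperture ρ f) T (rate ρ f) N₀ N₁ (2 * R * (1 / 2) ^ n)
      (fun t ξ => F (n + 1) i t ξ - F n i t ξ) := by
    intro n
    induction n with
    | zero =>
      intro i
      refine ((hF_adm 1 i).sub (hF_adm 0 i)).mono h₀ h₁ (by linarith)
    | succ n ih =>
      intro i
      have h := hlip _ _ _ (by positivity) (hF_adm (n + 1)) (hF_adm n) ih i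
      rw [hF_succ (n + 1), hF_succ n] at *
      refine h.mono h₀ h₁ (le_of_eq ?_)
      rw [pow_succ]; ring
  -- Convergence is known only over the diamond. The iterates are cut off outside it so that the
  -- sequence converges everywhere and its limit is measurable.
  have hmeasD : MeasurableSet {w : ℂ × Plane | w.1 ∈ diamond (aperture ρ f) T} := by
    have : IsClosed (diamond (aperture ρ f) T) := by
      refine IsClosed.and (isClosed_le ?_ ?_) (isClosed_le ?_ ?_)
      · exact Complex.continuous_im.abs
      · exact continuous_const.mul Complex.continuous_re
      · exact Complex.continuous_im.abs
      · exact continuous_const.mul (continuous_const.sub Complex.continuous_re)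
    exact this.measurableSet.preimage measurable_fst
  have hdist : ∀ i, ∀ t ∈ diamond (aperture ρ f) T, ∀ ξ, ∀ n, dist (F n i t ξ) (F (n + 1) i t ξ) ≤
      2 * R * env (rate ρ f) T N₀ N₁ t.re ξ * (1 / 2) ^ n := by
    intro i t ht ξ n
    rw [dist_comm, dist_eq_norm]
    refine ((hF_diff n i).bound t ht ξ).trans (le_of_eq ?_)
    ring
  have hlim : ∀ (i : Fin 3) (w : ℂ × Plane), ∃ l : ℂ, Tendsto (fun n =>
      {w : ℂ × Plane | w.1 ∈ diamond (aperture ρ f) T}.indicator (fun w => F n i w.1 w.2) w)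
      atTop (𝓝 l) := by
    intro i w
    by_cases hw : w.1 ∈ diamond (aperture ρ f) T
    · obtain ⟨l, hl⟩ := cauchySeq_tendsto_of_complete
        (cauchySeq_of_le_geometric (1 / 2) _ (by norm_num) (hdist i w.1 hw w.2))
      refine ⟨l, hl.congr fun n => ?_⟩
      rw [indicator_of_mem (show w ∈ {w : ℂ × Plane | w.1 ∈ diamond (aperture ρ f) T} from hw)]
    · refine ⟨0, tendsto_const_nhds.congr fun n => ?_⟩
      rw [indicator_of_notMem (show w ∉ {w : ℂ × Plane | w.1 ∈ diamond (aperture ρ f) T} from hw)]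
  choose l hl using hlim
  set u : Fin 3 → ℂ → Plane → ℂ := fun i t ξ => l i (t, ξ) with hu
  have hu_meas : ∀ i, Measurable fun w : ℂ × Plane => u i w.1 w.2 := fun i =>
    measurable_of_tendsto_metrizable (fun n => (hF_adm n i).meas.indicator hmeasD)
      (tendsto_pi_nhds.2 (hl i))
  have hu_lim : ∀ i, ∀ t ∈ diamond (aperture ρ f) T, ∀ ξ,
      Tendsto (fun n => F n i t ξ) atTop (𝓝 (u i t ξ)) := by
    intro i t ht ξ
    refine (hl i (t, ξ)).congr fun n => ?_
    rw [indicator_of_mem (show (t, ξ) ∈ {w : ℂ × Plane | w.1 ∈ diamond (aperture ρ f) T} from ht)]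
  -- `4 * R` is the tail of the geometric series with first term `2 * R` and ratio `1 / 2`.
  have hθ : Tendsto (fun n : ℕ => 4 * R * (1 / 2 : ℝ) ^ n) atTop (𝓝 0) := by
    simpa using (tendsto_pow_atTop_nhds_zero_of_lt_one (r := (1 / 2 : ℝ)) (by norm_num)
      (by norm_num)).const_mul (4 * R)
  have hu_adm := fun i => Adm.of_tendsto (fun n => hF_adm n i) hθ hσ hc.le h₀ h₁ (hu_meas i)
    (fun n t ht ξ => by
      rw [← dist_eq_norm]
      refine (dist_le_of_le_geometric_of_tendsto (1 / 2) _ (by norm_num) (hdist i t ht ξ)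
        (hu_lim i t ht ξ) n).trans (le_of_eq ?_)
      ring)
  have hu1 := fun i => (hu_adm i).1
  refine ⟨u, hu1, hsrc u hu1, (hmap u hu1).1, fun i t ht ξ => ?_⟩
  have h1 : Tendsto (fun n => F (n + 1) i t ξ) atTop (𝓝 (u i t ξ)) :=
    (hu_lim i t ht ξ).comp (tendsto_add_atTop_nat 1)
  refine tendsto_nhds_unique h1 ?_
  rw [tendsto_iff_norm_sub_tendsto_zero]
  refine squeeze_zero (fun n => norm_nonneg _) (g := fun n : ℕ =>
    4 * R * (1 / 2 : ℝ) ^ n / 2 * env (rate ρ f) T N₀ N₁ t.re ξ) (fun n => ?_) ?_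
  · rw [hF_succ]
    exact (hlip (F n) u _ (by positivity) (hF_adm n) hu1 (fun i => (hu_adm i).2 n) i).bound t ht ξ
  · simpa using (hθ.div_const 2).mul_const (env (rate ρ f) T N₀ N₁ t.re ξ)

/-! ### Inverse Fourier transforms -/

/-- The plane wave `exp (2 i π z · ξ)`. -/
def wave (z ξ : Plane) : ℂ := Complex.exp (2 * Real.pi * Complex.I * (ξ 0 * z 0 + ξ 1 * z 1))

/-- The inverse Fourier transform of an integrable function. -/
def invF (h : Plane → ℂ) (z : Plane) : ℂ := ∫ ξ, wave z ξ * h ξ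

theorem wave_eq (z ξ : Plane) :
    wave z ξ = Complex.exp ((2 * Real.pi * inner ℝ ξ z : ℝ) * Complex.I) := by
  unfold wave
  rw [PiLp.inner_apply, Fin.sum_univ_two]
  simp only [RCLike.inner_apply, conj_trivial]
  push_cast
  ring_nf

theorem norm_wave (z ξ : Plane) : ‖wave z ξ‖ = 1 := by
  rw [wave_eq, Complex.norm_exp_ofReal_mul_I]

theorem wave_comm (z ξ : Plane) : wave z ξ = wave ξ z := by
  unfold wave; ring_nf

theorem wave_neg (z ξ : Plane) : wave z (-ξ) = conj (wave z ξ) := by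
  rw [wave_eq, wave_eq, ← Complex.exp_conj, inner_neg_left]
  simp only [map_mul, Complex.conj_ofReal, Complex.conj_I]
  push_cast; ring_nf

theorem wave_mul_wave (z ξ η : Plane) : wave z η * wave z (ξ - η) = wave z ξ := by
  unfold wave
  rw [← Complex.exp_add]
  simp only [PiLp.sub_apply, Complex.ofReal_sub]
  ring_nf

theorem continuous_wave : Continuous fun w : Plane × Plane => wave w.1 w.2 := by
  unfold wave
  fun_prop

theorem continuous_wave_right (z : Plane) : Continuous (wave z) :=
  continuous_wave.comp (Continuous.prodMk_right z)

theorem invF_eq (h : Plane → ℂ) : invF h = 𝓕⁻ h := by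
  funext z
  rw [Real.fourierInv_eq', invF]
  congr 1; ext ξ
  rw [wave_eq, smul_eq_mul]

section InvF

variable {h u v : Plane → ℂ}

theorem integrable_wave_mul (hi : Integrable h) (z : Plane) : Integrable fun ξ => wave z ξ * h ξ :=
  hi.bdd_mul (continuous_wave_right z).aestronglyMeasurable
    (Eventually.of_forall fun ξ => (norm_wave z ξ).le)

theorem norm_invF_le (h : Plane → ℂ) (z : Plane) : ‖invF h z‖ ≤ ∫ ξ, ‖h ξ‖ := by
  refine (norm_integral_le_integral_norm _).trans (le_of_eq ?_)
  simp [norm_wave]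

theorem invF_add (hu : Integrable u) (hv : Integrable v) (z : Plane) :
    invF (fun ξ => u ξ + v ξ) z = invF u z + invF v z := by
  unfold invF
  rw [← integral_add (integrable_wave_mul hu z) (integrable_wave_mul hv z)]
  congr 1; ext ξ; ring

theorem invF_const_mul (a : ℂ) (z : Plane) : invF (fun ξ => a * h ξ) z = a * invF h z := by
  unfold invF
  rw [← integral_const_mul]
  congr 1; ext ξ; ring

theorem invF_sum {ι : Type*} (s : Finset ι) {f : ι → Plane → ℂ} (hf : ∀ i ∈ s, Integrable (f i))
    (z : Plane) : invF (fun ξ => ∑ i ∈ s, f i ξ) z = ∑ i ∈ s, invF (f i) z := by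
  unfold invF
  rw [← integral_finsetSum s fun i hi => integrable_wave_mul (hf i hi) z]
  simp [Finset.mul_sum]

theorem invF_congr_ae (he : u =ᵐ[volume] v) : invF u = invF v := by
  funext z
  exact integral_congr_ae (he.mono fun ξ hξ => by simp [hξ])

theorem invF_conj_neg (h : Plane → ℂ) (z : Plane) :
    invF (fun ξ => conj (h (-ξ))) z = conj (invF h z) := by
  unfold invF
  rw [← integral_conj, ← integral_neg_eq_self]
  congr 1; ext ξ
  simp only [neg_neg, wave_neg, map_mul]

theorem ofReal_re_invF (hs : ∀ ξ, h (-ξ) = conj (h ξ)) (z : Plane) :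
    ((invF h z).re : ℂ) = invF h z := by
  refine Complex.conj_eq_iff_re.1 ?_
  rw [← invF_conj_neg]
  congr 1; ext ξ
  rw [hs, Complex.conj_conj]

/-- The wave is a character, so twisting both factors by it twists the convolution; what remains is
that the integral of a convolution is the product of the integrals. -/
theorem invF_conv (hu : Integrable u) (hv : Integrable v) (z : Plane) :
    invF (conv u v) z = invF u z * invF v z := by
  have h := integral_convolution (ContinuousLinearMap.mul ℂ ℂ) (integrable_wave_mul hu z)
    (integrable_wave_mul hv z)
  simp only [ContinuousLinearMap.mul_apply'] at h
  unfold invF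
  rw [← h]
  congr 1; ext ξ
  rw [convolution_def, conv, ← integral_const_mul]
  congr 1; ext η
  simp only [ContinuousLinearMap.mul_apply']
  rw [← wave_mul_wave z ξ η]
  ring

theorem continuous_invF (hi : Integrable h) : Continuous (invF h) := by
  refine continuous_of_dominated (bound := fun ξ => ‖h ξ‖) (fun z => ?_) (fun z => ?_) hi.norm ?_
  · exact (integrable_wave_mul hi z).aestronglyMeasurable
  · exact Eventually.of_forall fun ξ => by rw [norm_mul, norm_wave, one_mul]
  · refine Eventually.of_forall fun ξ => ?_
    have : Continuous fun z => wave z ξ := continuous_wave.comp (Continuous.prodMk_left ξ)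
    exact this.mul continuous_const

theorem exists_hasFDerivAt_invF (hi : Integrable h) (hi' : Integrable fun ξ => ‖ξ‖ * ‖h ξ‖)
    (z : Plane) : ∃ L : Plane →L[ℝ] ℂ, HasFDerivAt (invF h) L z ∧
      ∀ v, L v = invF (fun ξ => 2 * Real.pi * Complex.I * (inner ℝ ξ v : ℝ) * h ξ) z := by
  have hn : Integrable fun ξ => h (-ξ) := hi.comp_neg
  have hn' : Integrable fun ξ => ‖ξ‖ * ‖h (-ξ)‖ := by simpa using hi'.comp_neg
  have hd := Real.hasFDerivAt_fourier hn hn' z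
  rw [← Real.fourierInv_eq_fourier_comp_neg, ← invF_eq] at hd
  refine ⟨_, hd, fun v => ?_⟩
  have hI : Integrable (VectorFourier.fourierSMulRight (innerSL ℝ) fun ξ : Plane => h (-ξ)) := by
    refine (hn'.const_mul (2 * Real.pi * ‖innerSL ℝ (E := Plane)‖)).mono' ?_ ?_
    · exact hn.aestronglyMeasurable.fourierSMulRight
    · refine Eventually.of_forall fun ξ => ?_
      refine (VectorFourier.norm_fourierSMulRight_le _ _ _).trans (le_of_eq ?_)
      ring
  rw [Real.fourier_continuousLinearMap_apply hI, invF_eq, Real.fourierInv_eq_fourier_comp_neg]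
  refine congrFun (congrArg _ (funext fun ξ => ?_)) z
  rw [VectorFourier.fourierSMulRight_apply, inner_neg_left]
  change -(2 * (Real.pi : ℂ) * Complex.I) * (((inner ℝ ξ v : ℝ) : ℂ) * h (-ξ)) = _
  push_cast; ring

theorem gradient_apply_eq {g : Plane → ℝ} {z : Plane} (hg : DifferentiableAt ℝ g z) (j : Fin 2) :
    (∇ g z) j = fderiv ℝ g z (EuclideanSpace.single j 1) := by
  have h := hg.hasGradientAt.hasFDerivAt.fderiv
  rw [h, InnerProductSpace.toDual_apply_apply, EuclideanSpace.inner_single_right]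
  simp

theorem hasGradientAt_re_invF (hi : Integrable h) (hi' : Integrable fun ξ => ‖ξ‖ * ‖h ξ‖) (c : ℝ)
    (z : Plane) : HasGradientAt (fun z => (invF h z).re + c)
      (WithLp.toLp 2 fun j : Fin 2 =>
        (invF (fun ξ => 2 * Real.pi * Complex.I * ξ j * h ξ) z).re) z := by
  obtain ⟨L, hL, hLv⟩ := exists_hasFDerivAt_invF hi hi' z
  rw [hasGradientAt_iff_hasFDerivAt]
  have h1 : HasFDerivAt (fun z => (invF h z).re + c) (Complex.reCLM.comp L) z :=
    (Complex.reCLM.hasFDerivAt.comp z hL).add_const c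
  refine h1.congr_fderiv (ContinuousLinearMap.ext fun v => Eq.symm ?_)
  have hv : v = ∑ j : Fin 2, v j • EuclideanSpace.single j (1 : ℝ) := by
    ext i; fin_cases i <;> simp
  rw [InnerProductSpace.toDual_apply_apply]
  conv_rhs => rw [hv]
  rw [map_sum, PiLp.inner_apply]
  refine Finset.sum_congr rfl fun j _ => ?_
  rw [map_smul, ContinuousLinearMap.comp_apply, hLv]
  simp [EuclideanSpace.inner_single_right]

end InvF

/-! ### Duality with test functions -/

/-- Fubini's theorem and the symmetry of `wave` in its two arguments. This identity moves every weak
formulation between physical and Fourier space. -/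
theorem integral_invF_mul {h χ : Plane → ℂ} (hi : Integrable h) (hχ : Integrable χ) :
    ∫ z, invF h z * χ z = ∫ ξ, h ξ * invF χ ξ := by
  have hint : Integrable (fun w : Plane × Plane => wave w.1 w.2 * (χ w.1 * h w.2))
      (volume.prod volume) :=
    (hχ.mul_prod hi).bdd_mul continuous_wave.aestronglyMeasurable
      (Eventually.of_forall fun w => (norm_wave w.1 w.2).le)
  calc ∫ z, invF h z * χ z = ∫ z, ∫ ξ, wave z ξ * (χ z * h ξ) := by
        refine integral_congr_ae (Eventually.of_forall fun z => ?_)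
        simp only [invF]
        rw [← integral_mul_const]
        congr 1; ext ξ; ring
    _ = ∫ ξ, ∫ z, wave z ξ * (χ z * h ξ) :=
        integral_integral_swap (f := fun z ξ => wave z ξ * (χ z * h ξ)) hint
    _ = ∫ ξ, h ξ * invF χ ξ := by
        refine integral_congr_ae (Eventually.of_forall fun ξ => ?_)
        simp only [invF]
        rw [← integral_const_mul]
        congr 1; ext z
        rw [wave_comm]; ring

/-- The partial derivatives of a function on the plane. -/
def pd (j : Fin 2) (χ : Plane → ℝ) (z : Plane) : ℝ := fderiv ℝ χ z (EuclideanSpace.single j 1)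

namespace IsTestFunction

variable {χ : Plane → ℝ}

theorem continuous (hχ : IsTestFunction χ) : Continuous χ := hχ.1.continuous

theorem integrable (hχ : IsTestFunction χ) : Integrable χ :=
  hχ.continuous.integrable_of_hasCompactSupport hχ.2

theorem differentiable (hχ : IsTestFunction χ) : Differentiable ℝ χ :=
  hχ.1.differentiable (by simp)

theorem pd (hχ : IsTestFunction χ) (j : Fin 2) : IsTestFunction (pd j χ) :=
  ⟨(hχ.1.fderiv_right (m := ∞) (by simp)).clm_apply contDiff_const,
    (hχ.2.fderiv (𝕜 := ℝ)).comp_left (g := fun L : Plane →L[ℝ] ℝ =>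
      L (EuclideanSpace.single j 1)) (by simp)⟩

theorem gradient_apply (hχ : IsTestFunction χ) (z : Plane) (j : Fin 2) :
    (∇ χ z) j = CrowdMFG.pd j χ z := gradient_apply_eq (hχ.differentiable z) j

theorem invF_pd (hχ : IsTestFunction χ) (j : Fin 2) (ξ : Plane) :
    invF (fun z => (CrowdMFG.pd j χ z : ℂ)) ξ =
      -(2 * Real.pi * Complex.I * ξ j * invF (fun z => (χ z : ℂ)) ξ) := by
  have hw : ∀ z, HasFDerivAt (fun z => wave ξ z) ((2 * Real.pi * Complex.I * wave ξ z) •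
      (Complex.ofRealCLM.comp (innerSL ℝ ξ))) z := by
    intro z
    have h1 : HasFDerivAt (fun z : Plane => ((2 * Real.pi * inner ℝ ξ z : ℝ) : ℂ) * Complex.I)
        ((2 * Real.pi * Complex.I) • (Complex.ofRealCLM.comp (innerSL ℝ ξ))) z := by
      have h2 := (Complex.ofRealCLM.comp (innerSL ℝ ξ)).hasFDerivAt (x := z)
      have h3 := h2.const_mul (2 * Real.pi * Complex.I)
      refine h3.congr_of_eventuallyEq (Eventually.of_forall fun z => ?_)
      simp only [ContinuousLinearMap.comp_apply, Complex.ofRealCLM_apply, innerSL_apply_apply]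
      push_cast; ring
    have h2 := h1.cexp
    have e : (fun z => wave ξ z) =
        fun z => Complex.exp (((2 * Real.pi * inner ℝ ξ z : ℝ) : ℂ) * Complex.I) := by
      funext z; rw [wave_comm, wave_eq]
    rw [e]
    refine h2.congr_fderiv ?_
    rw [smul_smul]
    congr 1
    rw [wave_comm, wave_eq]; ring
  have hχ' : ∀ z, HasFDerivAt (fun z => (χ z : ℂ)) (Complex.ofRealCLM.comp (fderiv ℝ χ z)) z :=
    fun z => Complex.ofRealCLM.hasFDerivAt.comp z (hχ.differentiable z).hasFDerivAt
  have hfw : ∀ z, fderiv ℝ (fun z => wave ξ z) z (EuclideanSpace.single j 1) =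
      2 * Real.pi * Complex.I * ξ j * wave ξ z := by
    intro z
    rw [(hw z).fderiv]
    simp [EuclideanSpace.inner_single_right]
    ring
  have hfχ : ∀ z, fderiv ℝ (fun z => (χ z : ℂ)) z (EuclideanSpace.single j 1) =
      (CrowdMFG.pd j χ z : ℂ) := by
    intro z
    rw [(hχ' z).fderiv]
    rfl
  have hi1 := integrable_wave_mul (hχ.integrable.ofReal (𝕜 := ℂ)) ξ
  have hi2 := integrable_wave_mul ((hχ.pd j).integrable.ofReal (𝕜 := ℂ)) ξ
  have key := integral_mul_fderiv_eq_neg_fderiv_mul_of_integrable (μ := (volume : Measure Plane))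
    (f := fun z => wave ξ z) (g := fun z => (χ z : ℂ)) (v := EuclideanSpace.single j 1) ?_ ?_ hi1
    (fun z _ => (hw z).differentiableAt) (fun z _ => (hχ' z).differentiableAt)
  · simp only [hfw, hfχ] at key
    unfold invF
    rw [key, ← integral_const_mul]
    congr 2; ext z; ring
  · simp only [hfw, mul_assoc]
    exact ((hi1.const_mul _).const_mul _).const_mul _ |>.const_mul _
  · simp only [hfχ]
    exact hi2

end IsTestFunction

/-! ### Nonlinear terms -/

section PolyInv

variable {σ T c N₀ N₁ R : ℝ} {u : Fin 3 → ℂ → Plane → ℂ}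

/-- The inverse transform turns convolutions into products, so one syntactic polynomial describes
the nonlinearity on both sides. -/
theorem Poly.invF_four (hu : ∀ i, Adm σ T c N₀ N₁ R (u i)) (hσ : 0 < σ) (hc : 0 ≤ c) (h₀ : 0 ≤ N₀)
    (h₁ : 0 ≤ N₁) (hκ : convConst N₀ N₁ ≤ 1) (hR : 0 ≤ R) (p : Poly) {t : ℂ}
    (ht : t ∈ diamond σ T) (z : Plane) :
    invF (p.four u t) z = p.eval (fun i => invF (u i t) z) := by
  have hint : ∀ p : Poly, Integrable (p.four u t) := fun p =>
    (Poly.adm_four hu hσ hc h₀ h₁ hκ hR p).integrable hσ hc h₀ h₁ ht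
  induction p with
  | var i => rfl
  | add p q hp hq =>
    simp only [four, eval]
    rw [invF_add (hint p) (hint q), hp, hq]
  | smul a p hp =>
    simp only [four, eval]
    rw [invF_const_mul, hp]
    rfl
  | mul p q hp hq =>
    simp only [four, eval]
    rw [invF_conv (hint p) (hint q), hp, hq]

theorem Poly.eval_ofReal (p : Poly) (x : Fin 3 → ℝ) :
    p.eval (fun i => (x i : ℂ)) = (p.eval x : ℝ) := by
  induction p with
  | var i => rfl
  | add p q hp hq => simp only [eval, hp, hq]; push_cast; rfl
  | smul a p hp => simp only [eval, hp, Complex.coe_algebraMap, Algebra.algebraMap_self,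
      RingHom.id_apply]; push_cast; rfl
  | mul p q hp hq => simp only [eval, hp, hq]; push_cast; rfl

theorem Poly.invF_fourQuad (hu : ∀ i, Adm σ T c N₀ N₁ R (u i)) (hσ : 0 < σ) (hc : 0 ≤ c)
    (h₀ : 0 ≤ N₀) (h₁ : 0 ≤ N₁) (hκ : convConst N₀ N₁ ≤ 1) (hR : 0 ≤ R) (P : Fin 3 → Poly) {t : ℂ}
    (ht : t ∈ diamond σ T) (z : Plane) :
    invF (fourQuad P u t) z =
      ∑ i, (P i).eval (fun i => invF (u i t) z) * invF (u i t) z := by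
  unfold fourQuad
  have hp : ∀ p : Poly, Adm σ T c N₀ N₁ (size R p) (p.four u) := Poly.adm_four hu hσ hc h₀ h₁ hκ hR
  rw [invF_sum _ fun i _ => ((hp (P i)).conv (hu i) hσ hc h₀ h₁
    (size_nonneg hR _) hR).integrable hσ hc h₀ h₁ ht]
  refine Finset.sum_congr rfl fun i _ => ?_
  rw [invF_conv ((hp (P i)).integrable hσ hc h₀ h₁ ht) ((hu i).integrable hσ hc h₀ h₁ ht),
    invF_four hu hσ hc h₀ h₁ hκ hR (P i) ht]

end PolyInv

/-! ### Real analyticity -/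

/-- The second order Taylor estimate for bounded holomorphic functions on a disc. -/
theorem norm_sub_sub_deriv_le {g : ℂ → ℂ} {t s : ℂ} {r B : ℝ} (hr : 0 < r)
    (hg : DifferentiableOn ℂ g (Metric.ball t r)) (hB : ∀ s ∈ Metric.ball t r, ‖g s‖ ≤ B)
    (hs : s ∈ Metric.ball t r) :
    ‖g s - g t - (s - t) * deriv g t‖ ≤ 4 * B / r ^ 2 * ‖s - t‖ ^ 2 := by
  have hB0 : 0 ≤ B := (norm_nonneg _).trans (hB t (Metric.mem_ball_self hr))
  have hn : Metric.ball t r ∈ 𝓝 t := Metric.ball_mem_nhds t hr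
  -- The Schwarz lemma bounds the slope of a bounded holomorphic function. It is applied to `g` and
  -- then to its slope `dslope g t`, which is again holomorphic and bounded.
  have h1 : ∀ s ∈ Metric.ball t r, ‖dslope g t s‖ ≤ 2 * B / r := by
    intro s hs
    refine Complex.norm_dslope_le_div_of_mapsTo_ball hg (fun s hs => ?_) hs
    rw [Metric.mem_closedBall, dist_eq_norm]
    calc ‖g s - g t‖ ≤ ‖g s‖ + ‖g t‖ := norm_sub_le _ _
      _ ≤ 2 * B := by linarith [hB s hs, hB t (Metric.mem_ball_self hr)]
  have hd := (Complex.differentiableOn_dslope hn).2 hg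
  have h2 : ‖dslope (dslope g t) t s‖ ≤ (2 * (2 * B / r)) / r := by
    refine Complex.norm_dslope_le_div_of_mapsTo_ball hd (fun s hs => ?_) hs
    rw [Metric.mem_closedBall, dist_eq_norm]
    calc ‖dslope g t s - dslope g t t‖ ≤ ‖dslope g t s‖ + ‖dslope g t t‖ := norm_sub_le _ _
      _ ≤ 2 * (2 * B / r) := by linarith [h1 s hs, h1 t (Metric.mem_ball_self hr)]
  have e1 := sub_smul_dslope g t s
  have e2 := sub_smul_dslope (dslope g t) t s
  rw [dslope_same, smul_eq_mul] at e2
  rw [smul_eq_mul] at e1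
  have e3 : g s - g t - (s - t) * deriv g t = (s - t) ^ 2 * dslope (dslope g t) t s := by
    linear_combination -e1 - (s - t) * e2
  rw [e3, norm_mul, norm_pow, mul_comm]
  calc _ ≤ (2 * (2 * B / r)) / r * ‖s - t‖ ^ 2 := by gcongr
    _ = _ := by field_simp; ring

/-- For maps into function spaces: a quadratic Taylor remainder that is uniform in the space
variable gives differentiability in norm. -/
theorem hasDerivAt_of_norm_sub_sub_le {E : Type*} [NormedAddCommGroup E] [NormedSpace ℂ E]
    {F : ℂ → E} {F' : E} {t : ℂ} {r C : ℝ} (hr : 0 < r)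
    (h : ∀ s ∈ Metric.ball t r, ‖F s - F t - (s - t) • F'‖ ≤ C * ‖s - t‖ ^ 2) :
    HasDerivAt F F' t := by
  have h1 : (fun s => F s - F t - (s - t) • F') =O[𝓝 t] fun s => ‖s - t‖ ^ 2 := by
    refine Asymptotics.IsBigO.of_bound C ?_
    filter_upwards [Metric.ball_mem_nhds t hr] with s hs
    rw [norm_pow, norm_norm]
    exact h s hs
  have h2 := (h1.hasFDerivAt (𝕜 := ℂ) one_lt_two).hasDerivAt
  have h3 : HasDerivAt (fun s => F t + (s - t) • F') ((1 : ℂ) • F') t :=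
    (((hasDerivAt_id t).sub_const t).smul_const F').const_add (F t)
  rw [one_smul] at h3
  refine ((h2.add h3).congr_deriv (by simp)).congr_of_eventuallyEq
    (Eventually.of_forall fun s => ?_)
  simp

/-- The damped exponential in one variable. -/
def dampedExp (a : ℝ) (j : Fin 2) (ζ : ℂ) (ξ : Plane) : ℂ :=
  Complex.exp (2 * Real.pi * Complex.I * ξ j * ζ - a * ‖ξ‖)

theorem continuous_dampedExp (a : ℝ) (j : Fin 2) (ζ : ℂ) : Continuous (dampedExp a j ζ) := by
  unfold dampedExp
  fun_prop

theorem norm_dampedExp_le {a : ℝ} (ha : 0 < a) (j : Fin 2) {ζ : ℂ}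
    (hζ : |ζ.im| ≤ a / (2 * Real.pi)) (ξ : Plane) : ‖dampedExp a j ζ ξ‖ ≤ 1 := by
  unfold dampedExp
  rw [Complex.norm_exp, Real.exp_le_one_iff]
  have hpi := Real.pi_pos
  have e : (2 * Real.pi * Complex.I * ξ j * ζ - a * ‖ξ‖ : ℂ).re =
      -(2 * Real.pi * (ξ j * ζ.im)) - a * ‖ξ‖ := by
    simp
    ring
  rw [e]
  have h1 : -(ξ j * ζ.im) ≤ ‖ξ‖ * (a / (2 * Real.pi)) := by
    refine (neg_le_abs _).trans ?_
    rw [abs_mul]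
    exact mul_le_mul (abs_coord_le ξ j) hζ (abs_nonneg _) (norm_nonneg _)
  have h2 := mul_le_mul_of_nonneg_left h1 (by positivity : 0 ≤ 2 * Real.pi)
  have e2 : 2 * Real.pi * (‖ξ‖ * (a / (2 * Real.pi))) = a * ‖ξ‖ := by field_simp
  rw [e2] at h2
  linarith

open Classical in
/-- The damped exponential as a bounded function. -/
def dampedExpBCF (a : ℝ) (j : Fin 2) (ζ : ℂ) : BoundedContinuousFunction Plane ℂ :=
  if h : 0 < a ∧ |ζ.im| ≤ a / (2 * Real.pi) then
    BoundedContinuousFunction.ofNormedAddCommGroup (dampedExp a j ζ) (continuous_dampedExp a j ζ) 1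
      (norm_dampedExp_le h.1 j h.2)
  else 0

theorem dampedExpBCF_apply {a : ℝ} (ha : 0 < a) (j : Fin 2) {ζ : ℂ}
    (hζ : |ζ.im| ≤ a / (2 * Real.pi)) (ξ : Plane) : dampedExpBCF a j ζ ξ = dampedExp a j ζ ξ := by
  unfold dampedExpBCF
  rw [dif_pos ⟨ha, hζ⟩]
  rfl

/-- On the strip the scalar functions are all bounded by `1`, so the Taylor estimate holds with the
same constant for every `ξ`, which is differentiability in the sup norm. -/
theorem differentiableOn_dampedExpBCF {a : ℝ} (ha : 0 < a) (j : Fin 2) :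
    DifferentiableOn ℂ (dampedExpBCF a j) {ζ | |ζ.im| < a / (2 * Real.pi)} := by
  intro ζ hζ
  refine DifferentiableAt.differentiableWithinAt ?_
  have hopen : IsOpen {ζ : ℂ | |ζ.im| < a / (2 * Real.pi)} :=
    isOpen_lt Complex.continuous_im.abs continuous_const
  obtain ⟨r, hr, hrU⟩ := Metric.isOpen_iff.1 hopen ζ hζ
  have hdiff : ∀ ξ : Plane, Differentiable ℂ fun ζ => dampedExp a j ζ ξ := by
    intro ξ
    unfold dampedExp
    fun_prop
  have hbd : ∀ ξ, ∀ s ∈ Metric.ball ζ r, ‖dampedExp a j s ξ‖ ≤ 1 := fun ξ s hs =>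
    norm_dampedExp_le ha j (hrU hs).le ξ
  have hderiv : ∀ ξ : Plane, deriv (fun ζ => dampedExp a j ζ ξ) ζ =
      dampedExp a j ζ ξ * (2 * Real.pi * Complex.I * ξ j) := by
    intro ξ
    have h1 : HasDerivAt (fun ζ : ℂ => 2 * Real.pi * Complex.I * ξ j * ζ - a * ‖ξ‖)
        (2 * Real.pi * Complex.I * ξ j * 1) ζ :=
      ((hasDerivAt_id ζ).const_mul _).sub_const _
    rw [mul_one] at h1
    exact h1.cexp.deriv
  have hcont : Continuous fun ξ : Plane => deriv (fun ζ => dampedExp a j ζ ξ) ζ := by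
    simp only [hderiv]
    exact (continuous_dampedExp a j ζ).mul (by fun_prop)
  have hbd' : ∀ ξ : Plane, ‖deriv (fun ζ => dampedExp a j ζ ξ) ζ‖ ≤ 1 / (r / 2) := by
    intro ξ
    refine Complex.norm_deriv_le_of_forall_mem_sphere_norm_le (by positivity)
      (hdiff ξ).diffContOnCl fun s hs => hbd ξ s ?_
    rw [Metric.mem_ball, Metric.mem_sphere.1 hs]
    linarith
  refine (hasDerivAt_of_norm_sub_sub_le (F' := BoundedContinuousFunction.ofNormedAddCommGroup
    (fun ξ => deriv (fun ζ => dampedExp a j ζ ξ) ζ) hcont _ hbd') (C := 4 * 1 / r ^ 2) hr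
    fun s hs => ?_).differentiableAt
  refine (BoundedContinuousFunction.norm_le (by positivity)).2 fun ξ => ?_
  have := norm_sub_sub_deriv_le hr (hdiff ξ).differentiableOn (hbd ξ) hs
  rw [← dampedExpBCF_apply ha j (hrU hs).le, ← dampedExpBCF_apply ha j (le_of_lt hζ)] at this
  exact this

/-! ### Integrable families as holomorphic functionals on bounded functions -/

section Pairing

variable {g : ℂ → Plane → ℂ} {U : Set ℂ} {B : Plane → ℝ}

/-- Integration against an integrable function, as a functional on bounded functions. -/
def pairing (h : Plane → ℂ) (hi : Integrable h) : BoundedContinuousFunction Plane ℂ →L[ℂ] ℂ :=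
  LinearMap.mkContinuous
    { toFun := fun b => ∫ ξ, b ξ * h ξ
      map_add' := fun b b' => by
        have hb : ∀ b : BoundedContinuousFunction Plane ℂ, Integrable fun ξ => b ξ * h ξ := fun b =>
          hi.bdd_mul b.continuous.aestronglyMeasurable (Eventually.of_forall b.norm_coe_le_norm)
        rw [← integral_add (hb b) (hb b')]
        congr 1; ext ξ
        rw [BoundedContinuousFunction.add_apply]; ring
      map_smul' := fun c b => by
        simp only [BoundedContinuousFunction.smul_apply, smul_eq_mul, RingHom.id_apply, mul_assoc]
        rw [integral_const_mul] }
    (∫ ξ, ‖h ξ‖) fun b => by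
      change ‖∫ ξ, b ξ * h ξ‖ ≤ _
      rw [mul_comm (∫ ξ, ‖h ξ‖), ← integral_const_mul]
      refine norm_integral_le_of_norm_le (hi.norm.const_mul _) (Eventually.of_forall fun ξ => ?_)
      rw [norm_mul]
      exact mul_le_mul_of_nonneg_right (b.norm_coe_le_norm ξ) (norm_nonneg _)

theorem pairing_apply {h : Plane → ℂ} (hi : Integrable h)
    (b : BoundedContinuousFunction Plane ℂ) : pairing h hi b = ∫ ξ, b ξ * h ξ := rfl

open Classical in
/-- The functional of integration against a family of integrable functions. -/
def pairingFamily (g : ℂ → Plane → ℂ) (t : ℂ) : BoundedContinuousFunction Plane ℂ →L[ℂ] ℂ :=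
  if h : Integrable (g t) then pairing (g t) h else 0

theorem pairingFamily_apply {t : ℂ} (hi : Integrable (g t))
    (b : BoundedContinuousFunction Plane ℂ) : pairingFamily g t b = ∫ ξ, b ξ * g t ξ := by
  unfold pairingFamily
  rw [dif_pos hi, pairing_apply]

/-- Holomorphy into the dual space in operator norm: the scalar Taylor remainders are dominated by
`4 * B ξ / r ^ 2`, which is integrable in `ξ`. -/
theorem differentiableOn_pairingFamily (hU : IsOpen U)
    (hm : ∀ t ∈ U, AEStronglyMeasurable (g t) volume)
    (hd : ∀ᵐ ξ, DifferentiableOn ℂ (fun t => g t ξ) U) (hB : Integrable B)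
    (hb : ∀ᵐ ξ, ∀ t ∈ U, ‖g t ξ‖ ≤ B ξ) : DifferentiableOn ℂ (pairingFamily g) U := by
  intro t ht
  refine DifferentiableAt.differentiableWithinAt ?_
  obtain ⟨r, hr, hrU⟩ := Metric.isOpen_iff.1 hU t ht
  have hint : ∀ s ∈ U, Integrable (g s) := fun s hs =>
    hB.mono' (hm s hs) (hb.mono fun ξ h => h s hs)
  have hmeas : AEStronglyMeasurable (fun ξ => deriv (fun t => g t ξ) t) volume :=
    aestronglyMeasurable_deriv hU hm hd ht
  have hint' : Integrable fun ξ => deriv (fun t => g t ξ) t := by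
    refine (hB.div_const (r / 2)).mono' hmeas ?_
    filter_upwards [hd, hb] with ξ hξ hbξ
    have hsub : Metric.closedBall t (r / 2) ⊆ U :=
      (Metric.closedBall_subset_ball (by linarith)).trans hrU
    exact Complex.norm_deriv_le_of_forall_mem_sphere_norm_le (by positivity)
      ((hξ.mono hsub).diffContOnCl_ball subset_rfl)
      fun s hs => hbξ s (hsub (Metric.sphere_subset_closedBall hs))
  refine (hasDerivAt_of_norm_sub_sub_le (F' := pairing _ hint')
    (C := ∫ ξ, 4 * B ξ / r ^ 2) hr fun s hs => ?_).differentiableAt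
  have hC : Integrable fun ξ => 4 * B ξ / r ^ 2 := (hB.const_mul 4).div_const _
  have hB0 : ∀ᵐ ξ, 0 ≤ B ξ := hb.mono fun ξ h => (norm_nonneg _).trans (h t ht)
  have hC0 : 0 ≤ ∫ ξ, 4 * B ξ / r ^ 2 := integral_nonneg_of_ae (hB0.mono fun ξ h => by
    simp only [Pi.zero_apply]; positivity)
  refine ContinuousLinearMap.opNorm_le_bound _ (by positivity) fun b => ?_
  have hbi : ∀ {h : Plane → ℂ}, Integrable h → Integrable fun ξ => b ξ * h ξ := fun hi =>
    hi.bdd_mul b.continuous.aestronglyMeasurable (Eventually.of_forall b.norm_coe_le_norm)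
  have e : (pairingFamily g s - pairingFamily g t - (s - t) • pairing _ hint') b =
      ∫ ξ, b ξ * (g s ξ - g t ξ - (s - t) * deriv (fun t => g t ξ) t) := by
    have h1 : Integrable fun ξ => b ξ * g s ξ - b ξ * g t ξ :=
      (hbi (hint s (hrU hs))).sub (hbi (hint t ht))
    rw [sub_apply, sub_apply, smul_apply, pairingFamily_apply (hint s (hrU hs)),
      pairingFamily_apply (hint t ht), pairing_apply, smul_eq_mul, ← integral_const_mul,
      ← integral_sub (hbi (hint s (hrU hs))) (hbi (hint t ht)),
      ← integral_sub h1 ((hbi hint').const_mul _)]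
    congr 1; ext ξ; ring
  rw [e, mul_assoc, mul_comm, ← integral_const_mul]
  refine norm_integral_le_of_norm_le (hC.const_mul _) ?_
  filter_upwards [hd, hb] with ξ hξ hbξ
  rw [norm_mul]
  have := norm_sub_sub_deriv_le hr (hξ.mono hrU) (fun s hs => hbξ s (hrU hs)) hs
  calc _ ≤ ‖b‖ * (4 * B ξ / r ^ 2 * ‖s - t‖ ^ 2) :=
        mul_le_mul (b.norm_coe_le_norm ξ) this (norm_nonneg _) (norm_nonneg _)
    _ = _ := by ring

end Pairing

/-- The value `invF (g t) z` is the pairing of `g t` times `e^{2a|ξ|}` with the product of two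
damped exponentials, one for each coordinate of `z` and each taking a factor `e^{-a|ξ|}`. The
functional is holomorphic in `t` and each exponential is holomorphic in its coordinate; evaluation
and multiplication are bounded bilinear maps. Joint analyticity follows without power series in
several variables. -/
theorem analyticAt_invF {g : ℂ → Plane → ℂ} {U : Set ℂ} {B : Plane → ℝ} {a : ℝ} (ha : 0 < a)
    (hU : IsOpen U) (hm : ∀ t ∈ U, AEStronglyMeasurable (g t) volume)
    (hd : ∀ᵐ ξ, DifferentiableOn ℂ (fun t => g t ξ) U) (hB : Integrable B)
    (hb : ∀ᵐ ξ, ∀ t ∈ U, ‖g t ξ‖ * Real.exp (2 * a * ‖ξ‖) ≤ B ξ) {t : ℝ} (ht : (t : ℂ) ∈ U)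
    (z : Plane) : AnalyticAt ℝ (fun w : ℝ × Plane => invF (g w.1) w.2) (t, z) := by
  set G : ℂ → Plane → ℂ := fun t ξ => g t ξ * ((Real.exp (2 * a * ‖ξ‖) : ℝ) : ℂ) with hG
  have hGb : ∀ᵐ ξ, ∀ t ∈ U, ‖G t ξ‖ ≤ B ξ := by
    filter_upwards [hb] with ξ hξ t ht
    rw [hG, norm_mul, Complex.norm_real, Real.norm_of_nonneg (Real.exp_nonneg _)]
    exact hξ t ht
  have hGm : ∀ t ∈ U, AEStronglyMeasurable (G t) volume := fun t ht =>
    (hm t ht).mul (by fun_prop : Continuous fun ξ : Plane =>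
      ((Real.exp (2 * a * ‖ξ‖) : ℝ) : ℂ)).aestronglyMeasurable
  have hGi : ∀ t ∈ U, Integrable (G t) := fun t ht =>
    hB.mono' (hGm t ht) (hGb.mono fun ξ h => h t ht)
  have hGd := differentiableOn_pairingFamily hU hGm
    (hd.mono fun ξ h => h.mul_const _) hB hGb
  have hpi := Real.pi_pos
  have hopen : IsOpen {ζ : ℂ | |ζ.im| < a / (2 * Real.pi)} :=
    isOpen_lt Complex.continuous_im.abs continuous_const
  have hmem : ∀ x : ℝ, (x : ℂ) ∈ {ζ : ℂ | |ζ.im| < a / (2 * Real.pi)} := fun x => by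
    simp only [mem_ofPred_eq, Complex.ofReal_im, abs_zero]; positivity
  have hreal : ∀ x : ℝ, |((x : ℝ) : ℂ).im| ≤ a / (2 * Real.pi) := fun x => le_of_lt (hmem x)
  have hL : AnalyticAt ℝ (fun w : ℝ × Plane => pairingFamily G (w.1 : ℂ)) (t, z) := by
    have h1 : AnalyticAt ℝ (pairingFamily G) (t : ℂ) :=
      (hGd.analyticAt (hU.mem_nhds ht)).restrictScalars
    have h2 : AnalyticAt ℝ (fun w : ℝ × Plane => (w.1 : ℂ)) (t, z) :=
      (Complex.ofRealCLM.comp (ContinuousLinearMap.fst ℝ ℝ Plane)).analyticAt _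
    exact AnalyticAt.comp (g := pairingFamily G) (f := fun w : ℝ × Plane => (w.1 : ℂ)) h1 h2
  have hb : ∀ j, AnalyticAt ℝ (fun w : ℝ × Plane => dampedExpBCF a j (w.2 j : ℂ)) (t, z) := by
    intro j
    have h1 : AnalyticAt ℝ (dampedExpBCF a j) ((z j : ℝ) : ℂ) :=
      ((differentiableOn_dampedExpBCF ha j).analyticAt
        (hopen.mem_nhds (hmem (z j)))).restrictScalars
    have h2 : AnalyticAt ℝ (fun w : ℝ × Plane => (w.2 j : ℂ)) (t, z) :=
      (Complex.ofRealCLM.comp ((EuclideanSpace.proj (𝕜 := ℝ) j).comp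
        (ContinuousLinearMap.snd ℝ ℝ Plane))).analyticAt _
    exact AnalyticAt.comp (g := dampedExpBCF a j) (f := fun w : ℝ × Plane => (w.2 j : ℂ)) h1 h2
  have hF : AnalyticAt ℝ (fun w : ℝ × Plane => pairingFamily G (w.1 : ℂ)
      (dampedExpBCF a 0 (w.2 0 : ℂ) * dampedExpBCF a 1 (w.2 1 : ℂ))) (t, z) := by
    have h1 := hL.prod ((hb 0).mul (hb 1))
    have h2 : AnalyticAt ℝ (fun x : (BoundedContinuousFunction Plane ℂ →L[ℂ] ℂ) ×
        BoundedContinuousFunction Plane ℂ => x.1 x.2)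
        (pairingFamily G (t : ℂ), dampedExpBCF a 0 (z 0 : ℂ) * dampedExpBCF a 1 (z 1 : ℂ)) :=
      ((ContinuousLinearMap.id ℂ (BoundedContinuousFunction Plane ℂ →L[ℂ] ℂ)).analyticAt_bilinear
        (pairingFamily G (t : ℂ),
          dampedExpBCF a 0 (z 0 : ℂ) * dampedExpBCF a 1 (z 1 : ℂ))).restrictScalars (𝕜 := ℝ)
    exact AnalyticAt.comp (g := fun x : (BoundedContinuousFunction Plane ℂ →L[ℂ] ℂ) ×
        BoundedContinuousFunction Plane ℂ => x.1 x.2) (f := fun w : ℝ × Plane =>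
        (pairingFamily G (w.1 : ℂ), dampedExpBCF a 0 (w.2 0 : ℂ) * dampedExpBCF a 1 (w.2 1 : ℂ)))
      h2 h1
  refine hF.congr ?_
  have hev : ∀ᶠ w : ℝ × Plane in 𝓝 (t, z), (w.1 : ℂ) ∈ U :=
    (Complex.continuous_ofReal.comp continuous_fst).continuousAt.preimage_mem_nhds
      (hU.mem_nhds ht)
  filter_upwards [hev] with w hw
  rw [pairingFamily_apply (hGi _ hw), invF]
  congr 1; ext ξ
  rw [BoundedContinuousFunction.mul_apply, dampedExpBCF_apply ha 0 (hreal _),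
    dampedExpBCF_apply ha 1 (hreal _), hG]
  unfold dampedExp wave
  have e : Complex.exp (2 * Real.pi * Complex.I * ξ 0 * w.2 0 - a * ‖ξ‖) *
      Complex.exp (2 * Real.pi * Complex.I * ξ 1 * w.2 1 - a * ‖ξ‖) *
      ((Real.exp (2 * a * ‖ξ‖) : ℝ) : ℂ) =
      Complex.exp (2 * Real.pi * Complex.I * (ξ 0 * w.2 0 + ξ 1 * w.2 1)) := by
    rw [Complex.ofReal_exp, ← Complex.exp_add, ← Complex.exp_add]
    congr 1
    push_cast; ring
  rw [← e]
  ring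

/-! ### Square integrable functions and their Fourier transforms -/

section SquareIntegrable

variable {F : Type*} [NormedAddCommGroup F] [InnerProductSpace ℂ F] [CompleteSpace F]

theorem IsTestFunction.exists_schwartzMap {χ : Plane → ℝ} (hχ : IsTestFunction χ) :
    ∃ η : 𝓢(Plane, ℂ), (∀ z, η z = χ z) ∧ ∀ ξ, (𝓕⁻ η) ξ = invF (fun z => (χ z : ℂ)) ξ := by
  have h1 : ContDiff ℝ ∞ fun z => (χ z : ℂ) := Complex.ofRealCLM.contDiff.comp hχ.1
  have h2 : HasCompactSupport fun z => (χ z : ℂ) := hχ.2.comp_left Complex.ofReal_zero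
  refine ⟨h2.toSchwartzMap h1, fun z => rfl, fun ξ => ?_⟩
  rw [SchwartzMap.fourierInv_coe, invF_eq]
  rfl

theorem Lp.integral_smul_fourierInv (f : Lp F 2 (volume : Measure Plane)) {χ : Plane → ℝ}
    (hχ : IsTestFunction χ) :
    ∫ z, (χ z : ℂ) • (𝓕⁻ f : Lp F 2 (volume : Measure Plane)) z =
      ∫ ξ, invF (fun z => (χ z : ℂ)) ξ • f ξ := by
  obtain ⟨η, h1, h2⟩ := hχ.exists_schwartzMap
  have h := DFunLike.congr_fun (Lp.fourierInv_toTemperedDistribution_eq f) η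
  rw [TemperedDistribution.fourierInv_apply, Lp.toTemperedDistribution_apply,
    Lp.toTemperedDistribution_apply] at h
  simp only [h1, h2] at h
  exact h.symm

/-- Agreement of the `L²` inversion with the inversion integral, checked by duality with test
functions. The functional `L` lets the same statement serve scalar functions and components of
vector fields. -/
theorem Lp.ae_eq_invF_of_integrable_fourier (f : Lp F 2 (volume : Measure Plane)) (L : F →L[ℂ] ℂ)
    (hi : Integrable fun ξ => L ((𝓕 f : Lp F 2 (volume : Measure Plane)) ξ)) :
    (fun z => L (f z)) =ᵐ[volume]
      invF fun ξ => L ((𝓕 f : Lp F 2 (volume : Measure Plane)) ξ) := by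
  have hloc : LocallyIntegrable fun z => L (f z) :=
    (L.comp_memLp' (Lp.memLp f)).locallyIntegrable one_le_two
  refine ae_eq_of_integral_contDiff_smul_eq hloc (continuous_invF hi).locallyIntegrable
    fun χ h1 h2 => ?_
  have hχ : IsTestFunction χ := ⟨h1, h2⟩
  obtain ⟨η, he1, he2⟩ := hχ.exists_schwartzMap
  have h := Lp.integral_smul_fourierInv (𝓕 f) hχ
  rw [FourierTransform.fourierInv_fourier_eq] at h
  have i1 : Integrable fun z => (χ z : ℂ) • f z := by
    have : MemLp (fun z => (χ z : ℂ)) 2 := by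
      have := η.memLp 2 (volume : Measure Plane)
      exact this.ae_eq (Eventually.of_forall he1)
    exact memLp_one_iff_integrable.1 ((Lp.memLp f).smul this)
  have i2 : Integrable fun ξ => invF (fun z => (χ z : ℂ)) ξ •
      (𝓕 f : Lp F 2 (volume : Measure Plane)) ξ := by
    have : MemLp (invF fun z => (χ z : ℂ)) 2 := by
      have := (𝓕⁻ η).memLp 2 (volume : Measure Plane)
      exact this.ae_eq (Eventually.of_forall he2)
    exact memLp_one_iff_integrable.1 ((Lp.memLp _).smul this)
  have h' := congrArg L h
  rw [← L.integral_comp_comm i1, ← L.integral_comp_comm i2] at h'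
  simp only [map_smul, smul_eq_mul] at h'
  have h3 := integral_invF_mul hi hχ.integrable.ofReal
  simp only [Complex.real_smul]
  rw [h']
  calc _ = _ := by congr 1; ext ξ; exact mul_comm _ _
    _ = _ := h3.symm
    _ = _ := by congr 1; ext ξ; exact mul_comm _ _

theorem eLpNorm_invF {h : Plane → ℂ} (hi : Integrable h) (h2 : MemLp h 2) :
    eLpNorm (invF h) 2 volume = eLpNorm h 2 volume := by
  set f : Lp ℂ 2 (volume : Measure Plane) := 𝓕⁻ (h2.toLp h) with hf
  have e0 : 𝓕 f = h2.toLp h := FourierTransform.fourier_fourierInv_eq _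
  have e1 : (𝓕 f : Lp ℂ 2 (volume : Measure Plane)) =ᵐ[volume] h := by
    rw [e0]; exact h2.coeFn_toLp
  have e2 := Lp.ae_eq_invF_of_integrable_fourier f (ContinuousLinearMap.id ℂ ℂ)
    (hi.congr e1.symm)
  have e3 : invF h =ᵐ[volume] f := by
    refine EventuallyEq.trans (Eventually.of_forall fun z => ?_) e2.symm
    exact congrFun (invF_congr_ae e1.symm) z
  rw [eLpNorm_congr_ae e3, ← eLpNorm_congr_ae e1, ← Lp.enorm_def, ← Lp.enorm_def,
    ← ofReal_norm, ← ofReal_norm, Lp.norm_fourier_eq]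

/-- The hypothesis says that the inverse transform of `H` vanishes against all test functions, so
that transform is zero, and `H` is recovered from it by the Fourier transform. -/
theorem ae_eq_zero_of_integral_invF_smul {H : Plane → ℂ} (h2 : MemLp H 2)
    (h : ∀ χ, IsTestFunction χ → ∫ ξ, invF (fun z => (χ z : ℂ)) ξ * H ξ = 0) :
    H =ᵐ[volume] 0 := by
  set f : Lp ℂ 2 (volume : Measure Plane) := 𝓕⁻ (h2.toLp H) with hf
  have hf0 : f =ᵐ[volume] (0 : Plane → ℂ) := by
    refine ae_eq_of_integral_contDiff_smul_eq ((Lp.memLp f).locallyIntegrable one_le_two)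
      (locallyIntegrable_const 0) fun χ c1 c2 => ?_
    have e := Lp.integral_smul_fourierInv (h2.toLp H) ⟨c1, c2⟩
    have e' : ∫ ξ, invF (fun z => (χ z : ℂ)) ξ • (h2.toLp H) ξ = 0 := by
      rw [← h χ ⟨c1, c2⟩]
      refine integral_congr_ae ?_
      filter_upwards [h2.coeFn_toLp] with ξ hξ
      rw [hξ, smul_eq_mul]
    rw [e'] at e
    simpa [Complex.real_smul] using e
  have h0 : f = 0 := Lp.ext (hf0.trans (Lp.coeFn_zero _ _ _).symm)
  have e0 : h2.toLp H = 0 := by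
    have : 𝓕 f = h2.toLp H := FourierTransform.fourier_fourierInv_eq _
    rw [← this, h0, FourierTransform.fourier_zero]
  exact h2.coeFn_toLp.symm.trans (e0 ▸ Lp.coeFn_zero _ _ _)

theorem memLp_two_of_weightedFourierNorm {g : Plane → F} (hg : weightedFourierNorm g ≠ ⊤) :
    MemLp g 2 := by
  by_contra h
  exact hg (by simp [weightedFourierNorm, h])

theorem ae_norm_fourier_le {g : Plane → F} (hg : weightedFourierNorm g ≠ ⊤) :
    ∀ᵐ ξ, ‖(𝓕 ((memLp_two_of_weightedFourierNorm hg).toLp g) :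
      Lp F 2 (volume : Measure Plane)) ξ‖ ≤ (weightedFourierNorm g).toReal * wt ξ := by
  have hm := memLp_two_of_weightedFourierNorm hg
  have e : weightedFourierNorm g = eLpNorm (fun ξ : Plane => ((1 + ‖ξ‖) ^ 3 : ℝ) •
      (𝓕 (hm.toLp g) : Lp F 2 (volume : Measure Plane)) ξ) ⊤ volume := by
    unfold weightedFourierNorm
    rw [dif_pos hm]
  have hle := enorm_ae_le_eLpNormEssSup (fun ξ : Plane => ((1 + ‖ξ‖) ^ 3 : ℝ) •
      (𝓕 (hm.toLp g) : Lp F 2 (volume : Measure Plane)) ξ) volume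
  rw [← eLpNorm_exponent_top, ← e] at hle
  filter_upwards [hle] with ξ hξ
  rw [← ofReal_norm, ENNReal.ofReal_le_iff_le_toReal hg, norm_smul,
    Real.norm_of_nonneg (by positivity)] at hξ
  unfold wt
  rw [← div_eq_mul_inv, le_div_iff₀ (by positivity)]
  linarith

/-- A symmetric, everywhere bounded representative of the Fourier transform of a real component. -/
theorem exists_representative {g : Plane → F} (hg : weightedFourierNorm g ≠ ⊤) (L : F →L[ℂ] ℂ)
    (hL : ∀ x, ‖L x‖ ≤ ‖x‖) (hr : ∀ z, conj (L (g z)) = L (g z)) :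
    ∃ h : Plane → ℂ, Measurable h ∧ (∀ ξ, ‖h ξ‖ ≤ (weightedFourierNorm g).toReal * wt ξ) ∧
      (∀ ξ, h (-ξ) = conj (h ξ)) ∧ (fun z => L (g z)) =ᵐ[volume] invF h := by
  set N := (weightedFourierNorm g).toReal
  have hN : 0 ≤ N := ENNReal.toReal_nonneg
  have hm := memLp_two_of_weightedFourierNorm hg
  set f := hm.toLp g with hf
  set G : Plane → ℂ := fun ξ => L ((𝓕 f : Lp F 2 (volume : Measure Plane)) ξ) with hG
  have hGm : AEStronglyMeasurable G volume := L.continuous.comp_aestronglyMeasurable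
    (Lp.aestronglyMeasurable _)
  have hGb : ∀ᵐ ξ, ‖G ξ‖ ≤ N * wt ξ := (ae_norm_fourier_le hg).mono fun ξ h => (hL _).trans h
  have hGi : Integrable G := (integrable_wt.const_mul N).mono' hGm hGb
  set h₀ := hGm.mk G
  have h₀m : Measurable h₀ := hGm.stronglyMeasurable_mk.measurable
  -- The bound on the transform holds almost everywhere; truncation makes it hold at every
  -- frequency, as the pointwise definition of `IsBoundary` demands.
  set h₁ : Plane → ℂ := {ξ | ‖h₀ ξ‖ ≤ N * wt ξ}.indicator h₀ with hh₁
  have h₁m : Measurable h₁ := h₀m.indicator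
    (measurableSet_le h₀m.norm (continuous_wt.measurable.const_mul N))
  have h₁b : ∀ ξ, ‖h₁ ξ‖ ≤ N * wt ξ := by
    intro ξ
    by_cases hξ : ‖h₀ ξ‖ ≤ N * wt ξ
    · rwa [hh₁, indicator_of_mem (by exact hξ)]
    · rw [hh₁, indicator_of_notMem (by exact hξ), norm_zero]
      exact mul_nonneg hN (wt_nonneg ξ)
  have h₁G : h₁ =ᵐ[volume] G := by
    filter_upwards [hGb, hGm.ae_eq_mk] with ξ b e
    change G ξ = h₀ ξ at e
    have hξ : ‖h₀ ξ‖ ≤ N * wt ξ := by rwa [← e]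
    rw [hh₁, indicator_of_mem (by exact hξ), e]
  have h₁i : Integrable h₁ := hGi.congr h₁G.symm
  have hg₁ : (fun z => L (g z)) =ᵐ[volume] invF h₁ := by
    have e := Lp.ae_eq_invF_of_integrable_fourier f L hGi
    rw [invF_congr_ae h₁G]
    refine EventuallyEq.trans ?_ e
    filter_upwards [hm.coeFn_toLp] with z hz
    rw [hf, hz]
  have hci : Integrable fun ξ => conj (h₁ (-ξ)) :=
    (Complex.conjLIE.integrable_comp_iff (φ := fun ξ => h₁ (-ξ))).2 h₁i.comp_neg
  -- Averaging with the conjugate reflection makes the Hermitian symmetry exact; the inverse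
  -- transform is unchanged because it is real.
  refine ⟨fun ξ => (1 / 2 : ℂ) * (h₁ ξ + conj (h₁ (-ξ))), ?_, fun ξ => ?_, fun ξ => ?_, ?_⟩
  · exact ((h₁m.add (Complex.continuous_conj.measurable.comp
      (h₁m.comp measurable_neg))).const_mul _)
  · rw [norm_mul]
    have a1 := h₁b ξ
    have a2 := h₁b (-ξ)
    rw [wt_neg] at a2
    have a3 : ‖h₁ ξ + conj (h₁ (-ξ))‖ ≤ ‖h₁ ξ‖ + ‖h₁ (-ξ)‖ :=
      (norm_add_le _ _).trans_eq (by rw [RCLike.norm_conj])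
    have a4 : ‖(1 / 2 : ℂ)‖ = 1 / 2 := by norm_num
    rw [a4]
    linarith
  · simp only [neg_neg, map_mul, map_add, Complex.conj_conj]
    rw [add_comm, map_div₀, map_one, Complex.conj_ofNat]
  · filter_upwards [hg₁] with z hz
    rw [invF_const_mul, invF_add h₁i hci, invF_conj_neg, ← hz, hr z]
    ring

end SquareIntegrable

/-! ### Convolution with test functions -/

/-- The convolution of `g` with the kernel `χ`. -/
def smear (χ g : Plane → ℝ) (z : Plane) : ℝ := ∫ y, χ (z - y) * g y

section Smear

variable {χ g : Plane → ℝ}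

theorem smear_eq_convolution (χ g : Plane → ℝ) :
    smear χ g = convolution χ g (ContinuousLinearMap.lsmul ℝ ℝ) volume := by
  funext z
  rw [convolution_lsmul_swap]
  rfl

namespace IsTestFunction

theorem comp_sub_left (hχ : IsTestFunction χ) (z : Plane) : IsTestFunction fun y => χ (z - y) :=
  ⟨hχ.1.comp (contDiff_const.sub contDiff_id),
    hχ.2.comp_homeomorph (Homeomorph.subLeft z)⟩

theorem pd_comp_sub_left (hχ : IsTestFunction χ) (j : Fin 2) (z y : Plane) :
    CrowdMFG.pd j (fun y => χ (z - y)) y = -CrowdMFG.pd j χ (z - y) := by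
  have h1 : HasFDerivAt (fun y => χ (z - y)) ((fderiv ℝ χ (z - y)).comp
      (-ContinuousLinearMap.id ℝ Plane)) y :=
    (hχ.differentiable (z - y)).hasFDerivAt.comp y ((hasFDerivAt_id y).const_sub z)
  unfold CrowdMFG.pd
  rw [h1.fderiv]
  simp

theorem integrable_mul (hχ : IsTestFunction χ) (hg : LocallyIntegrable g) :
    Integrable fun z => χ z * g z :=
  hg.integrable_smul_left_of_hasCompactSupport hχ.continuous hχ.2

theorem integrable_smear (hχ : IsTestFunction χ) (hg : LocallyIntegrable g) (z : Plane) :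
    Integrable fun y => χ (z - y) * g y := (hχ.comp_sub_left z).integrable_mul hg

theorem hasFDerivAt_smear (hχ : IsTestFunction χ) (hg : LocallyIntegrable g) (z : Plane) :
    DifferentiableAt ℝ (smear χ g) z ∧
      ∀ j, CrowdMFG.pd j (smear χ g) z = smear (CrowdMFG.pd j χ) g z := by
  have h := hχ.2.hasFDerivAt_convolution_left (ContinuousLinearMap.lsmul ℝ ℝ)
    (hχ.1.of_le (by simp)) hg z
  rw [← smear_eq_convolution] at h
  refine ⟨h.differentiableAt, fun j => ?_⟩
  have hi := (hχ.2.fderiv (𝕜 := ℝ)).convolutionExists_left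
    ((ContinuousLinearMap.lsmul ℝ ℝ).precompL Plane) (hχ.1.continuous_fderiv (by simp)) hg z
  have e := congrFun (smear_eq_convolution (CrowdMFG.pd j χ) g) z
  rw [e, CrowdMFG.pd, h.fderiv, convolution_def, ContinuousLinearMap.integral_apply hi]
  rfl

end IsTestFunction

theorem smear_congr_ae {g' : Plane → ℝ} (h : g =ᵐ[volume] g') : smear χ g = smear χ g' := by
  funext z
  refine integral_congr_ae (h.mono fun y hy => ?_)
  simp only [hy]

/-- Cauchy–Schwarz for the measure of density `k`, written with `k = k^{1/2} k^{1/2}`. -/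
theorem lintegral_mul_sq_le {α : Type*} [MeasurableSpace α] {ν : Measure α} {k f : α → ℝ≥0∞}
    (hk : Measurable k) (hf : Measurable f) :
    (∫⁻ x, k x * f x ∂ν) ^ 2 ≤ (∫⁻ x, k x ∂ν) * ∫⁻ x, k x * f x ^ 2 ∂ν := by
  have h1 : ∫⁻ x, k x * f x ∂ν = ∫⁻ x, k x ^ (1 / 2 : ℝ) * (k x ^ (1 / 2 : ℝ) * f x) ∂ν := by
    refine lintegral_congr fun x => ?_
    rw [← mul_assoc, ← ENNReal.rpow_add_of_nonneg _ _ (by norm_num) (by norm_num)]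
    norm_num
  have h2 := ENNReal.lintegral_mul_le_Lp_mul_Lq ν Real.HolderConjugate.two_two
    (hk.pow_const (1 / 2 : ℝ)).aemeasurable ((hk.pow_const (1 / 2 : ℝ)).mul hf).aemeasurable
  rw [h1]
  refine (pow_le_pow_left' h2 2).trans_eq ?_
  rw [mul_pow, ← ENNReal.rpow_natCast, ← ENNReal.rpow_natCast, ← ENNReal.rpow_mul,
    ← ENNReal.rpow_mul]
  norm_num
  congr 1
  · refine lintegral_congr fun x => ?_
    rw [← ENNReal.rpow_ofNat, ← ENNReal.rpow_mul]
    norm_num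
  · refine lintegral_congr fun x => ?_
    rw [mul_pow]
    congr 1
    rw [← ENNReal.rpow_ofNat, ← ENNReal.rpow_mul]
    norm_num

/-- Young's inequality for `L¹ * L² ⊂ L²`: weighted Cauchy–Schwarz in `y`, then Tonelli and
translation invariance. With `lintegral_mollifier` it shows that mollification does not increase
energies. -/
theorem lintegral_smear_sq_le (hχ : Measurable χ) (hg : AEMeasurable g) :
    ∫⁻ z, ‖smear χ g z‖ₑ ^ 2 ≤ (∫⁻ z, ‖χ z‖ₑ) ^ 2 * ∫⁻ z, ‖g z‖ₑ ^ 2 := by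
  wlog hgm : Measurable g generalizing g
  · have e := hg.ae_eq_mk
    have e2 : ∫⁻ z, ‖g z‖ₑ ^ 2 = ∫⁻ z, ‖hg.mk g z‖ₑ ^ 2 :=
      lintegral_congr_ae (e.mono fun z hz => by simp only [hz])
    rw [smear_congr_ae e, e2]
    exact this hg.measurable_mk.aemeasurable hg.measurable_mk
  set m := ∫⁻ z, ‖χ z‖ₑ with hm
  have hmz : ∀ z, ∫⁻ y, ‖χ (z - y)‖ₑ = m := fun z =>
    lintegral_sub_left_eq_self (fun y => ‖χ y‖ₑ) z
  have key : ∀ z, ‖smear χ g z‖ₑ ^ 2 ≤ m * ∫⁻ y, ‖χ (z - y)‖ₑ * ‖g y‖ₑ ^ 2 := by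
    intro z
    have hχz : Measurable fun y => ‖χ (z - y)‖ₑ :=
      (hχ.comp (measurable_const.sub measurable_id)).enorm
    have h1 : ‖smear χ g z‖ₑ ≤ ∫⁻ y, ‖χ (z - y)‖ₑ * ‖g y‖ₑ :=
      (enorm_integral_le_lintegral_enorm _).trans_eq (lintegral_congr fun y => enorm_mul _ _)
    exact (pow_le_pow_left' h1 2).trans ((lintegral_mul_sq_le hχz hgm.enorm).trans_eq (by rw [hmz z]))
  calc ∫⁻ z, ‖smear χ g z‖ₑ ^ 2 ≤ ∫⁻ z, m * ∫⁻ y, ‖χ (z - y)‖ₑ * ‖g y‖ₑ ^ 2 :=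
        lintegral_mono key
    _ = m * ∫⁻ z, ∫⁻ y, ‖χ (z - y)‖ₑ * ‖g y‖ₑ ^ 2 := by
        refine lintegral_const_mul _ ?_
        refine Measurable.lintegral_prod_right' (f := fun w : Plane × Plane =>
          ‖χ (w.1 - w.2)‖ₑ * ‖g w.2‖ₑ ^ 2) ?_
        exact (hχ.comp (measurable_fst.sub measurable_snd)).enorm.mul
          ((hgm.comp measurable_snd).enorm.pow_const 2)
    _ = m * ∫⁻ y, ∫⁻ z, ‖χ (z - y)‖ₑ * ‖g y‖ₑ ^ 2 := by
        rw [lintegral_lintegral_swap]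
        exact ((hχ.comp (measurable_fst.sub measurable_snd)).enorm.mul
          ((hgm.comp measurable_snd).enorm.pow_const 2)).aemeasurable
    _ = m * ∫⁻ y, m * ‖g y‖ₑ ^ 2 := by
        congr 1
        refine lintegral_congr fun y => ?_
        have hχy : Measurable fun z => ‖χ (z - y)‖ₑ :=
          (hχ.comp (measurable_id.sub measurable_const)).enorm
        rw [lintegral_mul_const _ hχy]
        congr 1
        exact lintegral_sub_right_eq_self (fun z => ‖χ z‖ₑ) y
    _ = _ := by
        rw [lintegral_const_mul _ (hgm.enorm.pow_const 2)]
        ring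

end Smear

/-- A sequence of mollifiers. -/
def mollifierBump (n : ℕ) : ContDiffBump (0 : Plane) where
  rIn := 1 / ((n : ℝ) + 1)
  rOut := 2 * (1 / ((n : ℝ) + 1))
  rIn_pos := by positivity
  rIn_lt_rOut := by
    have : 0 < 1 / ((n : ℝ) + 1) := by positivity
    linarith

/-- A sequence of mollifiers. -/
def mollifier (n : ℕ) : Plane → ℝ := (mollifierBump n).normed volume

theorem isTestFunction_mollifier (n : ℕ) : IsTestFunction (mollifier n) :=
  ⟨(mollifierBump n).contDiff_normed, (mollifierBump n).hasCompactSupport_normed⟩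

theorem lintegral_mollifier (n : ℕ) : ∫⁻ z, ‖mollifier n z‖ₑ = 1 := by
  have h1 := (mollifierBump n).integral_normed (μ := volume)
  have h2 : ∀ z, ‖mollifier n z‖ₑ = ENNReal.ofReal (mollifier n z) := fun z =>
    Real.enorm_of_nonneg ((mollifierBump n).nonneg_normed z)
  simp_rw [h2]
  rw [← ofReal_integral_eq_lintegral_ofReal (isTestFunction_mollifier n).integrable
    (Eventually.of_forall fun z => (mollifierBump n).nonneg_normed z)]
  unfold mollifier
  rw [h1, ENNReal.ofReal_one]

theorem ae_tendsto_smear_mollifier {g : Plane → ℝ} (hg : LocallyIntegrable g) :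
    ∀ᵐ z, Tendsto (fun n => smear (mollifier n) g z) atTop (𝓝 (g z)) := by
  simp_rw [smear_eq_convolution]
  refine ContDiffBump.ae_convolution_tendsto_right_of_locallyIntegrable (φ := mollifierBump)
    (K := 2) ?_ (Eventually.of_forall fun n => le_rfl) hg
  have h := (tendsto_one_div_add_atTop_nhds_zero_nat (𝕜 := ℝ)).const_mul 2
  rwa [mul_zero] at h

/-! ### Weak gradients tested against kernels -/

section WeakGradient

variable {g : Plane → ℝ} {G : Plane → Plane}

theorem _root_.MeasureTheory.LocallyIntegrable.apply (hG : LocallyIntegrable G) (j : Fin 2) :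
    LocallyIntegrable fun z => G z j := fun x => by
  obtain ⟨s, hs, hi⟩ := hG x
  exact ⟨s, hs, (EuclideanSpace.proj (𝕜 := ℝ) j).integrable_comp hi⟩

theorem IsTestFunction.integrable_pd_mul {χ : Plane → ℝ} (hχ : IsTestFunction χ)
    (hg : LocallyIntegrable g) (j : Fin 2) : Integrable fun z => g z * CrowdMFG.pd j χ z := by
  simpa only [mul_comm] using (hχ.pd j).integrable_mul hg

theorem integrable_toLp_of_apply {H : Plane → Plane} (h : ∀ j, Integrable fun z => H z j) :
    Integrable H := by
  have : H = fun z => ∑ j, H z j • EuclideanSpace.single j (1 : ℝ) := by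
    funext z
    ext i
    fin_cases i <;> simp [Fin.sum_univ_two]
  rw [this]
  exact integrable_finsetSum _ fun j _ => (h j).smul_const _

theorem integral_apply_plane {H : Plane → Plane} (h : Integrable H) (j : Fin 2) :
    (∫ z, H z) j = ∫ z, H z j :=
  ((EuclideanSpace.proj (𝕜 := ℝ) j).integral_comp_comm h).symm

theorem IsTestFunction.integrable_smul_gradient {χ : Plane → ℝ} (hχ : IsTestFunction χ)
    (hg : LocallyIntegrable g) : Integrable fun z => g z • ∇ χ z := by
  refine integrable_toLp_of_apply fun j => ?_
  simpa only [PiLp.smul_apply, hχ.gradient_apply, smul_eq_mul] using hχ.integrable_pd_mul hg j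

theorem hasWeakGradient_iff : HasWeakGradient g G ↔ LocallyIntegrable g ∧ LocallyIntegrable G ∧
    ∀ χ, IsTestFunction χ → ∀ j, ∫ z, g z * pd j χ z = -∫ z, G z j * χ z := by
  unfold HasWeakGradient
  refine and_congr_right fun hg => and_congr_right fun hG => forall₂_congr fun χ hχ => ?_
  have i1 := hχ.integrable_smul_gradient hg
  have i2 : Integrable fun z => χ z • G z :=
    hG.integrable_smul_left_of_hasCompactSupport hχ.continuous hχ.2
  have e1 : ∀ j, (∫ z, g z • ∇ χ z) j = ∫ z, g z * pd j χ z := fun j => by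
    rw [integral_apply_plane i1]
    simp only [PiLp.smul_apply, hχ.gradient_apply, smul_eq_mul]
  have e2 : ∀ j, (-∫ z, χ z • G z) j = -∫ z, G z j * χ z := fun j => by
    rw [PiLp.neg_apply, integral_apply_plane i2]
    simp only [PiLp.smul_apply, smul_eq_mul, mul_comm]
  constructor
  · intro h j
    rw [← e1, ← e2, h]
  · intro h
    ext j
    rw [e1, e2, h]

theorem HasWeakGradient.smear_pd (h : HasWeakGradient g G) {χ : Plane → ℝ}
    (hχ : IsTestFunction χ) (j : Fin 2) (z : Plane) :
    smear (pd j χ) g z = smear χ (fun y => G y j) z := by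
  have e := (hasWeakGradient_iff.1 h).2.2 _ (hχ.comp_sub_left z) j
  simp only [hχ.pd_comp_sub_left, mul_neg, integral_neg, neg_inj] at e
  unfold smear
  simp only [mul_comm _ (g _), mul_comm _ (G _ j)]
  exact e

/-- Each mollification of `g` is differentiable with zero gradient, hence constant, and the
mollifications converge to `g` almost everywhere. -/
theorem HasWeakGradient.ae_eq_const (h : HasWeakGradient g 0) : ∃ c, g =ᵐ[volume] fun _ => c := by
  have hc : ∀ n z, smear (mollifier n) g z = smear (mollifier n) g 0 := by
    intro n z
    have hn := isTestFunction_mollifier n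
    refine is_const_of_fderiv_eq_zero (fun z => (hn.hasFDerivAt_smear h.1 z).1) (fun z => ?_) _ _
    refine ContinuousLinearMap.coe_injective
      ((EuclideanSpace.basisFun (Fin 2) ℝ).toBasis.ext fun j => ?_)
    have e := (hn.hasFDerivAt_smear h.1 z).2 j
    rw [h.smear_pd hn] at e
    simpa [pd, smear] using e
  have hae := ae_tendsto_smear_mollifier h.1
  obtain ⟨z₀, hz₀⟩ := hae.exists
  refine ⟨g z₀, hae.mono fun z hz => ?_⟩
  simp only [hc _ z] at hz
  simp only [hc _ z₀] at hz₀
  exact tendsto_nhds_unique hz hz₀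

end WeakGradient

/-! ### Decay of the envelope -/

/-- Exponential decay at scale `1 / x` is traded for a dilation of the weight by `1 + x`. A third of
the exponent pays for one factor `1 + x ‖ξ‖`, and `1 + (1 + x) ‖ξ‖ ≤ (1 + x ‖ξ‖) (1 + ‖ξ‖)`; cubing
gives the claim. -/
theorem exists_exp_mul_le {c : ℝ} (hc : 0 < c) :
    ∃ A > 0, ∀ x ≥ 0, ∀ ξ : Plane, Real.exp (-c * x * ‖ξ‖) * wt ξ ≤ A * wt ((1 + x) • ξ) := by
  refine ⟨(1 + 3 / c) ^ 3, by positivity, fun x hx ξ => ?_⟩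
  have hξ := norm_nonneg ξ
  have hs : 0 ≤ x * ‖ξ‖ := mul_nonneg hx hξ
  have e0 : Real.exp (-c * x * ‖ξ‖) = (Real.exp (c * (x * ‖ξ‖) / 3) ^ 3)⁻¹ := by
    rw [← Real.exp_nat_mul, ← Real.exp_neg]
    congr 1; push_cast; ring
  have e1 : 1 + x * ‖ξ‖ ≤ (1 + 3 / c) * Real.exp (c * (x * ‖ξ‖) / 3) := by
    have h := Real.add_one_le_exp (c * (x * ‖ξ‖) / 3)
    have h2 := mul_le_mul_of_nonneg_left h (by positivity : 0 ≤ 1 + 3 / c)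
    refine le_trans ?_ h2
    have h3 : (1 + 3 / c) * (c * (x * ‖ξ‖) / 3 + 1) =
        1 + 3 / c + c * (x * ‖ξ‖) / 3 + x * ‖ξ‖ := by field_simp; ring
    rw [h3]
    have : 0 < 3 / c := by positivity
    have : 0 ≤ c * (x * ‖ξ‖) / 3 := by positivity
    linarith
  have e2 : 1 + ‖(1 + x) • ξ‖ ≤ (1 + x * ‖ξ‖) * (1 + ‖ξ‖) := by
    rw [norm_smul, Real.norm_of_nonneg (by linarith)]
    nlinarith [mul_nonneg hs hξ]
  have e3 : (1 + ‖(1 + x) • ξ‖) ^ 3 ≤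
      (1 + 3 / c) ^ 3 * (Real.exp (c * (x * ‖ξ‖) / 3) ^ 3 * (1 + ‖ξ‖) ^ 3) := by
    calc (1 + ‖(1 + x) • ξ‖) ^ 3 ≤ ((1 + x * ‖ξ‖) * (1 + ‖ξ‖)) ^ 3 := by gcongr
      _ ≤ (((1 + 3 / c) * Real.exp (c * (x * ‖ξ‖) / 3)) * (1 + ‖ξ‖)) ^ 3 := by gcongr
      _ = _ := by ring
  unfold wt
  rw [e0, ← mul_inv, ← div_eq_mul_inv, inv_eq_one_div,
    div_le_div_iff₀ (by positivity) (by positivity), one_mul]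
  exact e3

/-- The exponent is the dimension of the plane. It gives the rate `(1 + t)⁻²` in sup norm and, after
a square root, `(1 + t)⁻¹` in `L²`. -/
theorem integral_wt_smul {r : ℝ} (hr : 0 < r) : ∫ ξ, wt (r • ξ) = wtMass / r ^ 2 := by
  rw [Measure.integral_comp_smul, finrank_euclideanSpace_fin, abs_of_pos (by positivity),
    smul_eq_mul, wtMass]
  ring

theorem integrable_wt_smul {r : ℝ} (hr : 0 < r) : Integrable fun ξ => wt (r • ξ) :=
  integrable_wt.comp_smul hr.ne'

theorem exists_env_le {c : ℝ} (hc : 0 < c) :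
    ∃ A > 0, ∀ T N₀ N₁ x : ℝ, 0 ≤ N₀ → 0 ≤ N₁ → x ∈ Icc 0 T → ∀ ξ,
      env c T N₀ N₁ x ξ ≤ A * (N₀ * wt ((1 + x) • ξ) + N₁ * wt ((1 + (T - x)) • ξ)) := by
  obtain ⟨A, hA, h⟩ := exists_exp_mul_le hc
  refine ⟨A, hA, fun T N₀ N₁ x h₀ h₁ hx ξ => ?_⟩
  have a0 := mul_le_mul_of_nonneg_left (h x hx.1 ξ) h₀
  have a1 := mul_le_mul_of_nonneg_left (h (T - x) (sub_nonneg.2 hx.2) ξ) h₁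
  unfold env
  linarith

/-- The decay estimates for functions dominated by the envelope. -/
theorem exists_decay {c : ℝ} (hc : 0 < c) :
    ∃ A > 0, ∀ T N₀ N₁ x R : ℝ, 0 ≤ N₀ → 0 ≤ N₁ → 0 ≤ R → x ∈ Icc 0 T → ∀ h : Plane → ℂ,
      AEStronglyMeasurable h volume → (∀ ξ, ‖h ξ‖ ≤ R * env c T N₀ N₁ x ξ) →
      eLpNorm (invF h) 2 volume ≤ ENNReal.ofReal (R * A * (N₀ / (1 + x) + N₁ / (1 + T - x))) ∧
      eLpNorm (invF h) ⊤ volume ≤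
        ENNReal.ofReal (R * A * (N₀ / (1 + x) ^ 2 + N₁ / (1 + T - x) ^ 2)) := by
  obtain ⟨A, hA, hle⟩ := exists_env_le hc
  -- This `m` dominates `wtMass` for the sup bound, and its square dominates `2 * wtMass` for the
  -- `L²` bound.
  set m := 2 * wtMass + 1 with hm
  have hm1 : 1 ≤ m := by linarith [wtMass_nonneg]
  have hm0 : 0 < m := by linarith
  refine ⟨A * m, by positivity, fun T N₀ N₁ x R h₀ h₁ hR hx h hh hb => ?_⟩
  have hx0 : 0 < 1 + x := by linarith [hx.1]
  have hx1 : 0 < 1 + (T - x) := by linarith [hx.2]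
  have hx1' : 1 + T - x = 1 + (T - x) := by ring
  rw [hx1']
  have i0 := integrable_wt_smul hx0
  have i1 := integrable_wt_smul hx1
  set b : Plane → ℝ := fun ξ => R * (A * (N₀ * wt ((1 + x) • ξ) + N₁ * wt ((1 + (T - x)) • ξ)))
    with hbdef
  have hbb : ∀ ξ, ‖h ξ‖ ≤ b ξ := fun ξ => (hb ξ).trans
    (mul_le_mul_of_nonneg_left (hle T N₀ N₁ x h₀ h₁ hx ξ) hR)
  have bi : Integrable b := (((i0.const_mul N₀).add (i1.const_mul N₁)).const_mul A).const_mul R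
  have hi : Integrable h := bi.mono' hh (Eventually.of_forall hbb)
  -- Since the weight is at most `1`, its square has at most the same integral, so one mass serves
  -- both norms.
  have hw : ∀ r : ℝ, ∀ ξ : Plane, wt (r • ξ) ^ 2 ≤ wt (r • ξ) := fun r ξ => by
    have := wt_nonneg (r • ξ)
    have := wt_le_one (r • ξ)
    nlinarith
  have hsq : ∀ ξ, ‖h ξ‖ ^ 2 ≤ 2 * (R * A) ^ 2 *
      (N₀ ^ 2 * wt ((1 + x) • ξ) + N₁ ^ 2 * wt ((1 + (T - x)) • ξ)) := by
    intro ξ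
    have e1 : ‖h ξ‖ ^ 2 ≤ b ξ ^ 2 := pow_le_pow_left₀ (norm_nonneg _) (hbb ξ) 2
    have e2 := mul_le_mul_of_nonneg_left (hw (1 + x) ξ) (sq_nonneg N₀)
    have e3 := mul_le_mul_of_nonneg_left (hw (1 + (T - x)) ξ) (sq_nonneg N₁)
    have e4 : (N₀ * wt ((1 + x) • ξ) + N₁ * wt ((1 + (T - x)) • ξ)) ^ 2 ≤
        2 * (N₀ ^ 2 * wt ((1 + x) • ξ) + N₁ ^ 2 * wt ((1 + (T - x)) • ξ)) := by
      nlinarith [sq_nonneg (N₀ * wt ((1 + x) • ξ) - N₁ * wt ((1 + (T - x)) • ξ))]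
    have e5 := mul_le_mul_of_nonneg_left e4 (sq_nonneg (R * A))
    refine e1.trans (le_trans (le_of_eq ?_) (e5.trans (le_of_eq ?_)))
    · rw [hbdef]; ring
    · ring
  have sqi : Integrable fun ξ => ‖h ξ‖ ^ 2 := by
    refine Integrable.mono' (((i0.const_mul (N₀ ^ 2)).add (i1.const_mul (N₁ ^ 2))).const_mul
      (2 * (R * A) ^ 2)) (hh.norm.pow 2) (Eventually.of_forall fun ξ => ?_)
    rw [Real.norm_of_nonneg (by positivity)]
    exact hsq ξ
  have h2 : MemLp h 2 := (memLp_two_iff_integrable_sq_norm hh).2 sqi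
  have hm2 : wtMass ≤ m := by linarith [wtMass_nonneg]
  refine ⟨?_, ?_⟩
  · rw [eLpNorm_invF hi h2, h2.eLpNorm_eq_integral_rpow_norm two_ne_zero (by simp)]
    refine ENNReal.ofReal_le_ofReal ?_
    simp only [ENNReal.toReal_ofNat, Real.rpow_ofNat]
    rw [← one_div, ← Real.sqrt_eq_rpow]
    refine Real.sqrt_le_iff.2 ⟨by positivity, ?_⟩
    calc ∫ ξ, ‖h ξ‖ ^ 2 ≤ ∫ ξ, 2 * (R * A) ^ 2 *
          (N₀ ^ 2 * wt ((1 + x) • ξ) + N₁ ^ 2 * wt ((1 + (T - x)) • ξ)) :=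
          integral_mono sqi (((i0.const_mul (N₀ ^ 2)).add (i1.const_mul (N₁ ^ 2))).const_mul
            (2 * (R * A) ^ 2)) hsq
      _ = (R * A) ^ 2 * (2 * wtMass) * ((N₀ / (1 + x)) ^ 2 + (N₁ / (1 + (T - x))) ^ 2) := by
          rw [integral_const_mul, integral_add (i0.const_mul _) (i1.const_mul _),
            integral_const_mul, integral_const_mul, integral_wt_smul hx0, integral_wt_smul hx1,
            div_pow, div_pow]
          ring
      _ ≤ (R * A) ^ 2 * m ^ 2 * (N₀ / (1 + x) + N₁ / (1 + (T - x))) ^ 2 := by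
          gcongr
          · nlinarith
          · have : 0 ≤ N₀ / (1 + x) := by positivity
            have : 0 ≤ N₁ / (1 + (T - x)) := by positivity
            nlinarith
      _ = _ := by ring
  · have hsup : ∀ z, ‖invF h z‖ₑ ≤ ENNReal.ofReal (∫ ξ, b ξ) := fun z => by
      rw [← ofReal_norm]
      refine ENNReal.ofReal_le_ofReal ((norm_invF_le h z).trans ?_)
      exact integral_mono hi.norm bi hbb
    rw [eLpNorm_exponent_top]
    refine (eLpNormEssSup_le_of_ae_enorm_bound (Eventually.of_forall hsup)).trans ?_
    refine ENNReal.ofReal_le_ofReal ?_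
    rw [hbdef, integral_const_mul, integral_const_mul,
      integral_add (i0.const_mul _) (i1.const_mul _),
      integral_const_mul, integral_const_mul, integral_wt_smul hx0, integral_wt_smul hx1]
    calc _ = R * A * wtMass * (N₀ / (1 + x) ^ 2 + N₁ / (1 + (T - x)) ^ 2) := by ring
      _ ≤ R * A * m * (N₀ / (1 + x) ^ 2 + N₁ / (1 + (T - x)) ^ 2) := by gcongr
      _ = _ := by ring

/-! ### The potential of a curl free field -/

/-- Division by `2π|ξ|` on the Fourier side. -/
def potential (q : Plane → ℂ) (ξ : Plane) : ℂ := (((2 * Real.pi * ‖ξ‖)⁻¹ : ℝ) : ℂ) * q ξ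

/-- In polar coordinates of the plane the singularity `1 / r` cancels against `r dr`. Thus the value
function itself, up to a constant, is an absolutely convergent Fourier integral. -/
theorem integrable_wt_div_norm : Integrable fun ξ : Plane => ‖ξ‖⁻¹ * wt ξ := by
  have h := (integrable_fun_norm_addHaar (volume : Measure Plane)
    (f := fun r : ℝ => r⁻¹ * ((1 + r) ^ 3)⁻¹)).2 ?_
  · exact h
  rw [finrank_euclideanSpace_fin]
  have h1 : Integrable fun r : ℝ => (1 + ‖r‖) ^ (-(3 : ℝ)) :=
    integrable_one_add_norm (by simp)
  refine h1.integrableOn.congr_fun (fun r (hr : 0 < r) => ?_) measurableSet_Ioi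
  have : (0 : ℝ) ≤ 1 + r := by positivity
  simp only [Real.norm_of_nonneg hr.le]
  rw [Real.rpow_neg this]
  norm_num
  field_simp

section Potential

variable {q : Plane → ℂ} {C : ℝ}

theorem Measurable.potential (hq : Measurable q) : Measurable (potential q) := by
  unfold CrowdMFG.potential
  exact (Complex.measurable_ofReal.comp
    ((measurable_const.mul measurable_norm).inv)).mul hq

theorem norm_potential_le (hb : ∀ ξ, ‖q ξ‖ ≤ C * wt ξ) (ξ : Plane) :
    ‖potential q ξ‖ ≤ C / (2 * Real.pi) * (‖ξ‖⁻¹ * wt ξ) := by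
  have hpi := Real.pi_pos
  unfold potential
  rw [norm_mul, Complex.norm_real, Real.norm_of_nonneg (by positivity)]
  calc _ ≤ (2 * Real.pi * ‖ξ‖)⁻¹ * (C * wt ξ) := by gcongr; exact hb ξ
    _ = _ := by rw [mul_inv]; ring

theorem integrable_potential (hm : AEStronglyMeasurable (potential q) volume)
    (hb : ∀ ξ, ‖q ξ‖ ≤ C * wt ξ) : Integrable (potential q) :=
  (integrable_wt_div_norm.const_mul _).mono' hm (Eventually.of_forall (norm_potential_le hb))

theorem integrable_norm_mul_potential (hm : AEStronglyMeasurable (potential q) volume)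
    (hb : ∀ ξ, ‖q ξ‖ ≤ C * wt ξ) : Integrable fun ξ => ‖ξ‖ * ‖potential q ξ‖ := by
  have hpi := Real.pi_pos
  refine (integrable_wt.const_mul (C / (2 * Real.pi))).mono'
    (continuous_norm.aestronglyMeasurable.mul hm.norm) (Eventually.of_forall fun ξ => ?_)
  rw [Real.norm_of_nonneg (by positivity)]
  have hC : 0 ≤ C * wt ξ := (norm_nonneg _).trans (hb ξ)
  rcases eq_or_ne ξ 0 with rfl | hξ
  · rw [norm_zero, zero_mul]
    calc (0 : ℝ) ≤ C * wt 0 / (2 * Real.pi) := by positivity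
      _ = _ := by ring
  · have hn : 0 < ‖ξ‖ := norm_pos_iff.2 hξ
    calc ‖ξ‖ * ‖potential q ξ‖ ≤ ‖ξ‖ * (C / (2 * Real.pi) * (‖ξ‖⁻¹ * wt ξ)) :=
          mul_le_mul_of_nonneg_left (norm_potential_le hb ξ) hn.le
      _ = _ := by field_simp

theorem coord_mul_potential (q : Plane → ℂ) (j : Fin 2) (ξ : Plane) :
    2 * Real.pi * Complex.I * ξ j * potential q ξ = dir j ξ * q ξ := by
  have hpi : (Real.pi : ℂ) ≠ 0 := by exact_mod_cast Real.pi_ne_zero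
  unfold potential dir
  rcases eq_or_ne ξ 0 with rfl | hξ
  · simp
  · have hn : ((‖ξ‖ : ℝ) : ℂ) ≠ 0 := by exact_mod_cast (norm_pos_iff.2 hξ).ne'
    push_cast
    field_simp

theorem potential_symm (hs : ∀ ξ, q (-ξ) = conj (q ξ)) (ξ : Plane) :
    potential q (-ξ) = conj (potential q ξ) := by
  unfold potential
  rw [norm_neg, hs, map_mul, Complex.conj_ofReal]

theorem hasGradientAt_potential (hm : AEStronglyMeasurable (potential q) volume)
    (hb : ∀ ξ, ‖q ξ‖ ≤ C * wt ξ) (c : ℝ) (z : Plane) :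
    HasGradientAt (fun z => (invF (potential q) z).re + c)
      (WithLp.toLp 2 fun j => (invF (fun ξ => dir j ξ * q ξ) z).re) z := by
  have h := hasGradientAt_re_invF (integrable_potential hm hb)
    (integrable_norm_mul_potential hm hb) c z
  simpa only [coord_mul_potential] using h

end Potential

theorem hasWeakGradient_of_hasGradientAt {g : Plane → ℝ} {G : Plane → Plane}
    (hg : ∀ z, HasGradientAt g (G z) z) (hG : Continuous G) : HasWeakGradient g G := by
  have hd : Differentiable ℝ g := fun z => (hg z).differentiableAt
  refine hasWeakGradient_iff.2 ⟨hd.continuous.locallyIntegrable, hG.locallyIntegrable,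
    fun χ hχ j => ?_⟩
  have e : ∀ z, fderiv ℝ g z (EuclideanSpace.single j 1) = G z j := fun z => by
    rw [← gradient_apply_eq (hd z) j, (hg z).gradient]
  have hGj : Continuous fun z => G z j := (EuclideanSpace.proj (𝕜 := ℝ) j).continuous.comp hG
  have key := integral_mul_fderiv_eq_neg_fderiv_mul_of_integrable (μ := (volume : Measure Plane))
    (f := g) (g := χ) (v := EuclideanSpace.single j 1)
    ?_ (hχ.integrable_pd_mul hd.continuous.locallyIntegrable j) ?_ (fun z _ => hd z)
    fun z _ => hχ.differentiable z
  · simp only [e] at key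
    exact key
  · simp only [e]
    simpa only [mul_comm] using hχ.integrable_mul hGj.locallyIntegrable
  · simpa only [mul_comm] using hχ.integrable_mul hd.continuous.locallyIntegrable

/-- A weak gradient is curl free, by symmetry of the second derivatives of the test function. -/
theorem HasWeakGradient.integral_mul_pd_comm {g : Plane → ℝ} {G : Plane → Plane}
    (h : HasWeakGradient g G) {χ : Plane → ℝ} (hχ : IsTestFunction χ) :
    ∫ z, G z 0 * pd 1 χ z = ∫ z, G z 1 * pd 0 χ z := by
  have hi := (hasWeakGradient_iff.1 h).2.2
  have e0 := hi _ (hχ.pd 1) 0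
  have e1 := hi _ (hχ.pd 0) 1
  have hs : pd 0 (pd 1 χ) = pd 1 (pd 0 χ) := by
    funext z
    have hd : DifferentiableAt ℝ (fderiv ℝ χ) z :=
      (hχ.1.fderiv_right (m := 1) (by norm_cast)).differentiable one_ne_zero z
    have c : ∀ v w : Plane, fderiv ℝ (fun z => fderiv ℝ χ z v) z w =
        fderiv ℝ (fderiv ℝ χ) z w v := by
      intro v w
      rw [fderiv_clm_apply hd (differentiableAt_const _)]
      simp
    unfold pd
    rw [c, c]
    exact (hχ.1.contDiffAt.isSymmSndFDerivAt (by simp; norm_cast)).eq _ _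
  rw [hs, e1, neg_inj] at e0
  exact e0.symm

/-! ### The boundary data on the Fourier side -/

theorem exists_density_datum {ψ₀ : Plane → ℝ}
    (h : weightedFourierNorm (toComplexFun ψ₀) ≠ ⊤) :
    ∃ d : Plane → ℂ, Measurable d ∧
      (∀ ξ, ‖d ξ‖ ≤ (weightedFourierNorm (toComplexFun ψ₀)).toReal * wt ξ) ∧
      (∀ ξ, d (-ξ) = conj (d ξ)) ∧ ψ₀ =ᵐ[volume] fun z => (invF d z).re := by
  obtain ⟨d, h1, h2, h3, h4⟩ := exists_representative h (ContinuousLinearMap.id ℂ ℂ)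
    (fun _ => le_rfl) (fun z => Complex.conj_ofReal _)
  refine ⟨d, h1, h2, h3, h4.mono fun z hz => ?_⟩
  simp only [← hz, toComplexFun, ContinuousLinearMap.id_apply, Complex.ofReal_re]

theorem memLp_norm_mul_wt : MemLp (fun ξ : Plane => ‖ξ‖ * wt ξ) 2 := by
  have hm : AEStronglyMeasurable (fun ξ : Plane => ‖ξ‖ * wt ξ) volume :=
    (continuous_norm.mul continuous_wt).aestronglyMeasurable
  refine (memLp_two_iff_integrable_sq_norm hm).2 (integrable_wt.mono' (hm.norm.pow 2)
    (Eventually.of_forall fun ξ => ?_))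
  have hξ := norm_nonneg ξ
  simp only [norm_pow, norm_norm, norm_mul]
  rw [Real.norm_of_nonneg (wt_nonneg ξ)]
  unfold wt
  rw [mul_pow, inv_pow, ← div_eq_mul_inv, inv_eq_one_div,
    div_le_div_iff₀ (by positivity) (by positivity)]
  calc ‖ξ‖ ^ 2 * (1 + ‖ξ‖) ^ 3 ≤ (1 + ‖ξ‖) ^ 3 * (1 + ‖ξ‖) ^ 3 := by
        gcongr
        nlinarith [mul_nonneg hξ hξ, pow_nonneg hξ 3]
    _ = _ := by ring

/-- Being curl free, the transform `k` of the gradient is parallel to `ξ`, so it equals `dir j * q`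
for the single scalar `q = -∑ dir j * k j`. The potential of `q` then has the same weak gradient as
`φT` and differs from it by a constant. The factor 2 counts the two components of `k`. -/
theorem exists_value_datum {φT : Plane → ℝ} {GT : Plane → Plane} (hw : HasWeakGradient φT GT)
    (h : weightedFourierNorm (toComplexField GT) ≠ ⊤) :
    ∃ q : Plane → ℂ, Measurable q ∧
      (∀ ξ, ‖q ξ‖ ≤ 2 * (weightedFourierNorm (toComplexField GT)).toReal * wt ξ) ∧
      (∀ ξ, q (-ξ) = conj (q ξ)) ∧
      ∃ c, φT =ᵐ[volume] fun z => (invF (potential q) z).re + c := by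
  set N := (weightedFourierNorm (toComplexField GT)).toReal with hN
  have hN0 : 0 ≤ N := ENNReal.toReal_nonneg
  have hex := fun j : Fin 2 => exists_representative h (EuclideanSpace.proj (𝕜 := ℂ) j)
    (fun x => PiLp.norm_apply_le x j) (fun z => Complex.conj_ofReal (GT z j))
  choose k km kb ks kG using hex
  have ki : ∀ j, Integrable (k j) := fun j => (integrable_wt.const_mul N).mono'
    (km j).aestronglyMeasurable (Eventually.of_forall (kb j))
  have kG' : ∀ j, ∀ᵐ z, ((GT z j : ℝ) : ℂ) = invF (k j) z := fun j => kG j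
  have hcurl : ∀ᵐ ξ : Plane, (ξ 1 : ℂ) * k 0 ξ = ξ 0 * k 1 ξ := by
    set H : Plane → ℂ := fun ξ => ξ 1 * k 0 ξ - ξ 0 * k 1 ξ with hH
    have hHm : AEStronglyMeasurable H volume := by
      refine Measurable.aestronglyMeasurable ?_
      exact ((Complex.measurable_ofReal.comp (measurable_coord 1)).mul (km 0)).sub
        ((Complex.measurable_ofReal.comp (measurable_coord 0)).mul (km 1))
    have hH2 : MemLp H 2 := by
      -- The weight gives square integrability of `‖ξ‖ * wt ξ` but not integrability, so the
      -- vanishing of the curl is deduced in `L²`.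
      refine (memLp_norm_mul_wt.const_mul (2 * N)).of_le hHm (Eventually.of_forall fun ξ => ?_)
      have b : ∀ i j, ‖(ξ i : ℂ) * k j ξ‖ ≤ ‖ξ‖ * (N * wt ξ) := fun i j => by
        rw [norm_mul, Complex.norm_real]
        exact mul_le_mul (abs_coord_le ξ i) (kb j ξ) (norm_nonneg _) (norm_nonneg _)
      rw [Real.norm_of_nonneg (by have := wt_nonneg ξ; positivity)]
      calc ‖H ξ‖ ≤ _ := norm_sub_le _ _
        _ ≤ _ := by linarith [b 1 0, b 0 1]
    have hz := ae_eq_zero_of_integral_invF_smul hH2 fun χ hχ => ?_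
    · exact hz.mono fun ξ hξ => sub_eq_zero.1 hξ
    have e : ∀ i j, ∫ z, ((GT z j * pd i χ z : ℝ) : ℂ) =
        -(2 * Real.pi * Complex.I) *
          ∫ ξ : Plane, invF (fun z => (χ z : ℂ)) ξ * (ξ i * k j ξ) := by
      intro i j
      rw [← integral_const_mul]
      calc ∫ z, ((GT z j * pd i χ z : ℝ) : ℂ) = ∫ z, invF (k j) z * (pd i χ z : ℂ) := by
            refine integral_congr_ae ((kG' j).mono fun z hz => ?_)
            simp only [← hz]
            push_cast; rfl
        _ = _ := by
            rw [integral_invF_mul (χ := fun z => (pd i χ z : ℂ)) (ki j) (hχ.pd i).integrable.ofReal]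
            congr 1; ext ξ
            rw [hχ.invF_pd]; ring
    have ee := congrArg (fun x : ℝ => (x : ℂ)) (hw.integral_mul_pd_comm hχ)
    simp only [← integral_complex_ofReal] at ee
    rw [e 1 0, e 0 1] at ee
    have hpi : (Real.pi : ℂ) ≠ 0 := by exact_mod_cast Real.pi_ne_zero
    have ee' := mul_left_cancel₀ (neg_ne_zero.2 (mul_ne_zero (mul_ne_zero two_ne_zero hpi)
      Complex.I_ne_zero)) ee
    have hχ2 : MemLp (invF fun z => (χ z : ℂ)) 2 := by
      obtain ⟨η, -, he⟩ := hχ.exists_schwartzMap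
      exact ((𝓕⁻ η).memLp 2 (volume : Measure Plane)).ae_eq (Eventually.of_forall he)
    have hint : ∀ i j, Integrable fun ξ : Plane =>
        invF (fun z => (χ z : ℂ)) ξ * (ξ i * k j ξ) := by
      intro i j
      have hm : AEStronglyMeasurable (fun ξ : Plane => (ξ i : ℂ) * k j ξ) volume :=
        ((Complex.measurable_ofReal.comp (measurable_coord i)).mul (km j)).aestronglyMeasurable
      have h2 : MemLp (fun ξ : Plane => (ξ i : ℂ) * k j ξ) 2 := by
        refine (memLp_norm_mul_wt.const_mul N).of_le hm (Eventually.of_forall fun ξ => ?_)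
        rw [Real.norm_of_nonneg (by have := wt_nonneg ξ; positivity), norm_mul, Complex.norm_real]
        calc _ ≤ ‖ξ‖ * (N * wt ξ) :=
            mul_le_mul (abs_coord_le ξ i) (kb j ξ) (norm_nonneg _) (norm_nonneg _)
          _ = _ := by ring
      exact memLp_one_iff_integrable.1 (h2.mul hχ2)
    simp only [hH, mul_sub]
    rw [integral_sub (hint 1 0) (hint 0 1), ee', sub_self]
  set q : Plane → ℂ := fun ξ => ∑ j, -dir j ξ * k j ξ with hq
  have qm : Measurable q := Finset.measurable_sum _ fun j _ =>
    ((isSymbol_dir j).meas.neg).mul (km j)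
  have qb : ∀ ξ, ‖q ξ‖ ≤ 2 * N * wt ξ := by
    intro ξ
    refine (norm_sum_le _ _).trans ?_
    have : ∀ j, ‖-dir j ξ * k j ξ‖ ≤ N * wt ξ := fun j => by
      rw [norm_mul, norm_neg, ← one_mul (N * wt ξ)]
      exact mul_le_mul ((isSymbol_dir j).bound ξ) (kb j ξ) (norm_nonneg _) zero_le_one
    rw [Fin.sum_univ_two]
    linarith [this 0, this 1]
  have qs : ∀ ξ, q (-ξ) = conj (q ξ) := by
    intro ξ
    rw [hq, map_sum]
    refine Finset.sum_congr rfl fun j _ => ?_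
    rw [map_mul, map_neg, ks, (isSymbol_dir j).symm]
  have hdir : ∀ j, (fun ξ => dir j ξ * q ξ) =ᵐ[volume] k j := by
    intro j
    have h0 : ∀ᵐ ξ : Plane, ξ ≠ 0 := by
      simp [ae_iff, measure_singleton]
    filter_upwards [hcurl, h0] with ξ hξ hξ0
    have hn : ((‖ξ‖ : ℝ) : ℂ) ≠ 0 := by exact_mod_cast (norm_pos_iff.2 hξ0).ne'
    have hns : ((‖ξ‖ : ℝ) : ℂ) ^ 2 = ξ 0 ^ 2 + ξ 1 ^ 2 := by
      have := EuclideanSpace.real_norm_sq_eq ξ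
      rw [Fin.sum_univ_two] at this
      exact_mod_cast this
    have hI := Complex.I_sq
    simp only [hq, Fin.sum_univ_two]
    unfold dir
    field_simp
    fin_cases j
    · simp only [Fin.zero_eta, Fin.isValue]
      rw [hns]
      linear_combination (-(ξ 0 : ℂ) * (ξ 0 * k 0 ξ + ξ 1 * k 1 ξ)) * hI - ξ 1 * hξ
    · simp only [Fin.mk_one, Fin.isValue]
      rw [hns]
      linear_combination (-(ξ 1 : ℂ) * (ξ 0 * k 0 ξ + ξ 1 * k 1 ξ)) * hI + ξ 0 * hξ
  refine ⟨q, qm, qb, qs, ?_⟩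
  have hpm := (Measurable.potential qm).aestronglyMeasurable (μ := (volume : Measure Plane))
  have hcont : Continuous fun z => (WithLp.toLp 2 fun j => (invF (fun ξ => dir j ξ * q ξ) z).re :
      Plane) := by
    refine (PiLp.continuous_toLp 2 _).comp (continuous_pi fun j => ?_)
    refine Complex.continuous_re.comp (continuous_invF ?_)
    exact (ki j).congr (hdir j).symm
  have hpw := hasWeakGradient_of_hasGradientAt (hasGradientAt_potential hpm qb 0) hcont
  have hdiff : HasWeakGradient (fun z => φT z - ((invF (potential q) z).re + 0)) 0 := by
    rw [hasWeakGradient_iff] at hw hpw ⊢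
    refine ⟨hw.1.sub hpw.1, locallyIntegrable_const 0, fun χ hχ j => ?_⟩
    simp only [Pi.zero_apply, PiLp.zero_apply, zero_mul, integral_zero, neg_zero, sub_mul]
    rw [integral_sub (hχ.integrable_pd_mul hw.1 j) (hχ.integrable_pd_mul hpw.1 j), hw.2.2 χ hχ j,
      hpw.2.2 χ hχ j, neg_sub_neg, sub_eq_zero]
    refine integral_congr_ae ((kG' j).mono fun z hz => ?_)
    simp only [invF_congr_ae (hdir j), ← hz, Complex.ofReal_re]
  obtain ⟨c, hc⟩ := hdiff.ae_eq_const
  refine ⟨c, hc.mono fun z hz => ?_⟩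
  simp only at hz
  linarith

/-! ### The solution of the system on the Fourier side -/

/-- The mobility as a polynomial expression in the density. -/
def mobilityPoly (ρ f : ℝ) : Poly :=
  .add (.smul (f ^ 2 - 2 * f * ρ) (.var 0))
    (.add (.smul (ρ - 2 * f) (.mul (.var 0) (.var 0)))
      (.mul (.var 0) (.mul (.var 0) (.var 0))))

/-- The nonlinear terms of the system: the `j`-th one is `∑ i, nonlinearity j i * xᵢ`. -/
def nonlinearity (ρ f κ : ℝ) : Fin 3 → Fin 3 → Poly :=
  ![![.add (.smul (1 / f) (.mul (.var 0) (.var 0))) (.smul (ρ / f - 2) (.var 0)),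
      -- `Poly` has no constant terms, in particular no zero; `.smul 0 (.var 0)` stands for it.
      mobilityPoly ρ f, .smul 0 (.var 0)],
    ![.smul 0 (.var 0), .smul 0 (.var 0), mobilityPoly ρ f],
    ![.smul κ (.var 0),
      .add (.smul (1 / 2 * f ^ 2) (.var 1))
        (.add (.mul (.add (.smul (1 / 2) (.mul (.var 0) (.var 0))) (.smul (-f) (.var 0))) (.var 1))
          (.add (.smul (1 / f) (.mul (.var 0) (.var 0))) (.smul (-2) (.var 0)))),
      .add (.smul (1 / 2 * f ^ 2) (.var 2))
        (.mul (.add (.smul (1 / 2) (.mul (.var 0) (.var 0))) (.smul (-f) (.var 0))) (.var 2))]]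

theorem flux_zero_eq (ρm ρb κ r : ℝ) (p : Plane) :
    flux ρm ρb r p 0 = (sat ρm ρb - 2 * ρb) * r + ρb * sat ρm ρb ^ 2 * p 0 +
      ∑ i, (nonlinearity ρb (sat ρm ρb) κ 0 i).eval ![r, p 0, p 1] *
        (![r, p 0, p 1] : Fin 3 → ℝ) i := by
  simp [flux, nonlinearity, mobilityPoly, Poly.eval, Fin.sum_univ_three, mobility, e₁]
  ring

theorem flux_one_eq (ρm ρb κ r : ℝ) (p : Plane) :
    flux ρm ρb r p 1 = ρb * sat ρm ρb ^ 2 * p 1 +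
      ∑ i, (nonlinearity ρb (sat ρm ρb) κ 1 i).eval ![r, p 0, p 1] *
        (![r, p 0, p 1] : Fin 3 → ℝ) i := by
  simp [flux, nonlinearity, mobilityPoly, Poly.eval, Fin.sum_univ_three, mobility, e₁]
  ring

theorem valueRHS_eq (ρm ρb κ r : ℝ) (p : Plane) :
    valueRHS ρm ρb κ r p = sat ρm ρb * p 0 - 1 / sat ρm ρb * r +
      ∑ i, (nonlinearity ρb (sat ρm ρb) κ 2 i).eval ![r, p 0, p 1] *
        (![r, p 0, p 1] : Fin 3 → ℝ) i := by
  have e := EuclideanSpace.real_norm_sq_eq p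
  rw [Fin.sum_univ_two] at e
  simp [valueRHS, nonlinearity, Poly.eval, Fin.sum_univ_three, e]
  ring

/-- The density and the gradient at a fixed time, from their Fourier transforms. -/
def physGradient (v : Plane → ℂ) (z : Plane) : Plane :=
  WithLp.toLp 2 fun j => (invF (fun ξ => dir j ξ * v ξ) z).re

/-- The Fourier transforms `w` of the density, `v` of `2π|ξ|` times the value function, `Fl` of the
flux and `Ra` of the time derivative of the value function, for a solution of the system. -/
structure IsSpectral (ρm ρb κ σ T c N₀ N₁ R : ℝ) (d q : Plane → ℂ) (w v : ℂ → Plane → ℂ)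
    (Fl : Fin 2 → ℂ → Plane → ℂ) (Ra : ℂ → Plane → ℂ) : Prop where
  hσ : 0 < σ
  hc : 0 < c
  h₀ : 0 ≤ N₀
  h₁ : 0 ≤ N₁
  hR : 0 ≤ R
  hT : 0 < T
  density : Adm σ T c N₀ N₁ R w
  value : Adm σ T c N₀ N₁ R v
  flux : ∀ j, Adm σ T c N₀ N₁ R (Fl j)
  rate : Adm σ T c N₀ N₁ R Ra
  flux_eq : ∀ t : ℝ, t ∈ Icc 0 T → ∀ z j, invF (Fl j t) z =
    (CrowdMFG.flux ρm ρb (invF (w t) z).re (physGradient (v t) z) j : ℝ)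
  rate_eq : ∀ t : ℝ, t ∈ Icc 0 T → ∀ z, invF (Ra t) z =
    (valueRHS ρm ρb κ (invF (w t) z).re (physGradient (v t) z) : ℝ)
  density_deriv : ∀ t ∈ Ioo 0 T, ∀ ξ ≠ 0, HasDerivAt (fun t : ℝ => w t ξ)
    (∑ j, 2 * Real.pi * Complex.I * ξ j * Fl j t ξ) t
  value_deriv : ∀ t ∈ Ioo 0 T, ∀ ξ ≠ 0, HasDerivAt (fun t : ℝ => v t ξ)
    (2 * Real.pi * ‖ξ‖ * Ra t ξ) t
  density_cont : ∀ ξ, ContinuousOn (fun t : ℝ => w t ξ) (Icc 0 T)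
  value_cont : ∀ ξ, ContinuousOn (fun t : ℝ => v t ξ) (Icc 0 T)
  density_zero : ∀ ξ, w (0 : ℝ) ξ = d ξ
  value_end : ∀ ξ ≠ 0, v (T : ℝ) ξ = q ξ

/-- From here on only `IsSpectral` is used: it keeps what physical space needs from the fixed point
and hides the modes. -/
theorem exists_isSpectral {ρm ρb : ℝ} (κ : ℝ) (hρ : 0 < ρb) (hf : ρb < sat ρm ρb) :
    ∃ R : ℝ, 0 < R ∧ ∃ ε : ℝ, 0 < ε ∧ ∀ (T N₀ N₁ : ℝ) (d q : Plane → ℂ), 0 < T → 0 ≤ N₀ → 0 ≤ N₁ →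
      N₀ + N₁ ≤ ε → IsBoundary (rate ρb (sat ρm ρb)) T N₀ N₁ 0 1 d →
      IsBoundary (rate ρb (sat ρm ρb)) T N₀ N₁ T 1 q →
      ∃ w v Fl Ra, IsSpectral ρm ρb κ (aperture ρb (sat ρm ρb)) T (rate ρb (sat ρm ρb)) N₀ N₁ R
        d q w v Fl Ra := by
  set f := sat ρm ρb with hfdef
  have hσ := aperture_pos hρ hf
  have hc := (rate_pos hρ hf).le
  obtain ⟨C, hC, ε, hε, H⟩ := exists_fixedPoint hρ hf (nonlinearity ρb f κ)
  -- Large enough to bound the solution and also its flux and rate: the coefficients are those of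
  -- the linear parts, and the final `1` is the size of the nonlinear sources.
  set R := C * (1 + |f - 2 * ρb| + |ρb * f ^ 2| + |f| + |1 / f|) + 1 with hRdef
  have hR : 0 < R := by positivity
  refine ⟨R, hR, ε, hε, fun T N₀ N₁ d q hT h₀ h₁ hN hd hq => ?_⟩
  obtain ⟨hκ, u, hu, hS, hv, he⟩ := H T N₀ N₁ d q hT h₀ h₁ hN hd hq
  set S : Fin 3 → ℂ → Plane → ℂ := fun j => Poly.fourQuad (nonlinearity ρb f κ j) u with hSdef
  set v := linValue ρb f T d q S with hvdef
  have hCR : C ≤ R := by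
    have : 0 ≤ C * (|f - 2 * ρb| + |ρb * f ^ 2| + |f| + |1 / f|) := by positivity
    rw [hRdef]; linarith
  have a1 := mul_nonneg hC.le (abs_nonneg (f - 2 * ρb))
  have a2 := mul_nonneg hC.le (abs_nonneg (ρb * f ^ 2))
  have a3 := mul_nonneg hC.le (abs_nonneg f)
  have a4 := mul_nonneg hC.le (abs_nonneg (1 / f))
  -- The fixed point equation holds only over the diamond; a neighbourhood of an interior time lies
  -- in it, which is enough to transfer derivatives.
  have hnear : ∀ t ∈ Ioo 0 T, ∀ᶠ s : ℝ in 𝓝 t, (s : ℂ) ∈ diamond (aperture ρb f) T := by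
    intro t ht
    filter_upwards [Ioo_mem_nhds ht.1 ht.2] with s hs
    exact ofReal_mem_diamond hσ (Ioo_subset_Icc_self hs)
  have hw : ∀ t ∈ diamond (aperture ρb f) T, ∀ ξ, u 0 t ξ = linDensity ρb f T d q S t ξ :=
    fun t ht ξ => he 0 t ht ξ
  have hp : ∀ j : Fin 2, ∀ t ∈ diamond (aperture ρb f) T, ∀ ξ,
      u j.succ t ξ = dir j ξ * v t ξ := by
    intro j t ht ξ
    rw [he j.succ t ht ξ]
    fin_cases j <;> rfl
  have hFl : ∀ j, ∀ t ∈ diamond (aperture ρb f) T, ∀ ξ,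
      linFlux ρb f u S j t ξ = linFlux ρb f (linSol ρb f T d q S) S j t ξ := by
    intro j t ht ξ
    unfold linFlux
    rw [he 0 t ht ξ, he 1 t ht ξ, he 2 t ht ξ]
  have hRa : ∀ t ∈ diamond (aperture ρb f) T, ∀ ξ,
      linRate f u S t ξ = linRate f (linSol ρb f T d q S) S t ξ := by
    intro t ht ξ
    unfold linRate
    rw [he 0 t ht ξ, he 1 t ht ξ]
  have hint : ∀ i, ∀ t ∈ diamond (aperture ρb f) T, Integrable (u i t) := fun i t ht =>
    (hu i).integrable hσ hc h₀ h₁ ht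
  have hSint : ∀ j, ∀ t ∈ diamond (aperture ρb f) T, Integrable (S j t) := fun j t ht =>
    (hS j).integrable hσ hc h₀ h₁ ht
  have hreal : ∀ i, ∀ t : ℝ, t ∈ Icc 0 T → ∀ z,
      invF (u i t) z = ((invF (u i t) z).re : ℝ) := fun i t ht z =>
    (ofReal_re_invF ((hu i).symm t ht) z).symm
  have hgrad : ∀ t : ℝ, t ∈ Icc 0 T → ∀ z j,
      physGradient (v t) z j = (invF (u j.succ t) z).re := by
    intro t ht z j
    unfold physGradient
    have : u j.succ t = fun ξ => dir j ξ * v t ξ := funext (hp j t (ofReal_mem_diamond hσ ht))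
    rw [this]
  have hSinv : ∀ j, ∀ t : ℝ, t ∈ Icc 0 T → ∀ z, invF (S j t) z =
      ((∑ i, (nonlinearity ρb f κ j i).eval ![(invF (u 0 t) z).re, physGradient (v t) z 0,
        physGradient (v t) z 1] * (![(invF (u 0 t) z).re, physGradient (v t) z 0,
        physGradient (v t) z 1] : Fin 3 → ℝ) i : ℝ) : ℂ) := by
    intro j t ht z
    have hx : (fun i => invF (u i t) z) = fun i => (((![(invF (u 0 t) z).re,
        physGradient (v t) z 0, physGradient (v t) z 1] : Fin 3 → ℝ) i : ℝ) : ℂ) := by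
      funext i
      rw [hreal i t ht z, hgrad t ht, hgrad t ht]
      fin_cases i <;> rfl
    have hx' := fun i => congrFun hx i
    simp only at hx'
    rw [hSdef]
    simp only
    rw [Poly.invF_fourQuad hu hσ hc h₀ h₁ hκ hC.le _ (ofReal_mem_diamond hσ ht), hx]
    rw [Complex.ofReal_sum]
    refine Finset.sum_congr rfl fun i _ => ?_
    rw [hx' i, Poly.eval_ofReal, Complex.ofReal_mul]
  have hF0 : linFlux ρb f u S 0 = fun t ξ => ((f - 2 * ρb : ℝ) : ℂ) * u 0 t ξ +
      ((ρb * f ^ 2 : ℝ) : ℂ) * u 1 t ξ + S 0 t ξ := by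
    funext t ξ
    simp [linFlux]
  have hF1 : linFlux ρb f u S 1 = fun t ξ => ((ρb * f ^ 2 : ℝ) : ℂ) * u 2 t ξ + S 1 t ξ := by
    funext t ξ
    simp [linFlux]
  have hRe : linRate f u S = fun t ξ => (f : ℂ) * u 1 t ξ - ((1 / f : ℝ) : ℂ) * u 0 t ξ +
      S 2 t ξ := by
    funext t ξ
    simp [linRate]
  refine ⟨u 0, v, linFlux ρb f u S, linRate f u S, ?_⟩
  refine ⟨hσ, rate_pos hρ hf, h₀, h₁, hR.le, hT, (hu 0).mono h₀ h₁ hCR, hv.mono h₀ h₁ hCR,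
    fun j => ?_, ?_, ?_, ?_, ?_, ?_, ?_, ?_, ?_, ?_⟩
  · fin_cases j
    · refine hF0 ▸ ((((hu 0).const_mul (f - 2 * ρb)).add ((hu 1).const_mul (ρb * f ^ 2))).add
        (hS 0)).mono h₀ h₁ (by rw [hRdef]; linarith)
    · refine hF1 ▸ (((hu 2).const_mul (ρb * f ^ 2)).add (hS 1)).mono h₀ h₁ (by rw [hRdef]; linarith)
  · refine hRe ▸ ((((hu 1).const_mul f).sub ((hu 0).const_mul (1 / f))).add
      (hS 2)).mono h₀ h₁ (by rw [hRdef]; linarith)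
  · intro t ht z j
    have htd := ofReal_mem_diamond hσ ht
    have g0 := hgrad t ht z 0
    have g1 := hgrad t ht z 1
    simp only [Fin.succ_zero_eq_one, Fin.succ_one_eq_two] at g0 g1
    fin_cases j
    · change invF (linFlux ρb f u S 0 t) z = (CrowdMFG.flux ρm ρb _ _ 0 : ℝ)
      have i0 := (hint 0 t htd).const_mul ((f - 2 * ρb : ℝ) : ℂ)
      have i1 := (hint 1 t htd).const_mul ((ρb * f ^ 2 : ℝ) : ℂ)
      have i01 : Integrable fun ξ => ((f - 2 * ρb : ℝ) : ℂ) * u 0 t ξ +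
        ((ρb * f ^ 2 : ℝ) : ℂ) * u 1 t ξ := i0.add i1
      rw [flux_zero_eq ρm ρb κ, hF0, invF_add i01 (hSint 0 t htd), invF_add i0 i1, invF_const_mul,
        invF_const_mul, hSinv 0 t ht z, hreal 0 t ht z, hreal 1 t ht z, ← g0]
      simp only [Complex.ofReal_re]
      push_cast
      rfl
    · change invF (linFlux ρb f u S 1 t) z = (CrowdMFG.flux ρm ρb _ _ 1 : ℝ)
      have i2 := (hint 2 t htd).const_mul ((ρb * f ^ 2 : ℝ) : ℂ)
      rw [flux_one_eq ρm ρb κ, hF1, invF_add i2 (hSint 1 t htd), invF_const_mul,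
        hSinv 1 t ht z, hreal 2 t ht z, ← g1]
      push_cast
      rfl
  · intro t ht z
    have htd := ofReal_mem_diamond hσ ht
    have g0 := hgrad t ht z 0
    simp only [Fin.succ_zero_eq_one] at g0
    have i0 := (hint 1 t htd).const_mul (f : ℂ)
    have i1 := (hint 0 t htd).const_mul ((-(1 / f) : ℝ) : ℂ)
    have i01 : Integrable fun ξ => (f : ℂ) * u 1 t ξ + ((-(1 / f) : ℝ) : ℂ) * u 0 t ξ := i0.add i1
    have e : linRate f u S t = fun ξ => ((f : ℂ) * u 1 t ξ + ((-(1 / f) : ℝ) : ℂ) * u 0 t ξ) +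
        S 2 t ξ := by
      funext ξ
      unfold linRate
      push_cast
      ring
    rw [valueRHS_eq, e, invF_add i01 (hSint 2 t htd), invF_add i0 i1, invF_const_mul,
      invF_const_mul, hSinv 2 t ht z, hreal 0 t ht z, hreal 1 t ht z, ← g0]
    simp only [Complex.ofReal_re]
    push_cast
    ring
  · intro t ht ξ hξ
    have htd := ofReal_mem_diamond hσ (Ioo_subset_Icc_self ht)
    have e : ∑ j, 2 * Real.pi * Complex.I * ξ j * linFlux ρb f u S j t ξ = _ :=
      Finset.sum_congr rfl fun j _ => by rw [hFl j _ htd ξ]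
    rw [e]
    exact (hasDerivAt_linDensity hρ hf h₀ h₁ zero_le_one hS ht hξ).congr_of_eventuallyEq
      ((hnear t ht).mono fun s hs => hw s hs ξ)
  · intro t ht ξ hξ
    have htd := ofReal_mem_diamond hσ (Ioo_subset_Icc_self ht)
    rw [hRa _ htd]
    exact hasDerivAt_linValue hρ hf h₀ h₁ zero_le_one hS ht hξ
  · intro ξ
    exact (continuousOn_linDensity hρ hf hT.le h₀ h₁ zero_le_one hS ξ).congr fun t ht =>
      hw t (ofReal_mem_diamond hσ ht) ξ
  · exact continuousOn_linValue hρ hf hT.le h₀ h₁ zero_le_one hS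
  · intro ξ
    rw [hw _ (ofReal_mem_diamond hσ ⟨le_rfl, hT.le⟩) ξ, linDensity_zero]
  · exact fun ξ hξ => linValue_end hρ hf hξ

/-! ### The solution in physical space -/

theorem Adm.measurable_real {σ T c N₀ N₁ R : ℝ} {s : ℂ → Plane → ℂ} (h : Adm σ T c N₀ N₁ R s) :
    Measurable fun w : ℝ × Plane => s w.1 w.2 :=
  h.meas.comp ((Complex.measurable_ofReal.comp measurable_fst).prodMk measurable_snd)

theorem measurable_invF {r : ℝ → Plane → ℂ} (hr : Measurable fun w : ℝ × Plane => r w.1 w.2) :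
    Measurable fun w : ℝ × Plane => invF (r w.1) w.2 := by
  have m1 : Measurable fun x : (ℝ × Plane) × Plane => wave x.1.2 x.2 := by
    unfold wave
    fun_prop
  have mr : Measurable fun x : (ℝ × Plane) × Plane => (x.1.1, x.2) := by fun_prop
  have m2 : Measurable fun x : (ℝ × Plane) × Plane => r x.1.1 x.2 := hr.comp mr
  have m3 : StronglyMeasurable (fun x : (ℝ × Plane) × Plane => wave x.1.2 x.2 * r x.1.1 x.2) :=
    (m1.mul m2).stronglyMeasurable
  have m4 := m3.integral_prod_right' (ν := (volume : Measure Plane))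
  exact m4.measurable

theorem IsTestFunction.integrable_ofReal {χ : Plane → ℝ} (hχ : IsTestFunction χ) :
    Integrable fun z => (χ z : ℂ) := hχ.integrable.ofReal

/-- Fubini's theorem for a time integral on the Fourier side, tested against `χ`. -/
theorem integral_intervalIntegral_mul_invF {r : ℝ → Plane → ℂ} {a b M : ℝ} (hab : a ≤ b)
    (hr : Measurable fun w : ℝ × Plane => r w.1 w.2)
    (hb : ∀ s ∈ Icc a b, ∀ ξ, ‖r s ξ‖ ≤ M * wt ξ) {χ : Plane → ℂ} (hχ : Integrable χ) :
    IntervalIntegrable (fun s => ∫ z, invF (r s) z * χ z) volume a b ∧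
      Integrable (fun ξ => (∫ s in a..b, r s ξ) * invF χ ξ) ∧
      ∫ ξ, (∫ s in a..b, r s ξ) * invF χ ξ = ∫ s in a..b, ∫ z, invF (r s) z * χ z := by
  have hi : ∀ s ∈ Icc a b, Integrable (r s) := fun s hs =>
    (integrable_wt.const_mul M).mono' (hr.comp measurable_prodMk_left).aestronglyMeasurable
      (Eventually.of_forall (hb s hs))
  have hX := continuous_invF hχ
  set B := ∫ z, ‖χ z‖ with hB
  have hprod : Integrable (fun w : ℝ × Plane => r w.1 w.2 * invF χ w.2)
      ((volume.restrict (Ioc a b)).prod volume) := by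
    have hdom : Integrable (fun w : ℝ × Plane => (1 : ℝ) * (M * wt w.2 * B))
        ((volume.restrict (Ioc a b)).prod volume) :=
      (integrable_const (1 : ℝ)).mul_prod ((integrable_wt.const_mul M).mul_const B)
    refine hdom.mono' (hr.mul (hX.measurable.comp measurable_snd)).aestronglyMeasurable ?_
    have hmem : ∀ᵐ w : ℝ × Plane ∂((volume.restrict (Ioc a b)).prod volume), w.1 ∈ Ioc a b :=
      Measure.quasiMeasurePreserving_fst.ae (ae_restrict_mem measurableSet_Ioc)
    filter_upwards [hmem] with w hw
    rw [norm_mul, one_mul]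
    exact mul_le_mul (hb _ (Ioc_subset_Icc_self hw) _) (norm_invF_le χ _) (norm_nonneg _)
      ((norm_nonneg _).trans (hb _ (Ioc_subset_Icc_self hw) _))
  have hin : ∀ s ∈ Icc a b, ∫ ξ, r s ξ * invF χ ξ = ∫ z, invF (r s) z * χ z := fun s hs =>
    (integral_invF_mul (hi s hs) hχ).symm
  have hleft : ∀ ξ, (∫ s in a..b, r s ξ) * invF χ ξ =
      ∫ s in Ioc a b, r s ξ * invF χ ξ := fun ξ => by
    rw [intervalIntegral.integral_of_le hab, integral_mul_const]
  refine ⟨?_, ?_, ?_⟩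
  · rw [intervalIntegrable_iff_integrableOn_Ioc_of_le hab]
    refine hprod.integral_prod_left.congr ?_
    filter_upwards [ae_restrict_mem measurableSet_Ioc] with s hs
    exact hin s (Ioc_subset_Icc_self hs)
  · simp only [hleft]
    exact hprod.integral_prod_right
  · simp only [hleft]
    rw [intervalIntegral.integral_of_le hab, ← integral_integral_swap hprod]
    refine setIntegral_congr_fun measurableSet_Ioc fun s hs => ?_
    exact hin s (Ioc_subset_Icc_self hs)

/-- The density with Fourier transform `w`. -/
def physDensity (w : ℂ → Plane → ℂ) (t : ℝ) (z : Plane) : ℝ := (invF (w t) z).re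

/-- The value function with Fourier transform `v / (2π|ξ|)`, up to the constant `C`. -/
def physValue (v : ℂ → Plane → ℂ) (C : ℝ) (t : ℝ) (z : Plane) : ℝ :=
  (invF (potential (v t)) z).re + C

namespace IsSpectral

variable {ρm ρb κ σ T c N₀ N₁ R : ℝ} {d q : Plane → ℂ} {w v : ℂ → Plane → ℂ}
  {Fl : Fin 2 → ℂ → Plane → ℂ} {Ra : ℂ → Plane → ℂ}

theorem mem_diamond (h : IsSpectral ρm ρb κ σ T c N₀ N₁ R d q w v Fl Ra) {t : ℝ}
    (ht : t ∈ Icc 0 T) : (t : ℂ) ∈ diamond σ T := ofReal_mem_diamond h.hσ ht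

theorem bound_wt (h : IsSpectral ρm ρb κ σ T c N₀ N₁ R d q w v Fl Ra) {s : ℂ → Plane → ℂ}
    (hs : Adm σ T c N₀ N₁ R s) {t : ℂ} (ht : t ∈ diamond σ T) (ξ : Plane) :
    ‖s t ξ‖ ≤ R * (N₀ + N₁) * wt ξ := by
  rw [mul_assoc]
  exact hs.bound_wt h.hσ h.hc.le h.h₀ h.h₁ h.hR ht ξ

theorem integrable (h : IsSpectral ρm ρb κ σ T c N₀ N₁ R d q w v Fl Ra) {s : ℂ → Plane → ℂ}
    (hs : Adm σ T c N₀ N₁ R s) {t : ℝ} (ht : t ∈ Icc 0 T) : Integrable (s t) :=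
  hs.integrable h.hσ h.hc.le h.h₀ h.h₁ (h.mem_diamond ht)

theorem ofReal_physDensity (h : IsSpectral ρm ρb κ σ T c N₀ N₁ R d q w v Fl Ra) {t : ℝ}
    (ht : t ∈ Icc 0 T) (z : Plane) : (physDensity w t z : ℂ) = invF (w t) z :=
  ofReal_re_invF (h.density.symm t ht) z

theorem aestronglyMeasurable_potential (h : IsSpectral ρm ρb κ σ T c N₀ N₁ R d q w v Fl Ra)
    (t : ℂ) : AEStronglyMeasurable (potential (v t)) volume :=
  (Measurable.potential (h.value.measurable_right t)).aestronglyMeasurable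

theorem integrable_potential (h : IsSpectral ρm ρb κ σ T c N₀ N₁ R d q w v Fl Ra) {t : ℂ}
    (ht : t ∈ diamond σ T) : Integrable (potential (v t)) :=
  CrowdMFG.integrable_potential (h.aestronglyMeasurable_potential t) (h.bound_wt h.value ht)

theorem ofReal_physValue (h : IsSpectral ρm ρb κ σ T c N₀ N₁ R d q w v Fl Ra) (C : ℝ) {t : ℝ}
    (ht : t ∈ Icc 0 T) (z : Plane) :
    (physValue v C t z : ℂ) = invF (potential (v t)) z + C := by
  unfold physValue
  rw [Complex.ofReal_add, ofReal_re_invF (potential_symm (h.value.symm t ht))]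

theorem hasGradientAt_physValue (h : IsSpectral ρm ρb κ σ T c N₀ N₁ R d q w v Fl Ra) (C : ℝ)
    {t : ℝ} (ht : t ∈ Icc 0 T) (z : Plane) :
    HasGradientAt (physValue v C t) (physGradient (v t) z) z :=
  hasGradientAt_potential (h.aestronglyMeasurable_potential t)
    (h.bound_wt h.value (h.mem_diamond ht)) C z

theorem gradient_physValue (h : IsSpectral ρm ρb κ σ T c N₀ N₁ R d q w v Fl Ra) (C : ℝ)
    {t : ℝ} (ht : t ∈ Icc 0 T) : ∇ (physValue v C t) = physGradient (v t) :=
  funext fun z => (h.hasGradientAt_physValue C ht z).gradient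

theorem adm_dir (h : IsSpectral ρm ρb κ σ T c N₀ N₁ R d q w v Fl Ra) (j : Fin 2) :
    Adm σ T c N₀ N₁ R fun t ξ => dir j ξ * v t ξ := by
  have := h.value.symbol_mul (isSymbol_dir j).meas (isSymbol_dir j).bound (isSymbol_dir j).symm
  rwa [one_mul] at this

theorem continuous_physDensity (h : IsSpectral ρm ρb κ σ T c N₀ N₁ R d q w v Fl Ra) {t : ℝ}
    (ht : t ∈ Icc 0 T) : Continuous (physDensity w t) :=
  Complex.continuous_re.comp (continuous_invF (h.integrable h.density ht))

theorem continuous_physGradient (h : IsSpectral ρm ρb κ σ T c N₀ N₁ R d q w v Fl Ra) {t : ℝ}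
    (ht : t ∈ Icc 0 T) : Continuous (physGradient (v t)) :=
  (PiLp.continuous_toLp 2 _).comp (continuous_pi fun j =>
    Complex.continuous_re.comp (continuous_invF (h.integrable (h.adm_dir j) ht)))

theorem measurable_physDensity (h : IsSpectral ρm ρb κ σ T c N₀ N₁ R d q w v Fl Ra) :
    Measurable fun x : ℝ × Plane => physDensity w x.1 x.2 :=
  Complex.measurable_re.comp (measurable_invF (r := fun t : ℝ => w t) h.density.measurable_real)

theorem measurable_physGradient (h : IsSpectral ρm ρb κ σ T c N₀ N₁ R d q w v Fl Ra) :
    Measurable fun x : ℝ × Plane => physGradient (v x.1) x.2 := by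
  refine (PiLp.continuous_toLp 2 fun _ : Fin 2 => ℝ).measurable.comp
    (measurable_pi_lambda _ fun j => ?_)
  exact Complex.measurable_re.comp (measurable_invF
    (r := fun t : ℝ => fun ξ => dir j ξ * v t ξ) (h.adm_dir j).measurable_real)

theorem hasWeakGradient_physValue (h : IsSpectral ρm ρb κ σ T c N₀ N₁ R d q w v Fl Ra) (C : ℝ)
    {t : ℝ} (ht : t ∈ Icc 0 T) : HasWeakGradient (physValue v C t) (physGradient (v t)) :=
  hasWeakGradient_of_hasGradientAt (h.hasGradientAt_physValue C ht) (h.continuous_physGradient ht)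

theorem physDensity_zero (h : IsSpectral ρm ρb κ σ T c N₀ N₁ R d q w v Fl Ra) :
    physDensity w 0 = fun z => (invF d z).re := by
  have : w (0 : ℝ) = d := funext h.density_zero
  funext z
  rw [physDensity, this]

theorem ae_ne_zero : ∀ᵐ ξ : Plane, ξ ≠ 0 := by
  simp [ae_iff, measure_singleton]

theorem physValue_end (h : IsSpectral ρm ρb κ σ T c N₀ N₁ R d q w v Fl Ra) (C : ℝ) :
    physValue v C T = fun z => (invF (potential q) z).re + C := by
  have : potential (v (T : ℝ)) =ᵐ[volume] potential q := by
    filter_upwards [ae_ne_zero] with ξ hξ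
    rw [potential, potential, h.value_end ξ hξ]
  funext z
  rw [physValue, invF_congr_ae this]

/-- The ODE at each nonzero frequency is integrated in time, multiplied by the transform of `χ` and
integrated in `ξ`; Fubini and duality return to physical space. -/
theorem integral_mul_physDensity (h : IsSpectral ρm ρb κ σ T c N₀ N₁ R d q w v Fl Ra)
    {χ : Plane → ℝ} (hχ : IsTestFunction χ) {t : ℝ} (ht : t ∈ Icc 0 T) :
    ∫ z, physDensity w t z * χ z = (∫ z, physDensity w 0 z * χ z)
      - ∫ s in (0 : ℝ)..t, ∫ z, inner ℝ (CrowdMFG.flux ρm ρb (physDensity w s z)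
        (physGradient (v s) z)) (∇ χ z) := by
  have h0T : (0 : ℝ) ∈ Icc 0 T := ⟨le_rfl, h.hT.le⟩
  have hsub : Icc 0 t ⊆ Icc 0 T := Icc_subset_Icc_right ht.2
  have hF := fun j : Fin 2 => integral_intervalIntegral_mul_invF (r := fun s : ℝ => Fl j s)
    (M := R * (N₀ + N₁)) ht.1 (h.flux j).measurable_real
    (fun s hs ξ => h.bound_wt (h.flux j) (h.mem_diamond (hsub hs)) ξ) (hχ.pd j).integrable_ofReal
  have htest : ∀ s ∈ Icc 0 T, ((∫ z, physDensity w s z * χ z : ℝ) : ℂ) =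
      ∫ ξ, w s ξ * invF (fun z => (χ z : ℂ)) ξ := by
    intro s hs
    rw [← integral_invF_mul (h.integrable h.density hs) hχ.integrable_ofReal,
      ← integral_complex_ofReal]
    congr 1; ext z
    rw [Complex.ofReal_mul, h.ofReal_physDensity hs]
  have hflux : ∀ s ∈ Icc 0 T, ((∫ z, inner ℝ (CrowdMFG.flux ρm ρb (physDensity w s z)
      (physGradient (v s) z)) (∇ χ z) : ℝ) : ℂ) =
      ∑ j, ∫ z, invF (Fl j s) z * (pd j χ z : ℂ) := by
    intro s hs
    have hi : ∀ j, Integrable fun z => invF (Fl j s) z * (pd j χ z : ℂ) := fun j =>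
      (hχ.pd j).integrable_ofReal.bdd_mul
        (continuous_invF (h.integrable (h.flux j) hs)).aestronglyMeasurable
        (Eventually.of_forall fun z => norm_invF_le (Fl j s) z)
    rw [← integral_finsetSum _ fun j _ => hi j, ← integral_complex_ofReal]
    congr 1; ext z
    rw [PiLp.inner_apply, Complex.ofReal_sum]
    refine Finset.sum_congr rfl fun j _ => ?_
    rw [h.flux_eq s hs, hχ.gradient_apply, ← Complex.ofReal_mul]
    simp [physDensity, mul_comm]
  -- Fundamental theorem of calculus at fixed frequency: continuity up to the endpoints and the
  -- derivative inside suffice. By `invF_pd` the multiplier `2πi ξ j` becomes minus a derivative of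
  -- `χ`.
  have hinc : ∀ᵐ ξ : Plane, w t ξ * invF (fun z => (χ z : ℂ)) ξ =
      w (0 : ℝ) ξ * invF (fun z => (χ z : ℂ)) ξ -
        ∑ j, (∫ s in (0 : ℝ)..t, Fl j s ξ) * invF (fun z => (pd j χ z : ℂ)) ξ := by
    filter_upwards [ae_ne_zero] with ξ hξ
    have hint : ∀ j, IntervalIntegrable (fun s : ℝ => Fl j s ξ) volume 0 t := fun j =>
      (h.flux j).intervalIntegrable h.hσ h.hc.le h.h₀ h.h₁ h.hR h0T ht ξ
    have hsum : IntervalIntegrable (fun s : ℝ => ∑ j, 2 * Real.pi * Complex.I * ξ j * Fl j s ξ)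
        volume 0 t := by
      simp only [Fin.sum_univ_two]
      exact ((hint 0).const_mul _).add ((hint 1).const_mul _)
    have e := intervalIntegral.integral_eq_sub_of_hasDerivAt_of_le ht.1
      ((h.density_cont ξ).mono hsub)
      (fun s hs => h.density_deriv s ⟨hs.1, hs.2.trans_le ht.2⟩ ξ hξ)
      hsum
    rw [intervalIntegral.integral_finsetSum fun j _ => (hint j).const_mul _] at e
    simp only [intervalIntegral.integral_const_mul] at e
    simp only [hχ.invF_pd]
    simp only [Fin.sum_univ_two] at e ⊢
    linear_combination -(invF (fun z => (χ z : ℂ)) ξ) * e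
  have iw : ∀ s ∈ Icc 0 T, Integrable fun ξ => w s ξ * invF (fun z => (χ z : ℂ)) ξ := fun s hs =>
    (h.integrable h.density hs).mul_bdd
      (continuous_invF hχ.integrable_ofReal).aestronglyMeasurable
      (Eventually.of_forall (norm_invF_le _))
  have e1 : ((∫ z, physDensity w t z * χ z : ℝ) : ℂ) =
      ((∫ z, physDensity w 0 z * χ z : ℝ) : ℂ) - ((∫ s in (0 : ℝ)..t, ∫ z,
        inner ℝ (CrowdMFG.flux ρm ρb (physDensity w s z) (physGradient (v s) z)) (∇ χ z) : ℝ) : ℂ) := by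
    rw [htest t ht, htest 0 h0T, integral_congr_ae hinc,
      integral_sub (iw 0 h0T) (integrable_finsetSum _ fun j _ => (hF j).2.1),
      integral_finsetSum _ fun j _ => (hF j).2.1]
    congr 1
    simp only [fun j => (hF j).2.2]
    rw [← intervalIntegral.integral_finsetSum fun j _ => (hF j).1,
      ← intervalIntegral.integral_ofReal]
    refine intervalIntegral.integral_congr fun s hs => ?_
    rw [uIcc_of_le ht.1] at hs
    exact (hflux s (hsub hs)).symm
  exact_mod_cast e1

theorem integral_mul_physValue (h : IsSpectral ρm ρb κ σ T c N₀ N₁ R d q w v Fl Ra) (C : ℝ)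
    {χ : Plane → ℝ} (hχ : IsTestFunction χ) {t : ℝ} (ht : t ∈ Icc 0 T) :
    ∫ z, physValue v C t z * χ z = (∫ z, physValue v C T z * χ z)
      - ∫ s in t..T, ∫ z, valueRHS ρm ρb κ (physDensity w s z) (physGradient (v s) z) * χ z := by
  have hTT : T ∈ Icc 0 T := ⟨h.hT.le, le_rfl⟩
  have hsub : Icc t T ⊆ Icc 0 T := Icc_subset_Icc_left ht.1
  have hF := integral_intervalIntegral_mul_invF (r := fun s : ℝ => Ra s)
    (M := R * (N₀ + N₁)) ht.2 h.rate.measurable_real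
    (fun s hs ξ => h.bound_wt h.rate (h.mem_diamond (hsub hs)) ξ) hχ.integrable_ofReal
  have htest : ∀ s ∈ Icc 0 T, ((∫ z, physValue v C s z * χ z : ℝ) : ℂ) =
      (∫ ξ, potential (v s) ξ * invF (fun z => (χ z : ℂ)) ξ) + ∫ z, (C : ℂ) * χ z := by
    intro s hs
    have hi := h.integrable_potential (h.mem_diamond hs)
    have i1 : Integrable fun z => invF (potential (v s)) z * (χ z : ℂ) :=
      hχ.integrable_ofReal.bdd_mul (continuous_invF hi).aestronglyMeasurable
        (Eventually.of_forall fun z => norm_invF_le _ z)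
    rw [← integral_invF_mul hi hχ.integrable_ofReal,
      ← integral_add i1 (hχ.integrable_ofReal.const_mul _), ← integral_complex_ofReal]
    congr 1; ext z
    rw [Complex.ofReal_mul, h.ofReal_physValue C hs]
    ring
  have hrate : ∀ s ∈ Icc 0 T, ((∫ z, valueRHS ρm ρb κ (physDensity w s z)
      (physGradient (v s) z) * χ z : ℝ) : ℂ) = ∫ z, invF (Ra s) z * (χ z : ℂ) := by
    intro s hs
    rw [← integral_complex_ofReal]
    congr 1; ext z
    rw [h.rate_eq s hs, ← Complex.ofReal_mul]
    rfl
  -- The factor `2π‖ξ‖` in the ODE of `v` cancels against the division in `potential`, so no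
  -- derivative falls on `χ`.
  have hinc : ∀ᵐ ξ : Plane, potential (v t) ξ * invF (fun z => (χ z : ℂ)) ξ =
      potential (v T) ξ * invF (fun z => (χ z : ℂ)) ξ -
        (∫ s in t..T, Ra s ξ) * invF (fun z => (χ z : ℂ)) ξ := by
    filter_upwards [ae_ne_zero] with ξ hξ
    have hpi : (Real.pi : ℂ) ≠ 0 := by exact_mod_cast Real.pi_ne_zero
    have hn : ((‖ξ‖ : ℝ) : ℂ) ≠ 0 := by exact_mod_cast (norm_pos_iff.2 hξ).ne'
    have hint : IntervalIntegrable (fun s : ℝ => Ra s ξ) volume t T :=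
      h.rate.intervalIntegrable h.hσ h.hc.le h.h₀ h.h₁ h.hR ht hTT ξ
    have e := intervalIntegral.integral_eq_sub_of_hasDerivAt_of_le ht.2
      ((h.value_cont ξ).mono hsub)
      (fun s hs => h.value_deriv s ⟨ht.1.trans_lt hs.1, hs.2⟩ ξ hξ) (hint.const_mul _)
    rw [intervalIntegral.integral_const_mul] at e
    unfold potential
    push_cast
    field_simp
    linear_combination (invF (fun z => (χ z : ℂ)) ξ) * e
  have iw : ∀ s ∈ Icc 0 T, Integrable fun ξ =>
      potential (v s) ξ * invF (fun z => (χ z : ℂ)) ξ := fun s hs =>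
    (h.integrable_potential (h.mem_diamond hs)).mul_bdd
      (continuous_invF hχ.integrable_ofReal).aestronglyMeasurable
      (Eventually.of_forall (norm_invF_le _))
  have e1 : ((∫ z, physValue v C t z * χ z : ℝ) : ℂ) =
      ((∫ z, physValue v C T z * χ z : ℝ) : ℂ) - ((∫ s in t..T, ∫ z,
        valueRHS ρm ρb κ (physDensity w s z) (physGradient (v s) z) * χ z : ℝ) : ℂ) := by
    rw [htest t ht, htest T hTT, integral_congr_ae hinc, integral_sub (iw T hTT) hF.2.1, hF.2.2,
      sub_add_eq_add_sub]
    congr 1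
    rw [← intervalIntegral.integral_ofReal]
    refine intervalIntegral.integral_congr fun s hs => ?_
    rw [uIcc_of_le ht.2] at hs
    exact (hrate s (hsub hs)).symm
  exact_mod_cast e1

end IsSpectral

/-! ### Divergences -/

section Divergence

variable {V W : Plane → Plane} {z : Plane}

theorem divergence_add (hV : DifferentiableAt ℝ V z) (hW : DifferentiableAt ℝ W z) :
    divergence (fun y => V y + W y) z = divergence V z + divergence W z := by
  unfold divergence
  rw [fderiv_fun_add hV hW, ← Finset.sum_add_distrib]
  rfl

theorem divergence_const_smul (hV : DifferentiableAt ℝ V z) (a : ℝ) :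
    divergence (fun y => a • V y) z = a * divergence V z := by
  unfold divergence
  rw [fderiv_fun_const_smul hV, Finset.mul_sum]
  rfl

theorem divergence_smul_e₁ {g : Plane → ℝ} (hg : DifferentiableAt ℝ g z) :
    divergence (fun y => g y • e₁) z = dx g z := by
  unfold divergence
  rw [fderiv_smul_const hg, Fin.sum_univ_two]
  simp [e₁, dx]

theorem divergence_eq_sum (hV : DifferentiableAt ℝ V z) :
    divergence V z = ∑ i, pd i (fun y => V y i) z := by
  refine Finset.sum_congr rfl fun i _ => ?_
  have h := ((EuclideanSpace.proj (𝕜 := ℝ) i).hasFDerivAt (x := V z)).comp z hV.hasFDerivAt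
  have e : fderiv ℝ (fun y => V y i) z = (EuclideanSpace.proj (𝕜 := ℝ) i).comp (fderiv ℝ V z) :=
    h.fderiv
  rw [pd, e]
  rfl

theorem laplacian_eq_divergence {φ : Plane → ℝ} (hφ : ∀ z, HasGradientAt φ (V z) z)
    (hV : DifferentiableAt ℝ V z) : (Δ φ) z = divergence V z := by
  have e : fderiv ℝ φ = fun y => innerSL ℝ (V y) := funext fun y => (hφ y).hasFDerivAt.fderiv
  have h := ((innerSL ℝ (E := Plane)).hasFDerivAt (x := V z)).comp z hV.hasFDerivAt
  have e2 : fderiv ℝ (fun y => innerSL ℝ (V y)) z = (innerSL ℝ (E := Plane)).comp (fderiv ℝ V z) :=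
    h.fderiv
  rw [InnerProductSpace.laplacian_eq_iteratedFDeriv_orthonormalBasis φ
    (EuclideanSpace.basisFun (Fin 2) ℝ)]
  refine Finset.sum_congr rfl fun i _ => ?_
  rw [iteratedFDeriv_two_apply, e, e2]
  simp [EuclideanSpace.inner_single_right]

/-- Links the pointwise equation, written term by term, with the flux form used on the Fourier side
and in the weak formulation. -/
theorem densityRHS_eq_divergence (ρm ρb : ℝ) {ψ φ : Plane → ℝ}
    (hφ : ∀ z, HasGradientAt φ (V z) z) (hψ : DifferentiableAt ℝ ψ z)
    (hV : DifferentiableAt ℝ V z) :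
    densityRHS ρm ρb ψ φ z = divergence (fun y => flux ρm ρb (ψ y) (V y)) z := by
  have hg : ∇ φ = V := funext fun y => (hφ y).gradient
  have hm : DifferentiableAt ℝ (fun y => mobility ρm ρb (ψ y)) z := by
    unfold mobility
    fun_prop
  have h3 : DifferentiableAt ℝ (fun y => ψ y ^ 3) z := hψ.pow 3
  have h2 : DifferentiableAt ℝ (fun y => ψ y ^ 2) z := hψ.pow 2
  have e : (fun y => flux ρm ρb (ψ y) (V y)) = fun y =>
      ((((sat ρm ρb - 2 * ρb) • (ψ y • e₁) + (ρb * sat ρm ρb ^ 2) • V y)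
        + mobility ρm ρb (ψ y) • V y) + (1 / sat ρm ρb) • (ψ y ^ 3 • e₁))
        + (ρb / sat ρm ρb - 2) • (ψ y ^ 2 • e₁) := by
    funext y
    unfold flux
    module
  have d1 : DifferentiableAt ℝ (fun y => ψ y • e₁) z := hψ.smul_const _
  have d2 : DifferentiableAt ℝ (fun y => mobility ρm ρb (ψ y) • V y) z := hm.smul hV
  have d3 : DifferentiableAt ℝ (fun y => ψ y ^ 3 • e₁) z := h3.smul_const _
  have d4 : DifferentiableAt ℝ (fun y => ψ y ^ 2 • e₁) z := h2.smul_const _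
  have c1 := d1.fun_const_smul (sat ρm ρb - 2 * ρb)
  have c2 := hV.fun_const_smul (ρb * sat ρm ρb ^ 2)
  have c3 := d3.fun_const_smul (1 / sat ρm ρb)
  have c4 := d4.fun_const_smul (ρb / sat ρm ρb - 2)
  rw [e, divergence_add (((c1.fun_add c2).fun_add d2).fun_add c3) c4,
    divergence_add ((c1.fun_add c2).fun_add d2) c3, divergence_add (c1.fun_add c2) d2,
    divergence_add c1 c2, divergence_const_smul d1, divergence_const_smul hV,
    divergence_const_smul d3, divergence_const_smul d4, divergence_smul_e₁ hψ,
    divergence_smul_e₁ h3, divergence_smul_e₁ h2, ← laplacian_eq_divergence hφ hV, densityRHS, hg]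

end Divergence

/-! ### Regularity at interior times -/

/-- The integral is differentiated in complex time, where no bound on the derivative is required,
and then restricted to real time. The derivative of the integrand needs to be identified only for
almost every `ξ`. -/
theorem hasDerivAt_re_invF {s : ℂ → Plane → ℂ} {U : Set ℂ} (hU : IsOpen U)
    (hm : ∀ t ∈ U, AEStronglyMeasurable (s t) volume)
    (hd : ∀ ξ, DifferentiableOn ℂ (fun t => s t ξ) U) {B : Plane → ℝ} (hB : Integrable B)
    (hb : ∀ ξ, ∀ t ∈ U, ‖s t ξ‖ ≤ B ξ) {t : ℝ} (ht : (t : ℂ) ∈ U) {s' : Plane → ℂ}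
    (hs' : ∀ᵐ ξ, HasDerivAt (fun t : ℝ => s t ξ) (s' ξ) t) (z : Plane) :
    HasDerivAt (fun t : ℝ => (invF (s t) z).re) (invF s' z).re t := by
  have h := hasDerivAt_integral_of_differentiableOn (ν := (volume : Measure Plane))
    (f := fun t ξ => wave z ξ * s t ξ) hU
    (fun t ht => (continuous_wave_right z).aestronglyMeasurable.mul (hm t ht))
    (Eventually.of_forall fun ξ => (hd ξ).const_mul _) hB
    (Eventually.of_forall fun ξ t ht => by rw [norm_mul, norm_wave, one_mul]; exact hb ξ t ht) ht
  have e : ∫ ξ, deriv (fun t => wave z ξ * s t ξ) (t : ℂ) = invF s' z := by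
    refine integral_congr_ae (hs'.mono fun ξ hξ => ?_)
    have h1 := ((hd ξ).differentiableAt (hU.mem_nhds ht)).hasDerivAt
    have h2 := h1.comp_ofReal.unique hξ
    simp only
    rw [(h1.const_mul (wave z ξ)).deriv, h2]
  rw [e] at h
  exact h.real_of_complex

/-- At distance `m` from both ends each exponential of the envelope is at most `e^{-cm‖ξ‖}`. This
gain yields smoothness and analyticity at interior times. -/
theorem env_mul_exp_le_wt {c T N₀ N₁ x m : ℝ} (hc : 0 ≤ c) (h₀ : 0 ≤ N₀) (h₁ : 0 ≤ N₁)
    (hx : m ≤ x) (hx' : x ≤ T - m) (ξ : Plane) :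
    env c T N₀ N₁ x ξ * Real.exp (c * m * ‖ξ‖) ≤ (N₀ + N₁) * wt ξ := by
  have hw := wt_nonneg ξ
  have hξ := mul_nonneg hc (norm_nonneg ξ)
  unfold env
  rw [mul_right_comm]
  refine mul_le_mul_of_nonneg_right ?_ hw
  rw [add_mul, mul_assoc N₀, mul_assoc N₁, ← Real.exp_add, ← Real.exp_add]
  have e1 : Real.exp (-c * x * ‖ξ‖ + c * m * ‖ξ‖) ≤ 1 := by
    rw [Real.exp_le_one_iff]; nlinarith
  have e2 : Real.exp (-c * (T - x) * ‖ξ‖ + c * m * ‖ξ‖) ≤ 1 := by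
    rw [Real.exp_le_one_iff]; nlinarith
  nlinarith

namespace IsSpectral

variable {ρm ρb κ σ T c N₀ N₁ R : ℝ} {d q : Plane → ℂ} {w v : ℂ → Plane → ℂ}
  {Fl : Fin 2 → ℂ → Plane → ℂ} {Ra : ℂ → Plane → ℂ}

theorem norm_mul_exp_le (h : IsSpectral ρm ρb κ σ T c N₀ N₁ R d q w v Fl Ra) {s : ℂ → Plane → ℂ}
    (hs : Adm σ T c N₀ N₁ R s) {m : ℝ} {t : ℂ} (ht : t ∈ diamond σ T) (h1 : m ≤ t.re)
    (h2 : t.re ≤ T - m) (ξ : Plane) :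
    ‖s t ξ‖ * Real.exp (c * m * ‖ξ‖) ≤ R * (N₀ + N₁) * wt ξ := by
  calc _ ≤ R * env c T N₀ N₁ t.re ξ * Real.exp (c * m * ‖ξ‖) :=
        mul_le_mul_of_nonneg_right (hs.bound t ht ξ) (Real.exp_nonneg _)
    _ = R * (env c T N₀ N₁ t.re ξ * Real.exp (c * m * ‖ξ‖)) := by ring
    _ ≤ R * ((N₀ + N₁) * wt ξ) :=
        mul_le_mul_of_nonneg_left (env_mul_exp_le_wt h.hc.le h.h₀ h.h₁ h1 h2 ξ) h.hR
    _ = _ := by ring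

theorem integrable_norm_mul (h : IsSpectral ρm ρb κ σ T c N₀ N₁ R d q w v Fl Ra)
    {s : ℂ → Plane → ℂ} (hs : Adm σ T c N₀ N₁ R s) {t : ℝ} (ht : t ∈ Ioo 0 T) :
    Integrable fun ξ => ‖ξ‖ * ‖s t ξ‖ := by
  have hc := h.hc
  set m := min t (T - t) with hm
  have hm0 : 0 < m := lt_min ht.1 (sub_pos.2 ht.2)
  have hb := h.norm_mul_exp_le hs (h.mem_diamond (Ioo_subset_Icc_self ht)) (m := m)
    (by rw [Complex.ofReal_re]; exact min_le_left _ _)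
    (by rw [Complex.ofReal_re]; linarith [min_le_right t (T - t)])
  refine (integrable_wt.const_mul (1 / (c * m) * (R * (N₀ + N₁)))).mono'
    (continuous_norm.aestronglyMeasurable.mul (hs.measurable_right t).norm.aestronglyMeasurable)
    (Eventually.of_forall fun ξ => ?_)
  have h1 : ‖ξ‖ ≤ 1 / (c * m) * Real.exp (c * m * ‖ξ‖) := by
    have := Real.add_one_le_exp (c * m * ‖ξ‖)
    rw [one_div, ← div_eq_inv_mul, le_div_iff₀ (by positivity)]
    linarith
  rw [Real.norm_of_nonneg (by positivity)]
  calc ‖ξ‖ * ‖s t ξ‖ ≤ 1 / (c * m) * Real.exp (c * m * ‖ξ‖) * ‖s t ξ‖ := by gcongr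
    _ = 1 / (c * m) * (‖s t ξ‖ * Real.exp (c * m * ‖ξ‖)) := by ring
    _ ≤ 1 / (c * m) * (R * (N₀ + N₁) * wt ξ) := mul_le_mul_of_nonneg_left (hb ξ) (by positivity)
    _ = _ := by ring

theorem integrable_coord_mul (h : IsSpectral ρm ρb κ σ T c N₀ N₁ R d q w v Fl Ra)
    {s : ℂ → Plane → ℂ} (hs : Adm σ T c N₀ N₁ R s) {t : ℝ} (ht : t ∈ Ioo 0 T) (j : Fin 2) :
    Integrable fun ξ : Plane => 2 * Real.pi * Complex.I * ξ j * s t ξ := by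
  have hpi := Real.pi_pos
  refine ((h.integrable_norm_mul hs ht).const_mul (2 * Real.pi)).mono'
    (((measurable_const.mul (Complex.measurable_ofReal.comp (measurable_coord j))).mul
      (hs.measurable_right t)).aestronglyMeasurable) (Eventually.of_forall fun ξ => ?_)
  rw [norm_mul, norm_mul, Complex.norm_real]
  have : ‖(2 * Real.pi * Complex.I : ℂ)‖ = 2 * Real.pi := by
    simp [abs_of_pos hpi]
  rw [this, mul_assoc]
  have := abs_coord_le ξ j
  rw [← Real.norm_eq_abs] at this
  gcongr

theorem hasGradientAt_re (h : IsSpectral ρm ρb κ σ T c N₀ N₁ R d q w v Fl Ra)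
    {s : ℂ → Plane → ℂ} (hs : Adm σ T c N₀ N₁ R s) {t : ℝ} (ht : t ∈ Ioo 0 T) (z : Plane) :
    HasGradientAt (fun z => (invF (s t) z).re)
      (WithLp.toLp 2 fun j => (invF (fun ξ => 2 * Real.pi * Complex.I * ξ j * s t ξ) z).re) z := by
  have := hasGradientAt_re_invF (h.integrable hs (Ioo_subset_Icc_self ht))
    (h.integrable_norm_mul hs ht) 0 z
  simpa only [add_zero] using this

theorem differentiable_physDensity (h : IsSpectral ρm ρb κ σ T c N₀ N₁ R d q w v Fl Ra)
    {t : ℝ} (ht : t ∈ Ioo 0 T) : Differentiable ℝ (physDensity w t) := fun z =>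
  (h.hasGradientAt_re h.density ht z).differentiableAt

theorem differentiable_physGradient (h : IsSpectral ρm ρb κ σ T c N₀ N₁ R d q w v Fl Ra)
    {t : ℝ} (ht : t ∈ Ioo 0 T) : Differentiable ℝ (physGradient (v t)) := fun z =>
  (differentiableAt_piLp 2).2 fun j => (h.hasGradientAt_re (h.adm_dir j) ht z).differentiableAt

theorem hasDerivAt_physDensity (h : IsSpectral ρm ρb κ σ T c N₀ N₁ R d q w v Fl Ra) (C : ℝ)
    {t : ℝ} (ht : t ∈ Ioo 0 T) (z : Plane) :
    HasDerivAt (fun s => physDensity w s z)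
      (densityRHS ρm ρb (physDensity w t) (physValue v C t) z) t := by
  have htI := Ioo_subset_Icc_self ht
  have hd := hasDerivAt_re_invF isOpen_openDiamond
    (fun t _ => (h.density.measurable_right t).aestronglyMeasurable) h.density.holo
    (integrable_wt.const_mul (R * (N₀ + N₁)))
    (fun ξ t ht => h.bound_wt h.density (openDiamond_subset ht) ξ)
    (ofReal_mem_openDiamond h.hσ ht)
    (ae_ne_zero.mono fun ξ hξ => h.density_deriv t ht ξ hξ) z
  refine hd.congr_deriv ?_
  rw [densityRHS_eq_divergence ρm ρb (h.hasGradientAt_physValue C htI)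
    (h.differentiable_physDensity ht z) (h.differentiable_physGradient ht z)]
  have hfl : (fun y => CrowdMFG.flux ρm ρb (physDensity w t y) (physGradient (v t) y)) =
      fun y => WithLp.toLp 2 fun j => (invF (Fl j t) y).re := by
    funext y
    ext j
    have := congrArg Complex.re (h.flux_eq t htI y j)
    rw [Complex.ofReal_re] at this
    exact this.symm
  have hdiff : DifferentiableAt ℝ
      (fun y => (WithLp.toLp 2 fun j => (invF (Fl j t) y).re : Plane)) z :=
    (differentiableAt_piLp 2).2 fun j => (h.hasGradientAt_re (h.flux j) ht z).differentiableAt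
  rw [hfl, divergence_eq_sum hdiff, invF_sum _ fun j _ => h.integrable_coord_mul (h.flux j) ht j,
    Complex.re_sum]
  refine Finset.sum_congr rfl fun j _ => ?_
  have hg := h.hasGradientAt_re (h.flux j) ht z
  have e := gradient_apply_eq hg.differentiableAt j
  rw [hg.gradient] at e
  exact e

theorem differentiableOn_potential (h : IsSpectral ρm ρb κ σ T c N₀ N₁ R d q w v Fl Ra)
    (ξ : Plane) : DifferentiableOn ℂ (fun t => potential (v t) ξ) (openDiamond σ T) :=
  (h.value.holo ξ).const_mul _

theorem hasDerivAt_physValue (h : IsSpectral ρm ρb κ σ T c N₀ N₁ R d q w v Fl Ra) (C : ℝ)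
    {t : ℝ} (ht : t ∈ Ioo 0 T) (z : Plane) :
    HasDerivAt (fun s => physValue v C s z)
      (valueRHS ρm ρb κ (physDensity w t z) (physGradient (v t) z)) t := by
  have hd := hasDerivAt_re_invF (s := fun t => potential (v t)) (s' := Ra t) isOpen_openDiamond
    (fun t _ => h.aestronglyMeasurable_potential t) h.differentiableOn_potential
    (integrable_wt_div_norm.const_mul (R * (N₀ + N₁) / (2 * Real.pi)))
    (fun ξ t ht => norm_potential_le (h.bound_wt h.value (openDiamond_subset ht)) ξ)
    (ofReal_mem_openDiamond h.hσ ht)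
    (ae_ne_zero.mono fun ξ hξ => ?_) z
  · have e := congrArg Complex.re (h.rate_eq t (Ioo_subset_Icc_self ht) z)
    rw [Complex.ofReal_re] at e
    exact (hd.add_const C).congr_deriv e
  · have hpi : (Real.pi : ℂ) ≠ 0 := by exact_mod_cast Real.pi_ne_zero
    have hn : ((‖ξ‖ : ℝ) : ℂ) ≠ 0 := by exact_mod_cast (norm_pos_iff.2 hξ).ne'
    refine ((h.value_deriv t ht ξ hξ).const_mul _).congr_deriv ?_
    push_cast
    field_simp

theorem solvesClassically (h : IsSpectral ρm ρb κ σ T c N₀ N₁ R d q w v Fl Ra) (C : ℝ) :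
    SolvesClassically ρm ρb κ T (physDensity w) (physValue v C) := fun t ht z => by
  refine ⟨h.hasDerivAt_physDensity C ht z, ?_⟩
  rw [h.gradient_physValue C (Ioo_subset_Icc_self ht)]
  exact h.hasDerivAt_physValue C ht z

theorem analyticAt_re_invF (h : IsSpectral ρm ρb κ σ T c N₀ N₁ R d q w v Fl Ra)
    {s : ℂ → Plane → ℂ} (hm : ∀ t, AEStronglyMeasurable (s t) volume)
    (hd : ∀ ξ, DifferentiableOn ℂ (fun t => s t ξ) (openDiamond σ T)) {B : Plane → ℝ}
    (hB : Integrable B) (hb : ∀ m : ℝ, ∀ t ∈ openDiamond σ T, m ≤ t.re → t.re ≤ T - m →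
      ∀ ξ, ‖s t ξ‖ * Real.exp (c * m * ‖ξ‖) ≤ B ξ) (C : ℝ) :
    AnalyticInside T fun t z => (invF (s t) z).re + C := by
  rintro ⟨t, z⟩ ⟨ht, -⟩
  have hc := h.hc
  -- Half the distance to the ends, so that the complex neighbourhood of `t` used below keeps the
  -- distance `m` from them.
  set m := min t (T - t) / 2 with hm'
  have hmin : 0 < min t (T - t) := lt_min ht.1 (sub_pos.2 ht.2)
  have hm0 : 0 < m := by positivity
  have hU : IsOpen (openDiamond σ T ∩ Complex.re ⁻¹' Ioo m (T - m)) :=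
    isOpen_openDiamond.inter (isOpen_Ioo.preimage Complex.continuous_re)
  have ht1 : m < t := by linarith [min_le_left t (T - t)]
  have ht2 : t < T - m := by linarith [min_le_right t (T - t)]
  have h1 := analyticAt_invF (g := s) (a := c * m / 2) (B := B) (by positivity) hU
    (fun t _ => hm t) (Eventually.of_forall fun ξ => (hd ξ).mono inter_subset_left) hB
    (Eventually.of_forall fun ξ t ht => by
      have e : 2 * (c * m / 2) * ‖ξ‖ = c * m * ‖ξ‖ := by ring
      rw [e]
      exact hb m t ht.1 ht.2.1.le ht.2.2.le ξ)
    (t := t) ⟨ofReal_mem_openDiamond h.hσ ht, by simpa using ⟨ht1, ht2⟩⟩ z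
  have h2 : AnalyticAt ℝ (fun x : ℝ × Plane => (invF (s x.1) x.2).re) (t, z) :=
    AnalyticAt.comp (g := Complex.re) (f := fun x : ℝ × Plane => invF (s x.1) x.2)
      (Complex.reCLM.analyticAt _) h1
  exact h2.add analyticAt_const

theorem analyticInside_physDensity (h : IsSpectral ρm ρb κ σ T c N₀ N₁ R d q w v Fl Ra) :
    AnalyticInside T (physDensity w) := by
  have := h.analyticAt_re_invF (fun t => (h.density.measurable_right t).aestronglyMeasurable)
    h.density.holo (integrable_wt.const_mul (R * (N₀ + N₁)))
    (fun m t ht h1 h2 ξ => h.norm_mul_exp_le h.density (openDiamond_subset ht) h1 h2 ξ) 0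
  simp only [add_zero] at this
  exact this

theorem analyticInside_physValue (h : IsSpectral ρm ρb κ σ T c N₀ N₁ R d q w v Fl Ra) (C : ℝ) :
    AnalyticInside T (physValue v C) := by
  have hpi := Real.pi_pos
  refine h.analyticAt_re_invF (s := fun t => potential (v t)) h.aestronglyMeasurable_potential
    h.differentiableOn_potential
    (integrable_wt_div_norm.const_mul (R * (N₀ + N₁) / (2 * Real.pi)))
    (fun m t ht h1 h2 ξ => ?_) C
  have hb := h.norm_mul_exp_le h.value (openDiamond_subset ht) h1 h2 ξ
  unfold potential
  rw [norm_mul, Complex.norm_real, Real.norm_of_nonneg (by positivity), mul_assoc]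
  calc _ ≤ (2 * Real.pi * ‖ξ‖)⁻¹ * (R * (N₀ + N₁) * wt ξ) := by gcongr
    _ = _ := by rw [mul_inv]; ring

end IsSpectral

/-! ### Square integrable fields in space-time -/

theorem memLp_two_iff_lintegral_sq {α : Type*} [MeasurableSpace α] {ν : Measure α} {f : α → ℝ}
    (hf : AEStronglyMeasurable f ν) : MemLp f 2 ν ↔ ∫⁻ x, ‖f x‖ₑ ^ 2 ∂ν ≠ ⊤ := by
  rw [MemLp, and_iff_right hf,
    eLpNorm_lt_top_iff_lintegral_rpow_enorm_lt_top two_ne_zero (by simp), lt_top_iff_ne_top]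
  simp

/-- Lebesgue measure on the time interval. -/
def timeMeasure (T : ℝ) : Measure ℝ := volume.restrict (Ioc 0 T)

instance (T : ℝ) : IsFiniteMeasure (timeMeasure T) := by
  unfold timeMeasure; infer_instance

/-- A measurable field, square integrable in space-time. -/
structure SqField (T : ℝ) (X : ℝ → Plane → ℝ) : Prop where
  meas : Measurable fun w : ℝ × Plane => X w.1 w.2
  sq : MemLp (fun w : ℝ × Plane => X w.1 w.2) 2 ((timeMeasure T).prod volume)

namespace SqField

variable {T : ℝ} {X Y : ℝ → Plane → ℝ}

theorem measurable_slice (h : SqField T X) (t : ℝ) : Measurable (X t) :=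
  h.meas.comp measurable_prodMk_left

theorem lintegral_eq (h : SqField T X) :
    ∫⁻ w, ‖X w.1 w.2‖ₑ ^ 2 ∂((timeMeasure T).prod volume) =
      ∫⁻ t, (∫⁻ z, ‖X t z‖ₑ ^ 2) ∂timeMeasure T :=
  lintegral_prod _ (h.meas.enorm.pow_const 2).aemeasurable

theorem of_lintegral (hm : Measurable fun w : ℝ × Plane => X w.1 w.2)
    (h : ∫⁻ t, (∫⁻ z, ‖X t z‖ₑ ^ 2) ∂timeMeasure T ≠ ⊤) : SqField T X :=
  ⟨hm, (memLp_two_iff_lintegral_sq hm.aestronglyMeasurable).2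
    (by rwa [lintegral_prod _ (hm.enorm.pow_const 2).aemeasurable])⟩

theorem lintegral_ne_top (h : SqField T X) : ∫⁻ t, (∫⁻ z, ‖X t z‖ₑ ^ 2) ∂timeMeasure T ≠ ⊤ := by
  rw [← h.lintegral_eq]
  exact (memLp_two_iff_lintegral_sq h.meas.aestronglyMeasurable).1 h.sq

theorem slice (h : SqField T X) : ∀ᵐ t ∂timeMeasure T, MemLp (X t) 2 := by
  have hm : Measurable fun t => ∫⁻ z, ‖X t z‖ₑ ^ 2 :=
    (h.meas.enorm.pow_const 2).lintegral_prod_right'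
  filter_upwards [ae_lt_top hm h.lintegral_ne_top] with t ht
  exact (memLp_two_iff_lintegral_sq (h.measurable_slice t).aestronglyMeasurable).2 ht.ne

theorem slice_left (h : SqField T X) : ∀ᵐ z, MemLp (fun t => X t z) 2 (timeMeasure T) := by
  have hm : Measurable fun z => ∫⁻ t, ‖X t z‖ₑ ^ 2 ∂timeMeasure T :=
    (h.meas.enorm.pow_const 2).lintegral_prod_left'
  have hne : ∫⁻ z, ∫⁻ t, ‖X t z‖ₑ ^ 2 ∂timeMeasure T ≠ ⊤ := by
    rw [← lintegral_lintegral_swap (h.meas.enorm.pow_const 2).aemeasurable]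
    exact h.lintegral_ne_top
  filter_upwards [ae_lt_top hm hne] with z hz
  have hmz : Measurable fun t => X t z := h.meas.comp measurable_prodMk_right
  exact (memLp_two_iff_lintegral_sq hmz.aestronglyMeasurable).2 hz.ne

theorem add (hX : SqField T X) (hY : SqField T Y) : SqField T fun t z => X t z + Y t z :=
  ⟨hX.meas.add hY.meas, hX.sq.add hY.sq⟩

theorem sub (hX : SqField T X) (hY : SqField T Y) : SqField T fun t z => X t z - Y t z :=
  ⟨hX.meas.sub hY.meas, hX.sq.sub hY.sq⟩

theorem const_mul (hX : SqField T X) (a : ℝ) : SqField T fun t z => a * X t z :=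
  ⟨hX.meas.const_mul a, hX.sq.const_mul a⟩

theorem of_le (hX : SqField T X) (hm : Measurable fun w : ℝ × Plane => Y w.1 w.2)
    (h : ∀ t z, |Y t z| ≤ |X t z|) : SqField T Y :=
  ⟨hm, hX.sq.of_le hm.aestronglyMeasurable (Eventually.of_forall fun w => h w.1 w.2)⟩

theorem integrable_mul (hX : SqField T X) (hY : SqField T Y) :
    Integrable (fun w : ℝ × Plane => X w.1 w.2 * Y w.1 w.2) ((timeMeasure T).prod volume) :=
  memLp_one_iff_integrable.1 (hY.sq.mul hX.sq)

theorem measurable_smear (hX : Measurable fun w : ℝ × Plane => X w.1 w.2) {χ : Plane → ℝ}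
    (hχ : Measurable χ) : Measurable fun w : ℝ × Plane => CrowdMFG.smear χ (X w.1) w.2 := by
  have m1 : Measurable fun x : (ℝ × Plane) × Plane => χ (x.1.2 - x.2) := hχ.comp (by fun_prop)
  have mr : Measurable fun x : (ℝ × Plane) × Plane => (x.1.1, x.2) := by fun_prop
  have m2 : Measurable fun x : (ℝ × Plane) × Plane => X x.1.1 x.2 := hX.comp mr
  have m3 : StronglyMeasurable fun x : (ℝ × Plane) × Plane => χ (x.1.2 - x.2) * X x.1.1 x.2 :=
    (m1.mul m2).stronglyMeasurable
  exact (m3.integral_prod_right' (ν := (volume : Measure Plane))).measurable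

theorem lintegral_smear_le (hX : SqField T X) {χ : Plane → ℝ} (hχ : Measurable χ) :
    ∫⁻ t, (∫⁻ z, ‖CrowdMFG.smear χ (X t) z‖ₑ ^ 2) ∂timeMeasure T ≤
      (∫⁻ z, ‖χ z‖ₑ) ^ 2 * ∫⁻ t, (∫⁻ z, ‖X t z‖ₑ ^ 2) ∂timeMeasure T := by
  rw [← lintegral_const_mul _ (hX.meas.enorm.pow_const 2).lintegral_prod_right']
  exact lintegral_mono fun t => lintegral_smear_sq_le hχ (hX.measurable_slice t).aemeasurable

theorem smear (hX : SqField T X) {χ : Plane → ℝ} (hχ : IsTestFunction χ) :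
    SqField T fun t z => CrowdMFG.smear χ (X t) z := by
  refine of_lintegral (measurable_smear hX.meas hχ.continuous.measurable)
    ((hX.lintegral_smear_le hχ.continuous.measurable).trans_lt (ENNReal.mul_lt_top ?_ ?_)).ne
  · have h : ∫⁻ z, ‖χ z‖ₑ < ⊤ := hχ.integrable.2
    exact ENNReal.pow_lt_top h
  · exact hX.lintegral_ne_top.lt_top

/-- Integration in time against a bounded kernel. -/
theorem timeIntegral (hX : SqField T X) {k : ℝ → ℝ → ℝ}
    (hk : Measurable fun x : ℝ × ℝ => k x.1 x.2) (hk1 : ∀ t s, |k t s| ≤ 1) :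
    SqField T fun t z => ∫ s, k t s * X s z ∂timeMeasure T := by
  have m1 : Measurable fun x : (ℝ × Plane) × ℝ => (x.1.1, x.2) := by fun_prop
  have m2 : Measurable fun x : (ℝ × Plane) × ℝ => (x.2, x.1.2) := by fun_prop
  have m3 : Measurable fun x : (ℝ × Plane) × ℝ => k x.1.1 x.2 * X x.2 x.1.2 :=
    (hk.comp m1).mul (hX.meas.comp m2)
  -- Cauchy–Schwarz on a finite time interval. The constant depends on `T`, but only finiteness is
  -- used.
  have key : ∀ t z, ‖∫ s, k t s * X s z ∂timeMeasure T‖ₑ ^ 2 ≤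
      timeMeasure T univ * ∫⁻ s, ‖X s z‖ₑ ^ 2 ∂timeMeasure T := by
    intro t z
    have hz : Measurable fun s => ‖X s z‖ₑ := (hX.meas.comp measurable_prodMk_right).enorm
    have h1 : ‖∫ s, k t s * X s z ∂timeMeasure T‖ₑ ≤ ∫⁻ s, 1 * ‖X s z‖ₑ ∂timeMeasure T := by
      refine (enorm_integral_le_lintegral_enorm _).trans (lintegral_mono fun s => ?_)
      rw [enorm_mul]
      gcongr
      rw [Real.enorm_eq_ofReal_abs, ENNReal.ofReal_le_one]
      exact hk1 t s
    refine (pow_le_pow_left' h1 2).trans ((lintegral_mul_sq_le measurable_const hz).trans_eq ?_)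
    simp
  refine of_lintegral (m3.stronglyMeasurable.integral_prod_right' (ν := timeMeasure T)).measurable
    (((lintegral_mono fun t => lintegral_mono fun z => key t z)).trans_lt ?_).ne
  have hm : Measurable fun z => ∫⁻ s, ‖X s z‖ₑ ^ 2 ∂timeMeasure T :=
    (hX.meas.enorm.pow_const 2).lintegral_prod_left'
  simp only [lintegral_const, lintegral_const_mul _ hm]
  refine ENNReal.mul_lt_top (ENNReal.mul_lt_top (measure_lt_top _ _) ?_) (measure_lt_top _ _)
  rw [← lintegral_lintegral_swap (hX.meas.enorm.pow_const 2).aemeasurable]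
  exact hX.lintegral_ne_top.lt_top

end SqField

/-- Integration by parts in time. -/
theorem integral_primitive_mul {T : ℝ} {a b : ℝ → ℝ} (ha : Integrable a (timeMeasure T))
    (hb : Integrable b (timeMeasure T)) :
    ∫ t, (∫ s, (if s ≤ t then 1 else 0) * a s ∂timeMeasure T) * b t ∂timeMeasure T =
      ∫ s, a s * ∫ t, (if s ≤ t then 1 else 0) * b t ∂timeMeasure T ∂timeMeasure T := by
  have hm : Measurable fun x : ℝ × ℝ => if x.2 ≤ x.1 then (1 : ℝ) else 0 :=
    Measurable.ite (measurableSet_le measurable_snd measurable_fst) measurable_const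
      measurable_const
  have hprod : Integrable (fun x : ℝ × ℝ => (if x.2 ≤ x.1 then (1 : ℝ) else 0) * (b x.1 * a x.2))
      ((timeMeasure T).prod (timeMeasure T)) := by
    refine (hb.mul_prod ha).bdd_mul (c := 1) hm.aestronglyMeasurable
      (Eventually.of_forall fun x => ?_)
    split_ifs <;> simp
  have h := integral_integral_swap
    (f := fun t s => (if s ≤ t then (1 : ℝ) else 0) * (b t * a s)) hprod
  calc _ = ∫ t, ∫ s, (if s ≤ t then (1 : ℝ) else 0) * (b t * a s)
        ∂timeMeasure T ∂timeMeasure T := by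
        congr 1; ext t
        rw [← integral_mul_const]
        congr 1; ext s; ring
    _ = _ := h
    _ = _ := by
        congr 1; ext s
        rw [← integral_const_mul]
        congr 1; ext t; ring

/-- The energy identity for mollified solutions of the linear system with sources. -/
theorem energy_identity {T : ℝ} {D V H : ℝ → Plane → ℝ} {F G : Fin 2 → ℝ → Plane → ℝ}
    {χ : Plane → ℝ} (hχ : IsTestFunction χ) (hD : SqField T D) (hV : SqField T V)
    (hF : ∀ j, SqField T (F j)) (hG : ∀ j, SqField T (G j))
    (eD : ∀ᵐ t ∂timeMeasure T, ∀ z, smear χ (D t) z =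
      ∫ s, (if s ≤ t then 1 else 0) * ∑ j, smear (pd j χ) (F j s) z ∂timeMeasure T)
    (eH : ∀ᵐ t ∂timeMeasure T, ∀ z, smear χ (H t) z =
      -∫ s, (if t ≤ s then 1 else 0) * smear χ (V s) z ∂timeMeasure T)
    (eG : ∀ᵐ t ∂timeMeasure T, LocallyIntegrable (H t) ∧
      ∀ j z, smear (pd j χ) (H t) z = smear χ (G j t) z) :
    ∫ w, (∑ j, smear χ (F j w.1) w.2 * smear χ (G j w.1) w.2) -
      smear χ (D w.1) w.2 * smear χ (V w.1) w.2 ∂((timeMeasure T).prod volume) = 0 := by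
  set a : ℝ → Plane → ℝ := fun t z => ∑ j, smear (pd j χ) (F j t) z with ha
  have sa : SqField T a := by
    have := ((hF 0).smear (hχ.pd 0)).add ((hF 1).smear (hχ.pd 1))
    simpa only [ha, Fin.sum_univ_two] using this
  have sb : SqField T fun t z => smear χ (V t) z := hV.smear hχ
  have sD : SqField T fun t z => smear χ (D t) z := hD.smear hχ
  have sF := fun j => (hF j).smear hχ
  have sG := fun j => (hG j).smear hχ
  have mk : Measurable fun x : ℝ × ℝ => if x.1 ≤ x.2 then (1 : ℝ) else 0 :=
    Measurable.ite (measurableSet_le measurable_fst measurable_snd) measurable_const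
      measurable_const
  set B : ℝ → Plane → ℝ := fun t z =>
    ∫ s, (if t ≤ s then 1 else 0) * smear χ (V s) z ∂timeMeasure T with hB
  have sB : SqField T B := sb.timeIntegral mk fun t s => by split_ifs <;> simp
  have iDb := sD.integrable_mul sb
  have iaB := sa.integrable_mul sB
  -- Integration by parts in time. By `eD` the field `D` starts from zero and by `eH` the field `H =
  -- -B` ends at zero, so there are no boundary terms.
  have i1 : ∫ w, smear χ (D w.1) w.2 * smear χ (V w.1) w.2 ∂((timeMeasure T).prod volume) =
      ∫ w, a w.1 w.2 * B w.1 w.2 ∂((timeMeasure T).prod volume) := by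
    rw [integral_prod_symm _ iDb, integral_prod_symm _ iaB]
    refine integral_congr_ae ?_
    filter_upwards [sa.slice_left, sb.slice_left] with z hza hzb
    have h := integral_primitive_mul (hza.integrable one_le_two) (hzb.integrable one_le_two)
    rw [← h]
    refine integral_congr_ae (eD.mono fun t ht => ?_)
    simp only [ht z, ha]
  have i2 : ∀ᵐ t ∂timeMeasure T, ∫ z, a t z * B t z =
      ∫ z, ∑ j, smear χ (F j t) z * smear χ (G j t) z := by
    filter_upwards [eH, eG, sB.slice, (hF 0).slice, (hF 1).slice, ((hF 0).smear (hχ.pd 0)).slice,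
      ((hF 1).smear (hχ.pd 1)).slice, (sF 0).slice, (sF 1).slice, (sG 0).slice, (sG 1).slice]
      with t hH hGt hBt hF0 hF1 ha0 ha1 hs0 hs1 hg0 hg1
    have hFt : ∀ j, MemLp (F j t) 2 := fun j => by fin_cases j <;> assumption
    have hat : ∀ j, MemLp (fun z => smear (pd j χ) (F j t) z) 2 := fun j => by
      fin_cases j <;> assumption
    have hst : ∀ j, MemLp (fun z => smear χ (F j t) z) 2 := fun j => by fin_cases j <;> assumption
    have hgt : ∀ j, MemLp (fun z => smear χ (G j t) z) 2 := fun j => by fin_cases j <;> assumption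
    have hHB : (fun z => smear χ (H t) z) = fun z => -B t z := funext hH
    -- Nothing is assumed on `H` at infinity. Its mollification is square integrable because it is a
    -- time integral of `V`, and this justifies the integration by parts in space.
    have hHt : MemLp (fun z => smear χ (H t) z) 2 := by rw [hHB]; exact hBt.neg
    have hj : ∀ j, ∫ z, smear (pd j χ) (F j t) z * smear χ (H t) z =
        -∫ z, smear χ (F j t) z * smear χ (G j t) z := by
      intro j
      have hloc := (hFt j).locallyIntegrable one_le_two
      have dF := fun z => hχ.hasFDerivAt_smear hloc z
      have dH := fun z => hχ.hasFDerivAt_smear hGt.1 z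
      have eF : ∀ z, fderiv ℝ (smear χ (F j t)) z (EuclideanSpace.single j 1) =
          smear (pd j χ) (F j t) z := fun z => (dF z).2 j
      have eH' : ∀ z, fderiv ℝ (smear χ (H t)) z (EuclideanSpace.single j 1) =
          smear χ (G j t) z := fun z => ((dH z).2 j).trans (hGt.2 j z)
      have key := integral_mul_fderiv_eq_neg_fderiv_mul_of_integrable
        (μ := (volume : Measure Plane)) (f := smear χ (F j t)) (g := smear χ (H t))
        (v := EuclideanSpace.single j 1) ?_ ?_ ?_ (fun z _ => (dF z).1) (fun z _ => (dH z).1)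
      · simp only [eF, eH'] at key
        rw [key, neg_neg]
      · simp only [eF]
        exact memLp_one_iff_integrable.1 (hHt.mul (hat j))
      · simp only [eH']
        exact memLp_one_iff_integrable.1 ((hgt j).mul (hst j))
      · exact memLp_one_iff_integrable.1 (hHt.mul (hst j))
    have ia : ∀ j, Integrable fun z => smear (pd j χ) (F j t) z * smear χ (H t) z := fun j =>
      memLp_one_iff_integrable.1 (hHt.mul (hat j))
    have is : ∀ j, Integrable fun z => smear χ (F j t) z * smear χ (G j t) z := fun j =>
      memLp_one_iff_integrable.1 ((hgt j).mul (hst j))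
    have e : (fun z => a t z * B t z) =
        fun z => -∑ j, smear (pd j χ) (F j t) z * smear χ (H t) z := by
      funext z
      have : smear χ (H t) z = -B t z := congrFun hHB z
      simp only [ha, this, Finset.sum_mul, mul_neg, Finset.sum_neg_distrib, neg_neg]
    rw [e, integral_neg, integral_finsetSum _ fun j _ => ia j, integral_finsetSum _ fun j _ => is j,
      ← Finset.sum_neg_distrib]
    exact Finset.sum_congr rfl fun j _ => by rw [hj j, neg_neg]
  have iFG : Integrable (fun w : ℝ × Plane => ∑ j, smear χ (F j w.1) w.2 * smear χ (G j w.1) w.2)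
      ((timeMeasure T).prod volume) :=
    integrable_finsetSum _ fun j _ => (sF j).integrable_mul (sG j)
  rw [integral_sub iFG iDb, i1, sub_eq_zero, integral_prod _ iFG, integral_prod _ iaB]
  exact integral_congr_ae (i2.mono fun t ht => ht.symm)

/-! ### Uniqueness of small solutions -/

namespace Poly

/-- There is no constant term, so the value vanishes at least linearly with `δ`. -/
theorem abs_eval_le {x : Fin 3 → ℝ} {δ : ℝ} (hδ : 0 ≤ δ) (hδ1 : δ ≤ 1) (hx : ∀ i, |x i| ≤ δ)
    (p : Poly) : |eval x p| ≤ δ * size 1 p := by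
  induction p with
  | var i => simpa [eval, size] using hx i
  | add p q hp hq =>
    simpa only [eval, size, mul_add] using (abs_add_le _ _).trans (add_le_add hp hq)
  | smul a p hp =>
    simp only [eval, size, Algebra.algebraMap_self, RingHom.id_apply, abs_mul]
    nlinarith [mul_le_mul_of_nonneg_left hp (abs_nonneg a)]
  | mul p q hp hq =>
    simp only [eval, size, abs_mul]
    have h1 := size_nonneg zero_le_one p
    have h2 := size_nonneg zero_le_one q
    calc _ ≤ (δ * size 1 p) * (1 * size 1 q) := mul_le_mul hp
          (hq.trans (mul_le_mul_of_nonneg_right hδ1 h2)) (abs_nonneg _) (by positivity)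
      _ = _ := by ring

theorem abs_eval_sub_le {x y : Fin 3 → ℝ} {m : ℝ} (hx : ∀ i, |x i| ≤ 1) (hy : ∀ i, |y i| ≤ 1)
    (hm : ∀ i, |x i - y i| ≤ m) (p : Poly) : |eval x p - eval y p| ≤ lip 1 p * m := by
  have hm0 : 0 ≤ m := (abs_nonneg _).trans (hm 0)
  induction p with
  | var i => simpa [eval, lip] using hm i
  | add p q hp hq =>
    simp only [eval, lip, add_mul, add_sub_add_comm]
    exact (abs_add_le _ _).trans (add_le_add hp hq)
  | smul a p hp =>
    simp only [eval, lip, Algebra.algebraMap_self, RingHom.id_apply, ← mul_sub, abs_mul, mul_assoc]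
    exact mul_le_mul_of_nonneg_left hp (abs_nonneg a)
  | mul p q hp hq =>
    simp only [eval, lip]
    have h1 := abs_eval_le zero_le_one le_rfl hy p
    have h2 := abs_eval_le zero_le_one le_rfl hx q
    rw [one_mul] at h1 h2
    have e : eval x p * eval x q - eval y p * eval y q =
        (eval x p - eval y p) * eval x q + eval y p * (eval x q - eval y q) := by ring
    rw [e]
    refine (abs_add_le _ _).trans ?_
    rw [abs_mul, abs_mul]
    have h3 := mul_le_mul hp h2 (abs_nonneg _) (mul_nonneg (lip_nonneg zero_le_one p) hm0)
    have h4 := mul_le_mul h1 hq (abs_nonneg _) (size_nonneg zero_le_one p)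
    nlinarith

theorem measurable_eval {α : Type*} [MeasurableSpace α] {x : Fin 3 → α → ℝ}
    (hx : ∀ i, Measurable (x i)) (p : Poly) : Measurable fun w => eval (fun i => x i w) p := by
  induction p with
  | var i => exact hx i
  | add p q hp hq => exact hp.add hq
  | smul a p hp => exact hp.const_mul _
  | mul p q hp hq => exact hp.mul hq

/-- The expression `∑ i, P i * x i`. -/
def quad (P : Fin 3 → Poly) (x : Fin 3 → ℝ) : ℝ := ∑ i, (P i).eval x * x i

/-- A constant in the Lipschitz estimate of `quad`. -/
def quadConst (P : Fin 3 → Poly) : ℝ := ∑ i, (size 1 (P i) + lip 1 (P i))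

theorem quadConst_nonneg (P : Fin 3 → Poly) : 0 ≤ quadConst P :=
  Finset.sum_nonneg fun _ _ => add_nonneg (size_nonneg zero_le_one _) (lip_nonneg zero_le_one _)

/-- The expression vanishes to second order, so its Lipschitz constant on the cube of size `δ` is of
order `δ`; this is the smallness behind uniqueness. -/
theorem abs_quad_sub_le {x y : Fin 3 → ℝ} {δ m : ℝ} (hδ : 0 ≤ δ) (hδ1 : δ ≤ 1)
    (hx : ∀ i, |x i| ≤ δ) (hy : ∀ i, |y i| ≤ δ) (hm : ∀ i, |x i - y i| ≤ m) (P : Fin 3 → Poly) :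
    |quad P x - quad P y| ≤ quadConst P * δ * m := by
  unfold quad quadConst
  rw [← Finset.sum_sub_distrib, Finset.sum_mul, Finset.sum_mul]
  refine (Finset.abs_sum_le_sum_abs _ _).trans (Finset.sum_le_sum fun i _ => ?_)
  have hm0 : 0 ≤ m := (abs_nonneg _).trans (hm 0)
  have h1 := abs_eval_le hδ hδ1 hx (P i)
  have h2 := abs_eval_sub_le (fun i => (hx i).trans hδ1) (fun i => (hy i).trans hδ1) hm (P i)
  have e : eval x (P i) * x i - eval y (P i) * y i =
      eval x (P i) * (x i - y i) + (eval x (P i) - eval y (P i)) * y i := by ring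
  rw [e]
  refine (abs_add_le _ _).trans ?_
  rw [abs_mul, abs_mul]
  have h3 := mul_le_mul h1 (hm i) (abs_nonneg _) (mul_nonneg hδ (size_nonneg zero_le_one _))
  have h4 := mul_le_mul h2 (hy i) (abs_nonneg _) (mul_nonneg (lip_nonneg zero_le_one _) hm0)
  nlinarith

theorem measurable_quad {α : Type*} [MeasurableSpace α] {x : Fin 3 → α → ℝ}
    (hx : ∀ i, Measurable (x i)) (P : Fin 3 → Poly) : Measurable fun w => quad P fun i => x i w :=
  Finset.measurable_fun_sum _ fun i _ => (measurable_eval hx (P i)).mul (hx i)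

end Poly

/-- The linear part of the two components of the flux and of the right-hand side of the value
equation. -/
def linPart (ρ f : ℝ) (x : Fin 3 → ℝ) : Fin 3 → ℝ :=
  ![(f - 2 * ρ) * x 0 + ρ * f ^ 2 * x 1, ρ * f ^ 2 * x 2, f * x 1 - 1 / f * x 0]

theorem linPart_sub (ρ f : ℝ) (x y : Fin 3 → ℝ) (k : Fin 3) :
    linPart ρ f (fun i => x i - y i) k = linPart ρ f x k - linPart ρ f y k := by
  fin_cases k <;> simp [linPart] <;> ring

/-- Coercivity of the energy. -/
theorem exists_coercive {ρ f : ℝ} (hρ : 0 < ρ) (hf : ρ < f) : ∃ l : ℝ, 0 < l ∧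
    ∀ y n : Fin 3 → ℝ, l * ∑ i, y i ^ 2 ≤
      ((linPart ρ f y 0 + n 0) * y 1 + (linPart ρ f y 1 + n 1) * y 2
        - y 0 * (linPart ρ f y 2 + n 2)) + l⁻¹ * ∑ i, n i ^ 2 := by
  have hf0 : 0 < f := hρ.trans hf
  -- The form is `y₀²/f - 2ρ y₀y₁ + ρf²(y₁² + y₂²)`. The cross term is split by Young's inequality
  -- with weight `m`, which leaves positive squares exactly when `ρf < m < f²`; such `m` exist
  -- because `ρ < f`.
  set m := (ρ * f + f ^ 2) / 2 with hm
  have hm0 : 0 < m := by positivity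
  have hm1 : ρ * f < m := by rw [hm]; nlinarith
  have hm2 : m < f ^ 2 := by rw [hm]; nlinarith
  have h1 : 0 < 1 / f - ρ / m := by
    rw [sub_pos, div_lt_div_iff₀ hm0 hf0, one_mul]; exact hm1
  have h2 : 0 < ρ * (f ^ 2 - m) := mul_pos hρ (by linarith)
  -- Half of the coercivity constant is kept; the other half absorbs the products of `y` with the
  -- sources `n`.
  refine ⟨min (1 / f - ρ / m) (ρ * (f ^ 2 - m)) / 2, by positivity, fun y n => ?_⟩
  set l := min (1 / f - ρ / m) (ρ * (f ^ 2 - m)) / 2 with hl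
  have hl0 : 0 < l := by positivity
  have l1 : 2 * l ≤ 1 / f - ρ / m := by
    rw [hl, mul_div_cancel₀ _ two_ne_zero]; exact min_le_left _ _
  have l2 : 2 * l ≤ ρ * f ^ 2 - ρ * m := by
    rw [hl, mul_div_cancel₀ _ two_ne_zero, ← mul_sub]; exact min_le_right _ _
  have l3 : 2 * l ≤ ρ * f ^ 2 := l2.trans (by nlinarith [mul_pos hρ hm0])
  have young : ∀ a b : ℝ, -(a * b) ≤ l * a ^ 2 + l⁻¹ * b ^ 2 := by
    intro a b
    have e : l * a ^ 2 + l⁻¹ * b ^ 2 + a * b =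
        l * (a + l⁻¹ * b / 2) ^ 2 + 3 / 4 * (l⁻¹ * b ^ 2) := by field_simp; ring
    have : 0 ≤ l * (a + l⁻¹ * b / 2) ^ 2 + 3 / 4 * (l⁻¹ * b ^ 2) := by positivity
    linarith
  have cross : 2 * ρ * (y 0 * y 1) ≤ ρ / m * y 0 ^ 2 + ρ * m * y 1 ^ 2 := by
    have e : ρ / m * y 0 ^ 2 + ρ * m * y 1 ^ 2 - 2 * ρ * (y 0 * y 1) =
        ρ / m * (y 0 - m * y 1) ^ 2 := by field_simp; ring
    have : 0 ≤ ρ / m * (y 0 - m * y 1) ^ 2 := by positivity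
    linarith
  have q0 := mul_le_mul_of_nonneg_right l1 (sq_nonneg (y 0))
  have q1 := mul_le_mul_of_nonneg_right l2 (sq_nonneg (y 1))
  have q2 := mul_le_mul_of_nonneg_right l3 (sq_nonneg (y 2))
  have y0 := young (y 1) (n 0)
  have y1 := young (y 2) (n 1)
  have y2 := young (y 0) (-n 2)
  simp only [linPart, Fin.sum_univ_three, Matrix.cons_val_zero, Matrix.cons_val_one,
    Matrix.cons_val, neg_sq, mul_neg, neg_neg] at *
  nlinarith

/-- The space-time integral of the square of a field. -/
def energy (T : ℝ) (X : ℝ → Plane → ℝ) : ℝ≥0∞ := ∫⁻ t, (∫⁻ z, ‖X t z‖ₑ ^ 2) ∂timeMeasure T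

theorem SqField.ofReal_integral_sq {T : ℝ} {X : ℝ → Plane → ℝ} (h : SqField T X) :
    ENNReal.ofReal (∫ w, X w.1 w.2 ^ 2 ∂((timeMeasure T).prod volume)) = energy T X := by
  rw [energy, ← h.lintegral_eq, ofReal_integral_eq_lintegral_ofReal
    ((h.integrable_mul h).congr (Eventually.of_forall fun w => (pow_two _).symm))
    (Eventually.of_forall fun w => sq_nonneg _)]
  refine lintegral_congr fun w => ?_
  rw [← sq_abs, ENNReal.ofReal_pow (abs_nonneg _), Real.enorm_eq_ofReal_abs]

/-- Mollifications of almost every time slice converge almost everywhere; Fatou's lemma is applied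
in space and then in time. -/
theorem energy_le_of_forall_smear {T : ℝ} {X : ℝ → Plane → ℝ} (hX : SqField T X) {B : ℝ≥0∞}
    (h : ∀ n, energy T (fun t z => smear (mollifier n) (X t) z) ≤ B) : energy T X ≤ B := by
  have m1 : ∀ n, Measurable fun w : ℝ × Plane => ‖smear (mollifier n) (X w.1) w.2‖ₑ ^ 2 := fun n =>
    (SqField.measurable_smear hX.meas
      (isTestFunction_mollifier n).continuous.measurable).enorm.pow_const 2
  have m2 : ∀ n, Measurable fun t => ∫⁻ z, ‖smear (mollifier n) (X t) z‖ₑ ^ 2 := fun n =>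
    (m1 n).lintegral_prod_right'
  have key : energy T X ≤ ∫⁻ t, liminf (fun n => ∫⁻ z, ‖smear (mollifier n) (X t) z‖ₑ ^ 2) atTop
      ∂timeMeasure T := by
    refine lintegral_mono_ae ?_
    filter_upwards [hX.slice] with t ht
    have m3 : ∀ n, Measurable fun z => ‖smear (mollifier n) (X t) z‖ₑ ^ 2 := fun n => by
      have := (m1 n).comp (measurable_prodMk_left (x := t))
      exact this
    have hlim := ae_tendsto_smear_mollifier (ht.locallyIntegrable one_le_two)
    calc ∫⁻ z, ‖X t z‖ₑ ^ 2 = ∫⁻ z, liminf (fun n => ‖smear (mollifier n) (X t) z‖ₑ ^ 2) atTop := by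
          refine lintegral_congr_ae (hlim.mono fun z hz => ?_)
          have hz2 : Tendsto (fun n => ‖smear (mollifier n) (X t) z‖ₑ ^ 2) atTop
              (𝓝 (‖X t z‖ₑ ^ 2)) := ENNReal.Tendsto.pow hz.enorm
          exact hz2.liminf_eq.symm
      _ ≤ _ := lintegral_liminf_le m3
  refine key.trans ((lintegral_liminf_le m2).trans ?_)
  exact liminf_le_of_frequently_le' (Frequently.of_forall h)

theorem smear_linear_comb {χ g h k : Plane → ℝ} (hχ : IsTestFunction χ) (a b : ℝ)
    (hg : LocallyIntegrable g) (hh : LocallyIntegrable h) (hk : LocallyIntegrable k) (z : Plane) :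
    smear χ (fun y => a * g y + b * h y + k y) z =
      a * smear χ g z + b * smear χ h z + smear χ k z := by
  have i1 : Integrable fun y => a * (χ (z - y) * g y) := (hχ.integrable_smear hg z).const_mul a
  have i2 : Integrable fun y => b * (χ (z - y) * h y) := (hχ.integrable_smear hh z).const_mul b
  have i3 : Integrable fun y => a * (χ (z - y) * g y) + b * (χ (z - y) * h y) := i1.add i2
  unfold smear
  rw [← integral_const_mul, ← integral_const_mul, ← integral_add i1 i2,
    ← integral_add i3 (hχ.integrable_smear hk z)]
  congr 1
  ext y
  ring

/-- The energy estimate for the linear system with sources. -/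
theorem exists_energy_estimate {ρ f : ℝ} (hρ : 0 < ρ) (hf : ρ < f) : ∃ B : ℝ, 0 < B ∧
    ∀ (T : ℝ) (Y N : Fin 3 → ℝ → Plane → ℝ) (H : ℝ → Plane → ℝ), (∀ i, SqField T (Y i)) →
      (∀ i, SqField T (N i)) →
      (∀ χ, IsTestFunction χ → ∀ᵐ t ∂timeMeasure T, ∀ z, smear χ (Y 0 t) z =
        ∫ s, (if s ≤ t then 1 else 0) * ∑ j : Fin 2, smear (pd j χ)
          (fun y => linPart ρ f (fun i => Y i s y) j.castSucc + N j.castSucc s y) z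
            ∂timeMeasure T) →
      (∀ χ, IsTestFunction χ → ∀ᵐ t ∂timeMeasure T, ∀ z, smear χ (H t) z =
        -∫ s, (if t ≤ s then 1 else 0) * smear χ
          (fun y => linPart ρ f (fun i => Y i s y) 2 + N 2 s y) z ∂timeMeasure T) →
      (∀ χ, IsTestFunction χ → ∀ᵐ t ∂timeMeasure T, LocallyIntegrable (H t) ∧
        ∀ (j : Fin 2) z, smear (pd j χ) (H t) z = smear χ (Y j.succ t) z) →
      ∀ i, energy T (Y i) ≤ ENNReal.ofReal B * ∑ k, energy T (N k) := by
  obtain ⟨l, hl, hco⟩ := exists_coercive hρ hf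
  refine ⟨l⁻¹ * l⁻¹, by positivity, fun T Y N H hY hN eD eH eG i => ?_⟩
  have hL : ∀ k, SqField T fun t z => linPart ρ f (fun i => Y i t z) k := by
    intro k
    fin_cases k
    · exact ((hY 0).const_mul _).add ((hY 1).const_mul _)
    · exact (hY 2).const_mul _
    · exact ((hY 1).const_mul _).sub ((hY 0).const_mul _)
  have hF : ∀ k, SqField T fun t z => linPart ρ f (fun i => Y i t z) k + N k t z := fun k =>
    (hL k).add (hN k)
  refine energy_le_of_forall_smear (hY i) fun n => ?_
  set χ := mollifier n with hχdef
  have hχ : IsTestFunction χ := isTestFunction_mollifier n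
  have hid := energy_identity (G := fun j => Y j.succ) hχ (hY 0) (hF 2) (fun j => hF j.castSucc)
    (fun j => hY j.succ) (eD χ hχ) (eH χ hχ) (eG χ hχ)
  have sY := fun i => (hY i).smear hχ
  have sN := fun i => (hN i).smear hχ
  have sF := fun i => (hF i).smear hχ
  have hlin : ∀ᵐ w ∂((timeMeasure T).prod (volume : Measure Plane)), ∀ k,
      smear χ (fun y => linPart ρ f (fun i => Y i w.1 y) k + N k w.1 y) w.2 =
        linPart ρ f (fun i => smear χ (Y i w.1) w.2) k + smear χ (N k w.1) w.2 := by
    have hs : ∀ᵐ t ∂timeMeasure T, ∀ z, ∀ k,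
        smear χ (fun y => linPart ρ f (fun i => Y i t y) k + N k t y) z =
          linPart ρ f (fun i => smear χ (Y i t) z) k + smear χ (N k t) z := by
      filter_upwards [ae_all_iff.2 fun i => (hY i).slice, ae_all_iff.2 fun i => (hN i).slice]
        with t h1 h2 z k
      have key := fun a b i j k => smear_linear_comb hχ a b ((h1 i).locallyIntegrable one_le_two)
        ((h1 j).locallyIntegrable one_le_two) ((h2 k).locallyIntegrable one_le_two) z
      fin_cases k
      · exact key (f - 2 * ρ) (ρ * f ^ 2) 0 1 0
      · have := key (ρ * f ^ 2) 0 2 0 1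
        simp only [zero_mul, add_zero] at this
        exact this
      · have := key f (-(1 / f)) 1 0 2
        simp only [neg_mul, ← sub_eq_add_neg] at this
        exact this
    have hq : Measure.QuasiMeasurePreserving (Prod.fst : ℝ × Plane → ℝ)
      ((timeMeasure T).prod (volume : Measure Plane)) (timeMeasure T) :=
        Measure.quasiMeasurePreserving_fst
    exact (hq.ae hs).mono fun w hw => hw w.2
  have iY := fun i => (sY i).integrable_mul (sY i)
  have iN := fun i => (sN i).integrable_mul (sN i)
  simp only [← pow_two] at iY iN
  have iE : Integrable (fun w : ℝ × Plane => (∑ j : Fin 2,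
      smear χ (fun y => linPart ρ f (fun i => Y i w.1 y) j.castSucc + N j.castSucc w.1 y) w.2 *
        smear χ (Y j.succ w.1) w.2) - smear χ (Y 0 w.1) w.2 *
        smear χ (fun y => linPart ρ f (fun i => Y i w.1 y) 2 + N 2 w.1 y) w.2)
      ((timeMeasure T).prod volume) :=
    (integrable_finsetSum _ fun j _ => (sF j.castSucc).integrable_mul (sY j.succ)).sub
      ((sY 0).integrable_mul (sF 2))
  -- Coercivity is applied pointwise to the mollified fields and integrated over space-time. The
  -- integral of the bracket is zero by the energy identity, which leaves the sources only; the
  -- constant `l⁻¹ * l⁻¹` is free of `T`.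
  have hint := integral_mono_ae ((integrable_finsetSum Finset.univ fun i _ => iY i).const_mul l)
    (iE.add ((integrable_finsetSum Finset.univ fun i _ => iN i).const_mul l⁻¹))
    (hlin.mono fun w hw => ?_)
  · rw [integral_const_mul] at hint
    simp only [Pi.add_apply] at hint
    rw [integral_add iE ((integrable_finsetSum Finset.univ fun i _ => iN i).const_mul l⁻¹), hid,
      zero_add, integral_const_mul, integral_finsetSum _ fun i _ => iY i,
      integral_finsetSum _ fun i _ => iN i] at hint
    set a := fun i => ∫ w, smear χ (Y i w.1) w.2 ^ 2 ∂((timeMeasure T).prod volume) with ha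
    set b := fun i => ∫ w, smear χ (N i w.1) w.2 ^ 2 ∂((timeMeasure T).prod volume) with hb
    have ha0 : ∀ i, 0 ≤ a i := fun i => integral_nonneg fun w => sq_nonneg _
    have hb0 : ∀ i, 0 ≤ b i := fun i => integral_nonneg fun w => sq_nonneg _
    have hai : a i ≤ ∑ i, a i := Finset.single_le_sum (fun i _ => ha0 i) (Finset.mem_univ i)
    have hle : a i ≤ l⁻¹ * l⁻¹ * ∑ k, b k := by
      have := mul_le_mul_of_nonneg_left ((mul_le_mul_of_nonneg_left hai hl.le).trans hint)
        (inv_pos.2 hl).le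
      rwa [← mul_assoc, inv_mul_cancel₀ hl.ne', one_mul, ← mul_assoc] at this
    rw [← (sY i).ofReal_integral_sq]
    refine (ENNReal.ofReal_le_ofReal hle).trans ?_
    rw [ENNReal.ofReal_mul (by positivity), ENNReal.ofReal_sum_of_nonneg fun i _ => hb0 i]
    gcongr with k
    rw [hb, (sN k).ofReal_integral_sq]
    have := (hN k).lintegral_smear_le hχ.continuous.measurable
    rwa [hχdef, lintegral_mollifier, one_pow, one_mul] at this
  · have := hco (fun i => smear χ (Y i w.1) w.2) fun i => smear χ (N i w.1) w.2
    simp only [Pi.add_apply, Fin.sum_univ_two, hw]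
    exact this

/-! ### From weak solutions to bounded measurable fields -/

theorem lintegral_enorm_sq {α F : Type*} [MeasurableSpace α] [NormedAddCommGroup F] {ν : Measure α}
    (g : α → F) : ∫⁻ x, ‖g x‖ₑ ^ 2 ∂ν = eLpNorm g 2 ν ^ 2 := by
  rw [eLpNorm_eq_lintegral_rpow_enorm_toReal two_ne_zero (by simp), ← ENNReal.rpow_natCast,
    ← ENNReal.rpow_mul]
  simp

theorem timeMeasure_eq_Icc (T : ℝ) : timeMeasure T = volume.restrict (Icc 0 T) :=
  Measure.restrict_congr_set Ioc_ae_eq_Icc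

theorem ae_timeMeasure_mem (T : ℝ) : ∀ᵐ t ∂timeMeasure T, t ∈ Icc 0 T := by
  rw [timeMeasure_eq_Icc]
  exact ae_restrict_mem measurableSet_Icc

/-- Volterra integrals are written as kernels on one fixed finite measure, the form in which
Fubini's theorem is used in the energy identity. -/
theorem integral_zero_eq_timeMeasure {T t : ℝ} (ht : t ∈ Icc 0 T) (g : ℝ → ℝ) :
    ∫ s in (0 : ℝ)..t, g s = ∫ s, (if s ≤ t then 1 else 0) * g s ∂timeMeasure T := by
  have e : (fun s => (if s ≤ t then (1 : ℝ) else 0) * g s) = (Iic t).indicator g := by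
    funext s
    by_cases h : s ≤ t <;> simp [indicator, h]
  rw [e, integral_indicator measurableSet_Iic, timeMeasure, Measure.restrict_restrict
    measurableSet_Iic, intervalIntegral.integral_of_le ht.1]
  congr 2
  ext s
  exact ⟨fun h => ⟨h.2, h.1, h.2.trans ht.2⟩, fun h => ⟨h.2.1, h.1⟩⟩

theorem integral_end_eq_timeMeasure {T t : ℝ} (ht : t ∈ Icc 0 T) (g : ℝ → ℝ) :
    ∫ s in t..T, g s = ∫ s, (if t ≤ s then 1 else 0) * g s ∂timeMeasure T := by
  have e : (fun s => (if t ≤ s then (1 : ℝ) else 0) * g s) = (Ici t).indicator g := by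
    funext s
    by_cases h : t ≤ s <;> simp [indicator, h]
  rw [e, integral_indicator measurableSet_Ici, timeMeasure_eq_Icc, Measure.restrict_restrict
    measurableSet_Ici, intervalIntegral.integral_of_le ht.2, ← integral_Icc_eq_integral_Ioc]
  congr 2
  ext s
  exact ⟨fun h => ⟨h.1, ht.1.trans h.1, h.2⟩, fun h => ⟨h.1, h.2.2⟩⟩

theorem ae_eq_of_smear_mollifier {g h : Plane → ℝ} (hg : LocallyIntegrable g)
    (hh : LocallyIntegrable h) (e : ∀ n z, smear (mollifier n) g z = smear (mollifier n) h z) :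
    g =ᵐ[volume] h := by
  filter_upwards [ae_tendsto_smear_mollifier hg, ae_tendsto_smear_mollifier hh] with z h1 h2
  simp only [e] at h1
  exact tendsto_nhds_unique h1 h2

theorem locallyIntegrable_of_abs_le {g : Plane → ℝ} (hg : Measurable g) {C : ℝ}
    (h : ∀ z, |g z| ≤ C) : LocallyIntegrable g :=
  (memLp_top_of_bound hg.aestronglyMeasurable C (Eventually.of_forall h)).locallyIntegrable le_top

theorem integrable_smear_time {T C : ℝ} {X : ℝ → Plane → ℝ} {χ : Plane → ℝ}
    (hX : Measurable fun w : ℝ × Plane => X w.1 w.2) (hC : ∀ t z, |X t z| ≤ C)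
    (hχ : IsTestFunction χ) (z : Plane) :
    Integrable (fun s => smear χ (X s) z) (timeMeasure T) := by
  have hm := (SqField.measurable_smear hX hχ.continuous.measurable).comp
    (measurable_prodMk_right (y := z))
  refine Integrable.of_bound (C := ∫ y, |χ (z - y)| * C) hm.aestronglyMeasurable
    (Eventually.of_forall fun s => ?_)
  refine norm_integral_le_of_norm_le ((hχ.comp_sub_left z).integrable.abs.mul_const C)
    (Eventually.of_forall fun y => ?_)
  rw [Real.norm_eq_abs, abs_mul]
  exact mul_le_mul_of_nonneg_left (hC s y) (abs_nonneg _)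

/-- A bounded representative of a bounded square integrable field. -/
theorem exists_clamped {T δ : ℝ} {C : ℝ≥0} (hδ : 0 ≤ δ) {g : ℝ → Plane → ℝ}
    (hm : AEStronglyMeasurable (fun w : ℝ × Plane => g w.1 w.2)
      ((volume.restrict (Icc 0 T)).prod volume))
    (h2 : ∀ t ∈ Icc 0 T, eLpNorm (g t) 2 volume ≤ C)
    (hs : ∀ t ∈ Icc 0 T, eLpNorm (g t) ⊤ volume ≤ ENNReal.ofReal δ) :
    ∃ x : ℝ → Plane → ℝ, SqField T x ∧ (∀ t z, |x t z| ≤ δ) ∧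
      ∀ᵐ t ∂timeMeasure T, g t =ᵐ[volume] x t := by
  rw [← timeMeasure_eq_Icc] at hm
  set u := hm.mk with hu
  have hum : Measurable u := hm.stronglyMeasurable_mk.measurable
  -- A measurable representative is clamped to `[-δ, δ]`: the bound then holds everywhere, and on
  -- almost every slice nothing changes.
  have hxm : Measurable fun w : ℝ × Plane => max (-δ) (min δ (u w)) :=
    measurable_const.max (measurable_const.min hum)
  have hae : ∀ᵐ t ∂timeMeasure T, g t =ᵐ[volume] fun z => max (-δ) (min δ (u (t, z))) := by
    filter_upwards [Measure.ae_ae_of_ae_prod hm.ae_eq_mk, ae_timeMeasure_mem T] with t ht htT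
    have hb : ∀ᵐ z, ‖g t z‖ₑ ≤ ENNReal.ofReal δ :=
      (ae_le_eLpNormEssSup (f := g t)).mono fun z hz =>
        hz.trans (by simpa only [eLpNorm_exponent_top] using hs t htT)
    filter_upwards [ht, hb] with z hz hz2
    rw [Real.enorm_eq_ofReal_abs, ENNReal.ofReal_le_ofReal_iff hδ] at hz2
    have h3 := abs_le.1 hz2
    have hz' : g t z = u (t, z) := hz
    rw [← hz', min_eq_right h3.2, max_eq_right h3.1]
  refine ⟨fun t z => max (-δ) (min δ (u (t, z))), SqField.of_lintegral hxm ?_, fun t z => ?_, hae⟩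
  · have hle : ∫⁻ t, (∫⁻ z, ‖max (-δ) (min δ (u (t, z)))‖ₑ ^ 2) ∂timeMeasure T ≤
        ∫⁻ _, (C : ℝ≥0∞) ^ 2 ∂timeMeasure T := by
      refine lintegral_mono_ae ?_
      filter_upwards [hae, ae_timeMeasure_mem T] with t ht htT
      rw [lintegral_enorm_sq, ← eLpNorm_congr_ae ht]
      exact pow_le_pow_left' (h2 t htT) 2
    refine (hle.trans_lt ?_).ne
    rw [lintegral_const]
    exact ENNReal.mul_lt_top (ENNReal.pow_lt_top ENNReal.coe_lt_top) (measure_lt_top _ _)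
  · exact abs_le.2 ⟨le_max_left _ _, max_le (by linarith) (min_le_left _ _)⟩

/-- The three scalar fields on the right-hand sides of the system: the components of the flux and
the rate of the value function. -/
def sourceField (ρ f κ : ℝ) (x : Fin 3 → ℝ) (k : Fin 3) : ℝ :=
  linPart ρ f x k + Poly.quad (nonlinearity ρ f κ k) x

theorem exists_bound_sourceField (ρ f κ : ℝ) :
    ∃ C : ℝ, ∀ x : Fin 3 → ℝ, (∀ i, |x i| ≤ 1) → ∀ k, |sourceField ρ f κ x k| ≤ C := by
  refine ⟨(|f - 2 * ρ| + 2 * |ρ * f ^ 2| + |f| + |1 / f|) +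
    ∑ k, Poly.quadConst (nonlinearity ρ f κ k), fun x hx k => ?_⟩
  refine (abs_add_le _ _).trans (add_le_add ?_ ?_)
  · have hb : ∀ a i, |a * x i| ≤ |a| := fun a i => by
      rw [abs_mul]; exact mul_le_of_le_one_right (abs_nonneg a) (hx i)
    have h1 := abs_nonneg (f - 2 * ρ)
    have h2 := abs_nonneg (ρ * f ^ 2)
    have h3 := abs_nonneg f
    have h4 := abs_nonneg (1 / f)
    fin_cases k
    · have := abs_add_le ((f - 2 * ρ) * x 0) (ρ * f ^ 2 * x 1)
      have h5 := hb (f - 2 * ρ) 0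
      have h6 := hb (ρ * f ^ 2) 1
      show |(f - 2 * ρ) * x 0 + ρ * f ^ 2 * x 1| ≤ _
      linarith
    · have h6 := hb (ρ * f ^ 2) 2
      show |ρ * f ^ 2 * x 2| ≤ _
      linarith
    · have := abs_sub (f * x 1) (1 / f * x 0)
      have h5 := hb f 1
      have h6 := hb (1 / f) 0
      show |f * x 1 - 1 / f * x 0| ≤ _
      linarith
  · have h0 : Poly.quad (nonlinearity ρ f κ k) 0 = 0 := by simp [Poly.quad]
    have h1 := Poly.abs_quad_sub_le (y := 0) zero_le_one le_rfl hx (by simp) (m := 1)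
      (by simpa using hx) (nonlinearity ρ f κ k)
    rw [h0, sub_zero, mul_one, mul_one] at h1
    exact h1.trans (Finset.single_le_sum (f := fun k => Poly.quadConst (nonlinearity ρ f κ k))
      (fun k _ => Poly.quadConst_nonneg _) (Finset.mem_univ k))

theorem measurable_sourceField {α : Type*} [MeasurableSpace α] {x : Fin 3 → α → ℝ}
    (hx : ∀ i, Measurable (x i)) (ρ f κ : ℝ) (k : Fin 3) :
    Measurable fun w => sourceField ρ f κ (fun i => x i w) k := by
  refine Measurable.add ?_ (Poly.measurable_quad hx _)
  fin_cases k
  · exact ((hx 0).const_mul _).add ((hx 1).const_mul _)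
  · exact (hx 2).const_mul _
  · exact ((hx 1).const_mul _).sub ((hx 0).const_mul _)

/-- Bounded representatives `x` of the density and of the gradient. -/
structure IsState (T δ : ℝ) (ψ : ℝ → Plane → ℝ) (p : ℝ → Plane → Plane)
    (x : Fin 3 → ℝ → Plane → ℝ) : Prop where
  sq : ∀ i, SqField T (x i)
  small : ∀ i t z, |x i t z| ≤ δ
  density : ∀ᵐ t ∂timeMeasure T, ψ t =ᵐ[volume] x 0 t
  gradient : ∀ᵐ t ∂timeMeasure T, ∀ j : Fin 2, (fun z => p t z j) =ᵐ[volume] x j.succ t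

/-! ### The equations of a small solution, tested against kernels -/

section Solution

variable {ρm ρb κ T δ : ℝ} {ψ₀ φT : Plane → ℝ} {ψ φ : ℝ → Plane → ℝ} {p : ℝ → Plane → Plane}
  {x : Fin 3 → ℝ → Plane → ℝ}

theorem IsSolution.exists_isState (h : IsSolution ρm ρb κ T ψ₀ φT ψ φ p)
    (hs : StaysSmall T δ ψ p) (hδ : 0 ≤ δ) : ∃ x, IsState T δ ψ p x := by
  obtain ⟨C, hC⟩ := h.bounded
  obtain ⟨x0, s0, b0, e0⟩ := exists_clamped hδ h.measurable_density (fun t ht => (hC t ht).1)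
    fun t ht => le_self_add.trans (hs t ht)
  have hle : ∀ (r : ℝ≥0∞) t (j : Fin 2),
      eLpNorm (fun z => p t z j) r volume ≤ eLpNorm (p t) r volume := fun r t j => eLpNorm_mono fun z => PiLp.norm_apply_le (p t z) j
  have hj : ∀ j : Fin 2, ∃ x : ℝ → Plane → ℝ, SqField T x ∧ (∀ t z, |x t z| ≤ δ) ∧
      ∀ᵐ t ∂timeMeasure T, (fun z => p t z j) =ᵐ[volume] x t := fun j =>
    exists_clamped (g := fun t z => p t z j) hδ
      ((EuclideanSpace.proj (𝕜 := ℝ) j).continuous.comp_aestronglyMeasurable h.measurable_gradient)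
      (fun t ht => (hle 2 t j).trans (hC t ht).2.2.1)
      fun t ht => (hle ⊤ t j).trans (le_add_self.trans (hs t ht))
  choose y sy bly ey using hj
  refine ⟨Fin.cons x0 y, fun i => ?_, fun i => ?_, e0, ae_all_iff.2 fun j => by simpa using ey j⟩
  · refine Fin.cases ?_ (fun j => ?_) i
    · exact s0
    · exact sy j
  · refine Fin.cases ?_ (fun j => ?_) i
    · exact b0
    · exact bly j

theorem IsState.ae_eq (hx : IsState T δ ψ p x) (ρm ρb κ : ℝ) : ∀ᵐ t ∂timeMeasure T, ∀ᵐ z,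
    (∀ j : Fin 2, flux ρm ρb (ψ t z) (p t z) j =
      sourceField ρb (sat ρm ρb) κ (fun i => x i t z) j.castSucc) ∧
    valueRHS ρm ρb κ (ψ t z) (p t z) = sourceField ρb (sat ρm ρb) κ (fun i => x i t z) 2 := by
  filter_upwards [hx.density, hx.gradient] with t h1 h2
  filter_upwards [h1, h2 0, h2 1] with z z1 z2 z3
  have e : (![ψ t z, p t z 0, p t z 1] : Fin 3 → ℝ) = fun i => x i t z := by
    funext i
    fin_cases i
    · exact z1
    · exact z2
    · exact z3
  refine ⟨fun j => ?_, ?_⟩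
  · fin_cases j
    · refine (flux_zero_eq ρm ρb κ _ _).trans ?_
      rw [e, z1]
      rw [z2]
      rfl
    · refine (flux_one_eq ρm ρb κ _ _).trans ?_
      rw [e, z3]
      rfl
  · rw [valueRHS_eq, e, z1]
    rw [z2]
    rfl

theorem IsState.measurable_source (hx : IsState T δ ψ p x) (ρ f κ : ℝ) (k : Fin 3) :
    Measurable fun w : ℝ × Plane => sourceField ρ f κ (fun i => x i w.1 w.2) k :=
  measurable_sourceField (x := fun i (w : ℝ × Plane) => x i w.1 w.2) (fun i => (hx.sq i).meas)
    _ _ _ _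

theorem IsState.locallyIntegrable_source (hx : IsState T δ ψ p x) (hδ1 : δ ≤ 1) (ρ f κ : ℝ)
    (k : Fin 3) (t : ℝ) : LocallyIntegrable fun z => sourceField ρ f κ (fun i => x i t z) k := by
  obtain ⟨C, hC⟩ := exists_bound_sourceField ρ f κ
  exact locallyIntegrable_of_abs_le ((hx.measurable_source ρ f κ k).comp measurable_prodMk_left)
    fun z => hC _ (fun i => (hx.small i t z).trans hδ1) k

/-- The weak equation is tested against `y ↦ χ (z - y)`; the sign from differentiating in `y`
cancels that of the weak formulation. -/
theorem IsSolution.smear_density (h : IsSolution ρm ρb κ T ψ₀ φT ψ φ p) (hx : IsState T δ ψ p x)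
    (hδ1 : δ ≤ 1) {χ : Plane → ℝ} (hχ : IsTestFunction χ) {t : ℝ} (ht : t ∈ Icc 0 T) (z : Plane) :
    smear χ (ψ t) z = smear χ ψ₀ z + ∫ s, (if s ≤ t then 1 else 0) * ∑ j : Fin 2, smear (pd j χ)
      (fun y => sourceField ρb (sat ρm ρb) κ (fun i => x i s y) j.castSucc) z ∂timeMeasure T := by
  have e := h.density_eq _ (hχ.comp_sub_left z) t ht
  rw [integral_zero_eq_timeMeasure ht] at e
  unfold smear
  simp only [mul_comm (χ _)]
  rw [e, sub_eq_add_neg, ← integral_neg]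
  congr 1
  refine integral_congr_ae ((hx.ae_eq ρm ρb κ).mono fun s hs => ?_)
  simp only
  rw [← mul_neg]
  congr 1
  rw [← integral_neg, ← integral_finsetSum]
  · refine integral_congr_ae (hs.mono fun y hy => ?_)
    simp only [PiLp.inner_apply, (hχ.comp_sub_left z).gradient_apply, hχ.pd_comp_sub_left, ← hy.1,
      ← Finset.sum_neg_distrib, RCLike.inner_apply, conj_trivial]
    exact Finset.sum_congr rfl fun j _ => by ring
  · intro j _
    exact (hχ.pd j).integrable_smear (hx.locallyIntegrable_source hδ1 _ _ _ _ s) z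

theorem IsSolution.smear_value (h : IsSolution ρm ρb κ T ψ₀ φT ψ φ p) (hx : IsState T δ ψ p x)
    {χ : Plane → ℝ} (hχ : IsTestFunction χ) {t : ℝ} (ht : t ∈ Icc 0 T) (z : Plane) :
    smear χ (φ t) z = smear χ φT z - ∫ s, (if t ≤ s then 1 else 0) * smear χ
      (fun y => sourceField ρb (sat ρm ρb) κ (fun i => x i s y) 2) z ∂timeMeasure T := by
  have e := h.value_eq _ (hχ.comp_sub_left z) t ht
  rw [integral_end_eq_timeMeasure ht] at e
  unfold smear
  simp only [mul_comm (χ _)]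
  rw [e]
  congr 1
  refine integral_congr_ae ((hx.ae_eq ρm ρb κ).mono fun s hs => ?_)
  simp only
  congr 1
  exact integral_congr_ae (hs.mono fun y hy => by simp only [hy.2])

end Solution

/-! ### Absorption of the nonlinearity and uniqueness -/

theorem energy_sum_le {T a : ℝ} {N : ℝ → Plane → ℝ} {Y : Fin 3 → ℝ → Plane → ℝ}
    (hY : ∀ i, SqField T (Y i)) (ha : 0 ≤ a)
    (h : ∀ t z, N t z ^ 2 ≤ a * ∑ i, Y i t z ^ 2) :
    energy T N ≤ ENNReal.ofReal a * ∑ i, energy T (Y i) := by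
  have m1 : ∀ i, Measurable fun w : ℝ × Plane => ‖Y i w.1 w.2‖ₑ ^ 2 := fun i =>
    (hY i).meas.enorm.pow_const 2
  have m2 : ∀ i, Measurable fun t => ∫⁻ z, ‖Y i t z‖ₑ ^ 2 := fun i => (m1 i).lintegral_prod_right'
  have m3 : ∀ i t, Measurable fun z => ‖Y i t z‖ₑ ^ 2 := fun i t =>
    ((hY i).measurable_slice t).enorm.pow_const 2
  have e : ∀ b : ℝ, ‖b‖ₑ ^ 2 = ENNReal.ofReal (b ^ 2) := fun b => by
    rw [← sq_abs, ENNReal.ofReal_pow (abs_nonneg _), Real.enorm_eq_ofReal_abs]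
  have hp : ∀ t z, ‖N t z‖ₑ ^ 2 ≤ ENNReal.ofReal a * ∑ i, ‖Y i t z‖ₑ ^ 2 := fun t z => by
    simp only [e]
    rw [← ENNReal.ofReal_sum_of_nonneg fun i _ => sq_nonneg _, ← ENNReal.ofReal_mul ha]
    exact ENNReal.ofReal_le_ofReal (h t z)
  unfold energy
  refine (lintegral_mono fun t => lintegral_mono fun z => hp t z).trans_eq ?_
  rw [← lintegral_finsetSum _ fun i _ => m2 i,
    ← lintegral_const_mul _ (Finset.measurable_fun_sum _ fun i _ => m2 i)]
  refine lintegral_congr fun t => ?_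
  rw [lintegral_const_mul _ (Finset.measurable_fun_sum _ fun i _ => m3 i t),
    lintegral_finsetSum _ fun i _ => m3 i t]

theorem ae_eq_zero_of_energy {T : ℝ} {X : ℝ → Plane → ℝ} (hX : SqField T X)
    (h : energy T X = 0) : ∀ᵐ t ∂timeMeasure T, ∀ᵐ z, X t z = 0 := by
  have m1 : Measurable fun w : ℝ × Plane => ‖X w.1 w.2‖ₑ ^ 2 := hX.meas.enorm.pow_const 2
  have m2 : Measurable fun t => ∫⁻ z, ‖X t z‖ₑ ^ 2 := m1.lintegral_prod_right'
  filter_upwards [(lintegral_eq_zero_iff m2).1 h] with t ht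
  filter_upwards [(lintegral_eq_zero_iff ((hX.measurable_slice t).enorm.pow_const 2)).1 ht]
    with z hz
  simpa using hz

/-- Two states satisfying the same smeared equations agree, if they are small. -/
theorem exists_state_unique {ρ f : ℝ} (κ : ℝ) (hρ : 0 < ρ) (hf : ρ < f) :
    ∃ δ : ℝ, 0 < δ ∧ δ ≤ 1 ∧ ∀ (T : ℝ) (x x' : Fin 3 → ℝ → Plane → ℝ) (H : ℝ → Plane → ℝ),
      (∀ i, SqField T (x i)) → (∀ i, SqField T (x' i)) →
      (∀ i t z, |x i t z| ≤ δ) → (∀ i t z, |x' i t z| ≤ δ) →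
      (∀ χ, IsTestFunction χ → ∀ᵐ t ∂timeMeasure T, ∀ z, smear χ (fun y => x 0 t y - x' 0 t y) z =
        ∫ s, (if s ≤ t then 1 else 0) * ∑ j : Fin 2, smear (pd j χ)
          (fun y => sourceField ρ f κ (fun i => x i s y) j.castSucc -
            sourceField ρ f κ (fun i => x' i s y) j.castSucc) z ∂timeMeasure T) →
      (∀ χ, IsTestFunction χ → ∀ᵐ t ∂timeMeasure T, ∀ z, smear χ (H t) z =
        -∫ s, (if t ≤ s then 1 else 0) * smear χ (fun y => sourceField ρ f κ (fun i => x i s y) 2 -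
            sourceField ρ f κ (fun i => x' i s y) 2) z ∂timeMeasure T) →
      (∀ χ, IsTestFunction χ → ∀ᵐ t ∂timeMeasure T, LocallyIntegrable (H t) ∧
        ∀ (j : Fin 2) z, smear (pd j χ) (H t) z =
          smear χ (fun y => x j.succ t y - x' j.succ t y) z) →
      ∀ i, ∀ᵐ t ∂timeMeasure T, ∀ᵐ z, x i t z = x' i t z := by
  obtain ⟨B, hB, hest⟩ := exists_energy_estimate hρ hf
  set Q := ∑ k, Poly.quadConst (nonlinearity ρ f κ k) with hQ
  have hQ0 : 0 ≤ Q := Finset.sum_nonneg fun k _ => Poly.quadConst_nonneg _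
  have hQk : ∀ k, Poly.quadConst (nonlinearity ρ f κ k) ≤ Q := fun k =>
    Finset.single_le_sum (f := fun k => Poly.quadConst (nonlinearity ρ f κ k))
      (fun k _ => Poly.quadConst_nonneg _) (Finset.mem_univ k)
  have hden : 0 < 1 + 54 * B * Q ^ 2 := by positivity
  -- Chosen so that `27 B Q² δ² ≤ 1 / 2`. The three factors `3` come from squaring a sum of three
  -- terms, from summing over the three sources, and from summing over the three unknowns.
  set δ := 1 / (1 + 54 * B * Q ^ 2) with hδ
  have hδ0 : 0 < δ := by positivity
  have hδ1 : δ ≤ 1 := by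
    rw [hδ, div_le_one hden]
    have : 0 ≤ 54 * B * Q ^ 2 := by positivity
    linarith
  have hsmall : 27 * B * Q ^ 2 * δ ^ 2 ≤ 1 / 2 := by
    have h1 : δ * (1 + 54 * B * Q ^ 2) = 1 := by rw [hδ]; field_simp
    have h2 : 0 ≤ B * Q ^ 2 := by positivity
    have h3 : 27 * B * Q ^ 2 * δ ^ 2 ≤ 27 * B * Q ^ 2 * δ := by
      have := mul_le_mul_of_nonneg_left hδ1 (mul_nonneg h2 hδ0.le)
      nlinarith
    nlinarith
  refine ⟨δ, hδ0, hδ1, fun T x x' H sx sx' bx bx' eD eH eG => ?_⟩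
  set Y : Fin 3 → ℝ → Plane → ℝ := fun i t z => x i t z - x' i t z with hYdef
  set N : Fin 3 → ℝ → Plane → ℝ := fun k t z =>
    Poly.quad (nonlinearity ρ f κ k) (fun i => x i t z) -
      Poly.quad (nonlinearity ρ f κ k) (fun i => x' i t z) with hNdef
  have hY : ∀ i, SqField T (Y i) := fun i => (sx i).sub (sx' i)
  set M : ℝ → Plane → ℝ := fun t z => |Y 0 t z| + |Y 1 t z| + |Y 2 t z| with hM
  have hMle : ∀ i t z, |Y i t z| ≤ M t z := fun i t z => by
    have h0 := abs_nonneg (Y 0 t z)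
    have h1 := abs_nonneg (Y 1 t z)
    have h2 := abs_nonneg (Y 2 t z)
    fin_cases i
    · show |Y 0 t z| ≤ |Y 0 t z| + |Y 1 t z| + |Y 2 t z|
      linarith
    · show |Y 1 t z| ≤ |Y 0 t z| + |Y 1 t z| + |Y 2 t z|
      linarith
    · show |Y 2 t z| ≤ |Y 0 t z| + |Y 1 t z| + |Y 2 t z|
      linarith
  have hYa : ∀ i, SqField T fun t z => |Y i t z| := fun i =>
    (hY i).of_le (by simpa only [Real.norm_eq_abs] using (hY i).meas.norm) fun t z => (abs_abs _).le
  have hMs : SqField T M := ((hYa 0).add (hYa 1)).add (hYa 2)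
  have hNM : ∀ k t z, |N k t z| ≤ Q * δ * M t z := fun k t z => by
    refine (Poly.abs_quad_sub_le hδ0.le hδ1 (fun i => bx i t z) (fun i => bx' i t z)
      (fun i => hMle i t z) _).trans ?_
    have := (abs_nonneg _).trans (hMle 0 t z)
    gcongr
    exact hQk k
  have hN : ∀ k, SqField T (N k) := fun k =>
    (hMs.const_mul (Q * δ)).of_le
      ((Poly.measurable_quad (x := fun i (w : ℝ × Plane) => x i w.1 w.2)
          (fun i => (sx i).meas) _).sub
        (Poly.measurable_quad (x := fun i (w : ℝ × Plane) => x' i w.1 w.2)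
          (fun i => (sx' i).meas) _))
      fun t z => (hNM k t z).trans (le_abs_self _)
  have hN2 : ∀ k t z, N k t z ^ 2 ≤ 3 * Q ^ 2 * δ ^ 2 * ∑ i, Y i t z ^ 2 := fun k t z => by
    have h1 := pow_le_pow_left₀ (abs_nonneg _) (hNM k t z) 2
    have h2 : M t z ^ 2 ≤ 3 * ∑ i, Y i t z ^ 2 := by
      rw [Fin.sum_univ_three, ← sq_abs (Y 0 t z), ← sq_abs (Y 1 t z), ← sq_abs (Y 2 t z)]
      simp only [hM]
      nlinarith [sq_nonneg (|Y 0 t z| - |Y 1 t z|), sq_nonneg (|Y 0 t z| - |Y 2 t z|),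
        sq_nonneg (|Y 1 t z| - |Y 2 t z|)]
    rw [sq_abs] at h1
    have h3 := mul_le_mul_of_nonneg_left h2 (show 0 ≤ (Q * δ) ^ 2 by positivity)
    nlinarith
  have hsrc : ∀ k t y, sourceField ρ f κ (fun i => x i t y) k -
      sourceField ρ f κ (fun i => x' i t y) k = linPart ρ f (fun i => Y i t y) k + N k t y := fun k t y => by
    rw [hYdef, linPart_sub]
    simp only [sourceField, hNdef]
    ring
  simp only [hsrc] at eD eH
  have hE := hest T Y N H hY hN eD eH eG
  have hNE : ∀ k, energy T (N k) ≤ ENNReal.ofReal (3 * Q ^ 2 * δ ^ 2) * ∑ i, energy T (Y i) :=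
    fun k => energy_sum_le hY (by positivity) (hN2 k)
  set S := ∑ i, energy T (Y i) with hS
  have hStop : S ≠ ⊤ := (ENNReal.sum_lt_top.2 fun i _ => (hY i).lintegral_ne_top.lt_top).ne
  -- The total energy is at most half of itself; being finite, it is zero.
  have hSle : S ≤ ENNReal.ofReal (1 / 2) * S := by
    have h1 : ∀ i, energy T (Y i) ≤ ENNReal.ofReal (9 * B * Q ^ 2 * δ ^ 2) * S := fun i => by
      refine (hE i).trans ((mul_le_mul_right (Finset.sum_le_sum fun k _ => hNE k) _).trans_eq ?_)
      rw [Finset.sum_const, Finset.card_univ, Fintype.card_fin, nsmul_eq_mul, ← mul_assoc,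
        ← mul_assoc, Nat.cast_ofNat, show (3 : ℝ≥0∞) = ENNReal.ofReal 3 by simp,
        ← ENNReal.ofReal_mul hB.le, ← ENNReal.ofReal_mul (by positivity)]
      congr 2
      ring
    calc S ≤ ∑ _i : Fin 3, ENNReal.ofReal (9 * B * Q ^ 2 * δ ^ 2) * S :=
          Finset.sum_le_sum fun i _ => h1 i
      _ = ENNReal.ofReal (27 * B * Q ^ 2 * δ ^ 2) * S := by
          rw [Finset.sum_const, Finset.card_univ, Fintype.card_fin, nsmul_eq_mul, ← mul_assoc,
            Nat.cast_ofNat, show (3 : ℝ≥0∞) = ENNReal.ofReal 3 by simp,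
            ← ENNReal.ofReal_mul (by norm_num)]
          congr 2
          ring
      _ ≤ _ := mul_le_mul_left (ENNReal.ofReal_le_ofReal hsmall) _
  have hS0 : S = 0 := by
    have h1 := ENNReal.toReal_mono (ENNReal.mul_ne_top ENNReal.ofReal_ne_top hStop) hSle
    rw [ENNReal.toReal_mul, ENNReal.toReal_ofReal (by norm_num)] at h1
    have h2 : S.toReal = 0 := le_antisymm (by linarith) ENNReal.toReal_nonneg
    exact (ENNReal.toReal_eq_zero_iff _).1 h2 |>.resolve_right hStop
  intro i
  have hYi : energy T (Y i) = 0 := Finset.sum_eq_zero_iff.1 hS0 i (Finset.mem_univ i)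
  filter_upwards [ae_eq_zero_of_energy (hY i) hYi] with t ht
  filter_upwards [ht] with z hz
  exact sub_eq_zero.1 hz

theorem smear_sub {χ g h : Plane → ℝ} (hχ : IsTestFunction χ) (hg : LocallyIntegrable g)
    (hh : LocallyIntegrable h) (z : Plane) :
    smear χ (fun y => g y - h y) z = smear χ g z - smear χ h z := by
  unfold smear
  rw [← integral_sub (hχ.integrable_smear hg z) (hχ.integrable_smear hh z)]
  simp only [mul_sub]

/-- Small solutions with the same data agree. -/
theorem exists_unique_small {ρm ρb : ℝ} (κ : ℝ) (hρ : 0 < ρb) (hf : ρb < sat ρm ρb) :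
    ∃ δ : ℝ, 0 < δ ∧ ∀ (T : ℝ) (ψ₀ φT : Plane → ℝ) (ψ φ ψ' φ' : ℝ → Plane → ℝ)
      (p p' : ℝ → Plane → Plane), LocallyIntegrable φT →
      IsSolution ρm ρb κ T ψ₀ φT ψ φ p → StaysSmall T δ ψ p →
      IsSolution ρm ρb κ T ψ₀ φT ψ' φ' p' → StaysSmall T δ ψ' p' →
      ∀ t ∈ Icc 0 T, ψ' t =ᵐ[volume] ψ t ∧ φ' t =ᵐ[volume] φ t := by
  obtain ⟨δ, hδ0, hδ1, huniq⟩ := exists_state_unique κ hρ hf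
  refine ⟨δ, hδ0, fun T ψ₀ φT ψ φ ψ' φ' p p' hφT h hs h' hs' => ?_⟩
  obtain ⟨x, hx⟩ := h.exists_isState hs hδ0.le
  obtain ⟨x', hx'⟩ := h'.exists_isState hs' hδ0.le
  set f := sat ρm ρb with hfdef
  obtain ⟨C, hC⟩ := exists_bound_sourceField ρb f κ
  have iS : ∀ {χ : Plane → ℝ} (_ : IsTestFunction χ) {ψ p x} (_ : IsState T δ ψ p x) k z,
      Integrable (fun s => smear χ (fun y => sourceField ρb f κ (fun i => x i s y) k) z)
        (timeMeasure T) := by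
    intro χ hχ ψ p x hx k z
    exact integrable_smear_time (X := fun s y => sourceField ρb f κ (fun i => x i s y) k)
      (hx.measurable_source ρb f κ k) (fun t z => hC _ (fun i => (hx.small i t z).trans hδ1) k) hχ z
  have lS : ∀ {ψ p x} (_ : IsState T δ ψ p x) k s,
      LocallyIntegrable fun y => sourceField ρb f κ (fun i => x i s y) k := by
    intro ψ p x hx k s
    exact hx.locallyIntegrable_source hδ1 _ _ _ _ _
  have lx : ∀ {ψ p x} (_ : IsState T δ ψ p x) i t, LocallyIntegrable (x i t) := by
    intro ψ p x hx i t
    exact locallyIntegrable_of_abs_le ((hx.sq i).measurable_slice t) (hx.small i t)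
  have ik : ∀ {g : ℝ → ℝ} {k : ℝ → Prop} [DecidablePred k], MeasurableSet {s | k s} →
      Integrable g (timeMeasure T) →
      Integrable (fun s => (if k s then (1 : ℝ) else 0) * g s) (timeMeasure T) := by
    intro g k _ hk hg
    refine hg.bdd_mul (c := 1)
      (Measurable.ite hk measurable_const measurable_const).aestronglyMeasurable (Eventually.of_forall fun s => ?_)
    split_ifs <;> simp
  -- Agreement at almost every time first. `H` is the difference of the value functions, for which
  -- the common terminal datum cancels.
  have hae : ∀ i, ∀ᵐ t ∂timeMeasure T, ∀ᵐ z, x i t z = x' i t z := by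
    refine huniq T x x' (fun t z => φ t z - φ' t z) hx.sq hx'.sq hx.small hx'.small
      (fun χ hχ => ?_) (fun χ hχ => ?_) fun χ hχ => ?_
    · filter_upwards [ae_timeMeasure_mem T, hx.density, hx'.density] with t ht e e' z
      have d1 := h.smear_density hx hδ1 hχ ht z
      have d2 := h'.smear_density hx' hδ1 hχ ht z
      rw [smear_congr_ae e] at d1
      rw [smear_congr_ae e'] at d2
      rw [smear_sub hχ (lx hx 0 t) (lx hx' 0 t), d1, d2, add_sub_add_left_eq_sub, ← integral_sub]
      · refine integral_congr_ae (Eventually.of_forall fun s => ?_)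
        simp only
        rw [← mul_sub, ← Finset.sum_sub_distrib]
        congr 1
        exact Finset.sum_congr rfl fun j _ => (smear_sub (hχ.pd j) (lS hx _ s) (lS hx' _ s) z).symm
      · exact ik measurableSet_Iic (integrable_finsetSum _ fun j _ => iS (hχ.pd j) hx _ z)
      · exact ik measurableSet_Iic (integrable_finsetSum _ fun j _ => iS (hχ.pd j) hx' _ z)
    · filter_upwards [ae_timeMeasure_mem T] with t ht z
      rw [smear_sub hχ (h.gradient t ht).1 (h'.gradient t ht).1, h.smear_value hx hχ ht,
        h'.smear_value hx' hχ ht, sub_sub_sub_cancel_left, ← neg_sub, neg_inj, ← integral_sub]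
      · refine integral_congr_ae (Eventually.of_forall fun s => ?_)
        simp only
        rw [← mul_sub, smear_sub hχ (lS hx 2 s) (lS hx' 2 s)]
      · exact ik measurableSet_Ici (iS hχ hx _ z)
      · exact ik measurableSet_Ici (iS hχ hx' _ z)
    · filter_upwards [ae_timeMeasure_mem T, hx.gradient, hx'.gradient] with t ht e e'
      have g1 := h.gradient t ht
      have g2 := h'.gradient t ht
      refine ⟨g1.1.sub g2.1, fun j z => ?_⟩
      rw [smear_sub (hχ.pd j) g1.1 g2.1, g1.smear_pd hχ, g2.smear_pd hχ, smear_congr_ae (e j),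
        smear_congr_ae (e' j), smear_sub hχ (lx hx _ t) (lx hx' _ t)]
  -- The integrated equations involve the sources only through time integrals, so agreement at
  -- almost every time gives agreement at every time. The terminal condition also fixes the additive
  -- constant of the value function.
  have hsrc : ∀ᵐ s ∂timeMeasure T, ∀ (χ : Plane → ℝ) k z,
      smear χ (fun y => sourceField ρb f κ (fun i => x' i s y) k) z =
        smear χ (fun y => sourceField ρb f κ (fun i => x i s y) k) z := by
    filter_upwards [ae_all_iff.2 hae] with s hs χ k z
    refine congrFun (smear_congr_ae ?_) z
    filter_upwards [ae_all_iff.2 hs] with y hy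
    simp only [hy]
  intro t ht
  constructor
  · refine ae_eq_of_smear_mollifier ((h'.memLp t ht).1.locallyIntegrable one_le_two)
      ((h.memLp t ht).1.locallyIntegrable one_le_two) fun n z => ?_
    have hχ := isTestFunction_mollifier n
    rw [h.smear_density hx hδ1 hχ ht, h'.smear_density hx' hδ1 hχ ht]
    congr 1
    refine integral_congr_ae (hsrc.mono fun s hs => ?_)
    simp only [← hfdef, hs]
  · refine ae_eq_of_smear_mollifier (h'.gradient t ht).1 (h.gradient t ht).1 fun n z => ?_
    have hχ := isTestFunction_mollifier n
    rw [h.smear_value hx hχ ht, h'.smear_value hx' hχ ht]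
    congr 1
    refine integral_congr_ae (hsrc.mono fun s hs => ?_)
    simp only [← hfdef, hs]

/-! ### Norm bounds and weak formulation for the constructed solution -/

theorem eLpNorm_toLp_le {a b : Plane → ℝ} (ha : AEStronglyMeasurable a volume)
    (hb : AEStronglyMeasurable b volume) {r : ℝ≥0∞} (hr : 1 ≤ r) {G : Plane → Plane}
    (h0 : ∀ z, G z 0 = a z) (h1 : ∀ z, G z 1 = b z) :
    eLpNorm G r volume ≤ eLpNorm a r volume + eLpNorm b r volume := by
  have hle : ∀ z, ‖G z‖ ≤ ‖‖a z‖ + ‖b z‖‖ := fun z => by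
    rw [Real.norm_of_nonneg (by positivity : 0 ≤ ‖a z‖ + ‖b z‖), EuclideanSpace.norm_eq,
      Fin.sum_univ_two, h0, h1]
    refine Real.sqrt_le_iff.2 ⟨by positivity, ?_⟩
    nlinarith [norm_nonneg (a z), norm_nonneg (b z)]
  refine (eLpNorm_mono hle).trans ((eLpNorm_add_le ha.norm hb.norm hr).trans_eq ?_)
  rw [eLpNorm_norm, eLpNorm_norm]

/-- Decay in time of the density and of the gradient. -/
theorem IsSpectral.exists_decay {c : ℝ} (hc : 0 < c) :
    ∃ A > 0, ∀ {ρm ρb κ σ T N₀ N₁ R : ℝ} {d q : Plane → ℂ} {w v : ℂ → Plane → ℂ}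
      {Fl : Fin 2 → ℂ → Plane → ℂ} {Ra : ℂ → Plane → ℂ},
      IsSpectral ρm ρb κ σ T c N₀ N₁ R d q w v Fl Ra → ∀ t : ℝ, t ∈ Icc 0 T →
        eLpNorm (physDensity w t) 2 volume + eLpNorm (physGradient (v t)) 2 volume ≤
          ENNReal.ofReal (R * A * (N₀ / (1 + t) + N₁ / (1 + T - t))) ∧
        eLpNorm (physDensity w t) ⊤ volume + eLpNorm (physGradient (v t)) ⊤ volume ≤
          ENNReal.ofReal (R * A * (N₀ / (1 + t) ^ 2 + N₁ / (1 + T - t) ^ 2)) := by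
  obtain ⟨A, hA, H⟩ := CrowdMFG.exists_decay hc
  refine ⟨3 * A, by positivity, ?_⟩
  intro ρm ρb κ σ T N₀ N₁ R d q w v Fl Ra h t ht
  have hre : ∀ (r : ℝ≥0∞) (g : Plane → ℂ), eLpNorm (fun z => (g z).re) r volume ≤
      eLpNorm g r volume := fun r g => eLpNorm_mono fun z => Complex.abs_re_le_norm (g z)
  have hb : ∀ {s : ℂ → Plane → ℂ}, Adm σ T c N₀ N₁ R s → ∀ ξ, ‖s t ξ‖ ≤ R * env c T N₀ N₁ t ξ := by
    intro s hs ξ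
    simpa using hs.bound t (h.mem_diamond ht) ξ
  have key := fun {s : ℂ → Plane → ℂ} (hs : Adm σ T c N₀ N₁ R s) =>
    H T N₀ N₁ t R h.h₀ h.h₁ h.hR ht (s t) (hs.measurable_right t).aestronglyMeasurable (hb hs)
  have hcont := fun j : Fin 2 => (Complex.continuous_re.comp (continuous_invF
    (h.integrable (h.adm_dir j) ht))).aestronglyMeasurable (μ := (volume : Measure Plane))
  have total : ∀ (r : ℝ≥0∞) (E : ℝ), 1 ≤ r → 0 ≤ E →
      (∀ {s : ℂ → Plane → ℂ}, Adm σ T c N₀ N₁ R s →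
        eLpNorm (invF (s t)) r volume ≤ ENNReal.ofReal (R * A * E)) →
      eLpNorm (physDensity w t) r volume + eLpNorm (physGradient (v t)) r volume ≤
        ENNReal.ofReal (R * (3 * A) * E) := by
    intro r E hr hE hk
    have hRE : 0 ≤ R * A * E := mul_nonneg (mul_nonneg h.hR hA.le) hE
    have h1 : eLpNorm (physDensity w t) r volume ≤ ENNReal.ofReal (R * A * E) :=
      (hre r _).trans (hk h.density)
    have h2 := fun j : Fin 2 => (hre r _).trans (hk (h.adm_dir j))
    have h3 := (eLpNorm_toLp_le (G := physGradient (v t)) (hcont 0) (hcont 1) hr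
      (fun z => rfl) (fun z => rfl)).trans (add_le_add (h2 0) (h2 1))
    refine (add_le_add h1 h3).trans_eq ?_
    rw [← ENNReal.ofReal_add hRE hRE, ← ENNReal.ofReal_add hRE (by positivity)]
    congr 1
    ring
  have p0 : 0 < 1 + t := by linarith [ht.1]
  have p1 : 0 < 1 + T - t := by linarith [ht.2]
  have := h.h₀
  have := h.h₁
  exact ⟨total 2 _ one_le_two (by positivity) fun hs => (key hs).1,
    total ⊤ _ le_top (by positivity) fun hs => (key hs).2⟩

theorem IsSpectral.isSolution {ρm ρb κ σ T c N₀ N₁ R C E : ℝ} {d q : Plane → ℂ}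
    {w v : ℂ → Plane → ℂ} {Fl : Fin 2 → ℂ → Plane → ℂ} {Ra : ℂ → Plane → ℂ} {ψ₀ φT : Plane → ℝ}
    (h : IsSpectral ρm ρb κ σ T c N₀ N₁ R d q w v Fl Ra)
    (hψ : ψ₀ =ᵐ[volume] fun z => (invF d z).re)
    (hφ : φT =ᵐ[volume] fun z => (invF (potential q) z).re + C)
    (h2 : ∀ t ∈ Icc 0 T, eLpNorm (physDensity w t) 2 volume +
      eLpNorm (physGradient (v t)) 2 volume ≤ ENNReal.ofReal E)
    (hs : ∀ t ∈ Icc 0 T, eLpNorm (physDensity w t) ⊤ volume +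
      eLpNorm (physGradient (v t)) ⊤ volume ≤ ENNReal.ofReal E) :
    IsSolution ρm ρb κ T ψ₀ φT (physDensity w) (physValue v C)
      fun t => ∇ (physValue v C t) := by
  have hψ0 : ψ₀ =ᵐ[volume] physDensity w 0 := by rw [h.physDensity_zero]; exact hψ
  have hφT : φT =ᵐ[volume] physValue v C T := by rw [h.physValue_end]; exact hφ
  have hgrad := fun t (ht : t ∈ Icc 0 T) => h.gradient_physValue C ht
  refine ⟨h.measurable_physDensity.aestronglyMeasurable, ?_, fun t ht => ?_, fun t ht => ?_,
    ⟨E.toNNReal, fun t ht => ?_⟩, hψ0.symm, hφT.symm, fun χ hχ t ht => ?_, fun χ hχ t ht => ?_⟩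
  · refine h.measurable_physGradient.aestronglyMeasurable.congr ?_
    have hq : Measure.QuasiMeasurePreserving (Prod.fst : ℝ × Plane → ℝ)
      ((volume.restrict (Icc 0 T)).prod (volume : Measure Plane)) (volume.restrict (Icc 0 T)) :=
        Measure.quasiMeasurePreserving_fst
    filter_upwards [hq.ae (ae_restrict_mem measurableSet_Icc)] with x hx
    rw [hgrad x.1 hx]
  · rw [hgrad t ht]
    exact h.hasWeakGradient_physValue C ht
  · simp only [hgrad t ht]
    have m1 := (h.continuous_physDensity ht).aestronglyMeasurable (μ := (volume : Measure Plane))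
    have m2 := (h.continuous_physGradient ht).aestronglyMeasurable (μ := (volume : Measure Plane))
    have f2 := (h2 t ht).trans_lt ENNReal.ofReal_lt_top
    have fs := (hs t ht).trans_lt ENNReal.ofReal_lt_top
    exact ⟨⟨m1, le_self_add.trans_lt f2⟩, ⟨m1, le_self_add.trans_lt fs⟩,
      ⟨m2, le_add_self.trans_lt f2⟩, ⟨m2, le_add_self.trans_lt fs⟩⟩
  · simp only [hgrad t ht]
    exact ⟨le_self_add.trans (h2 t ht), le_self_add.trans (hs t ht),
      le_add_self.trans (h2 t ht), le_add_self.trans (hs t ht)⟩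
  · have e0 : ∫ z, ψ₀ z * χ z = ∫ z, physDensity w 0 z * χ z :=
      integral_congr_ae (hψ0.mono fun z hz => by simp only [hz])
    rw [e0, h.integral_mul_physDensity hχ ht]
    congr 1
    refine intervalIntegral.integral_congr fun s hsm => ?_
    rw [uIcc_of_le ht.1] at hsm
    simp only [hgrad s ⟨hsm.1, hsm.2.trans ht.2⟩]
  · have e0 : ∫ z, φT z * χ z = ∫ z, physValue v C T z * χ z :=
      integral_congr_ae (hφT.mono fun z hz => by simp only [hz])
    rw [e0, h.integral_mul_physValue C hχ ht]
    congr 1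
    refine intervalIntegral.integral_congr fun s hsm => ?_
    rw [uIcc_of_le ht.2] at hsm
    simp only [hgrad s ⟨ht.1.trans hsm.1, hsm.2⟩]

theorem mul_wt_le_env {c T N₀ N₁ : ℝ} (h₀ : 0 ≤ N₀) (h₁ : 0 ≤ N₁) (ξ : Plane) :
    N₀ * wt ξ ≤ env c T N₀ N₁ 0 ξ ∧ N₁ * wt ξ ≤ env c T N₀ N₁ T ξ := by
  have := wt_nonneg ξ
  unfold env
  constructor
  · refine mul_le_mul_of_nonneg_right ?_ this
    simp only [mul_zero, zero_mul, Real.exp_zero, mul_one]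
    linarith [mul_nonneg h₁ (Real.exp_nonneg (-c * (T - 0) * ‖ξ‖))]
  · refine mul_le_mul_of_nonneg_right ?_ this
    simp only [sub_self, mul_zero, zero_mul, Real.exp_zero, mul_one]
    linarith [mul_nonneg h₀ (Real.exp_nonneg (-c * T * ‖ξ‖))]

theorem ofReal_decay_le {M N₀ N₁ s₀ s₁ : ℝ} {a b : ℝ≥0∞} (hM : 0 ≤ M) (ha : a ≠ ⊤) (hb : b ≠ ⊤)
    (h0 : 0 < s₀) (h1 : 0 < s₁) (e₀ : N₀ ≤ 2 * a.toReal) (e₁ : N₁ ≤ 2 * b.toReal) :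
    ENNReal.ofReal (M * (N₀ / s₀ + N₁ / s₁)) ≤
      ENNReal.ofReal (2 * M) * (a / ENNReal.ofReal s₀ + b / ENNReal.ofReal s₁) := by
  have ea : a / ENNReal.ofReal s₀ = ENNReal.ofReal (a.toReal / s₀) := by
    rw [ENNReal.ofReal_div_of_pos h0, ENNReal.ofReal_toReal ha]
  have eb : b / ENNReal.ofReal s₁ = ENNReal.ofReal (b.toReal / s₁) := by
    rw [ENNReal.ofReal_div_of_pos h1, ENNReal.ofReal_toReal hb]
  rw [ea, eb, ← ENNReal.ofReal_add (by positivity) (by positivity),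
    ← ENNReal.ofReal_mul (by positivity)]
  refine ENNReal.ofReal_le_ofReal ?_
  have f0 := div_le_div_of_nonneg_right e₀ h0.le
  have f1 := div_le_div_of_nonneg_right e₁ h1.le
  calc M * (N₀ / s₀ + N₁ / s₁) ≤ M * (2 * a.toReal / s₀ + 2 * b.toReal / s₁) := by gcongr
    _ = _ := by ring

end CrowdMFG

end

theorem theorem1 (ρm ρb κ : ℝ) (hρb : 0 < ρb) (hρm : ρb < ρm / 2) :
    ∃ ε₀ > (0 : ℝ), ∃ δ > (0 : ℝ), ∃ K > (0 : ℝ),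
      ∀ T > (0 : ℝ), ∀ (ψ₀ φT : Plane → ℝ) (GT : Plane → Plane), HasWeakGradient φT GT →
        weightedFourierNorm (toComplexFun ψ₀) + weightedFourierNorm (toComplexField GT)
            ≤ ENNReal.ofReal ε₀ →
        ∃ ψ φ : ℝ → Plane → ℝ,
          IsSolution ρm ρb κ T ψ₀ φT ψ φ (fun t => ∇ (φ t)) ∧
          StaysSmall T δ ψ (fun t => ∇ (φ t)) ∧
          (∀ (ψ' φ' : ℝ → Plane → ℝ) (p' : ℝ → Plane → Plane),
            IsSolution ρm ρb κ T ψ₀ φT ψ' φ' p' → StaysSmall T δ ψ' p' →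
              ∀ t ∈ Icc 0 T, ψ' t =ᵐ[volume] ψ t ∧ φ' t =ᵐ[volume] φ t) ∧
          AnalyticInside T ψ ∧ AnalyticInside T φ ∧
          SolvesClassically ρm ρb κ T ψ φ ∧
          (∀ t ∈ Icc 0 T,
            eLpNorm (ψ t) 2 volume + eLpNorm (∇ (φ t)) 2 volume ≤
              ENNReal.ofReal K *
                (weightedFourierNorm (toComplexFun ψ₀) / ENNReal.ofReal (1 + t)
                  + weightedFourierNorm (toComplexField GT) / ENNReal.ofReal (1 + T - t))) ∧
          (∀ t ∈ Icc 0 T,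
            eLpNorm (ψ t) ∞ volume + eLpNorm (∇ (φ t)) ∞ volume ≤
              ENNReal.ofReal K *
                (weightedFourierNorm (toComplexFun ψ₀) / ENNReal.ofReal ((1 + t) ^ 2)
                  + weightedFourierNorm (toComplexField GT)
                    / ENNReal.ofReal ((1 + T - t) ^ 2))) := by
  have hf : ρb < sat ρm ρb := by unfold sat; linarith
  obtain ⟨δ, hδ, huniq⟩ := exists_unique_small κ hρb hf
  obtain ⟨R, hR, ε, hε, hex⟩ := exists_isSpectral κ hρb hf
  obtain ⟨A, hA, hdec⟩ := IsSpectral.exists_decay (rate_pos hρb hf)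
  -- `δ` is fixed by uniqueness, and the data are then taken small enough for existence and for the
  -- solution to stay in the `δ`-ball. The factors 2 come from `exists_value_datum`, which bounds
  -- the scalar datum `q` by twice the norm of the gradient.
  refine ⟨min (ε / 2) (δ / (2 * (R * A))), by positivity, δ, hδ, 2 * (R * A), by positivity,
    fun T hT ψ₀ φT GT hG hN => ?_⟩
  set a := weightedFourierNorm (toComplexFun ψ₀) with ha
  set b := weightedFourierNorm (toComplexField GT) with hb
  have hab : a + b ≠ ⊤ := (hN.trans_lt ENNReal.ofReal_lt_top).ne
  have ha' : a ≠ ⊤ := (ENNReal.add_ne_top.1 hab).1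
  have hb' : b ≠ ⊤ := (ENNReal.add_ne_top.1 hab).2
  have hN' := ENNReal.toReal_le_of_le_ofReal (by positivity) hN
  rw [ENNReal.toReal_add ha' hb'] at hN'
  have ha0 : 0 ≤ a.toReal := ENNReal.toReal_nonneg
  have hb0 : 0 ≤ b.toReal := ENNReal.toReal_nonneg
  obtain ⟨d, dm, db, ds, dψ⟩ := exists_density_datum ha'
  obtain ⟨q, qm, qb, qs, C, qφ⟩ := exists_value_datum hG hb'
  have henv := fun ξ => mul_wt_le_env (c := rate ρb (sat ρm ρb)) (T := T) ha0
    (mul_nonneg zero_le_two hb0) ξ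
  have hNε : a.toReal + 2 * b.toReal ≤ ε := by linarith [hN'.trans (min_le_left _ _)]
  have hNδ : R * A * (a.toReal + 2 * b.toReal) ≤ δ := by
    have h1 := hN'.trans (min_le_right _ _)
    rw [le_div_iff₀ (by positivity)] at h1
    nlinarith [mul_nonneg (mul_pos hR hA).le ha0]
  obtain ⟨w, v, Fl, Ra, h⟩ := hex T a.toReal (2 * b.toReal) d q hT ha0 (by positivity) hNε
    ⟨dm, fun ξ => by rw [one_mul]; exact (db ξ).trans (henv ξ).1, ds⟩
    ⟨qm, fun ξ => by rw [one_mul]; exact (qb ξ).trans (henv ξ).2, qs⟩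
  have hgrad := fun t (ht : t ∈ Icc 0 T) => h.gradient_physValue C ht
  have hdt := hdec h
  -- `n = 1` gives the uniform `L²` bound and `n = 2` the sup bound, both with the same `δ`.
  have hle : ∀ t ∈ Icc 0 T, ∀ n : ℕ,
      R * A * (a.toReal / (1 + t) ^ n + 2 * b.toReal / (1 + T - t) ^ n) ≤ δ := by
    intro t ht n
    refine le_trans ?_ hNδ
    have p0 : 1 ≤ (1 + t) ^ n := one_le_pow₀ (by linarith [ht.1])
    have p1 : 1 ≤ (1 + T - t) ^ n := one_le_pow₀ (by linarith [ht.2])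
    have := div_le_self ha0 p0
    have := div_le_self (mul_nonneg zero_le_two hb0) p1
    gcongr
  have hs2 := fun t (ht : t ∈ Icc 0 T) => (hdt t ht).1.trans
    (ENNReal.ofReal_le_ofReal (by simpa using hle t ht 1))
  have hsm := fun t (ht : t ∈ Icc 0 T) => (hdt t ht).2.trans (ENNReal.ofReal_le_ofReal (hle t ht 2))
  have hsol := h.isSolution dψ qφ hs2 hsm
  have hstay : StaysSmall T δ (physDensity w) fun t => ∇ (physValue v C t) := fun t ht => by
    simp only [hgrad t ht]
    exact hsm t ht
  refine ⟨physDensity w, physValue v C, hsol, hstay,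
    fun ψ' φ' p' h' hs' => huniq T ψ₀ φT _ _ ψ' φ' _ p' hG.1 hsol hstay h' hs',
    h.analyticInside_physDensity, h.analyticInside_physValue C, h.solvesClassically C,
    fun t ht => ?_, fun t ht => ?_⟩
  all_goals
    have p0 : 0 < 1 + t := by linarith [ht.1]
    have p1 : 0 < 1 + T - t := by linarith [ht.2]
    rw [hgrad t ht]
  · exact (hdt t ht).1.trans (ofReal_decay_le (by positivity) ha' hb' p0 p1 (by linarith) le_rfl)
  · exact (hdt t ht).2.trans (ofReal_decay_le (by positivity) ha' hb' (by positivity)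
      (by positivity) (by linarith) le_rfl)
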